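/- Lemma (invertibility of $\Delta_{\mathsf F,s}:\dot H^{1,0}_{sc}\to(\dot H^{1,0}_{sc})^*=\bar H^{-1,0}_{sc}$). Setting. Let $(\tilde M,g)$ be a smooth Riemannian manifold without boundary of dimension $n\ge 3$ (Hausdorff, second countable), let $x\in C^\infty(\tilde M;\mathbb R)$, and put $X=\{x\ge 0\}$, with interior $\{x>0\}$. Let $g_{sc}=x^{-4}\,dx^2+x^{-2}h$ be a scattering metric, where $h$ is a smooth symmetric 2-cotensor (smooth up to $x=0$), $g_{sc}$ is positive definite on $\{x>0\}$, and $h$ is positive definite on $\ker dx$ at the points of $\{x=0\}$. Let $\Omega\subset X$ have compact closure $\overline\Omega$ in $\tilde M$, with $dx\neq 0$ on $\overline\Omega$, so that $x$ can be used as a local coordinate near every point of $\overline\Omega$ (for instance, $\Omega$ a relatively compact domain whose boundary is transversal to $\partial X$). Let $L^2_{sc}$ be the space of square integrable complex covariant tensor fields on $\{x>0\}$, with respect to the fibre inner products and the volume measure of $g_{sc}$. Let $\dot H^{1,0}_{sc}=\dot H^{1,0}_{sc}(\Omega)$ be the space of symmetric 3-tensor fields $u\in L^2_{sc}$ whose weak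 covariant derivative $\nabla u$ relative to $g_{sc}$ on $\{x>0\}$ lies in $L^2_{sc}$ and which vanish almost everywhere outside $\overline\Omega$, with norm $(\|u\|^2_{L^2_{sc}}+\|\nabla u\|^2_{L^2_{sc}})^{1/2}$, and let $(\dot H^{1,0}_{sc})^*$ be its dual for the (sesquilinear) $L^2_{sc}$ pairing, i.e. the space of bounded antilinear functionals on it. (When $\Omega$ is a domain as above with regular boundary, this is the space $\bar H^{-1,0}_{sc}(\Omega)$ of restrictions to $\Omega$ of elements of $H^{-1,0}_{sc}(X)$.) Let $\mathrm d^s$ be the symmetrization of the Levi-Civita covariant derivative of $g$ (not of $g_{sc}$), taken weakly on $\{x>0\}$, let $\mathrm d^s_{\mathsf F}=e^{-\mathsf F/x}\,\mathrm d^s\,e^{\mathsf F/x}$, and let $\delta^s_{\mathsf F}$ be its adjoint with respect to $g_{sc}$. Statement. There exists $\mathsf F_0>0$ such that for every $\mathsf F\ge\mathsf F_0$ the operator $\mathrm d^s_{\mathsf F}$ is bounded from $\dot H^{1,0}_{sc}$ to the $L^2_{sc}$ space of 4-tensors, and the solenoidal Witten Laplacian $\Delta_{\mathsf F,s}=\delta^s_{\mathsf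 F}\mathrm d^s_{\mathsf F}$, that is, $$\langle\Delta_{\mathsf F,s}u,v\rangle=\langle \mathrm d^s_{\mathsf F}u,\mathrm d^s_{\mathsf F}v\rangle_{L^2_{sc}},\qquad u,v\in\dot H^{1,0}_{sc},$$ is invertible as a map $\dot H^{1,0}_{sc}\to(\dot H^{1,0}_{sc})^*$: it is a bounded linear bijection with bounded inverse. -/

import Mathlib

open Set MeasureTheory
open scoped Manifold ContDiff InnerProductSpace

noncomputable section

namespace ScatteringWitten

/-- Real covariant `2`-tensors (not necessarily symmetric or continuous) on an `n`-manifold. -/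
abbrev TwoTensor (n : ℕ) (M : Type*) [TopologicalSpace M]
    [ChartedSpace (EuclideanSpace ℝ (Fin n)) M] : Type _ :=
  ∀ p : M, TangentSpace (𝓡 n) p →L[ℝ] TangentSpace (𝓡 n) p →L[ℝ] ℝ

/-- Smoothness of a covariant `2`-tensor, as a section of the bundle of bilinear forms. -/
def IsSmoothTwoTensor {n : ℕ} {M : Type*} [TopologicalSpace M]
    [ChartedSpace (EuclideanSpace ℝ (Fin n)) M] [IsManifold (𝓡 n) ∞ M]
    (h : TwoTensor n M) : Prop :=
  ContMDiff (𝓡 n)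
    ((𝓡 n).prod 𝓘(ℝ, EuclideanSpace ℝ (Fin n) →L[ℝ] EuclideanSpace ℝ (Fin n) →L[ℝ] ℝ)) ∞
    (fun p => Bundle.TotalSpace.mk'
      (EuclideanSpace ℝ (Fin n) →L[ℝ] EuclideanSpace ℝ (Fin n) →L[ℝ] ℝ)
      (E := fun p : M => TangentSpace (𝓡 n) p →L[ℝ] TangentSpace (𝓡 n) p →L[ℝ] ℝ) p (h p))

section Geometry

variable {n : ℕ} {M : Type*} [TopologicalSpace M] [ChartedSpace (EuclideanSpace ℝ (Fin n)) M]
  [IsManifold (𝓡 n) ∞ M]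

/-- The differential of a real function. -/
def differential (x : M → ℝ) (p : M) : TangentSpace (𝓡 n) p →L[ℝ] ℝ :=
  mfderiv (𝓡 n) 𝓘(ℝ, ℝ) x p

/-- The scattering metric `x⁻⁴ dx² + x⁻² h` (meaningful where `x > 0`). -/
def scMetric (x : M → ℝ) (h : TwoTensor n M) : TwoTensor n M := fun p =>
  (x p ^ 4)⁻¹ • (differential x p).smulRight (differential x p) + (x p ^ 2)⁻¹ • h p

/-- The coordinate vector field `∂_i` of the chart `e`, at the point with coordinates `z`. -/
def coordVec (e : OpenPartialHomeomorph M (EuclideanSpace ℝ (Fin n)))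
    (z : EuclideanSpace ℝ (Fin n)) (i : Fin n) : TangentSpace (𝓡 n) (e.symm z) :=
  mfderiv 𝓘(ℝ, EuclideanSpace ℝ (Fin n)) (𝓡 n) e.symm z (EuclideanSpace.single i (1 : ℝ))

/-- The matrix `(G_{ij})` of a `2`-tensor in the chart `e`. -/
def gram (G : TwoTensor n M) (e : OpenPartialHomeomorph M (EuclideanSpace ℝ (Fin n)))
    (z : EuclideanSpace ℝ (Fin n)) : Matrix (Fin n) (Fin n) ℝ :=
  Matrix.of fun i j => G (e.symm z) (coordVec e z i) (coordVec e z j)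

/-- The partial derivative in the `l`-th coordinate direction. -/
def pd {W : Type*} [NormedAddCommGroup W] [NormedSpace ℝ W] (l : Fin n)
    (f : EuclideanSpace ℝ (Fin n) → W) (z : EuclideanSpace ℝ (Fin n)) : W :=
  fderiv ℝ f z (EuclideanSpace.single l (1 : ℝ))

/-- The Christoffel symbol `Γ^q_{kl}` of the metric `G` in the chart `e`. -/
def christoffel (G : TwoTensor n M) (e : OpenPartialHomeomorph M (EuclideanSpace ℝ (Fin n)))
    (z : EuclideanSpace ℝ (Fin n)) (q k l : Fin n) : ℝ :=
  (1 / 2) * ∑ r, (gram G e z)⁻¹ q r *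
    (pd k (fun w => gram G e w r l) z + pd l (fun w => gram G e w r k) z
      - pd r (fun w => gram G e w k l) z)

/-- The Riemannian volume measure of `G` on the open set `U`: the supremum, over all smooth
charts, of the measures `√det (G_{ij}) dz` transported to `M`. On overlaps of charts these measures
agree, so the supremum restricts to each of them on its own chart domain. -/
def volMeasure [MeasurableSpace M] (G : TwoTensor n M) (U : Set M) : Measure M :=
  ⨆ e ∈ IsManifold.maximalAtlas (𝓡 n) ∞ M,
    (((volume : Measure (EuclideanSpace ℝ (Fin n))).restrict
      (e.target ∩ e.symm ⁻¹' U)).withDensity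
        (fun z => ENNReal.ofReal (Real.sqrt (gram G e z).det))).map e.symm

/-- `b` is a Borel frame of the tangent bundle that is orthonormal for `G` over `U`. -/
def IsOrthonormalFrame (G : TwoTensor n M) (U : Set M)
    (b : ∀ p : M, Fin n → TangentSpace (𝓡 n) p) : Prop :=
  (∀ p ∈ U, ∀ i j, G p (b p i) (b p j) = if i = j then 1 else 0) ∧
  ∀ i, @Measurable M (TangentBundle (𝓡 n) M) (borel _) (borel _)
    (fun p => Bundle.TotalSpace.mk p (b p i))

/-- A chosen Borel `G`-orthonormal frame over `U`; nothing depends on which one is chosen, up to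
isometry. -/
def frame (G : TwoTensor n M) (U : Set M) : ∀ p : M, Fin n → TangentSpace (𝓡 n) p :=
  Classical.epsilon (IsOrthonormalFrame G U)

end Geometry

/-- The fibre of complex covariant `k`-tensors on an `n`-manifold, written in an orthonormal frame:
`t J` is the value of the tensor on the frame vectors `b_{J 0}, …, b_{J (k-1)}`. The Hermitian inner
product is the one that the metric induces on `k`-tensors. -/
abbrev Fibre (n k : ℕ) : Type := EuclideanSpace ℂ (Fin k → Fin n)

/-- Symmetry of a tensor in all its arguments. -/
def IsSymmetricTensor {n k : ℕ} (t : Fibre n k) : Prop :=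
  ∀ (σ : Equiv.Perm (Fin k)) (J : Fin k → Fin n), t (J ∘ σ) = t J

/-- Symmetrization of a tensor. -/
def symmetrize {n k : ℕ} (t : Fibre n k) : Fibre n k :=
  WithLp.toLp 2 fun J => (k.factorial : ℂ)⁻¹ * ∑ σ : Equiv.Perm (Fin k), t (J ∘ σ)

/-- `D` is the weak `l`-th partial derivative of `f` on the open set `S`. -/
def IsWeakPartial {n : ℕ} (S : Set (EuclideanSpace ℝ (Fin n))) (l : Fin n)
    (f D : EuclideanSpace ℝ (Fin n) → ℂ) : Prop :=
  LocallyIntegrableOn f S ∧ LocallyIntegrableOn D S ∧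
  ∀ φ : EuclideanSpace ℝ (Fin n) → ℝ, ContDiff ℝ ∞ φ → HasCompactSupport φ → tsupport φ ⊆ S →
    ∫ z, pd l φ z • f z = - ∫ z, φ z • D z

section Analysis

variable {n : ℕ} {M : Type*} [TopologicalSpace M] [ChartedSpace (EuclideanSpace ℝ (Fin n)) M]
  [IsManifold (𝓡 n) ∞ M]

/-- The region `{x > 0}`, the interior of `X = {x ≥ 0}`. -/
def interiorX (x : M → ℝ) : Set M := {p | 0 < x p}

/-- The component `f(∂_{J 0}, …, ∂_{J (k-1)})`, in the chart `e`, of the covariant `k`-tensor field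
on `{x > 0}` whose components in the `g_sc`-orthonormal frame are `f`. -/
def chartComp (x : M → ℝ) (h : TwoTensor n M) {k : ℕ}
    (e : OpenPartialHomeomorph M (EuclideanSpace ℝ (Fin n))) (f : M → Fibre n k)
    (J : Fin k → Fin n) (z : EuclideanSpace ℝ (Fin n)) : ℂ :=
  ∑ K : Fin k → Fin n, f (e.symm z) K *
    ∏ a, ((scMetric x h (e.symm z) (frame (scMetric x h) (interiorX x) (e.symm z) (K a))
      (coordVec e z (J a)) : ℝ) : ℂ)

/-- `w = ∇ u` weakly on `{x > 0}`, where `∇` is the Levi-Civita connection of `G`: in each chart,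
`w_{J l} = ∂_l u_J - ∑_a Γ^q_{l J_a} u_{J_0 … q … J_{k-1}}`, with `q` in the `a`-th place. -/
def IsWeakCovDeriv (x : M → ℝ) (h : TwoTensor n M) (G : TwoTensor n M) {k : ℕ}
    (u : M → Fibre n k) (w : M → Fibre n (k + 1)) : Prop :=
  ∀ e ∈ IsManifold.maximalAtlas (𝓡 n) ∞ M, ∀ (J : Fin k → Fin n) (l : Fin n),
    IsWeakPartial (e.target ∩ e.symm ⁻¹' interiorX x) l
      (chartComp x h e u J)
      (fun z => chartComp x h e w (Fin.snoc J l) z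
        + ∑ a : Fin k, ∑ q : Fin n,
            (christoffel G e z q l (J a) : ℂ) * chartComp x h e u (Function.update J a q) z)

theorem IsWeakPartial.integrable {n : ℕ} {S : Set (EuclideanSpace ℝ (Fin n))}
    {f : EuclideanSpace ℝ (Fin n) → ℂ} (hf : LocallyIntegrableOn f S)
    {ψ : EuclideanSpace ℝ (Fin n) → ℝ} (hψ : Continuous ψ) {K : Set (EuclideanSpace ℝ (Fin n))}
    (hK : IsCompact K) (hKS : K ⊆ S) (hψK : ∀ z, z ∉ K → ψ z = 0) :
    Integrable (fun z => ψ z • f z) := by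
  have h1 : IntegrableOn (fun z => ψ z • f z) K :=
    (hf.integrableOn_compact_subset hKS hK).continuousOn_smul hψ.continuousOn hK
  refine (integrableOn_iff_integrable_of_support_subset ?_).1 h1
  intro z hz
  by_contra hzK
  exact hz (by simp [hψK z hzK])

theorem pd_eq_zero {n : ℕ} (l : Fin n) (φ : EuclideanSpace ℝ (Fin n) → ℝ)
    (z : EuclideanSpace ℝ (Fin n)) (hz : z ∉ tsupport φ) : pd l φ z = 0 := by
  have : fderiv ℝ φ z = 0 := by
    by_contra hne
    exact hz (support_fderiv_subset ℝ hne)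
  simp [pd, this]

theorem continuous_pd {n : ℕ} (l : Fin n) {φ : EuclideanSpace ℝ (Fin n) → ℝ}
    (hφ : ContDiff ℝ ∞ φ) : Continuous (pd l φ) :=
  (hφ.continuous_fderiv (by simp)).clm_apply continuous_const

theorem IsWeakPartial.add {n : ℕ} {S : Set (EuclideanSpace ℝ (Fin n))} {l : Fin n}
    {f D f' D' : EuclideanSpace ℝ (Fin n) → ℂ}
    (H : IsWeakPartial S l f D) (H' : IsWeakPartial S l f' D') :
    IsWeakPartial S l (fun z => f z + f' z) (fun z => D z + D' z) := by
  refine ⟨H.1.add H'.1, H.2.1.add H'.2.1, fun φ hφ hc hs => ?_⟩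
  have e1 := H.2.2 φ hφ hc hs
  have e2 := H'.2.2 φ hφ hc hs
  have i1 := IsWeakPartial.integrable H.1 (continuous_pd l hφ) hc hs (pd_eq_zero l φ)
  have i2 := IsWeakPartial.integrable H'.1 (continuous_pd l hφ) hc hs (pd_eq_zero l φ)
  have i3 := IsWeakPartial.integrable H.2.1 hφ.continuous hc hs
    (fun z hz => image_eq_zero_of_notMem_tsupport hz)
  have i4 := IsWeakPartial.integrable H'.2.1 hφ.continuous hc hs
    (fun z hz => image_eq_zero_of_notMem_tsupport hz)
  simp only [smul_add]
  rw [integral_add i1 i2, integral_add i3 i4, e1, e2, neg_add]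

theorem IsWeakPartial.const_mul {n : ℕ} {S : Set (EuclideanSpace ℝ (Fin n))} {l : Fin n}
    {f D : EuclideanSpace ℝ (Fin n) → ℂ} (c : ℂ) (H : IsWeakPartial S l f D) :
    IsWeakPartial S l (fun z => c * f z) (fun z => c * D z) := by
  refine ⟨H.1.smul c, H.2.1.smul c, fun φ hφ hc hs => ?_⟩
  have e1 := H.2.2 φ hφ hc hs
  have k1 : ∀ (r : ℝ) (a : ℂ), r • (c * a) = c * (r • a) := fun r a => mul_smul_comm r c a |>.symm
  simp only [k1]
  rw [integral_const_mul, integral_const_mul, e1, mul_neg]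

theorem chartComp_add (x : M → ℝ) (h : TwoTensor n M) {k : ℕ}
    (e : OpenPartialHomeomorph M (EuclideanSpace ℝ (Fin n))) (f f' : M → Fibre n k)
    (J : Fin k → Fin n) (z : EuclideanSpace ℝ (Fin n)) :
    chartComp x h e (fun p => f p + f' p) J z = chartComp x h e f J z + chartComp x h e f' J z := by
  simp [chartComp, add_mul, Finset.sum_add_distrib]

theorem chartComp_smul (x : M → ℝ) (h : TwoTensor n M) {k : ℕ}
    (e : OpenPartialHomeomorph M (EuclideanSpace ℝ (Fin n))) (c : ℂ) (f : M → Fibre n k)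
    (J : Fin k → Fin n) (z : EuclideanSpace ℝ (Fin n)) :
    chartComp x h e (fun p => c • f p) J z = c * chartComp x h e f J z := by
  simp [chartComp, Finset.mul_sum, mul_assoc]

theorem IsWeakCovDeriv.add {x : M → ℝ} {h G : TwoTensor n M} {k : ℕ}
    {u u' : M → Fibre n k} {w w' : M → Fibre n (k + 1)}
    (H : IsWeakCovDeriv x h G u w) (H' : IsWeakCovDeriv x h G u' w') :
    IsWeakCovDeriv x h G (fun p => u p + u' p) (fun p => w p + w' p) := by
  intro e he J l
  have := (H e he J l).add (H' e he J l)
  convert! this using 1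
  · funext z; exact chartComp_add x h e u u' J z
  · funext z
    simp only [chartComp_add, mul_add, Finset.sum_add_distrib]
    ring

theorem IsWeakCovDeriv.const_smul {x : M → ℝ} {h G : TwoTensor n M} {k : ℕ} (c : ℂ)
    {u : M → Fibre n k} {w : M → Fibre n (k + 1)} (H : IsWeakCovDeriv x h G u w) :
    IsWeakCovDeriv x h G (fun p => c • u p) (fun p => c • w p) := by
  intro e he J l
  have := (H e he J l).const_mul c
  convert! this using 1
  · funext z; exact chartComp_smul x h e c u J z
  · funext z
    simp only [chartComp_smul, mul_add, Finset.mul_sum]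
    congr 1
    refine Finset.sum_congr rfl fun a _ => Finset.sum_congr rfl fun q _ => ?_
    ring

theorem IsWeakCovDeriv.zero {x : M → ℝ} {h G : TwoTensor n M} {k : ℕ} :
    IsWeakCovDeriv x h G (fun _ => (0 : Fibre n k)) (fun _ => (0 : Fibre n (k + 1))) := by
  intro e he J l
  have h0 : ∀ (m : ℕ) (I : Fin m → Fin n),
      chartComp x h e (fun _ : M => (0 : Fibre n m)) I = fun _ => 0 := by
    intro m I; funext z; simp [chartComp]
  simp only [h0, mul_zero, Finset.sum_const_zero, add_zero]
  exact ⟨locallyIntegrableOn_zero, locallyIntegrableOn_zero, fun φ _ _ _ => by simp⟩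

variable [MeasurableSpace M]

/-- `L²_sc(X; T^k)`: square integrable complex covariant `k`-tensor fields, for the fibre inner
product and the volume measure of `g_sc`. -/
abbrev L2sc (x : M → ℝ) (h : TwoTensor n M) (k : ℕ) : Type _ :=
  Lp (Fibre n k) 2 (volMeasure (scMetric x h) (interiorX x))

/-- `Ḣ^{1,0}_sc(Ω)` for symmetric `3`-tensors: the subspace of `H^{1,0}_sc(X)` of those fields that
are supported in the closure of `Ω`. The field `u` is stored together with its weak gradient `∇u`
relative to `g_sc`, so that the norm is `(‖u‖² + ‖∇u‖²)^{1/2}`, with norms in `L²_sc`. -/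
def dotH1 (x : M → ℝ) (h : TwoTensor n M) (Ω : Set M) :
    Submodule ℂ (WithLp 2 (L2sc x h 3 × L2sc x h 4)) where
  carrier := {U | ∃ (u : M → Fibre n 3) (w : M → Fibre n 4),
    U.fst =ᵐ[volMeasure (scMetric x h) (interiorX x)] u ∧
    U.snd =ᵐ[volMeasure (scMetric x h) (interiorX x)] w ∧
    IsWeakCovDeriv x h (scMetric x h) u w ∧
    (∀ p, IsSymmetricTensor (u p)) ∧
    ∀ p ∈ interiorX x \ closure Ω, u p = 0}
  add_mem' := by
    rintro U U' ⟨u, w, hu, hw, H, hs, h0⟩ ⟨u', w', hu', hw', H', hs', h0'⟩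
    refine ⟨fun p => u p + u' p, fun p => w p + w' p, ?_, ?_, H.add H', ?_, ?_⟩
    · filter_upwards [hu, hu', Lp.coeFn_add U.fst U'.fst] with p h1 h2 h3
      rw [WithLp.add_fst, h3, Pi.add_apply, h1, h2]
    · filter_upwards [hw, hw', Lp.coeFn_add U.snd U'.snd] with p h1 h2 h3
      rw [WithLp.add_snd, h3, Pi.add_apply, h1, h2]
    · intro p σ J
      simp [hs p σ J, hs' p σ J]
    · intro p hp
      simp [h0 p hp, h0' p hp]
  zero_mem' := by
    refine ⟨fun _ => 0, fun _ => 0, Lp.coeFn_zero _ _ _, Lp.coeFn_zero _ _ _, IsWeakCovDeriv.zero,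
      fun p σ J => rfl, fun p _ => rfl⟩
  smul_mem' := by
    rintro c U ⟨u, w, hu, hw, H, hs, h0⟩
    refine ⟨fun p => c • u p, fun p => c • w p, ?_, ?_, H.const_smul c, ?_, ?_⟩
    · filter_upwards [hu, Lp.coeFn_smul c U.fst] with p h1 h3
      rw [WithLp.smul_fst, h3, Pi.smul_apply, h1]
    · filter_upwards [hw, Lp.coeFn_smul c U.snd] with p h1 h3
      rw [WithLp.smul_snd, h3, Pi.smul_apply, h1]
    · intro p σ J
      simp [hs p σ J]
    · intro p hp
      simp [h0 p hp]

/-- `f = d^s_F u` weakly on `{x > 0}`, where `d^s_F = e^{-F/x} d^s e^{F/x}` and `d^s` is the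
symmetrization of the Levi-Civita covariant derivative of `g` (not of `g_sc`). -/
def IsSymmDiff (x : M → ℝ) (h g : TwoTensor n M) (F : ℝ) (u : L2sc x h 3) (f : L2sc x h 4) : Prop :=
  ∃ (v : M → Fibre n 3) (a : M → Fibre n 4),
    u =ᵐ[volMeasure (scMetric x h) (interiorX x)] v ∧
    IsWeakCovDeriv x h g (fun p => Real.exp (F / x p) • v p) a ∧
    f =ᵐ[volMeasure (scMetric x h) (interiorX x)]
      fun p => Real.exp (-(F / x p)) • symmetrize (a p)

end Analysis

section Operators

variable {H K : Type*} [NormedAddCommGroup H] [InnerProductSpace ℂ H]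
  [NormedAddCommGroup K] [InnerProductSpace ℂ K]

/-- The adjoint `δ : K → H^*` of `d : H → K`, where `H^*` is the space of bounded antilinear
functionals on `H`: `(δ f)(v) = ⟨f, d v⟩` in the convention that `⟨·, ·⟩` is antilinear in its
second entry, which is `⟪d v, f⟫` in the notation used here. -/
def dualAdjoint (d : H →L[ℂ] K) : K →L[ℂ] (H →L⋆[ℂ] ℂ) :=
  (innerSL ℂ (E := K)).flip.bilinearComp (ContinuousLinearMap.id ℂ K) d

theorem dualAdjoint_apply (d : H →L[ℂ] K) (f : K) (v : H) : dualAdjoint d f v = ⟪d v, f⟫_ℂ := rfl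

/-- The operator `δ d : H → H^*`. -/
def laplacianOf (d : H →L[ℂ] K) : H →L[ℂ] (H →L⋆[ℂ] ℂ) := (dualAdjoint d).comp d

end Operators

end ScatteringWitten

end

noncomputable section
namespace ScatteringWitten

/-! Invertibility is a coercivity statement. If ‖d_F u‖ ≥ c‖u‖ in the H¹ norm on the complete space
`dotH1`, then d_F has closed range, and the Riesz theorem on that range solves δ_F d_F u = L for
every bounded antilinear functional L (`laplacianOf_isInvertible`). The work lies in constructing
d_F and in proving the lower bound for large F.

Geometry. Near a point with dx ≠ 0 take a chart with x = y_o and pass to z = (1/x, y_j/x). The face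
x = 0 moves to infinity, the matrix of g_sc and its inverse become bounded together with their first
derivatives, and the Christoffel symbols of g, which is smooth up to x = 0, remain bounded
(`exists_goodChart`). Since 1/x is the coordinate z_o, conjugation by e^{F/x} adds the constant
covector F dz_o. Up to terms of order zero with bounds independent of F, the conjugated derivative
of u is thus t = ∂u + F e_o ⊗ u, with constant coefficients.

Algebra. The array t is symmetric in its first three indices, so |Sym t|² = |t|²/4 + (3/4) Re ⟨t,
t∘(0 3)⟩ (`sum_symArr_four`). As F is constant, the mixed terms of the flat norm integrate to zero
and ∫|t|² = ‖∂u‖² + F²‖u‖². In the other term, commuting derivatives produces the squared norm of a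
divergence formed with −F, which is nonnegative, plus an error. In the error the top order part is a
null Lagrangian, the part quadratic in F cancels pointwise, and the part linear in F is a total
derivative, up to derivatives of the coefficients (`norm_integral_bracket_le`). So the error is at
most ε‖∂u‖² + (C_ε + C F)‖u‖², which the main term absorbs once F is large (`exists_korn_const`).

Globalization. A finite partition of unity on the compact set closure Ω reduces to such charts.
Cutoffs and Christoffel symbols of g cost a multiple of ‖u‖² that does not depend on F, and F²‖u‖²
dominates it (`GoodPartition.exists_coercive`).

Foundations. Integration by parts for pairs of H¹ functions comes from correlation functions, which
are continuous, instead of density of smooth functions. The difference of e^{-F/x}∇e^{F/x} for g and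
∇ for g_sc is a tensor field of order zero (`lotField`), bounded over closure Ω, so d_F u is the
symmetrization of ∇u plus this field applied to u. -/

/-- The action of a real matrix on the components of a covariant tensor. -/
def tact {n k : ℕ} (M : Matrix (Fin n) (Fin n) ℝ) (f : (Fin k → Fin n) → ℂ)
    (J : Fin k → Fin n) : ℂ :=
  ∑ K : Fin k → Fin n, f K * ∏ a, ((M (K a) (J a) : ℝ) : ℂ)

/-! ### Component arrays: linear substitutions, symmetrization and its norm. -/

section TensorAlgebra

variable {n k : ℕ}

theorem sum_prod_mul (M N : Matrix (Fin n) (Fin n) ℝ) (K J : Fin k → Fin n) :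
    ∑ L : Fin k → Fin n, (∏ a, ((M (K a) (L a) : ℝ) : ℂ)) * ∏ a, ((N (L a) (J a) : ℝ) : ℂ)
      = ∏ a, (((M * N) (K a) (J a) : ℝ) : ℂ) := by
  simp only [← Finset.prod_mul_distrib, Matrix.mul_apply, Complex.ofReal_sum, Complex.ofReal_mul]
  rw [Finset.prod_univ_sum, Fintype.piFinset_univ]

theorem tact_mul (M N : Matrix (Fin n) (Fin n) ℝ) (f : (Fin k → Fin n) → ℂ) :
    tact (M * N) f = tact N (tact M f) := by
  funext J
  simp only [tact, ← sum_prod_mul, Finset.mul_sum, Finset.sum_mul]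
  rw [Finset.sum_comm]
  simp only [mul_assoc]

theorem tact_one (f : (Fin k → Fin n) → ℂ) : tact 1 f = f := by
  funext J
  rw [tact, Finset.sum_eq_single J]
  · simp
  · intro K _ hK
    obtain ⟨a, ha⟩ := Function.ne_iff.1 hK
    rw [Finset.prod_eq_zero (Finset.mem_univ a) (by simp [Matrix.one_apply_ne ha]), mul_zero]
  · simp

theorem tact_add (M : Matrix (Fin n) (Fin n) ℝ) (f g : (Fin k → Fin n) → ℂ) :
    tact M (fun K => f K + g K) = fun J => tact M f J + tact M g J := by
  funext J; simp [tact, add_mul, Finset.sum_add_distrib]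

theorem tact_const_mul (M : Matrix (Fin n) (Fin n) ℝ) (c : ℂ) (f : (Fin k → Fin n) → ℂ) :
    tact M (fun K => c * f K) = fun J => c * tact M f J := by
  funext J; simp [tact, Finset.mul_sum, mul_assoc]

theorem tact_sum {ι : Type*} (s : Finset ι) (M : Matrix (Fin n) (Fin n) ℝ)
    (f : ι → (Fin k → Fin n) → ℂ) :
    tact M (fun K => ∑ i ∈ s, f i K) = fun J => ∑ i ∈ s, tact M (f i) J := by
  funext J
  simp only [tact, Finset.sum_mul]
  rw [Finset.sum_comm]

theorem tact_perm (M : Matrix (Fin n) (Fin n) ℝ) (f : (Fin k → Fin n) → ℂ)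
    (σ : Equiv.Perm (Fin k)) (J : Fin k → Fin n) :
    tact M f (J ∘ σ) = tact M (fun K => f (K ∘ σ)) J := by
  simp only [tact]
  refine Fintype.sum_equiv (Equiv.arrowCongr σ (Equiv.refl _)) _ _ fun K => ?_
  have h1 : (Equiv.arrowCongr σ (Equiv.refl (Fin n)) K) ∘ σ = K := by
    funext a; simp [Equiv.arrowCongr]
  rw [h1]
  congr 1
  refine Fintype.prod_equiv σ _ _ fun a => ?_
  simp [Equiv.arrowCongr]

theorem norm_tact_le (M : Matrix (Fin n) (Fin n) ℝ) (f : (Fin k → Fin n) → ℂ) {C D : ℝ}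
    (hM : ∀ i j, |M i j| ≤ C) (hf : ∀ K, ‖f K‖ ≤ D) (J : Fin k → Fin n) :
    ‖tact M f J‖ ≤ (n : ℝ) ^ k * (D * C ^ k) := by
  refine (norm_sum_le _ _).trans ?_
  have : ∀ K : Fin k → Fin n, ‖f K * ∏ a, ((M (K a) (J a) : ℝ) : ℂ)‖ ≤ D * C ^ k := by
    intro K
    rw [norm_mul, norm_prod]
    have h2 : ∏ a, ‖((M (K a) (J a) : ℝ) : ℂ)‖ ≤ ∏ _a : Fin k, C :=
      Finset.prod_le_prod (fun _ _ => norm_nonneg _) (fun a _ => by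
        rw [Complex.norm_real]; exact hM _ _)
    rw [Finset.prod_const, Finset.card_univ, Fintype.card_fin] at h2
    have h0 : 0 ≤ ∏ a, ‖((M (K a) (J a) : ℝ) : ℂ)‖ := Finset.prod_nonneg fun _ _ => norm_nonneg _
    exact mul_le_mul (hf K) h2 h0 ((norm_nonneg _).trans (hf K))
  refine (Finset.sum_le_sum fun K _ => this K).trans ?_
  simp

/-- The Hermitian inner product of tensors, transported to coordinates. -/
theorem sum_tact_mul_conj (B : Matrix (Fin n) (Fin n) ℝ) (s t : (Fin k → Fin n) → ℂ) :
    ∑ I, tact B s I * (starRingEnd ℂ) (tact B t I)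
      = ∑ K, ∑ L, (∏ a, (((B * B.transpose) (K a) (L a) : ℝ) : ℂ)) *
          (s K * (starRingEnd ℂ) (t L)) := by
  have h1 : ∀ I, tact B s I * (starRingEnd ℂ) (tact B t I)
      = ∑ K, ∑ L, ((∏ a, ((B (K a) (I a) : ℝ) : ℂ)) * ∏ a, ((B.transpose (I a) (L a) : ℝ) : ℂ)) *
          (s K * (starRingEnd ℂ) (t L)) := by
    intro I
    simp only [tact, map_sum, map_mul, map_prod, Complex.conj_ofReal, Matrix.transpose_apply,
      Finset.sum_mul_sum]
    refine Finset.sum_congr rfl fun K _ => Finset.sum_congr rfl fun L _ => ?_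
    ring
  simp only [h1, ← sum_prod_mul]
  rw [Finset.sum_comm]
  refine Finset.sum_congr rfl fun K _ => ?_
  rw [Finset.sum_comm]
  refine Finset.sum_congr rfl fun L _ => ?_
  rw [Finset.sum_mul]

theorem symmetrize_apply (t : Fibre n k) (J : Fin k → Fin n) :
    symmetrize t J = (k.factorial : ℂ)⁻¹ * ∑ σ : Equiv.Perm (Fin k), t (J ∘ σ) := rfl

/-- Symmetrization of component arrays. -/
def symArr (t : (Fin k → Fin n) → ℂ) (J : Fin k → Fin n) : ℂ :=
  (k.factorial : ℂ)⁻¹ * ∑ σ : Equiv.Perm (Fin k), t (J ∘ σ)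

theorem tact_symArr (M : Matrix (Fin n) (Fin n) ℝ) (t : (Fin k → Fin n) → ℂ) :
    tact M (symArr t) = symArr (tact M t) := by
  funext J
  have h1 := congrFun (tact_const_mul M (k.factorial : ℂ)⁻¹
    (fun K => ∑ σ : Equiv.Perm (Fin k), t (K ∘ σ))) J
  rw [tact_sum] at h1
  simp only [symArr, tact_perm]
  exact h1

theorem norm_symArr_le (t : (Fin k → Fin n) → ℂ) {D : ℝ} (h : ∀ J, ‖t J‖ ≤ D) (J : Fin k → Fin n) :
    ‖symArr t J‖ ≤ D := by
  rw [symArr, norm_mul, norm_inv, Complex.norm_natCast]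
  have h1 : ‖∑ σ : Equiv.Perm (Fin k), t (J ∘ σ)‖ ≤ k.factorial * D := by
    refine (norm_sum_le _ _).trans ((Finset.sum_le_sum fun σ _ => h _).trans ?_)
    simp [Fintype.card_perm]
  have h2 : (0 : ℝ) < k.factorial := by positivity
  calc _ ≤ (k.factorial : ℝ)⁻¹ * (k.factorial * D) := by gcongr
    _ = D := by field_simp

theorem sum_comp_perm (σ : Equiv.Perm (Fin k)) (f : (Fin k → Fin n) → ℂ) :
    ∑ J : Fin k → Fin n, f (J ∘ σ) = ∑ J, f J :=
  Fintype.sum_equiv (Equiv.arrowCongr σ.symm (Equiv.refl _)) _ _ fun J => by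
    congr 1

/-- Symmetrization is an orthogonal projection, so |Sym t|² = ⟨t, Sym t⟩: in the double average over
(σ, τ) the inner sum depends only on σ⁻¹τ, and one average drops out. -/
theorem sum_symArr_mul_conj (t : (Fin k → Fin n) → ℂ) :
    ∑ J, symArr t J * (starRingEnd ℂ) (symArr t J)
      = (k.factorial : ℂ)⁻¹ * ∑ σ : Equiv.Perm (Fin k), ∑ J, t J * (starRingEnd ℂ) (t (J ∘ σ)) := by
  have hk : (k.factorial : ℂ) ≠ 0 := by exact_mod_cast k.factorial_ne_zero
  have h1 : ∀ J, symArr t J * (starRingEnd ℂ) (symArr t J)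
      = (k.factorial : ℂ)⁻¹ * ((k.factorial : ℂ)⁻¹ *
        ∑ σ : Equiv.Perm (Fin k), ∑ τ : Equiv.Perm (Fin k),
          t (J ∘ σ) * (starRingEnd ℂ) (t (J ∘ τ))) := by
    intro J
    rw [← Finset.sum_mul_sum]
    simp only [symArr, map_mul, map_sum, map_inv₀, map_natCast]
    ring
  simp only [h1]
  rw [← Finset.mul_sum, ← Finset.mul_sum, Finset.sum_comm]
  have h2 : ∀ σ : Equiv.Perm (Fin k), ∑ J : Fin k → Fin n, ∑ τ : Equiv.Perm (Fin k),
        t (J ∘ σ) * (starRingEnd ℂ) (t (J ∘ τ))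
      = ∑ τ : Equiv.Perm (Fin k), ∑ J : Fin k → Fin n, t J * (starRingEnd ℂ) (t (J ∘ τ)) := by
    intro σ
    rw [Finset.sum_comm]
    refine Fintype.sum_equiv (Equiv.mulLeft σ⁻¹) _ _ fun τ => ?_
    rw [← sum_comp_perm σ fun J =>
      t J * (starRingEnd ℂ) (t (J ∘ (Equiv.mulLeft σ⁻¹ τ : Equiv.Perm (Fin k))))]
    refine Finset.sum_congr rfl fun J _ => ?_
    have h3 : (J ∘ σ) ∘ (Equiv.mulLeft σ⁻¹ τ : Equiv.Perm (Fin k)) = J ∘ τ := by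
      funext a; simp
    rw [← h3]
  simp only [h2]
  rw [Finset.sum_const, Finset.card_univ, Fintype.card_perm, Fintype.card_fin, nsmul_eq_mul,
    ← mul_assoc ((k.factorial : ℂ)⁻¹) (k.factorial : ℂ), inv_mul_cancel₀ hk, one_mul]

/-- The pairing of t with t ∘ σ depends only on the double coset of σ with respect to the stabilizer
of 3. There are two double cosets: the stabilizer itself, with 6 of the 24 permutations, and its
complement, with 18, represented by the transposition (0 3). Hence the weights 1/4 and 3/4. -/
theorem sum_symArr_four (t : (Fin 4 → Fin n) → ℂ)
    (ht : ∀ σ : Equiv.Perm (Fin 4), σ 3 = 3 → ∀ J, t (J ∘ σ) = t J) :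
    ∑ J, symArr t J * (starRingEnd ℂ) (symArr t J)
      = (1 / 4 : ℂ) * ∑ J, t J * (starRingEnd ℂ) (t J)
        + (3 / 4 : ℂ) * ∑ J, t J * (starRingEnd ℂ) (t (J ∘ Equiv.swap 0 3)) := by
  rw [sum_symArr_mul_conj]
  set c : Equiv.Perm (Fin 4) → ℂ := fun σ => ∑ J, t J * (starRingEnd ℂ) (t (J ∘ σ)) with hc
  have hright : ∀ σ ρ : Equiv.Perm (Fin 4), ρ 3 = 3 → c (σ * ρ) = c σ := by
    intro σ ρ hρ
    refine Finset.sum_congr rfl fun J _ => ?_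
    have : J ∘ (σ * ρ : Equiv.Perm (Fin 4)) = (J ∘ σ) ∘ ρ := rfl
    rw [this, ht ρ hρ]
  have hleft : ∀ ρ σ : Equiv.Perm (Fin 4), ρ 3 = 3 → c (ρ * σ) = c σ := by
    intro ρ σ hρ
    simp only [hc]
    rw [← sum_comp_perm ρ (fun J => t J * (starRingEnd ℂ) (t (J ∘ σ)))]
    refine Finset.sum_congr rfl fun J _ => ?_
    rw [ht ρ hρ]
    rfl
  have hval : ∀ σ : Equiv.Perm (Fin 4), c σ = if σ 3 = 3 then c 1 else c (Equiv.swap 0 3) := by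
    intro σ
    split_ifs with h
    · rw [← hright 1 σ h, one_mul]
    -- Both outer transpositions fix 3 because σ 3 ≠ 3, so they do not change c. The product sends 3
    -- to 0 and is therefore (0 3) times a permutation fixing 3.
    · have h1 : c (Equiv.swap (σ 3) 0 * σ * Equiv.swap (σ⁻¹ 3) 0) = c σ := by
        rw [hright, hleft]
        · exact Equiv.swap_apply_of_ne_of_ne (Ne.symm h) (by decide)
        · refine Equiv.swap_apply_of_ne_of_ne (fun h' => h ?_) (by decide)
          exact (Equiv.Perm.inv_eq_iff_eq.1 h'.symm).symm
      have h2 : ∃ ρ : Equiv.Perm (Fin 4), ρ 3 = 3 ∧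
          Equiv.swap (σ 3) 0 * σ * Equiv.swap (σ⁻¹ 3) 0 = Equiv.swap 0 3 * ρ := by
        refine ⟨Equiv.swap 0 3 * (Equiv.swap (σ 3) 0 * σ * Equiv.swap (σ⁻¹ 3) 0), ?_, ?_⟩
        · have e1 : (Equiv.swap (σ⁻¹ 3) 0 : Equiv.Perm (Fin 4)) 3 = 3 :=
            Equiv.swap_apply_of_ne_of_ne (fun h' => h (Equiv.Perm.inv_eq_iff_eq.1 h'.symm).symm)
              (by decide)
          rw [Equiv.Perm.mul_apply, Equiv.Perm.mul_apply, Equiv.Perm.mul_apply, e1,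
            Equiv.swap_apply_left, Equiv.swap_apply_left]
        · rw [← mul_assoc, Equiv.swap_mul_self, one_mul]
      obtain ⟨ρ, hρ, e⟩ := h2
      rw [← h1, e, hright _ _ hρ]
  have hc1 : c 1 = ∑ J, t J * (starRingEnd ℂ) (t J) := rfl
  rw [Finset.sum_congr rfl fun σ _ => hval σ, Finset.sum_ite, Finset.sum_const, Finset.sum_const]
  have k1 : (Finset.univ.filter fun σ : Equiv.Perm (Fin 4) => σ 3 = 3).card = 6 := by decide
  have k2 : (Finset.univ.filter fun σ : Equiv.Perm (Fin 4) => ¬ σ 3 = 3).card = 18 := by decide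
  rw [k1, k2, ← hc1]
  simp only [Nat.factorial, nsmul_eq_mul]
  push_cast
  ring

end TensorAlgebra
end ScatteringWitten
end

noncomputable section
namespace ScatteringWitten

/-! ### Weak partial derivatives: Leibniz rule, restriction, extension by zero. -/

section WeakCalculus

variable {n : ℕ} {S : Set (EuclideanSpace ℝ (Fin n))} {l : Fin n}
  {f D : EuclideanSpace ℝ (Fin n) → ℂ}

theorem IsWeakPartial.congr_ae {f' D' : EuclideanSpace ℝ (Fin n) → ℂ} (hS : MeasurableSet S)
    (H : IsWeakPartial S l f D)
    (hf : f =ᵐ[volume.restrict S] f') (hD : D =ᵐ[volume.restrict S] D') :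
    IsWeakPartial S l f' D' := by
  refine ⟨H.1.congr hf, H.2.1.congr hD, fun φ hφ hc hs => ?_⟩
  rw [Filter.EventuallyEq, ae_restrict_iff' hS] at hf hD
  have h1 : ∫ z, pd l φ z • f' z = ∫ z, pd l φ z • f z := by
    refine integral_congr_ae ?_
    filter_upwards [hf] with z hz
    by_cases hzS : z ∈ S
    · rw [hz hzS]
    · rw [pd_eq_zero l φ z (fun h => hzS (hs h)), zero_smul, zero_smul]
  have h2 : ∫ z, φ z • D' z = ∫ z, φ z • D z := by
    refine integral_congr_ae ?_
    filter_upwards [hD] with z hz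
    by_cases hzS : z ∈ S
    · rw [hz hzS]
    · rw [image_eq_zero_of_notMem_tsupport (fun h => hzS (hs h)), zero_smul, zero_smul]
  rw [h1, h2, H.2.2 φ hφ hc hs]

theorem pd_mul {a b : EuclideanSpace ℝ (Fin n) → ℝ} {z : EuclideanSpace ℝ (Fin n)}
    (ha : DifferentiableAt ℝ a z) (hb : DifferentiableAt ℝ b z) (l : Fin n) :
    pd l (fun w => a w * b w) z = a z * pd l b z + b z * pd l a z := by
  simp only [pd]
  rw [fderiv_fun_mul ha hb]
  simp

theorem pd_congr {W : Type*} [NormedAddCommGroup W] [NormedSpace ℝ W]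
    {a b : EuclideanSpace ℝ (Fin n) → W} {z : EuclideanSpace ℝ (Fin n)}
    (h : a =ᶠ[nhds z] b) (l : Fin n) : pd l a z = pd l b z := by
  simp only [pd, h.fderiv_eq]

theorem contDiff_mul_of_tsupport_subset {a φ : EuclideanSpace ℝ (Fin n) → ℝ} (hS : IsOpen S)
    (ha : ContDiffOn ℝ ∞ a S) (hφ : ContDiff ℝ ∞ φ) (hs : tsupport φ ⊆ S) :
    ContDiff ℝ ∞ fun z => a z * φ z := by
  rw [contDiff_iff_contDiffAt]
  intro z
  by_cases hz : z ∈ S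
  · exact (ha.contDiffAt (hS.mem_nhds hz)).mul hφ.contDiffAt
  · have h0 : φ =ᶠ[nhds z] 0 := notMem_tsupport_iff_eventuallyEq.1 fun h => hz (hs h)
    have : (fun z => a z * φ z) =ᶠ[nhds z] fun _ => 0 := by
      filter_upwards [h0] with w hw
      simp [hw]
    exact contDiffAt_const.congr_of_eventuallyEq this

theorem tsupport_mul_subset_of {a φ : EuclideanSpace ℝ (Fin n) → ℝ} :
    tsupport (fun z => a z * φ z) ⊆ tsupport φ :=
  closure_mono fun z hz h => hz (by simp [h])

/-- Test with aφ instead of φ. It is smooth on the whole space, although a is smooth only on S,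
because φ is supported in S. -/
theorem IsWeakPartial.smul_smooth {a : EuclideanSpace ℝ (Fin n) → ℝ} (hS : IsOpen S)
    (ha : ContDiffOn ℝ ∞ a S) (H : IsWeakPartial S l f D) :
    IsWeakPartial S l (fun z => a z • f z) (fun z => a z • D z + pd l a z • f z) := by
  have hpd : ContinuousOn (pd l a) S := by
    have h1 := ha.continuousOn_fderiv_of_isOpen hS (by simp)
    exact h1.clm_apply continuousOn_const
  have hl := hS.isLocallyClosed
  refine ⟨H.1.continuousOn_smul hl ha.continuousOn,
    (H.2.1.continuousOn_smul hl ha.continuousOn).add (H.1.continuousOn_smul hl hpd),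
    fun φ hφ hc hs => ?_⟩
  set ψ : EuclideanSpace ℝ (Fin n) → ℝ := fun z => a z * φ z with hψ
  have hψs : tsupport ψ ⊆ tsupport φ := tsupport_mul_subset_of
  have hψd : ContDiff ℝ ∞ ψ := contDiff_mul_of_tsupport_subset hS ha hφ hs
  have hψc : HasCompactSupport ψ := hc.mono' (subset_closure.trans hψs)
  have e1 := H.2.2 ψ hψd hψc (hψs.trans hs)
  have key : ∀ z, pd l φ z • (a z • f z) = pd l ψ z • f z - φ z • (pd l a z • f z) := by
    intro z
    by_cases hz : z ∈ S
    · rw [hψ, pd_mul ((ha.contDiffAt (hS.mem_nhds hz)).differentiableAt (by simp))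
        (hφ.differentiable (by simp) z)]
      module
    · have h0 : z ∉ tsupport φ := fun h => hz (hs h)
      rw [pd_eq_zero l φ z h0, pd_eq_zero l ψ z fun h => h0 (hψs h),
        image_eq_zero_of_notMem_tsupport h0]
      simp
  have key2 : ∀ z, φ z • (a z • D z + pd l a z • f z) = ψ z • D z + φ z • (pd l a z • f z) := by
    intro z; simp only [hψ]; module
  have i1 := IsWeakPartial.integrable H.1 (continuous_pd l hψd) hψc (hψs.trans hs) (pd_eq_zero l ψ)
  have i2 := IsWeakPartial.integrable (H.1.continuousOn_smul hl hpd) hφ.continuous hc hs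
    (fun z hz => image_eq_zero_of_notMem_tsupport hz)
  have i3 := IsWeakPartial.integrable H.2.1 hψd.continuous hψc (hψs.trans hs)
    (fun z hz => image_eq_zero_of_notMem_tsupport hz)
  simp only [key, key2]
  rw [integral_sub i1 i2, integral_add i3 i2, e1]
  ring

theorem IsWeakPartial.mono {S' : Set (EuclideanSpace ℝ (Fin n))} (hS : S' ⊆ S)
    (H : IsWeakPartial S l f D) : IsWeakPartial S' l f D :=
  ⟨H.1.mono_set hS, H.2.1.mono_set hS, fun φ hφ hc hs => H.2.2 φ hφ hc (hs.trans hS)⟩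

theorem exists_smooth_cutoff {K : Set (EuclideanSpace ℝ (Fin n))} (hK : IsCompact K)
    (hS : IsOpen S) (hKS : K ⊆ S) :
    ∃ η : EuclideanSpace ℝ (Fin n) → ℝ, ContDiff ℝ ∞ η ∧ (∀ᶠ z in nhdsSet K, η z = 1) ∧
      tsupport η ⊆ S := by
  obtain ⟨L, hL, hKL, hLS⟩ := exists_compact_between hK hS hKS
  obtain ⟨η, h1, h2, -⟩ := exists_contMDiffMap_one_nhds_of_subset_interior
    𝓘(ℝ, EuclideanSpace ℝ (Fin n)) (n := ⊤) hK.isClosed hKL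
  refine ⟨η, η.contMDiff.contDiff, h1, ?_⟩
  have : tsupport η ⊆ L := closure_minimal (fun z hz => by
    by_contra h; exact hz (h2 z h)) hL.isClosed
  exact this.trans hLS

theorem locallyIntegrableOn_univ_of_eq_zero {K' : Set (EuclideanSpace ℝ (Fin n))}
    (hK' : IsClosed K') (hS : IsOpen S) (hKS : K' ⊆ S) (hf : LocallyIntegrableOn f S)
    (h0 : ∀ z ∉ K', f z = 0) : LocallyIntegrableOn f univ := by
  intro z _
  by_cases hz : z ∈ S
  · have h1 := hf z hz
    rw [hS.nhdsWithin_eq hz] at h1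
    rwa [nhdsWithin_univ]
  · refine ⟨K'ᶜ, ?_, ?_⟩
    · rw [nhdsWithin_univ]
      exact hK'.isOpen_compl.mem_nhds fun h => hz (hKS h)
    · exact (integrableOn_zero).congr_fun (fun w hw => (h0 w hw).symm) hK'.measurableSet.compl

/-- The functions live on a closed set K' inside S, so a test function φ on the whole space may be
multiplied by a cutoff equal to 1 near the compact set supp φ ∩ K'. K' itself need not be compact,
which matters because the coordinate domains reach infinity. -/
theorem IsWeakPartial.extend {K' : Set (EuclideanSpace ℝ (Fin n))}
    (hK' : IsClosed K') (hS : IsOpen S) (hKS : K' ⊆ S) (H : IsWeakPartial S l f D)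
    (hf0 : ∀ z ∉ K', f z = 0) (hD0 : ∀ z ∉ K', D z = 0) : IsWeakPartial univ l f D := by
  refine ⟨locallyIntegrableOn_univ_of_eq_zero hK' hS hKS H.1 hf0,
    locallyIntegrableOn_univ_of_eq_zero hK' hS hKS H.2.1 hD0, fun φ hφ hc _ => ?_⟩
  obtain ⟨η, hη, hη1, hηS⟩ := exists_smooth_cutoff (hc.isCompact.inter_right hK') hS
    (inter_subset_right.trans hKS)
  set ψ : EuclideanSpace ℝ (Fin n) → ℝ := fun z => φ z * η z with hψ
  have hψs : tsupport ψ ⊆ S := tsupport_mul_subset_of.trans hηS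
  have hψd : ContDiff ℝ ∞ ψ := hφ.mul hη
  have hψc : HasCompactSupport ψ := hc.mul_right
  have e1 := H.2.2 ψ hψd hψc hψs
  have hnear : ∀ z ∈ K', ψ =ᶠ[nhds z] φ := by
    intro z hz
    by_cases hzφ : z ∈ tsupport φ
    · have := hη1.filter_mono (nhds_le_nhdsSet (mem_inter hzφ hz))
      filter_upwards [this] with w hw
      simp [hψ, hw]
    · filter_upwards [notMem_tsupport_iff_eventuallyEq.1 hzφ] with w hw
      simp [hψ, hw]
  have k1 : ∀ z, pd l φ z • f z = pd l ψ z • f z := by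
    intro z
    by_cases hz : z ∈ K'
    · rw [pd_congr (hnear z hz)]
    · simp [hf0 z hz]
  have k2 : ∀ z, φ z • D z = ψ z • D z := by
    intro z
    by_cases hz : z ∈ K'
    · rw [(hnear z hz).self_of_nhds]
    · simp [hD0 z hz]
  simp only [k1, k2, e1]

end WeakCalculus

/-! ### Integration by parts in H¹ through correlation functions. -/

section Correlation

variable {n : ℕ}

local notation "V" => EuclideanSpace ℝ (Fin n)

/-- The correlation `t ↦ ∫ f(t + z) conj (g z) dz`. -/
def corr (f g : EuclideanSpace ℝ (Fin n) → ℂ) (t : EuclideanSpace ℝ (Fin n)) : ℂ :=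
  ∫ z, f (t + z) * (starRingEnd ℂ) (g z)

theorem integrable_mul_conj {f g : V → ℂ} (hf : MemLp f 2) (hg : MemLp g 2) :
    Integrable (fun z => f z * (starRingEnd ℂ) (g z)) := by
  have hg' : MemLp (fun z => (starRingEnd ℂ) (g z)) 2 := hg.star
  exact hf.integrable_mul hg'

theorem memLp_translate {f : V → ℂ} (hf : MemLp f 2) (t : V) :
    MemLp (fun z => f (t + z)) 2 volume :=
  hf.comp_measurePreserving (measurePreserving_add_left volume t)

theorem corr_eq_inner {f g : V → ℂ} (hf : MemLp f 2 volume) (hg : MemLp g 2 volume) (t : V) :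
    corr f g t = ⟪hg.toLp g, (DomAddAct.mk t +ᵥ hf.toLp f : Lp ℂ 2 (volume : Measure V))⟫_ℂ := by
  rw [L2.inner_def]
  refine integral_congr_ae ?_
  have h1 := DomAddAct.vadd_Lp_ae_eq (DomAddAct.mk t) (hf.toLp f)
  have h2 := (measurePreserving_add_left (volume : Measure V) t).quasiMeasurePreserving.ae_eq_comp
    hf.coeFn_toLp
  filter_upwards [h1, hg.coeFn_toLp, h2] with z hz hz2 hz3
  rw [hz, hz2]
  simp only [Function.comp_apply] at hz3
  simp only [DomAddAct.mk, RCLike.inner_apply]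
  exact congrArg (· * _) hz3.symm

/-- Translations act strongly continuously on L², and the correlation is an inner product with a
translate. Continuity is what allows an identity tested against all ρ to be evaluated at t = 0. -/
theorem continuous_corr {f g : V → ℂ} (hf : MemLp f 2) (hg : MemLp g 2) :
    Continuous (corr f g) := by
  have : corr f g = fun t => ⟪hg.toLp g,
      (DomAddAct.mk t +ᵥ hf.toLp f : Lp ℂ 2 (volume : Measure V))⟫_ℂ :=
    funext (corr_eq_inner hf hg)
  rw [this]
  have : Fact ((2 : ENNReal) ≠ ⊤) := ⟨by norm_num⟩
  have h1 : Continuous fun t : V => (DomAddAct.mk t : Vᵈᵃᵃ) := DomAddAct.continuous_mk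
  exact continuous_const.inner (h1.vadd continuous_const)

/-- By Tonelli, the integral of the norm in z is |ψ| times the correlation of |f| and |g|, a
continuous function with compact support. -/
theorem integrable_corr_kernel {f g : V → ℂ} (hf : MemLp f 2) (hg : MemLp g 2) {ψ : V → ℝ}
    (hψ : Continuous ψ) (hc : HasCompactSupport ψ) :
    Integrable (fun p : V × V => ψ p.1 • (f (p.1 + p.2) * (starRingEnd ℂ) (g p.2)))
      ((volume : Measure V).prod volume) := by
  have hm : AEStronglyMeasurable
      (fun p : V × V => ψ p.1 • (f (p.1 + p.2) * (starRingEnd ℂ) (g p.2)))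
      ((volume : Measure V).prod volume) := by
    have h1 : AEStronglyMeasurable (fun p : V × V => f (p.1 + p.2))
        ((volume : Measure V).prod volume) := by
      have := (Measure.quasiMeasurePreserving_snd (μ := (volume : Measure V)) (ν := volume)).comp
        (measurePreserving_prod_add (volume : Measure V) volume).quasiMeasurePreserving
      exact hf.1.comp_quasiMeasurePreserving this
    have h2 : AEStronglyMeasurable (fun p : V × V => (starRingEnd ℂ) (g p.2))
        ((volume : Measure V).prod volume) :=
      (hg.star).1.comp_snd
    exact (hψ.comp continuous_fst).aestronglyMeasurable.smul (h1.mul h2)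
  refine (integrable_prod_iff hm).2 ⟨?_, ?_⟩
  · refine Filter.Eventually.of_forall fun t => ?_
    exact (integrable_mul_conj (memLp_translate hf t) hg).smul (ψ t)
  · have h3 : (fun t : V => ∫ z, ‖ψ t • (f (t + z) * (starRingEnd ℂ) (g z))‖)
        = fun t => ‖ψ t‖ * (corr (fun z => (‖f z‖ : ℂ)) (fun z => (‖g z‖ : ℂ)) t).re := by
      funext t
      have : corr (fun z => (‖f z‖ : ℂ)) (fun z => (‖g z‖ : ℂ)) t
          = ((∫ z, ‖f (t + z)‖ * ‖g z‖ : ℝ) : ℂ) := by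
        rw [corr, ← integral_complex_ofReal]
        simp
      rw [this, Complex.ofReal_re, ← integral_const_mul]
      simp only [norm_smul, norm_mul, RCLike.norm_conj]
    rw [h3]
    have hf' : MemLp (fun z => (‖f z‖ : ℂ)) 2 := hf.norm.ofReal
    have hg' : MemLp (fun z => (‖g z‖ : ℂ)) 2 := hg.norm.ofReal
    refine Continuous.integrable_of_hasCompactSupport
      (hψ.norm.mul (Complex.continuous_re.comp (continuous_corr hf' hg'))) ?_
    exact hc.norm.mul_right

theorem pd_comp_sub (l : Fin n) (ρ : V → ℝ) (y z : V) :
    pd l (fun w => ρ (w - z)) y = pd l ρ (y - z) := by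
  simp only [pd]
  rw [fderiv_comp_sub]

theorem pd_comp_neg (l : Fin n) (ρ : V → ℝ) (y : V) :
    pd l (fun w => ρ (-w)) y = - pd l ρ (-y) := by
  simp only [pd]
  have h := fderiv_comp_smul (𝕜 := ℝ) (f := ρ) (x := y) (-1)
  simp only [neg_smul, one_smul] at h
  rw [h]; simp

/-- For each fixed z the translate ρ(· − z) is a test function for f; Fubini then integrates the
weak identity for f against the conjugate of g. -/
theorem integral_pd_smul_corr {l : Fin n} {f D g : V → ℂ} (H : IsWeakPartial univ l f D)
    (hf : MemLp f 2) (hD : MemLp D 2) (hg : MemLp g 2) {ρ : V → ℝ}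
    (hρ : ContDiff ℝ ∞ ρ) (hc : HasCompactSupport ρ) :
    ∫ t, pd l ρ t • corr f g t = - ∫ t, ρ t • corr D g t := by
  -- Fubini followed by the substitution y = t + z.
  have swap : ∀ {F : V → ℂ} {ψ : V → ℝ}, MemLp F 2 → Continuous ψ → HasCompactSupport ψ →
      ∫ t, ψ t • corr F g t = ∫ z, (∫ y, ψ (y - z) • F y) * (starRingEnd ℂ) (g z) := by
    intro F ψ hF hψ hψc
    have h1 : ∀ t, ψ t • corr F g t = ∫ z, ψ t • (F (t + z) * (starRingEnd ℂ) (g z)) := by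
      intro t; rw [corr, integral_smul]
    simp only [h1]
    rw [integral_integral_swap (integrable_corr_kernel hF hg hψ hψc)]
    refine integral_congr_ae (Filter.Eventually.of_forall fun z => ?_)
    simp only [← smul_mul_assoc]
    rw [integral_mul_const, ← integral_sub_right_eq_self (fun t => ψ t • F (t + z)) z]
    simp
  have hcd : HasCompactSupport (pd l ρ) := hc.mono' fun z hz => by
    by_contra h; exact hz (pd_eq_zero l ρ z h)
  rw [swap hf (continuous_pd l hρ) hcd, swap hD hρ.continuous hc, ← integral_neg]
  refine integral_congr_ae (Filter.Eventually.of_forall fun z => ?_)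
  have hφ : ContDiff ℝ ∞ fun w => ρ (w - z) := hρ.comp (contDiff_id.sub contDiff_const)
  have hφc : HasCompactSupport fun w => ρ (w - z) :=
    hc.comp_homeomorph (Homeomorph.subRight z)
  have := H.2.2 _ hφ hφc (subset_univ _)
  simp only [pd_comp_sub] at this
  simp only [this, neg_mul]

theorem corr_eq_conj {f g : V → ℂ} (t : V) :
    corr f g t = (starRingEnd ℂ) (corr g f (-t)) := by
  rw [corr, corr, ← integral_conj, ← integral_add_left_eq_self _ (-t)]
  refine integral_congr_ae (Filter.Eventually.of_forall fun z => ?_)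
  simp [mul_comm]

/-- Reflection t ↦ −t exchanges the two factors up to conjugation. The sign of the reflected
derivative cancels the minus sign of the weak derivative. -/
theorem integral_pd_smul_corr_right {l : Fin n} {f g D : V → ℂ} (H : IsWeakPartial univ l g D)
    (hf : MemLp f 2) (hg : MemLp g 2) (hD : MemLp D 2) {ρ : V → ℝ}
    (hρ : ContDiff ℝ ∞ ρ) (hc : HasCompactSupport ρ) :
    ∫ t, pd l ρ t • corr f g t = ∫ t, ρ t • corr f D t := by
  have hρ' : ContDiff ℝ ∞ fun w => ρ (-w) := hρ.comp contDiff_neg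
  have hc' : HasCompactSupport fun w => ρ (-w) := hc.comp_homeomorph (Homeomorph.neg _)
  have e := integral_pd_smul_corr H hg hD hf hρ' hc'
  simp only [pd_comp_neg, neg_smul, integral_neg, neg_inj] at e
  have key : ∀ (ψ : V → ℝ) (G : V → ℂ), ∫ t, ψ t • corr f G t
      = (starRingEnd ℂ) (∫ t, ψ (-t) • corr G f t) := by
    intro ψ G
    rw [← integral_conj, ← integral_neg_eq_self]
    refine integral_congr_ae (Filter.Eventually.of_forall fun z => ?_)
    simp only [Complex.real_smul, map_mul, Complex.conj_ofReal]
    rw [corr_eq_conj, neg_neg]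
  rw [key, key, e]

theorem eq_zero_of_forall_integral_smul_eq_zero {c : V → ℂ} (hcont : Continuous c)
    (h : ∀ ρ : V → ℝ, ContDiff ℝ ∞ ρ → HasCompactSupport ρ → ∫ t, ρ t • c t = 0) : c = 0 := by
  have := ae_eq_zero_of_integral_contDiff_smul_eq_zero (μ := volume) hcont.locallyIntegrable h
  exact (hcont.ae_eq_iff_eq volume continuous_const).1 this

/-- Integration by parts for two functions in `H¹(ℝⁿ)`. -/
theorem integral_weakPartial_add_eq_zero {l : Fin n} {f Df g Dg : V → ℂ}
    (Hf : IsWeakPartial univ l f Df) (Hg : IsWeakPartial univ l g Dg)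
    (hf : MemLp f 2) (hDf : MemLp Df 2) (hg : MemLp g 2) (hDg : MemLp Dg 2) :
    (∫ z, Df z * (starRingEnd ℂ) (g z)) + ∫ z, f z * (starRingEnd ℂ) (Dg z) = 0 := by
  -- Differentiating the correlation through the first or the second factor gives Df or −Dg, so this
  -- sum vanishes as a distribution in t and, by continuity, for every t. The value at t = 0 is the
  -- claim; no density argument is needed.
  have h0 : (fun t => corr Df g t + corr f Dg t) = 0 := by
    refine eq_zero_of_forall_integral_smul_eq_zero
      ((continuous_corr hDf hg).add (continuous_corr hf hDg)) fun ρ hρ hc => ?_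
    have e1 := integral_pd_smul_corr Hf hf hDf hg hρ hc
    have e2 := integral_pd_smul_corr_right Hg hf hg hDg hρ hc
    have i1 : ∀ {F G : V → ℂ}, MemLp F 2 → MemLp G 2 → Integrable fun t => ρ t • corr F G t :=
      fun hF hG => (hρ.continuous.smul (continuous_corr hF hG)).integrable_of_hasCompactSupport
        hc.smul_right
    simp only [smul_add]
    rw [integral_add (i1 hDf hg) (i1 hf hDg), ← e2, e1]
    ring
  have := congrFun h0 0
  simpa [corr] using this

theorem pd_pd_comm {ρ : V → ℝ} (hρ : ContDiff ℝ ∞ ρ) (i j : Fin n) (z : V) :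
    pd i (pd j ρ) z = pd j (pd i ρ) z := by
  have hd : DifferentiableAt ℝ (fderiv ℝ ρ) z :=
    (hρ.fderiv_right (m := ∞) (by simp)).differentiable (by simp) z
  have key : ∀ k m : Fin n, pd k (pd m ρ) z
      = fderiv ℝ (fderiv ℝ ρ) z (EuclideanSpace.single k 1) (EuclideanSpace.single m 1) := by
    intro k m
    change fderiv ℝ (fun w => fderiv ℝ ρ w (EuclideanSpace.single m 1)) z _ = _
    rw [fderiv_clm_apply hd (differentiableAt_const _)]
    simp
  rw [key, key]
  exact (hρ.contDiffAt.isSymmSndFDerivAt (by simp; exact WithTop.coe_le_coe.2 le_top)).eq _ _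

/-- Null Lagrangian identity for two functions in `H¹(ℝⁿ)`. -/
theorem integral_weakPartial_mul_comm {i j : Fin n} {f Dif Djf g Dig Djg : V → ℂ}
    (Hfi : IsWeakPartial univ i f Dif) (Hfj : IsWeakPartial univ j f Djf)
    (Hgi : IsWeakPartial univ i g Dig) (Hgj : IsWeakPartial univ j g Djg)
    (hf : MemLp f 2) (hfi : MemLp Dif 2) (hfj : MemLp Djf 2)
    (hg : MemLp g 2) (hgi : MemLp Dig 2) (hgj : MemLp Djg 2) :
    ∫ z, Dif z * (starRingEnd ℂ) (Djg z) = ∫ z, Djf z * (starRingEnd ℂ) (Dig z) := by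
  have h0 : (fun t => corr Dif Djg t - corr Djf Dig t) = 0 := by
    refine eq_zero_of_forall_integral_smul_eq_zero
      ((continuous_corr hfi hgj).sub (continuous_corr hfj hgi)) fun ρ hρ hc => ?_
    have hpd : ∀ k, ContDiff ℝ ∞ (pd k ρ) := fun k =>
      (hρ.fderiv_right (m := ∞) (by simp)).clm_apply contDiff_const
    have hpc : ∀ k, HasCompactSupport (pd k ρ) := fun k => hc.mono' fun z hz => by
      by_contra h; exact hz (pd_eq_zero k ρ z h)
    -- Both correlations equal −∂_i∂_j of the correlation of f and g in the sense of distributions,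
    -- and second derivatives of the test function commute.
    have e1 := integral_pd_smul_corr Hfi hf hfi hgj hρ hc
    have e2 := integral_pd_smul_corr_right Hgj hf hg hgj (hpd i) (hpc i)
    have e3 := integral_pd_smul_corr Hfj hf hfj hgi hρ hc
    have e4 := integral_pd_smul_corr_right Hgi hf hg hgi (hpd j) (hpc j)
    have i1 : ∀ {F G : V → ℂ}, MemLp F 2 → MemLp G 2 → Integrable fun t => ρ t • corr F G t :=
      fun hF hG => (hρ.continuous.smul (continuous_corr hF hG)).integrable_of_hasCompactSupport
        hc.smul_right
    simp only [smul_sub]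
    rw [integral_sub (i1 hfi hgj) (i1 hfj hgi)]
    have e5 : ∫ t, pd j (pd i ρ) t • corr f g t = ∫ t, pd i (pd j ρ) t • corr f g t := by
      simp only [pd_pd_comm hρ i j]
    rw [e2, e4] at e5
    rw [e5, e3] at e1
    exact sub_eq_zero.2 (neg_inj.1 e1).symm
  have := congrFun h0 0
  simp only [corr, zero_add, Pi.zero_apply] at this
  exact sub_eq_zero.1 this

end Correlation
end ScatteringWitten
end

noncomputable section
namespace ScatteringWitten

/-! ### The pointwise identity behind the Korn inequality. -/

section KornAlgebra

variable {n : ℕ}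

theorem sum_fin_succ_pi {k : ℕ} (f : (Fin (k + 1) → Fin n) → ℂ) :
    ∑ K, f K = ∑ a, ∑ K : Fin k → Fin n, f (Fin.cons a K) := by
  rw [← (Fin.consEquiv (fun _ : Fin (k + 1) => Fin n)).sum_comp, Fintype.sum_prod_type]
  rfl

theorem sum_fin_two_pi (f : (Fin 2 → Fin n) → ℂ) : ∑ K, f K = ∑ a, ∑ b, f ![a, b] := by
  rw [sum_fin_succ_pi]
  refine Finset.sum_congr rfl fun a _ => ?_
  rw [sum_fin_succ_pi]
  refine Finset.sum_congr rfl fun b _ => ?_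
  rw [Fintype.sum_unique]
  congr 1

theorem sum_fin_four_pi (f : (Fin 4 → Fin n) → ℂ) :
    ∑ K, f K = ∑ a, ∑ p, ∑ q, ∑ b, f ![a, p, q, b] := by
  rw [sum_fin_succ_pi]
  refine Finset.sum_congr rfl fun a _ => ?_
  rw [sum_fin_succ_pi]
  refine Finset.sum_congr rfl fun p _ => ?_
  rw [sum_fin_two_pi]
  rfl

theorem sum_fin_four_pi_inner (f : (Fin 4 → Fin n) → ℂ) :
    ∑ K, f K = ∑ J : Fin 2 → Fin n, ∑ a, ∑ b, f ![a, J 0, J 1, b] := by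
  rw [sum_fin_four_pi, sum_fin_two_pi, Finset.sum_comm]
  refine Finset.sum_congr rfl fun p _ => ?_
  rw [Finset.sum_comm]
  rfl

/-- The coefficient of the cross term of the symmetrized derivative. -/
def crossCoeff (G : Matrix (Fin n) (Fin n) ℝ) (K L : Fin 4 → Fin n) : ℝ :=
  G (K 0) (K 3) * G (L 0) (L 3) * G (K 1) (L 1) * G (K 2) (L 2)

/-- Exchange of the last (derivative) indices of two multi-indices. -/
def exchangeLast (P : (Fin 4 → Fin n) × (Fin 4 → Fin n)) : (Fin 4 → Fin n) × (Fin 4 → Fin n) :=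
  (Function.update P.1 3 (P.2 3), Function.update P.2 3 (P.1 3))

theorem exchangeLast_involutive : Function.Involutive (exchangeLast (n := n)) := by
  rintro ⟨K, L⟩
  simp [exchangeLast]

/-- Exchanging the last indices of the two multi-indices turns the contraction of t with its
transpose into one with the coefficients of a squared divergence: first and last index of the same
multi-index are paired. The price is that the derivative indices of the two factors are swapped,
which integration by parts can undo. -/
theorem sum_tact_swap (B : Matrix (Fin n) (Fin n) ℝ) (t : (Fin 4 → Fin n) → ℂ) :
    ∑ I, tact B t I * (starRingEnd ℂ) (tact B t (I ∘ Equiv.swap 0 3))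
      = ∑ K, ∑ L, (crossCoeff (B * B.transpose) K L : ℂ) *
          (t (Function.update K 3 (L 3)) * (starRingEnd ℂ) (t (Function.update L 3 (K 3)))) := by
  have hsymm : ∀ i j, (B * B.transpose) i j = (B * B.transpose) j i := by
    intro i j; simp [Matrix.mul_apply, mul_comm]
  simp only [tact_perm]
  rw [sum_tact_mul_conj]
  have h1 : ∀ K : Fin 4 → Fin n, ∑ L : Fin 4 → Fin n,
      (∏ a, (((B * B.transpose) (K a) (L a) : ℝ) : ℂ)) *
        (t K * (starRingEnd ℂ) (t (L ∘ Equiv.swap 0 3)))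
      = ∑ L : Fin 4 → Fin n,
      (∏ a, (((B * B.transpose) (K a) (L (Equiv.swap 0 3 a)) : ℝ) : ℂ)) *
        (t K * (starRingEnd ℂ) (t L)) := by
    intro K
    rw [← sum_comp_perm (Equiv.swap 0 3)]
    refine Finset.sum_congr rfl fun L _ => ?_
    have : (L ∘ Equiv.swap 0 3) ∘ Equiv.swap 0 3 = L := by funext a; simp
    rw [this]; rfl
  rw [Finset.sum_congr rfl fun K _ => h1 K, ← Fintype.sum_prod_type', ← Fintype.sum_prod_type']
  refine Fintype.sum_equiv exchangeLast_involutive.toPerm _ _ ?_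
  rintro ⟨K, L⟩
  simp only [Function.Involutive.coe_toPerm, exchangeLast, crossCoeff]
  have e : Function.update (Function.update K 3 (L 3)) 3 (K 3) = K := by simp
  have e' : Function.update (Function.update L 3 (K 3)) 3 (L 3) = L := by simp
  rw [Function.update_self, Function.update_self, e, e', Fin.prod_univ_four]
  congr 1
  have h0 : (Equiv.swap 0 3 : Equiv.Perm (Fin 4)) 1 = 1 := by decide
  have h2 : (Equiv.swap 0 3 : Equiv.Perm (Fin 4)) 2 = 2 := by decide
  have d0 : (0 : Fin 4) ≠ 3 := by decide
  have d1 : (1 : Fin 4) ≠ 3 := by decide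
  have d2 : (2 : Fin 4) ≠ 3 := by decide
  simp only [Equiv.swap_apply_left, Equiv.swap_apply_right, h0, h2, Function.update_of_ne d0,
    Function.update_of_ne d1, Function.update_of_ne d2]
  rw [hsymm (K 3) (L 0)]
  push_cast
  ring

theorem sum_mul_conj_self_re {ι : Type*} [Fintype ι] (t : ι → ℂ) :
    (∑ I, t I * (starRingEnd ℂ) (t I)) = ((∑ I, ‖t I‖ ^ 2 : ℝ) : ℂ) := by
  push_cast
  refine Finset.sum_congr rfl fun I _ => ?_
  rw [Complex.mul_conj, Complex.normSq_eq_norm_sq]; push_cast; rfl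

/-- Nonnegativity of the squared norm of a divergence. -/
theorem sum_crossCoeff_nonneg (B : Matrix (Fin n) (Fin n) ℝ) (t : (Fin 4 → Fin n) → ℂ) :
    0 ≤ (∑ K, ∑ L, (crossCoeff (B * B.transpose) K L : ℂ) * (t K * (starRingEnd ℂ) (t L))).re := by
  set G := B * B.transpose with hG
  -- The divergence, contracting the first index with the derivative index. The form is the squared
  -- norm of w for G on the two remaining indices.
  let w : (Fin 2 → Fin n) → ℂ := fun J => ∑ a, ∑ b, (G a b : ℂ) * t ![a, J 0, J 1, b]
  have h1 : (∑ K, ∑ L, (crossCoeff G K L : ℂ) * (t K * (starRingEnd ℂ) (t L)))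
      = ∑ J, ∑ J', (∏ a, ((G (J a) (J' a) : ℝ) : ℂ)) * (w J * (starRingEnd ℂ) (w J')) := by
    rw [sum_fin_four_pi_inner]
    refine Finset.sum_congr rfl fun J _ => ?_
    have h2 : ∀ a b, (∑ L, (crossCoeff G ![a, J 0, J 1, b] L : ℂ) *
        (t ![a, J 0, J 1, b] * (starRingEnd ℂ) (t L)))
        = ∑ J' : Fin 2 → Fin n, ∑ a', ∑ b', (crossCoeff G ![a, J 0, J 1, b] ![a', J' 0, J' 1, b'] : ℂ) *
          (t ![a, J 0, J 1, b] * (starRingEnd ℂ) (t ![a', J' 0, J' 1, b'])) :=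
      fun a b => sum_fin_four_pi_inner _
    simp only [h2]
    rw [Finset.sum_congr rfl fun a _ => Finset.sum_comm, Finset.sum_comm]
    refine Finset.sum_congr rfl fun J' _ => ?_
    simp only [w, map_sum, map_mul, Complex.conj_ofReal, Fin.prod_univ_two, Finset.sum_mul]
    simp only [Finset.mul_sum]
    refine Finset.sum_congr rfl fun a _ => Finset.sum_congr rfl fun b _ =>
      Finset.sum_congr rfl fun a' _ => Finset.sum_congr rfl fun b' _ => ?_
    simp [crossCoeff]
    ring
  rw [h1, ← sum_tact_mul_conj, sum_mul_conj_self_re, Complex.ofReal_re]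
  positivity

/-- Pointwise lower bound for the squared norm of a symmetrized derivative `t`, in terms of the
array `t'` of adjoint derivatives. -/
theorem sum_norm_symArr_ge (B : Matrix (Fin n) (Fin n) ℝ) (t t' : (Fin 4 → Fin n) → ℂ)
    (ht : ∀ σ : Equiv.Perm (Fin 4), σ 3 = 3 → ∀ J, t (J ∘ σ) = t J) :
    (1 / 4) * ∑ I, ‖tact B t I‖ ^ 2 + (3 / 4) *
        (∑ K, ∑ L, (crossCoeff (B * B.transpose) K L : ℂ) *
          (t (Function.update K 3 (L 3)) * (starRingEnd ℂ) (t (Function.update L 3 (K 3)))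
            - t' K * (starRingEnd ℂ) (t' L))).re
      ≤ ∑ I, ‖tact B (symArr t) I‖ ^ 2 := by
  have h1 := sum_symArr_four (tact B t) fun σ hσ J => by
    rw [tact_perm]
    simp only [ht σ hσ]
  rw [← tact_symArr, sum_mul_conj_self_re, sum_mul_conj_self_re, sum_tact_swap] at h1
  have h2 := congrArg Complex.re h1
  have e1 : ∀ (r : ℝ) (w : ℂ), ((1 / 4 : ℂ) * (r : ℂ) + 3 / 4 * w).re = 1 / 4 * r + 3 / 4 * w.re := by
    intro r w
    have : (1 / 4 : ℂ) * (r : ℂ) + 3 / 4 * w = ((1 / 4 * r : ℝ) : ℂ) + ((3 / 4 : ℝ) : ℂ) * w := by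
      push_cast; ring
    rw [this, Complex.add_re, Complex.ofReal_re, Complex.re_ofReal_mul]
  rw [e1, Complex.ofReal_re] at h2
  -- The t' terms enter with a minus sign and form the negative of a squared divergence, so
  -- subtracting them only lowers the left side.
  have h3 := sum_crossCoeff_nonneg B t'
  simp only [mul_sub, Finset.sum_sub_distrib, Complex.sub_re]
  linarith

end KornAlgebra
end ScatteringWitten
end

noncomputable section
namespace ScatteringWitten

/-! ### The weighted Korn inequality on Euclidean space. -/

section Korn

variable {n : ℕ}

local notation "V" => EuclideanSpace ℝ (Fin n)

/-- `f ∈ H¹(ℝⁿ)` with weak gradient `df`. -/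
structure IsH1 (f : EuclideanSpace ℝ (Fin n) → ℂ) (df : Fin n → EuclideanSpace ℝ (Fin n) → ℂ) :
    Prop where
  memLp : MemLp f 2 volume
  memLp_grad : ∀ l, MemLp (df l) 2 volume
  weak : ∀ l, IsWeakPartial univ l f (df l)

/-- The squared `L²` norm. -/
def sqNorm (f : EuclideanSpace ℝ (Fin n) → ℂ) : ℝ := ∫ z, ‖f z‖ ^ 2

theorem sqNorm_nonneg (f : V → ℂ) : 0 ≤ sqNorm f := integral_nonneg fun _ => by positivity

theorem integrable_norm_sq {f : V → ℂ} (hf : MemLp f 2 volume) : Integrable fun z => ‖f z‖ ^ 2 :=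
  hf.integrable_norm_pow (by norm_num)

theorem memLp_smul_of_bound {S K' : Set V} {b : V → ℝ} {f : V → ℂ} {C : ℝ}
    (hK' : IsClosed K') (hKS : K' ⊆ S) (hb : ContinuousOn b S) (hC : ∀ z ∈ K', |b z| ≤ C)
    (hf : MemLp f 2 volume) (h0 : ∀ z ∉ K', f z = 0) :
    MemLp (fun z => b z • f z) 2 volume := by
  have hm : AEStronglyMeasurable (fun z => b z • f z) volume := by
    have h1 : (fun z => b z • f z) = fun z => K'.indicator b z • f z := by
      funext z
      by_cases hz : z ∈ K'
      · simp [hz]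
      · simp [h0 z hz]
    rw [h1]
    have h2 : AEStronglyMeasurable (K'.indicator b) volume := by
      rw [aestronglyMeasurable_indicator_iff hK'.measurableSet]
      exact (hb.mono hKS).aestronglyMeasurable hK'.measurableSet
    exact h2.smul hf.1
  refine MemLp.of_le_mul (c := C) hf hm (Filter.Eventually.of_forall fun z => ?_)
  by_cases hz : z ∈ K'
  · rw [norm_smul]
    exact mul_le_mul_of_nonneg_right (hC z hz) (norm_nonneg _)
  · simp [h0 z hz]

theorem IsH1.smul {S K' : Set V} {a : V → ℝ} {f : V → ℂ} {df : Fin n → V → ℂ} {C : ℝ}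
    (hS : IsOpen S) (hK' : IsClosed K') (hKS : K' ⊆ S) (ha : ContDiffOn ℝ ∞ a S)
    (hC : ∀ z ∈ K', |a z| ≤ C) (hC' : ∀ l, ∀ z ∈ K', |pd l a z| ≤ C)
    (H : IsH1 f df) (h0 : ∀ z ∉ K', f z = 0) (h0' : ∀ l, ∀ z ∉ K', df l z = 0) :
    IsH1 (fun z => a z • f z) (fun l z => a z • df l z + pd l a z • f z) := by
  have hpd : ∀ l, ContinuousOn (pd l a) S := fun l =>
    (ha.continuousOn_fderiv_of_isOpen hS (by simp)).clm_apply continuousOn_const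
  refine ⟨memLp_smul_of_bound hK' hKS ha.continuousOn hC H.memLp h0, fun l => ?_, fun l => ?_⟩
  · exact (memLp_smul_of_bound hK' hKS ha.continuousOn hC (H.memLp_grad l) (h0' l)).add
      (memLp_smul_of_bound hK' hKS (hpd l) (hC' l) H.memLp h0)
  · refine (((H.weak l).mono (subset_univ S)).smul_smooth hS ha).extend hK' hS hKS ?_ ?_
    · intro z hz; simp [h0 z hz]
    · intro z hz; simp [h0 z hz, h0' l z hz]

theorem norm_integral_mul_conj_le {K' : Set V} {b : V → ℝ} {f g : V → ℂ} {C ε : ℝ}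
    (hC0 : 0 ≤ C) (hε : 0 < ε) (hC : ∀ z ∈ K', |b z| ≤ C)
    (hf : MemLp f 2 volume) (hg : MemLp g 2 volume) (h0 : ∀ z ∉ K', f z = 0) :
    ‖∫ z, (b z • f z) * (starRingEnd ℂ) (g z)‖ ≤ C * (ε⁻¹ * sqNorm f + ε * sqNorm g) := by
  refine (norm_integral_le_integral_norm _).trans ?_
  have e : C * (ε⁻¹ * sqNorm f + ε * sqNorm g)
      = ∫ z, C * (ε⁻¹ * ‖f z‖ ^ 2 + ε * ‖g z‖ ^ 2) := by
    rw [integral_const_mul, integral_add ((integrable_norm_sq hf).const_mul _)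
      ((integrable_norm_sq hg).const_mul _), integral_const_mul, integral_const_mul]
    rfl
  rw [e]
  refine integral_mono_of_nonneg (Filter.Eventually.of_forall fun z => norm_nonneg _)
    ((((integrable_norm_sq hf).const_mul _).add ((integrable_norm_sq hg).const_mul _)).const_mul _)
    (Filter.Eventually.of_forall fun z => ?_)
  have h1 : ‖f z‖ * ‖g z‖ ≤ ε⁻¹ * ‖f z‖ ^ 2 + ε * ‖g z‖ ^ 2 := by
    have h2 : 0 ≤ ε⁻¹ * (‖f z‖ - ε * ‖g z‖) ^ 2 := by positivity
    have h3 : ε⁻¹ * (‖f z‖ - ε * ‖g z‖) ^ 2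
        = ε⁻¹ * ‖f z‖ ^ 2 - 2 * (‖f z‖ * ‖g z‖) + ε * ‖g z‖ ^ 2 := by
      field_simp; ring
    have h4 : 0 ≤ ‖f z‖ * ‖g z‖ := by positivity
    linarith
  simp only [norm_mul, norm_smul, RCLike.norm_conj]
  by_cases hz : z ∈ K'
  · calc ‖b z‖ * ‖f z‖ * ‖g z‖ = |b z| * (‖f z‖ * ‖g z‖) := by rw [Real.norm_eq_abs]; ring
      _ ≤ C * (‖f z‖ * ‖g z‖) := mul_le_mul_of_nonneg_right (hC z hz) (by positivity)
      _ ≤ _ := mul_le_mul_of_nonneg_left h1 hC0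
  · rw [h0 z hz]; simp; positivity

theorem integrable_bracket {S K' : Set V} {a : V → ℝ} {f g : V → ℂ} {df dg : Fin n → V → ℂ} {C : ℝ}
    (hK' : IsClosed K') (hKS : K' ⊆ S) (ha : ContinuousOn a S)
    (hC : ∀ z ∈ K', |a z| ≤ C) (Hf : IsH1 f df) (Hg : IsH1 g dg)
    (h0 : ∀ z ∉ K', f z = 0) (h0' : ∀ l, ∀ z ∉ K', df l z = 0) (s : Fin n → ℝ) (i j : Fin n) :
    Integrable fun z => (a z : ℂ) *
      ((df j z + s j * f z) * (starRingEnd ℂ) (dg i z + s i * g z)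
        - (df i z - s i * f z) * (starRingEnd ℂ) (dg j z - s j * g z)) := by
  have e : ∀ (F G : V → ℂ), MemLp F 2 volume → MemLp G 2 volume → (∀ z ∉ K', F z = 0) →
      Integrable fun z => (a z : ℂ) * (F z * (starRingEnd ℂ) (G z)) := by
    intro F G hF hG hF0
    have := integrable_mul_conj (memLp_smul_of_bound hK' hKS ha hC hF hF0) hG
    simpa [Complex.real_smul, mul_assoc] using this
  simp only [mul_sub ((a _ : ℝ) : ℂ)]
  refine (e _ _ ((Hf.memLp_grad j).add (Hf.memLp.const_mul (s j : ℂ)))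
    ((Hg.memLp_grad i).add (Hg.memLp.const_mul (s i : ℂ))) ?_).sub
    (e _ _ ((Hf.memLp_grad i).sub (Hf.memLp.const_mul (s i : ℂ)))
    ((Hg.memLp_grad j).sub (Hg.memLp.const_mul (s j : ℂ))) ?_)
  · intro z hz; simp [h0 z hz, h0' _ z hz]
  · intro z hz; simp [h0 z hz, h0' _ z hz]

/-- With h = a f the bracket splits into ∂_j h ∂_i ḡ − ∂_i h ∂_j ḡ, a null Lagrangian with integral
zero; the total derivatives s_i ∂_j(h ḡ) and s_j ∂_i(h ḡ), also with integral zero; and terms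
containing a derivative of a. The products s_i s_j cancel because the second factor uses −s. Each
surviving term has either one derivative and no s, or one s and no derivative, which is one order
better than the main term. -/
theorem norm_integral_bracket_le {S K' : Set V} {a : V → ℝ} {f g : V → ℂ} {df dg : Fin n → V → ℂ}
    {C ε : ℝ} (hS : IsOpen S) (hK' : IsClosed K') (hKS : K' ⊆ S) (ha : ContDiffOn ℝ ∞ a S)
    (hC0 : 0 ≤ C) (hε : 0 < ε)
    (hC : ∀ z ∈ K', |a z| ≤ C) (hC' : ∀ l, ∀ z ∈ K', |pd l a z| ≤ C)
    (Hf : IsH1 f df) (Hg : IsH1 g dg)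
    (h0 : ∀ z ∉ K', f z = 0) (h0' : ∀ l, ∀ z ∉ K', df l z = 0) (s : Fin n → ℝ) (i j : Fin n) :
    ‖∫ z, (a z : ℂ) *
      ((df j z + s j * f z) * (starRingEnd ℂ) (dg i z + s i * g z)
        - (df i z - s i * f z) * (starRingEnd ℂ) (dg j z - s j * g z))‖
    ≤ C * (2 * ε⁻¹ * sqNorm f + ε * (sqNorm (dg i) + sqNorm (dg j))
        + (|s i| + |s j|) * (sqNorm f + sqNorm g)) := by
  have Hh := Hf.smul hS hK' hKS ha hC hC' h0 h0'
  have hpd : ∀ l, ContinuousOn (pd l a) S := fun l =>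
    (ha.continuousOn_fderiv_of_isOpen hS (by simp)).clm_apply continuousOn_const
  have hpf : ∀ l, MemLp (fun z => pd l a z • f z) 2 volume := fun l =>
    memLp_smul_of_bound hK' hKS (hpd l) (hC' l) Hf.memLp h0
  set h : V → ℂ := fun z => a z • f z with hh
  set dh : Fin n → V → ℂ := fun l z => a z • df l z + pd l a z • f z with hdh
  have i1 := integrable_mul_conj (Hh.memLp_grad j) (Hg.memLp_grad i)
  have i2 := integrable_mul_conj (Hh.memLp_grad i) (Hg.memLp_grad j)
  have i3 := integrable_mul_conj (hpf j) (Hg.memLp_grad i)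
  have i4 := integrable_mul_conj (hpf i) (Hg.memLp_grad j)
  have i5 := integrable_mul_conj (Hh.memLp_grad j) Hg.memLp
  have i6 := integrable_mul_conj Hh.memLp (Hg.memLp_grad j)
  have i7 := integrable_mul_conj (Hh.memLp_grad i) Hg.memLp
  have i8 := integrable_mul_conj Hh.memLp (Hg.memLp_grad i)
  have i9 := integrable_mul_conj (hpf j) Hg.memLp
  have i10 := integrable_mul_conj (hpf i) Hg.memLp
  have e : ∀ z, (a z : ℂ) *
      ((df j z + s j * f z) * (starRingEnd ℂ) (dg i z + s i * g z)
        - (df i z - s i * f z) * (starRingEnd ℂ) (dg j z - s j * g z))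
      = (dh j z * (starRingEnd ℂ) (dg i z) - dh i z * (starRingEnd ℂ) (dg j z))
        + ((pd i a z • f z) * (starRingEnd ℂ) (dg j z) - (pd j a z • f z) * (starRingEnd ℂ) (dg i z))
        + ((s i : ℂ) * (dh j z * (starRingEnd ℂ) (g z) + h z * (starRingEnd ℂ) (dg j z))
          + (s j : ℂ) * (dh i z * (starRingEnd ℂ) (g z) + h z * (starRingEnd ℂ) (dg i z)))
        - ((s i : ℂ) * ((pd j a z • f z) * (starRingEnd ℂ) (g z))
          + (s j : ℂ) * ((pd i a z • f z) * (starRingEnd ℂ) (g z))) := by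
    intro z
    simp only [hdh, hh, map_add, map_sub, map_mul, Complex.conj_ofReal, Complex.real_smul]
    ring
  have n1 := integral_weakPartial_mul_comm (Hh.weak j) (Hh.weak i) (Hg.weak j) (Hg.weak i)
    Hh.memLp (Hh.memLp_grad j) (Hh.memLp_grad i) Hg.memLp (Hg.memLp_grad j) (Hg.memLp_grad i)
  have n2 := integral_weakPartial_add_eq_zero (Hh.weak j) (Hg.weak j)
    Hh.memLp (Hh.memLp_grad j) Hg.memLp (Hg.memLp_grad j)
  have n3 := integral_weakPartial_add_eq_zero (Hh.weak i) (Hg.weak i)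
    Hh.memLp (Hh.memLp_grad i) Hg.memLp (Hg.memLp_grad i)
  have tot : ∫ z, (a z : ℂ) *
      ((df j z + s j * f z) * (starRingEnd ℂ) (dg i z + s i * g z)
        - (df i z - s i * f z) * (starRingEnd ℂ) (dg j z - s j * g z))
      = (∫ z, (pd i a z • f z) * (starRingEnd ℂ) (dg j z))
        - (∫ z, (pd j a z • f z) * (starRingEnd ℂ) (dg i z))
        - ((s i : ℂ) * (∫ z, (pd j a z • f z) * (starRingEnd ℂ) (g z))
          + (s j : ℂ) * ∫ z, (pd i a z • f z) * (starRingEnd ℂ) (g z)) := by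
    simp only [e]
    rw [integral_sub, integral_add, integral_add, integral_sub i1 i2, integral_sub i4 i3,
      integral_add, integral_add, integral_const_mul, integral_const_mul, integral_add i5 i6,
      integral_add i7 i8, integral_const_mul, integral_const_mul, n1, n2, n3]
    · ring
    · exact i9.const_mul _
    · exact i10.const_mul _
    · exact (i5.add i6).const_mul _
    · exact (i7.add i8).const_mul _
    · exact i1.sub i2
    · exact i4.sub i3
    · exact (i1.sub i2).add (i4.sub i3)
    · exact ((i5.add i6).const_mul _).add ((i7.add i8).const_mul _)
    · exact ((i1.sub i2).add (i4.sub i3)).add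
        (((i5.add i6).const_mul _).add ((i7.add i8).const_mul _))
    · exact (i9.const_mul _).add (i10.const_mul _)
  rw [tot]
  have b1 := norm_integral_mul_conj_le hC0 hε (hC' i) Hf.memLp (Hg.memLp_grad j) h0
  have b2 := norm_integral_mul_conj_le hC0 hε (hC' j) Hf.memLp (Hg.memLp_grad i) h0
  have b3 := norm_integral_mul_conj_le hC0 one_pos (hC' j) Hf.memLp Hg.memLp h0
  have b4 := norm_integral_mul_conj_le hC0 one_pos (hC' i) Hf.memLp Hg.memLp h0
  refine (norm_sub_le _ _).trans ((add_le_add (norm_sub_le _ _) (norm_add_le _ _)).trans ?_)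
  rw [norm_mul, norm_mul, Complex.norm_real, Complex.norm_real, Real.norm_eq_abs, Real.norm_eq_abs]
  have b3' := mul_le_mul_of_nonneg_left b3 (abs_nonneg (s i))
  have b4' := mul_le_mul_of_nonneg_left b4 (abs_nonneg (s j))
  rw [inv_one, one_mul, one_mul] at b3' b4'
  linarith [b1, b2, b3', b4']

/-- The conjugated derivative `∂ f + s f` of a `3`-tensor field, as an array of components. -/
def conjDeriv (s : Fin n → ℝ) (f : (Fin 3 → Fin n) → V → ℂ) (df : (Fin 3 → Fin n) → Fin n → V → ℂ)
    (z : V) (K : Fin 4 → Fin n) : ℂ :=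
  df (Fin.init K) (K (Fin.last 3)) z + s (K (Fin.last 3)) * f (Fin.init K) z

/-- The mixed term is r times the integral of ∂_l|f|², hence zero. This is where the weight produces
the positive term r²‖f‖². -/
theorem sqNorm_add_const_mul {f : V → ℂ} {df : Fin n → V → ℂ} (H : IsH1 f df) (l : Fin n) (r : ℝ) :
    ∫ z, ‖df l z + r * f z‖ ^ 2 = sqNorm (df l) + r ^ 2 * sqNorm f := by
  have h1 := integral_weakPartial_add_eq_zero (H.weak l) (H.weak l)
    H.memLp (H.memLp_grad l) H.memLp (H.memLp_grad l)
  have i1 := integrable_mul_conj (H.memLp_grad l) H.memLp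
  have i2 := integrable_mul_conj H.memLp (H.memLp_grad l)
  rw [← integral_add i1 i2] at h1
  have h2 := integral_re (i1.add i2)
  simp only [Pi.add_apply] at h2
  rw [h1, map_zero] at h2
  have e : ∀ z, ‖df l z + r * f z‖ ^ 2 = ‖df l z‖ ^ 2 + r ^ 2 * ‖f z‖ ^ 2
      + r * RCLike.re (df l z * (starRingEnd ℂ) (f z) + f z * (starRingEnd ℂ) (df l z)) := by
    intro z
    simp only [← Complex.normSq_eq_norm_sq, Complex.normSq_apply, RCLike.re_eq_complex_re]
    simp
    ring
  simp only [e]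
  rw [integral_add, integral_add, integral_const_mul, integral_const_mul, h2]
  · simp [sqNorm]
  · exact integrable_norm_sq (H.memLp_grad l)
  · exact (integrable_norm_sq H.memLp).const_mul _
  · exact (integrable_norm_sq (H.memLp_grad l)).add ((integrable_norm_sq H.memLp).const_mul _)
  · exact (i1.add i2).re.const_mul _

theorem sum_snoc {k : ℕ} {A : Type*} [AddCommMonoid A] (φ : (Fin k → Fin n) → Fin n → A) :
    ∑ K : Fin (k + 1) → Fin n, φ (Fin.init K) (K (Fin.last k)) = ∑ J, ∑ l, φ J l := by
  rw [← Fintype.sum_prod_type', ← (Fin.snocEquiv (fun _ : Fin (k + 1) => Fin n)).sum_comp,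
    ← (Equiv.prodComm _ _).sum_comp]
  refine Finset.sum_congr rfl fun p _ => ?_
  simp [Fin.snocEquiv]

/-- The difference between the cross term and the divergence term in the Korn inequality. -/
def kornBracket (s : Fin n → ℝ) (f : (Fin 3 → Fin n) → V → ℂ)
    (df : (Fin 3 → Fin n) → Fin n → V → ℂ) (K L : Fin 4 → Fin n) (z : V) : ℂ :=
  conjDeriv s f df z (Function.update K 3 (L 3))
      * (starRingEnd ℂ) (conjDeriv s f df z (Function.update L 3 (K 3)))
    - conjDeriv (-s) f df z K * (starRingEnd ℂ) (conjDeriv (-s) f df z L)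

theorem kornBracket_eq (s : Fin n → ℝ) (f : (Fin 3 → Fin n) → V → ℂ)
    (df : (Fin 3 → Fin n) → Fin n → V → ℂ) (K L : Fin 4 → Fin n) (z : V) :
    kornBracket s f df K L z
      = (df (Fin.init K) (L 3) z + s (L 3) * f (Fin.init K) z)
          * (starRingEnd ℂ) (df (Fin.init L) (K 3) z + s (K 3) * f (Fin.init L) z)
        - (df (Fin.init K) (K 3) z - s (K 3) * f (Fin.init K) z)
          * (starRingEnd ℂ) (df (Fin.init L) (L 3) z - s (L 3) * f (Fin.init L) z) := by
  have hlast : (Fin.last 3) = (3 : Fin 4) := rfl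
  have hinit : ∀ (K : Fin 4 → Fin n) (b : Fin n),
      (Fin.init (Function.update K 3 b) : Fin 3 → Fin n) = Fin.init K := by
    intro K b
    rw [← hlast, Fin.init_update_last]
  simp only [kornBracket, conjDeriv, hlast, Function.update_self, hinit, Pi.neg_apply,
    Complex.ofReal_neg, neg_mul, ← sub_eq_add_neg]

variable {S K' : Set (EuclideanSpace ℝ (Fin n))} {C : ℝ}
  {a : (Fin 4 → Fin n) → (Fin 4 → Fin n) → EuclideanSpace ℝ (Fin n) → ℝ}
  {f : (Fin 3 → Fin n) → EuclideanSpace ℝ (Fin n) → ℂ}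
  {df : (Fin 3 → Fin n) → Fin n → EuclideanSpace ℝ (Fin n) → ℂ}

theorem integrable_kornBracket (hK' : IsClosed K') (hKS : K' ⊆ S)
    (ha : ∀ K L, ContDiffOn ℝ ∞ (a K L) S) (haC : ∀ K L, ∀ z ∈ K', |a K L z| ≤ C)
    (H : ∀ J, IsH1 (f J) (df J)) (h0 : ∀ J, ∀ z ∉ K', f J z = 0)
    (h0' : ∀ J l, ∀ z ∉ K', df J l z = 0) (s : Fin n → ℝ) (K L : Fin 4 → Fin n) :
    Integrable fun z => (a K L z : ℂ) * kornBracket s f df K L z := by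
  simp only [kornBracket_eq]
  exact integrable_bracket hK' hKS (ha K L).continuousOn (haC K L) (H _) (H _) (h0 _) (h0' _)
    s (K 3) (L 3)

theorem norm_integral_sum_kornBracket_le (hS : IsOpen S) (hK' : IsClosed K') (hKS : K' ⊆ S)
    (hC0 : 0 ≤ C) (ha : ∀ K L, ContDiffOn ℝ ∞ (a K L) S) (haC : ∀ K L, ∀ z ∈ K', |a K L z| ≤ C)
    (haC' : ∀ K L l, ∀ z ∈ K', |pd l (a K L) z| ≤ C)
    (H : ∀ J, IsH1 (f J) (df J)) (h0 : ∀ J, ∀ z ∉ K', f J z = 0)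
    (h0' : ∀ J l, ∀ z ∉ K', df J l z = 0) {s : Fin n → ℝ} {F : ℝ} (hs : ∀ l, |s l| ≤ F)
    {ε : ℝ} (hε : 0 < ε) :
    ‖∫ z, ∑ K, ∑ L, (a K L z : ℂ) * kornBracket s f df K L z‖
      ≤ (Fintype.card (Fin 4 → Fin n) : ℝ) ^ 2 * (C * (2 * ε⁻¹ * ∑ J, sqNorm (f J)
        + 2 * ε * (∑ J, ∑ l, sqNorm (df J l)) + 4 * F * ∑ J, sqNorm (f J))) := by
  set P := ∑ J, ∑ l, sqNorm (df J l) with hP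
  set N := ∑ J, sqNorm (f J) with hN
  have hP0 : ∀ J l, sqNorm (df J l) ≤ P := by
    intro J l
    refine le_trans ?_ (Finset.single_le_sum (f := fun J => ∑ l, sqNorm (df J l))
      (fun J _ => Finset.sum_nonneg fun l _ => sqNorm_nonneg _) (Finset.mem_univ J))
    exact Finset.single_le_sum (f := fun l => sqNorm (df J l)) (fun l _ => sqNorm_nonneg _)
      (Finset.mem_univ l)
  have hN0 : ∀ J, sqNorm (f J) ≤ N := fun J =>
    Finset.single_le_sum (f := fun J => sqNorm (f J)) (fun J _ => sqNorm_nonneg _)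
      (Finset.mem_univ J)
  have bB : ∀ K L, ‖∫ z, (a K L z : ℂ) * kornBracket s f df K L z‖
      ≤ C * (2 * ε⁻¹ * N + 2 * ε * P + 4 * F * N) := by
    intro K L
    simp only [kornBracket_eq]
    refine (norm_integral_bracket_le hS hK' hKS (ha K L) hC0 hε (haC K L) (haC' K L) (H _) (H _)
      (h0 _) (h0' _) s (K 3) (L 3)).trans ?_
    refine mul_le_mul_of_nonneg_left ?_ hC0
    have h1 : 2 * ε⁻¹ * sqNorm (f (Fin.init K)) ≤ 2 * ε⁻¹ * N :=
      mul_le_mul_of_nonneg_left (hN0 _) (by positivity)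
    have h2 : ε * (sqNorm (df (Fin.init L) (K 3)) + sqNorm (df (Fin.init L) (L 3)))
        ≤ ε * (P + P) := mul_le_mul_of_nonneg_left (add_le_add (hP0 _ _) (hP0 _ _)) hε.le
    have h3 : (|s (K 3)| + |s (L 3)|) * (sqNorm (f (Fin.init K)) + sqNorm (f (Fin.init L)))
        ≤ (F + F) * (N + N) :=
      mul_le_mul (add_le_add (hs _) (hs _)) (add_le_add (hN0 _) (hN0 _))
        (add_nonneg (sqNorm_nonneg _) (sqNorm_nonneg _))
        (by linarith [(abs_nonneg _).trans (hs (K 3))])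
    linarith
  have iB := integrable_kornBracket hK' hKS ha haC H h0 h0' s
  rw [integral_finsetSum _ fun K _ => integrable_finsetSum _ fun L _ => iB K L]
  refine (norm_sum_le _ _).trans ?_
  have h1 : ∀ K : Fin 4 → Fin n, ‖∫ z, ∑ L, (a K L z : ℂ) * kornBracket s f df K L z‖
      ≤ (Fintype.card (Fin 4 → Fin n) : ℝ) * (C * (2 * ε⁻¹ * N + 2 * ε * P + 4 * F * N)) := by
    intro K
    rw [integral_finsetSum _ fun L _ => iB K L]
    refine (norm_sum_le _ _).trans ((Finset.sum_le_sum fun L _ => bB K L).trans ?_)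
    rw [Finset.sum_const, Finset.card_univ, nsmul_eq_mul]
  refine (Finset.sum_le_sum fun K _ => h1 K).trans ?_
  rw [Finset.sum_const, Finset.card_univ, nsmul_eq_mul]
  exact le_of_eq (by ring)

theorem integral_sum_norm_conjDeriv_sq (H : ∀ J, IsH1 (f J) (df J)) (o : Fin n) (F : ℝ) :
    ∫ z, ∑ K, ‖conjDeriv (Pi.single o F) f df z K‖ ^ 2
      = (∑ J, ∑ l, sqNorm (df J l)) + F ^ 2 * ∑ J, sqNorm (f J) := by
  have iE : ∀ K, Integrable fun z => ‖conjDeriv (Pi.single o F) f df z K‖ ^ 2 := fun K =>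
    integrable_norm_sq (((H _).memLp_grad _).add ((H _).memLp.const_mul _))
  rw [integral_finsetSum _ fun K _ => iE K]
  have h1 : ∀ K : Fin 4 → Fin n, ∫ z, ‖conjDeriv (Pi.single o F) f df z K‖ ^ 2
      = (fun J l => sqNorm (df J l) + (Pi.single o F : Fin n → ℝ) l ^ 2 * sqNorm (f J))
          (Fin.init K) (K (Fin.last 3)) :=
    fun K => sqNorm_add_const_mul (H _) _ _
  rw [Finset.sum_congr rfl fun K _ => h1 K]
  refine (sum_snoc fun J l => sqNorm (df J l)
    + (Pi.single o F : Fin n → ℝ) l ^ 2 * sqNorm (f J)).trans ?_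
  simp only [Finset.sum_add_distrib, Finset.mul_sum]
  congr 1
  refine Finset.sum_congr rfl fun J _ => ?_
  rw [Finset.sum_eq_single o]
  · simp
  · intro l _ hl; simp [hl]
  · simp

/-- The weighted Korn inequality on `ℝⁿ`: for a large weight the symmetrized conjugated derivative
controls the whole `H¹` norm. -/
theorem exists_korn_const (n : ℕ) {c C : ℝ} (hc : 0 < c) (hC0 : 0 ≤ C) :
    ∃ F₁ : ℝ, 0 < F₁ ∧ ∀ (S K' : Set (EuclideanSpace ℝ (Fin n))), IsOpen S → IsClosed K' → K' ⊆ S →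
    ∀ a : (Fin 4 → Fin n) → (Fin 4 → Fin n) → EuclideanSpace ℝ (Fin n) → ℝ,
    (∀ K L, ContDiffOn ℝ ∞ (a K L) S) → (∀ K L, ∀ z ∈ K', |a K L z| ≤ C) →
    (∀ K L l, ∀ z ∈ K', |pd l (a K L) z| ≤ C) →
    ∀ (f : (Fin 3 → Fin n) → EuclideanSpace ℝ (Fin n) → ℂ)
      (df : (Fin 3 → Fin n) → Fin n → EuclideanSpace ℝ (Fin n) → ℂ),
    (∀ J, IsH1 (f J) (df J)) → (∀ J, ∀ z ∉ K', f J z = 0) → (∀ J l, ∀ z ∉ K', df J l z = 0) →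
    ∀ (o : Fin n) (F : ℝ), F₁ ≤ F → ∀ q : EuclideanSpace ℝ (Fin n) → ℝ, Integrable q →
    (∀ z, 0 ≤ q z) →
    (∀ z ∈ K', (c / 4) * ∑ K, ‖conjDeriv (Pi.single o F) f df z K‖ ^ 2
      + (3 / 4) * (∑ K, ∑ L, (a K L z : ℂ) * kornBracket (Pi.single o F) f df K L z).re ≤ q z) →
    (c / 8) * ((∑ J, ∑ l, sqNorm (df J l)) + F ^ 2 * ∑ J, sqNorm (f J)) ≤ ∫ z, q z := by
  set m : ℝ := (Fintype.card (Fin 4 → Fin n) : ℝ) ^ 2 with hm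
  have hm0 : 0 ≤ m := by positivity
  have hmC : 0 < m * C + 1 := by positivity
  -- Chosen so that m C ε ≤ c/16: the gradient part of the error, (3/2) m C ε P, is then at most
  -- 3c/32 of the gradient term, less than the c/8 that may be spent. The added 1 covers C = 0.
  obtain ⟨ε, hεdef⟩ : ∃ ε : ℝ, ε = c / (16 * (m * C + 1)) := ⟨_, rfl⟩
  have hε : 0 < ε := by rw [hεdef]; positivity
  -- A and B are the coefficients of ‖f‖² and F‖f‖² in the error; F ≥ 1 and 8(A + B) ≤ cF give A +
  -- BF ≤ (c/8)F².
  obtain ⟨A, hA⟩ : ∃ A : ℝ, A = 3 / 2 * (m * C) * ε⁻¹ := ⟨_, rfl⟩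
  obtain ⟨B, hB⟩ : ∃ B : ℝ, B = 3 * (m * C) := ⟨_, rfl⟩
  have hA0 : 0 ≤ A := by rw [hA]; positivity
  have hB0 : 0 ≤ B := by rw [hB]; positivity
  refine ⟨1 + 8 * (A + B) / c, by positivity, ?_⟩
  intro S K' hS hK' hKS a ha haC haC' f df H h0 h0' o F hF q hq hq0 hqge
  have hdivnn : 0 ≤ 8 * (A + B) / c := by positivity
  have hF1 : 1 ≤ F := by linarith
  have hFA : 8 * (A + B) ≤ c * F := by
    have : 8 * (A + B) / c ≤ F := by linarith
    rw [div_le_iff₀ hc] at this; linarith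
  have hsabs : ∀ l, |(Pi.single o F : Fin n → ℝ) l| ≤ F := by
    intro l
    by_cases h : l = o
    · subst h; simp [abs_of_pos (by linarith : 0 < F)]
    · simp [h]; linarith
  have hE := integral_sum_norm_conjDeriv_sq H o F
  have bX := norm_integral_sum_kornBracket_le hS hK' hKS hC0 ha haC haC' H h0 h0' hsabs hε
  have iX : Integrable fun z => ∑ K, ∑ L, (a K L z : ℂ) * kornBracket (Pi.single o F) f df K L z :=
    integrable_finsetSum _ fun K _ => integrable_finsetSum _ fun L _ =>
      integrable_kornBracket hK' hKS ha haC H h0 h0' _ K L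
  have iS : Integrable fun z => ∑ K, ‖conjDeriv (Pi.single o F) f df z K‖ ^ 2 :=
    integrable_finsetSum _ fun K _ =>
      integrable_norm_sq (((H _).memLp_grad _).add ((H _).memLp.const_mul _))
  have iXre : Integrable fun z =>
      (∑ K, ∑ L, (a K L z : ℂ) * kornBracket (Pi.single o F) f df K L z).re := iX.re
  have hle := integral_mono ((iS.const_mul (c / 4)).add (iXre.const_mul (3 / 4))) hq fun z => by
    by_cases hz : z ∈ K'
    · exact hqge z hz
    -- Off K' all components and derivatives vanish, so only q ≥ 0 is needed there.
    · have e0 : ∀ (r : Fin n → ℝ) K, conjDeriv r f df z K = 0 := by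
        intro r K; simp [conjDeriv, h0 _ z hz, h0' _ _ z hz]
      simp only [Pi.add_apply, kornBracket, e0]
      simpa using hq0 z
  have hre : |∫ z, (∑ K, ∑ L, (a K L z : ℂ) * kornBracket (Pi.single o F) f df K L z).re|
      ≤ ‖∫ z, ∑ K, ∑ L, (a K L z : ℂ) * kornBracket (Pi.single o F) f df K L z‖ := by
    have h1 := integral_re iX
    simp only [RCLike.re_eq_complex_re] at h1
    rw [h1]
    exact Complex.abs_re_le_norm _
  simp only [Pi.add_apply] at hle
  rw [integral_add (iS.const_mul _) (iXre.const_mul _), integral_const_mul, integral_const_mul,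
    hE] at hle
  have hre' := (abs_le.1 (hre.trans bX)).1
  have hNnn : 0 ≤ ∑ J, sqNorm (f J) := Finset.sum_nonneg fun J _ => sqNorm_nonneg _
  have hPnn : 0 ≤ ∑ J, ∑ l, sqNorm (df J l) :=
    Finset.sum_nonneg fun J _ => Finset.sum_nonneg fun l _ => sqNorm_nonneg _
  rw [← hm] at hre'
  generalize (∫ z, (∑ K, ∑ L, (a K L z : ℂ) * kornBracket (Pi.single o F) f df K L z).re) = X
    at hle hre'
  generalize (∑ J, sqNorm (f J)) = N at hle hre' hNnn ⊢
  generalize (∑ J, ∑ l, sqNorm (df J l)) = P at hle hre' hPnn ⊢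
  have hεm : m * C * ε ≤ c / 16 := by
    rw [hεdef, ← mul_div_assoc, div_le_div_iff₀ (by positivity) (by norm_num)]
    nlinarith
  have h1 : m * C * ε * P ≤ c / 16 * P := mul_le_mul_of_nonneg_right hεm hPnn
  have h2 : A + B * F ≤ c / 8 * F ^ 2 := by nlinarith
  have h3 : (A + B * F) * N ≤ c / 8 * F ^ 2 * N := mul_le_mul_of_nonneg_right h2 hNnn
  have h4 : 3 / 4 * (m * (C * (2 * ε⁻¹ * N + 2 * ε * P + 4 * F * N)))
      = (A + B * F) * N + 3 / 2 * (m * C * ε * P) := by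
    simp only [hA, hB]; ring
  have h5 : 0 ≤ c * P := by positivity
  linarith

end Korn
end ScatteringWitten
end

noncomputable section
namespace ScatteringWitten

/-! ### Changes of charts and the matrix of a metric in a chart. -/

section Charts

set_option linter.unusedSectionVars false

variable {n : ℕ} {M : Type*} [TopologicalSpace M] [ChartedSpace (EuclideanSpace ℝ (Fin n)) M]
  [IsManifold (𝓡 n) ∞ M]
  {e e' : OpenPartialHomeomorph M (EuclideanSpace ℝ (Fin n))}

/-- The matrix of partial derivatives of a map of `ℝⁿ`. -/
def jac (ψ : EuclideanSpace ℝ (Fin n) → EuclideanSpace ℝ (Fin n)) (z : EuclideanSpace ℝ (Fin n)) :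
    Matrix (Fin n) (Fin n) ℝ :=
  Matrix.of fun a i => pd i ψ z a

/-- The change of coordinates from the chart `e'` to the chart `e`. -/
def transition (e e' : OpenPartialHomeomorph M (EuclideanSpace ℝ (Fin n)))
    (z : EuclideanSpace ℝ (Fin n)) : EuclideanSpace ℝ (Fin n) := e (e'.symm z)

theorem contDiffOn_transition (he : e ∈ IsManifold.maximalAtlas (𝓡 n) ∞ M)
    (he' : e' ∈ IsManifold.maximalAtlas (𝓡 n) ∞ M) :
    ContDiffOn ℝ ∞ (transition e e') (e'.target ∩ e'.symm ⁻¹' e.source) := by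
  rw [← contMDiffOn_iff_contDiffOn]
  exact (contMDiffOn_of_mem_maximalAtlas he).comp
    ((contMDiffOn_symm_of_mem_maximalAtlas he').mono inter_subset_left) fun z hz => hz.2

theorem isOpen_target_inter (e : OpenPartialHomeomorph M (EuclideanSpace ℝ (Fin n))) {U : Set M}
    (hU : IsOpen U) : IsOpen (e.target ∩ e.symm ⁻¹' U) :=
  e.isOpen_inter_preimage_symm hU

theorem apply_eq_sum_pd {W : Type*} [NormedAddCommGroup W] [NormedSpace ℝ W]
    (L : EuclideanSpace ℝ (Fin n) →L[ℝ] W) (v : EuclideanSpace ℝ (Fin n)) :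
    L v = ∑ a, v a • L (EuclideanSpace.single a 1) := by
  conv_lhs => rw [← (EuclideanSpace.basisFun (Fin n) ℝ).sum_repr v]
  simp [map_sum]

theorem coordVec_change (he : e ∈ IsManifold.maximalAtlas (𝓡 n) ∞ M)
    (he' : e' ∈ IsManifold.maximalAtlas (𝓡 n) ∞ M) {z : EuclideanSpace ℝ (Fin n)}
    (hz : z ∈ e'.target) (hz' : e'.symm z ∈ e.source) (i : Fin n) :
    (coordVec e' z i : EuclideanSpace ℝ (Fin n))
      = ∑ a, jac (transition e e') z a i •
        (coordVec e (transition e e' z) a : EuclideanSpace ℝ (Fin n)) := by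
  have h1 : (e'.symm : EuclideanSpace ℝ (Fin n) → M) =ᶠ[nhds z]
      (e.symm : EuclideanSpace ℝ (Fin n) → M) ∘ transition e e' := by
    filter_upwards [(isOpen_target_inter e' e.open_source).mem_nhds ⟨hz, hz'⟩] with w hw
    simp [transition, e.left_inv hw.2]
  have hd1 : MDifferentiableAt 𝓘(ℝ, EuclideanSpace ℝ (Fin n)) 𝓘(ℝ, EuclideanSpace ℝ (Fin n))
      (transition e e') z :=
    (((contDiffOn_transition he he').contDiffAt
      ((isOpen_target_inter e' e.open_source).mem_nhds ⟨hz, hz'⟩)).differentiableAt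
        (by simp)).mdifferentiableAt
  have hd2 : MDifferentiableAt 𝓘(ℝ, EuclideanSpace ℝ (Fin n)) (𝓡 n)
      (e.symm : EuclideanSpace ℝ (Fin n) → M) (transition e e' z) :=
    (contMDiffAt_symm_of_mem_maximalAtlas he (e.map_source hz')).mdifferentiableAt (by simp)
  have h2 := h1.mfderiv_eq (I := 𝓘(ℝ, EuclideanSpace ℝ (Fin n))) (I' := 𝓡 n)
  rw [mfderiv_comp z hd2 hd1] at h2
  have h3 := DFunLike.congr_fun h2
    (EuclideanSpace.single i (1 : ℝ) : EuclideanSpace ℝ (Fin n))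
  rw [mfderiv_eq_fderiv] at h3
  refine Eq.trans h3 ?_
  exact apply_eq_sum_pd (W := EuclideanSpace ℝ (Fin n))
    (mfderiv 𝓘(ℝ, EuclideanSpace ℝ (Fin n)) (𝓡 n) e.symm (transition e e' z)) _

theorem symm_transition {z : EuclideanSpace ℝ (Fin n)} (hz' : e'.symm z ∈ e.source) :
    e.symm (transition e e' z) = e'.symm z := e.left_inv hz'

theorem cotangent_change (L : ∀ p : M, TangentSpace (𝓡 n) p →L[ℝ] ℝ)
    (he : e ∈ IsManifold.maximalAtlas (𝓡 n) ∞ M)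
    (he' : e' ∈ IsManifold.maximalAtlas (𝓡 n) ∞ M) {z : EuclideanSpace ℝ (Fin n)}
    (hz : z ∈ e'.target) (hz' : e'.symm z ∈ e.source) (i : Fin n) :
    L (e'.symm z) (coordVec e' z i)
      = ∑ a, jac (transition e e') z a i *
        L (e.symm (transition e e' z)) (coordVec e (transition e e' z) a) := by
  -- The base points agree only propositionally. All tangent spaces are the model space as types, so
  -- one vector can be fed to the tensor at either point.
  have key : ∀ p q : M, p = q → ∀ v : EuclideanSpace ℝ (Fin n),
      (L p : EuclideanSpace ℝ (Fin n) →L[ℝ] ℝ) v = (L q : EuclideanSpace ℝ (Fin n) →L[ℝ] ℝ) v := by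
    rintro p _ rfl v; rfl
  have h1 := key _ _ (symm_transition hz').symm
    (coordVec e' z i : EuclideanSpace ℝ (Fin n))
  refine Eq.trans h1 ?_
  rw [coordVec_change he he' hz hz' i, map_sum]
  refine Finset.sum_congr rfl fun a _ => ?_
  rw [map_smul]; rfl

theorem gram_change (G : TwoTensor n M) (he : e ∈ IsManifold.maximalAtlas (𝓡 n) ∞ M)
    (he' : e' ∈ IsManifold.maximalAtlas (𝓡 n) ∞ M) {z : EuclideanSpace ℝ (Fin n)}
    (hz : z ∈ e'.target) (hz' : e'.symm z ∈ e.source) :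
    gram G e' z = (jac (transition e e') z).transpose * gram G e (transition e e' z)
      * jac (transition e e') z := by
  have key : ∀ p q : M, p = q → ∀ v w : EuclideanSpace ℝ (Fin n),
      (G p : EuclideanSpace ℝ (Fin n) →L[ℝ] EuclideanSpace ℝ (Fin n) →L[ℝ] ℝ) v w
        = (G q : EuclideanSpace ℝ (Fin n) →L[ℝ] EuclideanSpace ℝ (Fin n) →L[ℝ] ℝ) v w := by
    rintro p _ rfl v w; rfl
  ext i j
  have h1 := key _ _ (symm_transition hz').symm
    (coordVec e' z i : EuclideanSpace ℝ (Fin n)) (coordVec e' z j : EuclideanSpace ℝ (Fin n))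
  refine Eq.trans h1 ?_
  rw [coordVec_change he he' hz hz' i, coordVec_change he he' hz hz' j]
  simp only [map_sum, map_smul, Matrix.mul_apply, Matrix.transpose_apply, Finset.sum_mul,
    _root_.sum_apply, _root_.smul_apply, smul_eq_mul]
  refine Finset.sum_congr rfl fun a _ => ?_
  rw [Finset.mul_sum]
  refine Finset.sum_congr rfl fun b _ => ?_
  simp only [gram, Matrix.of_apply]
  ring_nf

/-- The coordinate fields are the tangent map of the inverse chart applied to constant fields, hence
smooth sections, and a smooth bilinear form evaluated on them is smooth. -/
theorem contDiffOn_gram {G : TwoTensor n M} (hG : IsSmoothTwoTensor G)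
    (he : e ∈ IsManifold.maximalAtlas (𝓡 n) ∞ M) (i j : Fin n) :
    ContDiffOn ℝ ∞ (fun z => gram G e z i j) e.target := by
  have hsymm := contMDiffOn_symm_of_mem_maximalAtlas he
  have hv : ∀ i : Fin n, ContMDiffOn 𝓘(ℝ, EuclideanSpace ℝ (Fin n)) ((𝓡 n).tangent) ∞
      (fun z => (Bundle.TotalSpace.mk' (EuclideanSpace ℝ (Fin n)) (e.symm z) (coordVec e z i) :
        TangentBundle (𝓡 n) M)) e.target := by
    intro i
    have h1 := hsymm.contMDiffOn_tangentMapWithin (m := ∞) (by simp) e.open_target.uniqueMDiffOn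
    have h2 : ContMDiff 𝓘(ℝ, EuclideanSpace ℝ (Fin n))
        (𝓘(ℝ, EuclideanSpace ℝ (Fin n)).tangent) ∞
        (fun z : EuclideanSpace ℝ (Fin n) => (⟨z, EuclideanSpace.single i (1 : ℝ)⟩ :
          TangentBundle 𝓘(ℝ, EuclideanSpace ℝ (Fin n)) (EuclideanSpace ℝ (Fin n)))) := by
      intro z
      exact contMDiffAt_vectorSpace_iff_contDiffAt.2 contDiffAt_const
    refine (h1.comp h2.contMDiffOn (s := e.target) fun z hz => hz).congr fun z hz => ?_
    simp only [Function.comp_apply, tangentMapWithin, coordVec]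
    rw [mfderivWithin_of_isOpen e.open_target hz]
  rw [← contMDiffOn_iff_contDiffOn]
  intro z hz
  have h3 := (hG.contMDiffAt (x := e.symm z)).comp_contMDiffWithinAt z (hsymm z hz)
  have h4 := ContMDiffWithinAt.clm_bundle_apply₂ (E₃ := Bundle.Trivial M ℝ) (F₃ := ℝ)
    h3 (hv i z hz) (hv j z hz)
  exact (Bundle.contMDiffWithinAt_totalSpace.1 h4).2

theorem differential_coordVec {x : M → ℝ} (hx : ContMDiff (𝓡 n) 𝓘(ℝ, ℝ) ∞ x)
    (he : e ∈ IsManifold.maximalAtlas (𝓡 n) ∞ M) {z : EuclideanSpace ℝ (Fin n)}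
    (hz : z ∈ e.target) (i : Fin n) :
    differential (n := n) x (e.symm z) (coordVec e z i) = pd i (fun w => x (e.symm w)) z := by
  have hd2 : MDifferentiableAt 𝓘(ℝ, EuclideanSpace ℝ (Fin n)) (𝓡 n)
      (e.symm : EuclideanSpace ℝ (Fin n) → M) z :=
    (contMDiffAt_symm_of_mem_maximalAtlas he hz).mdifferentiableAt (by simp)
  have h2 := mfderiv_comp z ((hx (e.symm z)).mdifferentiableAt (by simp)) hd2
  rw [mfderiv_eq_fderiv] at h2
  exact (DFunLike.congr_fun h2 (EuclideanSpace.single i (1 : ℝ) : EuclideanSpace ℝ (Fin n))).symm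

theorem contDiffOn_comp_symm {x : M → ℝ} (hx : ContMDiff (𝓡 n) 𝓘(ℝ, ℝ) ∞ x)
    (he : e ∈ IsManifold.maximalAtlas (𝓡 n) ∞ M) :
    ContDiffOn ℝ ∞ (fun w => x (e.symm w)) e.target := by
  rw [← contMDiffOn_iff_contDiffOn]
  exact hx.comp_contMDiffOn (contMDiffOn_symm_of_mem_maximalAtlas he)

/-- The coordinate vectors of a chart are linearly independent. -/
theorem injective_sum_coordVec (he : e ∈ IsManifold.maximalAtlas (𝓡 n) ∞ M)
    {z : EuclideanSpace ℝ (Fin n)} (hz : z ∈ e.target) :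
    Function.Injective (mfderiv 𝓘(ℝ, EuclideanSpace ℝ (Fin n)) (𝓡 n) e.symm z) := by
  have hd2 : MDifferentiableAt 𝓘(ℝ, EuclideanSpace ℝ (Fin n)) (𝓡 n)
      (e.symm : EuclideanSpace ℝ (Fin n) → M) z :=
    (contMDiffAt_symm_of_mem_maximalAtlas he hz).mdifferentiableAt (by simp)
  have hd1 : MDifferentiableAt (𝓡 n) 𝓘(ℝ, EuclideanSpace ℝ (Fin n)) e (e.symm z) :=
    (contMDiffAt_of_mem_maximalAtlas he (e.map_target hz)).mdifferentiableAt (by simp)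
  have h1 : (e ∘ e.symm : EuclideanSpace ℝ (Fin n) → _) =ᶠ[nhds z] id := by
    filter_upwards [e.open_target.mem_nhds hz] with w hw
    simp [e.right_inv hw]
  have h2 := mfderiv_comp z hd1 hd2
  rw [h1.mfderiv_eq] at h2
  have h3 : ∀ v, mfderiv (𝓡 n) 𝓘(ℝ, EuclideanSpace ℝ (Fin n)) e (e.symm z)
      (mfderiv 𝓘(ℝ, EuclideanSpace ℝ (Fin n)) (𝓡 n) e.symm z v) = v := by
    intro v
    have h4 := DFunLike.congr_fun h2 v
    rw [mfderiv_id] at h4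
    exact h4.symm
  exact Function.LeftInverse.injective h3

theorem gram_mulVec {G : TwoTensor n M} (z : EuclideanSpace ℝ (Fin n)) (v w : Fin n → ℝ) :
    dotProduct v (Matrix.mulVec (gram G e z) w)
      = G (e.symm z)
          (mfderiv 𝓘(ℝ, EuclideanSpace ℝ (Fin n)) (𝓡 n) e.symm z (WithLp.toLp 2 v : EuclideanSpace ℝ (Fin n)))
          (mfderiv 𝓘(ℝ, EuclideanSpace ℝ (Fin n)) (𝓡 n) e.symm z (WithLp.toLp 2 w : EuclideanSpace ℝ (Fin n))) := by
  have h1 : ∀ v : EuclideanSpace ℝ (Fin n),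
      (mfderiv 𝓘(ℝ, EuclideanSpace ℝ (Fin n)) (𝓡 n) e.symm z v : EuclideanSpace ℝ (Fin n))
        = ∑ a, v a • (coordVec e z a : EuclideanSpace ℝ (Fin n)) := fun v =>
    apply_eq_sum_pd (W := EuclideanSpace ℝ (Fin n))
      (mfderiv 𝓘(ℝ, EuclideanSpace ℝ (Fin n)) (𝓡 n) e.symm z) v
  have h2 : ∀ v w : EuclideanSpace ℝ (Fin n),
      (G (e.symm z) : EuclideanSpace ℝ (Fin n) →L[ℝ] EuclideanSpace ℝ (Fin n) →L[ℝ] ℝ)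
        (∑ a, v a • (coordVec e z a : EuclideanSpace ℝ (Fin n)))
        (∑ a, w a • (coordVec e z a : EuclideanSpace ℝ (Fin n)))
      = ∑ a, ∑ b, v a * (gram G e z a b * w b) := by
    intro v w
    simp only [map_sum, map_smul, _root_.sum_apply, _root_.smul_apply,
      smul_eq_mul, Finset.mul_sum]
    rw [Finset.sum_comm]
    refine Finset.sum_congr rfl fun a _ => Finset.sum_congr rfl fun b _ => ?_
    simp only [gram, Matrix.of_apply]
    ring
  simp only [dotProduct, Matrix.mulVec, Finset.mul_sum]
  have h3 := h2 (WithLp.toLp 2 v) (WithLp.toLp 2 w)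
  rw [← h1, ← h1] at h3
  exact h3.symm

theorem gram_posDef {G : TwoTensor n M} (he : e ∈ IsManifold.maximalAtlas (𝓡 n) ∞ M)
    {z : EuclideanSpace ℝ (Fin n)} (hz : z ∈ e.target)
    (hs : ∀ v w : TangentSpace (𝓡 n) (e.symm z), G (e.symm z) v w = G (e.symm z) w v)
    (hp : ∀ v : TangentSpace (𝓡 n) (e.symm z), v ≠ 0 → 0 < G (e.symm z) v v) :
    (gram G e z).PosDef := by
  refine Matrix.PosDef.of_dotProduct_mulVec_pos ?_ fun v hv => ?_
  · ext i j
    simp [gram, hs (coordVec e z i)]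
  · simp only [star_trivial]
    rw [gram_mulVec]
    refine hp _ fun h => hv ?_
    have h1 := injective_sum_coordVec he hz (h.trans (map_zero _).symm)
    exact congrArg (WithLp.ofLp) h1

end Charts
end ScatteringWitten
end

noncomputable section
namespace ScatteringWitten

/-! ### The transformation law of Christoffel symbols. -/

section Christoffel

variable {n : ℕ}

local notation "V" => EuclideanSpace ℝ (Fin n)

/-- The Christoffel symbols of a matrix-valued function. -/
def chr (A : EuclideanSpace ℝ (Fin n) → Matrix (Fin n) (Fin n) ℝ) (z : EuclideanSpace ℝ (Fin n))
    (q k l : Fin n) : ℝ :=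
  (1 / 2) * ∑ r, (A z)⁻¹ q r *
    (pd k (fun w => A w r l) z + pd l (fun w => A w r k) z - pd r (fun w => A w k l) z)

theorem pd_eval {ψ : V → V} {z : V} (hψ : DifferentiableAt ℝ ψ z) (k p : Fin n) :
    pd k (fun w => ψ w p) z = pd k ψ z p := by
  have h := ((EuclideanSpace.proj p : V →L[ℝ] ℝ).hasFDerivAt (x := ψ z)).comp z hψ.hasFDerivAt
  simp only [pd]
  exact DFunLike.congr_fun h.fderiv _

theorem pd_comp {f : V → ℝ} {ψ : V → V} {z : V} (hf : DifferentiableAt ℝ f (ψ z))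
    (hψ : DifferentiableAt ℝ ψ z) (k : Fin n) :
    pd k (fun w => f (ψ w)) z = ∑ c, jac ψ z c k * pd c f (ψ z) := by
  have h1 : fderiv ℝ (fun w => f (ψ w)) z = (fderiv ℝ f (ψ z)).comp (fderiv ℝ ψ z) :=
    fderiv_comp z hf hψ
  simp only [pd]
  rw [h1, ContinuousLinearMap.comp_apply, apply_eq_sum_pd]
  rfl

theorem pd_sum {ι : Type*} (s : Finset ι) {f : ι → V → ℝ} {z : V}
    (hf : ∀ i ∈ s, DifferentiableAt ℝ (f i) z) (k : Fin n) :
    pd k (fun w => ∑ i ∈ s, f i w) z = ∑ i ∈ s, pd k (f i) z := by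
  simp only [pd]
  rw [fderiv_fun_sum hf]
  simp

theorem sum_three_comm (φ : Fin n → Fin n → Fin n → ℝ) :
    ∑ a, ∑ b, ∑ c, φ a b c = ∑ c, ∑ a, ∑ b, φ a b c := by
  rw [Finset.sum_congr rfl fun a _ => Finset.sum_comm, Finset.sum_comm]

/-- The second derivatives of a map of `ℝⁿ`. -/
def hess (ψ : EuclideanSpace ℝ (Fin n) → EuclideanSpace ℝ (Fin n)) (z : EuclideanSpace ℝ (Fin n))
    (p k l : Fin n) : ℝ :=
  pd k (fun w => jac ψ w p l) z

theorem differentiableAt_jac {ψ : V → V} {z : V} (hψ : ContDiffAt ℝ ∞ ψ z) (p l : Fin n) :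
    DifferentiableAt ℝ (fun w => jac ψ w p l) z := by
  have h1 : DifferentiableAt ℝ (fderiv ℝ ψ) z :=
    (hψ.fderiv_right (m := ∞) (by simp)).differentiableAt (by simp)
  have h2 : DifferentiableAt ℝ (fun w => pd l ψ w) z := h1.clm_apply (differentiableAt_const _)
  exact (differentiableAt_euclidean.1 h2) p

theorem hess_symm {ψ : V → V} {z : V} (hψ : ContDiffAt ℝ ∞ ψ z) (p k l : Fin n) :
    hess ψ z p k l = hess ψ z p l k := by
  have h1 : DifferentiableAt ℝ (fderiv ℝ ψ) z :=
    (hψ.fderiv_right (m := ∞) (by simp)).differentiableAt (by simp)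
  have key : ∀ k l, hess ψ z p k l
      = (fderiv ℝ (fderiv ℝ ψ) z (EuclideanSpace.single k 1) (EuclideanSpace.single l 1)) p := by
    intro k l
    have h2 : DifferentiableAt ℝ (fun w => pd l ψ w) z := h1.clm_apply (differentiableAt_const _)
    have h3 : hess ψ z p k l = pd k (fun w => pd l ψ w) z p := pd_eval h2 k p
    rw [h3]
    change (fderiv ℝ (fun w => fderiv ℝ ψ w (EuclideanSpace.single l 1)) z _) p = _
    rw [fderiv_clm_apply h1 (differentiableAt_const _)]
    simp
  rw [key, key, (hψ.isSymmSndFDerivAt (by simp; exact WithTop.coe_le_coe.2 le_top)).eq]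

/-- The transformation law of the Christoffel symbols. -/
theorem chr_change {A A' : V → Matrix (Fin n) (Fin n) ℝ} {ψ : V → V} {z : V}
    (hψ : ContDiffAt ℝ ∞ ψ z) (hA : ∀ i j, DifferentiableAt ℝ (fun w => A w i j) (ψ z))
    (hsymm : (A (ψ z)).IsSymm) (hdet : IsUnit (A (ψ z)).det) (hJ : IsUnit (jac ψ z).det)
    (hA' : ∀ᶠ w in nhds z, A' w = (jac ψ w).transpose * A (ψ w) * jac ψ w) (p k l : Fin n) :
    ∑ q, jac ψ z p q * chr A' z q k l
      = (∑ a, ∑ b, chr A (ψ z) p a b * (jac ψ z a k * jac ψ z b l)) + hess ψ z p k l := by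
  have hψ1 : DifferentiableAt ℝ ψ z := hψ.differentiableAt (by simp)
  set J := jac ψ z with hJdef
  set H := hess ψ z with hH
  have hHs : ∀ p k l, H p k l = H p l k := hess_symm hψ
  let dA : Fin n → Fin n → Fin n → ℝ := fun c a b => pd c (fun w => A w a b) (ψ z)
  -- Sf pairs two vectors with A, and Tf pairs two vectors with a directional derivative of A. The
  -- derivative of JᵀAJ is one Tf term and two Sf terms that contain the Hessian.
  let Sf : (Fin n → ℝ) → (Fin n → ℝ) → ℝ := fun u v => ∑ a, ∑ b, u a * A (ψ z) a b * v b
  let Tf : (Fin n → ℝ) → (Fin n → ℝ) → (Fin n → ℝ) → ℝ := fun u v w =>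
    ∑ a, ∑ b, ∑ c, u c * dA c a b * v a * w b
  have hSs : ∀ u v, Sf u v = Sf v u := by
    intro u v
    simp only [Sf]
    rw [Finset.sum_comm]
    refine Finset.sum_congr rfl fun a _ => Finset.sum_congr rfl fun b _ => ?_
    rw [← hsymm.apply a b]; ring
  have hder : ∀ k r l, pd k (fun w => A' w r l) z
      = Sf (fun a => H a k r) (fun b => J b l) + Tf (fun c => J c k) (fun a => J a r) (fun b => J b l)
        + Sf (fun a => J a r) (fun b => H b k l) := by
    intro k r l
    have h1 : (fun w => A' w r l) =ᶠ[nhds z]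
        fun w => ∑ a, ∑ b, jac ψ w a r * (A (ψ w) a b * jac ψ w b l) := by
      filter_upwards [hA'] with w hw
      rw [hw]
      simp only [Matrix.mul_apply, Matrix.transpose_apply, Finset.sum_mul]
      rw [Finset.sum_comm]
      refine Finset.sum_congr rfl fun a _ => Finset.sum_congr rfl fun b _ => ?_
      ring
    have hAψ : ∀ a b, DifferentiableAt ℝ (fun w => A (ψ w) a b) z := fun a b =>
      (hA a b).comp z hψ1
    have hJd := differentiableAt_jac hψ
    have hd : ∀ a b, DifferentiableAt ℝ (fun w => jac ψ w a r * (A (ψ w) a b * jac ψ w b l)) z :=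
      fun a b => (hJd a r).mul ((hAψ a b).mul (hJd b l))
    rw [pd_congr h1]
    refine (pd_sum (f := fun a w => ∑ b, jac ψ w a r * (A (ψ w) a b * jac ψ w b l)) _
      (fun a _ => DifferentiableAt.fun_sum fun b _ => hd a b) k).trans ?_
    simp only [Sf, Tf, ← Finset.sum_add_distrib]
    refine Finset.sum_congr rfl fun a _ => ?_
    refine (pd_sum (f := fun b w => jac ψ w a r * (A (ψ w) a b * jac ψ w b l)) _
      (fun b _ => hd a b) k).trans ?_
    refine Finset.sum_congr rfl fun b _ => ?_
    have hd' : DifferentiableAt ℝ (fun w => A (ψ w) a b * jac ψ w b l) z := (hAψ a b).mul (hJd b l)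
    rw [pd_mul (a := fun w => jac ψ w a r) (hJd a r) hd' k,
      pd_mul (b := fun w => jac ψ w b l) (hAψ a b) (hJd b l) k,
      pd_comp (f := fun w => A w a b) (hA a b) hψ1]
    change J a r * (A (ψ z) a b * H b k l + J b l * ∑ c, J c k * dA c a b)
      + A (ψ z) a b * J b l * H a k r = _
    have h2 : ∑ c, J c k * dA c a b * J a r * J b l = (∑ c, J c k * dA c a b) * J a r * J b l := by
      rw [Finset.sum_mul, Finset.sum_mul]
    rw [h2]; ring
  -- In the Koszul combination four of the six Hessian terms cancel by symmetry of A and of second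
  -- derivatives; the remaining two coincide and absorb the factor 1/2.
  have hlow : ∀ r, (1 / 2) * (pd k (fun w => A' w r l) z + pd l (fun w => A' w r k) z
        - pd r (fun w => A' w k l) z)
      = ∑ s, J s r * ((∑ a, ∑ b, (1 / 2) * (dA a s b + dA b s a - dA s a b) * (J a k * J b l))
          + ∑ b, A (ψ z) s b * H b k l) := by
    intro r
    rw [hder, hder, hder]
    have e1 : (fun a => H a k r) = fun a => H a r k := funext fun a => hHs a k r
    have e2 : (fun a => H a l r) = fun a => H a r l := funext fun a => hHs a l r
    have e3 : (fun a => H a l k) = fun a => H a k l := funext fun a => hHs a l k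
    have t1 : Tf (fun c => J c k) (fun a => J a r) (fun b => J b l)
        = ∑ s, ∑ a, ∑ b, J s r * (dA a s b * (J a k * J b l)) := by
      simp only [Tf]
      refine Finset.sum_congr rfl fun s _ => ?_
      rw [Finset.sum_comm]
      refine Finset.sum_congr rfl fun a _ => Finset.sum_congr rfl fun b _ => ?_
      ring
    have t2 : Tf (fun c => J c l) (fun a => J a r) (fun b => J b k)
        = ∑ s, ∑ a, ∑ b, J s r * (dA b s a * (J a k * J b l)) := by
      simp only [Tf]
      refine Finset.sum_congr rfl fun s _ => Finset.sum_congr rfl fun a _ =>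
        Finset.sum_congr rfl fun b _ => ?_
      ring
    have t3 : Tf (fun c => J c r) (fun a => J a k) (fun b => J b l)
        = ∑ s, ∑ a, ∑ b, J s r * (dA s a b * (J a k * J b l)) := by
      simp only [Tf]
      rw [sum_three_comm]
      refine Finset.sum_congr rfl fun s _ => Finset.sum_congr rfl fun a _ =>
        Finset.sum_congr rfl fun b _ => ?_
      ring
    have t4 : Sf (fun a => J a r) (fun b => H b k l)
        = ∑ s, J s r * ∑ b, A (ψ z) s b * H b k l := by
      simp only [Sf, Finset.mul_sum]
      refine Finset.sum_congr rfl fun s _ => Finset.sum_congr rfl fun b _ => ?_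
      ring
    rw [e1, e2, e3, hSs (fun a => H a r l) (fun b => J b k)]
    have lhs : ∀ x y t u v s : ℝ, 1 / 2 * (x + t + s + (y + u + s) - (x + v + y))
        = (1 / 2) * (t + u - v) + s := by intros; ring
    rw [lhs, t1, t2, t3, t4]
    simp only [mul_add, Finset.sum_add_distrib]
    congr 1
    rw [← Finset.sum_add_distrib, ← Finset.sum_sub_distrib, Finset.mul_sum]
    refine Finset.sum_congr rfl fun s _ => ?_
    rw [← Finset.sum_add_distrib, ← Finset.sum_sub_distrib, Finset.mul_sum, Finset.mul_sum]
    refine Finset.sum_congr rfl fun a _ => ?_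
    rw [← Finset.sum_add_distrib, ← Finset.sum_sub_distrib, Finset.mul_sum, Finset.mul_sum]
    refine Finset.sum_congr rfl fun b _ => ?_
    ring
  have hAz : A' z = J.transpose * A (ψ z) * J := hA'.self_of_nhds
  -- J (JᵀAJ)⁻¹ Jᵀ = A⁻¹, which raises the index of the lowered symbols.
  have hinv : ∀ s, ∑ q, ∑ r, J p q * ((A' z)⁻¹ q r * J s r) = (A (ψ z))⁻¹ p s := by
    intro s
    have h1 : J * (A' z)⁻¹ * J.transpose = (A (ψ z))⁻¹ := by
      have hJt : IsUnit J.transpose.det := by rwa [Matrix.det_transpose]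
      rw [hAz, Matrix.mul_inv_rev, Matrix.mul_inv_rev, ← mul_assoc, Matrix.mul_nonsing_inv _ hJ,
        one_mul, mul_assoc, Matrix.nonsing_inv_mul _ hJt, mul_one]
    rw [← h1]
    simp only [Matrix.mul_apply, Matrix.transpose_apply, Finset.sum_mul]
    rw [Finset.sum_comm]
    refine Finset.sum_congr rfl fun r _ => Finset.sum_congr rfl fun q _ => ?_
    ring
  set W : Fin n → ℝ := fun s =>
    (∑ a, ∑ b, (1 / 2) * (dA a s b + dA b s a - dA s a b) * (J a k * J b l))
      + ∑ b, A (ψ z) s b * H b k l with hW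
  have hL : ∑ q, J p q * chr A' z q k l = ∑ s, (A (ψ z))⁻¹ p s * W s := by
    have h1 : ∀ q, J p q * chr A' z q k l = ∑ s, ∑ r, J p q * ((A' z)⁻¹ q r * J s r) * W s := by
      intro q
      simp only [chr]
      rw [Finset.mul_sum, Finset.mul_sum, Finset.sum_comm]
      refine Finset.sum_congr rfl fun r _ => ?_
      have h3 : ∀ a b c : ℝ, a * (1 / 2 * (b * c)) = a * (b * (1 / 2 * c)) := by intros; ring
      rw [h3, hlow r, Finset.mul_sum, Finset.mul_sum]
      refine Finset.sum_congr rfl fun s _ => ?_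
      ring
    rw [Finset.sum_congr rfl fun q _ => h1 q, Finset.sum_comm]
    refine Finset.sum_congr rfl fun s _ => ?_
    rw [← hinv s, Finset.sum_mul]
    refine Finset.sum_congr rfl fun q _ => ?_
    rw [Finset.sum_mul]
  rw [hL]
  simp only [hW, mul_add, Finset.sum_add_distrib]
  congr 1
  · have h1 : ∀ a b, chr A (ψ z) p a b * (J a k * J b l)
        = ∑ s, (A (ψ z))⁻¹ p s * ((1 / 2) * (dA a s b + dA b s a - dA s a b) * (J a k * J b l)) := by
      intro a b
      simp only [chr, Finset.mul_sum, Finset.sum_mul]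
      refine Finset.sum_congr rfl fun s _ => ?_
      simp only [dA]; ring
    simp only [h1, Finset.mul_sum]
    rw [← sum_three_comm]
  · have h1 : (A (ψ z))⁻¹ * A (ψ z) = 1 := Matrix.nonsing_inv_mul _ hdet
    have h2 : ∀ b, ∑ s, (A (ψ z))⁻¹ p s * A (ψ z) s b = (1 : Matrix (Fin n) (Fin n) ℝ) p b := by
      intro b; rw [← h1, Matrix.mul_apply]
    simp only [Finset.mul_sum, ← mul_assoc]
    rw [Finset.sum_comm]
    simp only [← Finset.sum_mul, h2]
    rw [Finset.sum_eq_single p]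
    · simp
    · intro b _ hb; simp [Matrix.one_apply_ne hb.symm]
    · simp

end Christoffel
end ScatteringWitten
end

noncomputable section
namespace ScatteringWitten

/-! ### The Riemannian volume measure and its chart expressions. -/

section Volume

set_option linter.unusedSectionVars false

variable {n : ℕ} {M : Type*} [TopologicalSpace M] [ChartedSpace (EuclideanSpace ℝ (Fin n)) M]
  [IsManifold (𝓡 n) ∞ M]
  {e e' : OpenPartialHomeomorph M (EuclideanSpace ℝ (Fin n))}

/-- The coordinate image of the open set `U` in the chart `e`. -/
abbrev dom (e : OpenPartialHomeomorph M (EuclideanSpace ℝ (Fin n))) (U : Set M) :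
    Set (EuclideanSpace ℝ (Fin n)) :=
  e.target ∩ e.symm ⁻¹' U

/-- `G` is a smooth Riemannian metric on the open set `U`. -/
structure IsMetricOn (G : TwoTensor n M) (U : Set M) : Prop where
  isOpen : IsOpen U
  smooth : ∀ e ∈ IsManifold.maximalAtlas (𝓡 n) ∞ M, ∀ i j,
    ContDiffOn ℝ ∞ (fun z => gram G e z i j) (dom e U)
  symm : ∀ p ∈ U, ∀ v w : TangentSpace (𝓡 n) p, G p v w = G p w v
  pos : ∀ p ∈ U, ∀ v : TangentSpace (𝓡 n) p, v ≠ 0 → 0 < G p v v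

variable {G : TwoTensor n M} {U : Set M}

theorem IsMetricOn.posDef (hG : IsMetricOn G U) (he : e ∈ IsManifold.maximalAtlas (𝓡 n) ∞ M)
    {z : EuclideanSpace ℝ (Fin n)} (hz : z ∈ dom e U) : (gram G e z).PosDef :=
  gram_posDef he hz.1 (hG.symm _ hz.2) (hG.pos _ hz.2)

theorem IsMetricOn.isOpen_dom (hG : IsMetricOn G U)
    (e : OpenPartialHomeomorph M (EuclideanSpace ℝ (Fin n))) : IsOpen (dom e U) :=
  isOpen_target_inter e hG.isOpen

/-- The Riemannian volume density in a chart. -/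
def density (G : TwoTensor n M) (e : OpenPartialHomeomorph M (EuclideanSpace ℝ (Fin n)))
    (z : EuclideanSpace ℝ (Fin n)) : ENNReal :=
  ENNReal.ofReal (Real.sqrt (gram G e z).det)

theorem IsMetricOn.contDiffOn_det (hG : IsMetricOn G U)
    (he : e ∈ IsManifold.maximalAtlas (𝓡 n) ∞ M) :
    ContDiffOn ℝ ∞ (fun z => (gram G e z).det) (dom e U) := by
  simp only [Matrix.det_apply]
  refine ContDiffOn.sum fun σ _ => ContDiffOn.const_smul _ (contDiffOn_prod fun i _ => ?_)
  exact hG.smooth e he _ _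

theorem IsMetricOn.aemeasurable_density (hG : IsMetricOn G U)
    (he : e ∈ IsManifold.maximalAtlas (𝓡 n) ∞ M) :
    AEMeasurable (density G e) (volume.restrict (dom e U)) := by
  have h1 : ContinuousOn (density G e) (dom e U) :=
    ENNReal.continuous_ofReal.comp_continuousOn
      (Real.continuous_sqrt.comp_continuousOn (hG.contDiffOn_det he).continuousOn)
  exact h1.aemeasurable (hG.isOpen_dom e).measurableSet

theorem IsMetricOn.density_ne_zero (hG : IsMetricOn G U)
    (he : e ∈ IsManifold.maximalAtlas (𝓡 n) ∞ M) {z : EuclideanSpace ℝ (Fin n)}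
    (hz : z ∈ dom e U) : density G e z ≠ 0 := by
  have := (hG.posDef he hz).det_pos
  simp [density, this]

theorem det_fderiv_eq (ψ : EuclideanSpace ℝ (Fin n) → EuclideanSpace ℝ (Fin n))
    (z : EuclideanSpace ℝ (Fin n)) : (fderiv ℝ ψ z).det = (jac ψ z).det := by
  have h1 : LinearMap.toMatrix (EuclideanSpace.basisFun (Fin n) ℝ).toBasis
      (EuclideanSpace.basisFun (Fin n) ℝ).toBasis
      ((fderiv ℝ ψ z) : EuclideanSpace ℝ (Fin n) →ₗ[ℝ] EuclideanSpace ℝ (Fin n)) = jac ψ z := by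
    ext i j
    simp [LinearMap.toMatrix_apply, jac, pd]
  rw [← h1, LinearMap.det_toMatrix]

theorem jac_transition_mul (he : e ∈ IsManifold.maximalAtlas (𝓡 n) ∞ M)
    (he' : e' ∈ IsManifold.maximalAtlas (𝓡 n) ∞ M) {z : EuclideanSpace ℝ (Fin n)}
    (hz : z ∈ e'.target) (hz' : e'.symm z ∈ e.source) :
    jac (transition e' e) (transition e e' z) * jac (transition e e') z = 1 := by
  have h1 : DifferentiableAt ℝ (transition e e') z :=
    ((contDiffOn_transition he he').contDiffAt
      ((isOpen_target_inter e' e.open_source).mem_nhds ⟨hz, hz'⟩)).differentiableAt (by simp)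
  have hz2 : transition e e' z ∈ e.target ∩ e.symm ⁻¹' e'.source :=
    ⟨e.map_source hz', by
      change e.symm (transition e e' z) ∈ e'.source
      rw [symm_transition hz']; exact e'.map_target hz⟩
  have h2 : DifferentiableAt ℝ (transition e' e) (transition e e' z) :=
    ((contDiffOn_transition he' he).contDiffAt
      ((isOpen_target_inter e e'.open_source).mem_nhds hz2)).differentiableAt (by simp)
  have h3 : transition e' e ∘ transition e e' =ᶠ[nhds z] id := by
    filter_upwards [(isOpen_target_inter e' e.open_source).mem_nhds ⟨hz, hz'⟩] with w hw
    simp [transition, e.left_inv hw.2, e'.right_inv hw.1]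
  have h4 := h3.fderiv_eq (𝕜 := ℝ)
  rw [fderiv_comp z h2 h1] at h4
  ext i j
  have h5 := DFunLike.congr_fun h4 (EuclideanSpace.single j (1 : ℝ))
  have h6 := congrArg (fun v : EuclideanSpace ℝ (Fin n) => v i) h5
  simp only [ContinuousLinearMap.comp_apply, fderiv_id, ContinuousLinearMap.id_apply] at h6
  rw [apply_eq_sum_pd (fderiv ℝ (transition e' e) (transition e e' z))] at h6
  have h7 : (∑ a, (fderiv ℝ (transition e e') z (EuclideanSpace.single j 1)) a •
      fderiv ℝ (transition e' e) (transition e e' z) (EuclideanSpace.single a 1) :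
        EuclideanSpace ℝ (Fin n)) i
      = (jac (transition e' e) (transition e e' z) * jac (transition e e') z) i j := by
    simp [Matrix.mul_apply, jac, pd, mul_comm]
  rw [← h7, h6]
  simp [Matrix.one_apply]

theorem isUnit_det_jac_transition (he : e ∈ IsManifold.maximalAtlas (𝓡 n) ∞ M)
    (he' : e' ∈ IsManifold.maximalAtlas (𝓡 n) ∞ M) {z : EuclideanSpace ℝ (Fin n)}
    (hz : z ∈ e'.target) (hz' : e'.symm z ∈ e.source) :
    IsUnit (jac (transition e e') z).det := by
  have h := congrArg Matrix.det (jac_transition_mul he he' hz hz')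
  rw [Matrix.det_mul, Matrix.det_one] at h
  exact IsUnit.of_mul_eq_one _ (by rw [mul_comm]; exact h)

theorem density_change (he : e ∈ IsManifold.maximalAtlas (𝓡 n) ∞ M)
    (he' : e' ∈ IsManifold.maximalAtlas (𝓡 n) ∞ M) {z : EuclideanSpace ℝ (Fin n)}
    (hz : z ∈ e'.target) (hz' : e'.symm z ∈ e.source) :
    density G e' z = ENNReal.ofReal |(fderiv ℝ (transition e e') z).det| *
      density G e (transition e e' z) := by
  rw [density, density, gram_change G he he' hz hz', det_fderiv_eq, Matrix.det_mul, Matrix.det_mul,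
    Matrix.det_transpose, ← ENNReal.ofReal_mul (abs_nonneg _)]
  congr 1
  rw [show (jac (transition e e') z).det * (gram G e (transition e e' z)).det *
    (jac (transition e e') z).det = (jac (transition e e') z).det ^ 2 *
      (gram G e (transition e e' z)).det by ring, Real.sqrt_mul (sq_nonneg _), Real.sqrt_sq_eq_abs]

variable [MeasurableSpace M] [BorelSpace M]

/-- The Riemannian volume measure of a chart, transported to the manifold. -/
def volChart (G : TwoTensor n M) (U : Set M)
    (e : OpenPartialHomeomorph M (EuclideanSpace ℝ (Fin n))) : Measure M :=
  ((volume.restrict (dom e U)).withDensity (density G e)).map e.symm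

theorem volChart_le (he : e ∈ IsManifold.maximalAtlas (𝓡 n) ∞ M) :
    volChart G U e ≤ volMeasure G U :=
  le_iSup₂ (f := fun e (_ : e ∈ IsManifold.maximalAtlas (𝓡 n) ∞ M) => volChart G U e) e he

theorem IsMetricOn.aemeasurable_symm (hG : IsMetricOn G U)
    (e : OpenPartialHomeomorph M (EuclideanSpace ℝ (Fin n))) :
    AEMeasurable e.symm (volume.restrict (dom e U)) :=
  (e.continuousOn_symm.mono inter_subset_left).aemeasurable (hG.isOpen_dom e).measurableSet

theorem IsMetricOn.aemeasurable_symm' (hG : IsMetricOn G U)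
    (e : OpenPartialHomeomorph M (EuclideanSpace ℝ (Fin n))) :
    AEMeasurable e.symm ((volume.restrict (dom e U)).withDensity (density G e)) :=
  (hG.aemeasurable_symm e).mono_ac (withDensity_absolutelyContinuous _ _)

theorem IsMetricOn.lintegral_volChart (hG : IsMetricOn G U)
    (he : e ∈ IsManifold.maximalAtlas (𝓡 n) ∞ M) {f : M → ENNReal}
    (hf : AEMeasurable f (volChart G U e)) :
    ∫⁻ p, f p ∂(volChart G U e) = ∫⁻ z in dom e U, density G e z * f (e.symm z) := by
  rw [volChart, lintegral_map' hf (hG.aemeasurable_symm' e)]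
  exact lintegral_withDensity_eq_lintegral_mul₀' (hG.aemeasurable_density he)
    (hf.comp_aemeasurable (hG.aemeasurable_symm' e))

theorem measurableSet_dom_preimage (e : OpenPartialHomeomorph M (EuclideanSpace ℝ (Fin n)))
    {A : Set M} (hA : MeasurableSet A) : MeasurableSet (e.target ∩ e.symm ⁻¹' A) := by
  have h1 : Measurable (e.target.domRestrict e.symm) :=
    (continuousOn_iff_continuous_domRestrict.1 e.continuousOn_symm).measurable
  have h2 := e.open_target.measurableSet.subtype_image (h1 hA)
  convert! h2 using 1
  ext z
  simp only [mem_inter_iff, mem_preimage, mem_image, Subtype.exists,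
    exists_and_right, exists_eq_right]
  exact ⟨fun h => ⟨h.1, h.2⟩, fun ⟨h, h'⟩ => ⟨h, h'⟩⟩

theorem IsMetricOn.volChart_apply (hG : IsMetricOn G U)
    (he : e ∈ IsManifold.maximalAtlas (𝓡 n) ∞ M) {A : Set M} (hA : MeasurableSet A) :
    volChart G U e A = ∫⁻ z in dom e (U ∩ A), density G e z := by
  have h0 : MeasurableSet (dom e (U ∩ A)) :=
    measurableSet_dom_preimage e (hG.isOpen.measurableSet.inter hA)
  rw [← lintegral_indicator_one hA, hG.lintegral_volChart he
    ((measurable_one.indicator hA).aemeasurable), ← lintegral_indicator h0,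
    ← lintegral_indicator (hG.isOpen_dom e).measurableSet]
  congr 1
  funext z
  by_cases hz : z ∈ dom e U
  · by_cases hzA : e.symm z ∈ A
    · rw [indicator_of_mem hz, indicator_of_mem (s := dom e (U ∩ A)) ⟨hz.1, hz.2, hzA⟩,
        indicator_of_mem hzA]
      simp
    · rw [indicator_of_mem hz, indicator_of_notMem (s := dom e (U ∩ A)) fun h => hzA h.2.2,
        indicator_of_notMem hzA]
      simp
  · rw [indicator_of_notMem hz, indicator_of_notMem fun h => hz ⟨h.1, h.2.1⟩]

/-- The change of variables formula for the transition map, together with √det(JᵀGJ) = |det J| √det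
G. -/
theorem IsMetricOn.volChart_le_volChart (hG : IsMetricOn G U)
    (he : e ∈ IsManifold.maximalAtlas (𝓡 n) ∞ M) (he' : e' ∈ IsManifold.maximalAtlas (𝓡 n) ∞ M) :
    (volChart G U e').restrict e.source ≤ volChart G U e := by
  refine Measure.le_iff.2 fun A hA => ?_
  rw [Measure.restrict_apply hA]
  have hB : MeasurableSet (A ∩ e.source) := hA.inter e.open_source.measurableSet
  rw [hG.volChart_apply he' hB, hG.volChart_apply he hA]
  set T := dom e' (U ∩ (A ∩ e.source)) with hT
  have hTm : MeasurableSet T := measurableSet_dom_preimage e' (hG.isOpen.measurableSet.inter hB)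
  have h1 : ∀ z ∈ T, HasFDerivWithinAt (transition e e') (fderiv ℝ (transition e e') z) T z := by
    intro z hz
    exact (((contDiffOn_transition he he').contDiffAt
      ((isOpen_target_inter e' e.open_source).mem_nhds ⟨hz.1, hz.2.2.2⟩)).differentiableAt
        (by simp)).hasFDerivAt.hasFDerivWithinAt
  have h2 : InjOn (transition e e') T := by
    intro z hz w hw hzw
    have h3 := e.injOn hz.2.2.2 hw.2.2.2 hzw
    exact e'.symm.injOn hz.1 hw.1 h3
  calc ∫⁻ z in T, density G e' z
      = ∫⁻ z in T, ENNReal.ofReal |(fderiv ℝ (transition e e') z).det| *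
          density G e (transition e e' z) :=
        setLIntegral_congr_fun hTm fun z hz => density_change he he' hz.1 hz.2.2.2
    _ = ∫⁻ z in transition e e' '' T, density G e z :=
        (lintegral_image_eq_lintegral_abs_det_fderiv_mul volume hTm h1 h2 _).symm
    _ ≤ ∫⁻ z in dom e (U ∩ A), density G e z := by
        refine lintegral_mono_set ?_
        rintro _ ⟨z, hz, rfl⟩
        refine ⟨e.map_source hz.2.2.2, ?_⟩
        change e.symm (transition e e' z) ∈ U ∩ A
        rw [symm_transition hz.2.2.2]
        exact ⟨hz.2.1, hz.2.2.1⟩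

/-- On its domain, each chart computes the Riemannian volume. -/
theorem IsMetricOn.restrict_volMeasure_le (hG : IsMetricOn G U)
    (he : e ∈ IsManifold.maximalAtlas (𝓡 n) ∞ M) :
    (volMeasure G U).restrict e.source ≤ volChart G U e := by
  have hs := e.open_source.measurableSet
  -- The right side dominates every chart measure, so it dominates the supremum: on the domain of e
  -- by comparison of charts, elsewhere because it is infinite. The infinite summand disappears on
  -- restricting to that domain.
  have h1 : volMeasure G U ≤ volChart G U e + (⊤ : Measure M).restrict e.sourceᶜ := by
    refine iSup₂_le fun e' he' => ?_
    change volChart G U e' ≤ _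
    rw [← Measure.restrict_add_restrict_compl (μ := volChart G U e') hs]
    exact add_le_add (hG.volChart_le_volChart he he') (Measure.restrict_mono le_rfl le_top)
  refine (Measure.restrict_mono le_rfl h1).trans ?_
  rw [Measure.restrict_add, Measure.restrict_restrict hs, inter_compl_self, Measure.restrict_empty,
    add_zero]
  exact Measure.restrict_le_self

theorem IsMetricOn.lintegral_dom_le (hG : IsMetricOn G U)
    (he : e ∈ IsManifold.maximalAtlas (𝓡 n) ∞ M) {f : M → ENNReal}
    (hf : AEMeasurable f (volMeasure G U)) :
    ∫⁻ z in dom e U, density G e z * f (e.symm z) ≤ ∫⁻ p, f p ∂(volMeasure G U) := by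
  rw [← hG.lintegral_volChart he (hf.mono_measure (volChart_le he))]
  exact lintegral_mono' (volChart_le he) le_rfl

theorem IsMetricOn.lintegral_source_le (hG : IsMetricOn G U)
    (he : e ∈ IsManifold.maximalAtlas (𝓡 n) ∞ M) {f : M → ENNReal}
    (hf : AEMeasurable f (volMeasure G U)) :
    ∫⁻ p in e.source, f p ∂(volMeasure G U)
      ≤ ∫⁻ z in dom e U, density G e z * f (e.symm z) := by
  rw [← hG.lintegral_volChart he (hf.mono_measure (volChart_le he))]
  exact lintegral_mono' (hG.restrict_volMeasure_le he) le_rfl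

theorem IsMetricOn.volume_absolutelyContinuous (hG : IsMetricOn G U)
    (he : e ∈ IsManifold.maximalAtlas (𝓡 n) ∞ M) :
    volume.restrict (dom e U) ≪ (volume.restrict (dom e U)).withDensity (density G e) :=
  withDensity_absolutelyContinuous' (hG.aemeasurable_density he)
    ((ae_restrict_iff' (hG.isOpen_dom e).measurableSet).2
      (Filter.Eventually.of_forall fun _ hz => hG.density_ne_zero he hz))

/-- The volume density is positive on the chart domain, so Lebesgue null sets are controlled by
volume null sets and not only conversely. -/
theorem IsMetricOn.ae_chart (hG : IsMetricOn G U)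
    (he : e ∈ IsManifold.maximalAtlas (𝓡 n) ∞ M) {P : M → Prop}
    (hP : ∀ᵐ p ∂(volMeasure G U), P p) : ∀ᵐ z ∂(volume.restrict (dom e U)), P (e.symm z) := by
  have h1 : ∀ᵐ p ∂(volChart G U e), P p := (Measure.absolutelyContinuous_of_le (volChart_le he)) hP
  exact (hG.volume_absolutelyContinuous he) (ae_of_ae_map (hG.aemeasurable_symm' e) h1)

theorem IsMetricOn.aestronglyMeasurable_chart (hG : IsMetricOn G U)
    (he : e ∈ IsManifold.maximalAtlas (𝓡 n) ∞ M) {W : Type*} [TopologicalSpace W] {f : M → W}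
    (hf : AEStronglyMeasurable f (volMeasure G U)) :
    AEStronglyMeasurable (fun z => f (e.symm z)) (volume.restrict (dom e U)) := by
  have h1 : AEStronglyMeasurable f (volChart G U e) := hf.mono_measure (volChart_le he)
  exact (h1.comp_aemeasurable (hG.aemeasurable_symm' e)).mono_ac
    (hG.volume_absolutelyContinuous he)

theorem exists_countable_charts [SecondCountableTopology M] :
    ∃ s : Set (OpenPartialHomeomorph M (EuclideanSpace ℝ (Fin n))), s.Countable ∧
      (∀ e ∈ s, e ∈ IsManifold.maximalAtlas (𝓡 n) ∞ M) ∧ ∀ p : M, ∃ e ∈ s, p ∈ e.source := by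
  obtain ⟨s, hs, hcov⟩ := TopologicalSpace.countable_cover_nhds
    (f := fun p : M => (chartAt (EuclideanSpace ℝ (Fin n)) p).source)
    fun p => chart_source_mem_nhds _ p
  refine ⟨(chartAt (EuclideanSpace ℝ (Fin n))) '' s, hs.image _, ?_, fun p => ?_⟩
  · rintro _ ⟨p, -, rfl⟩
    exact IsManifold.chart_mem_maximalAtlas p
  · obtain ⟨q, hq, hp⟩ := mem_iUnion₂.1 (hcov ▸ mem_univ p)
    exact ⟨_, ⟨q, hq, rfl⟩, hp⟩

/-- Countably many charts cover M, and on each one the volume is bounded by the chart measure.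
Measurability of the property is needed to pull it back through a push-forward. -/
theorem IsMetricOn.ae_of_charts [SecondCountableTopology M] (hG : IsMetricOn G U)
    {P : M → Prop} (hPm : MeasurableSet {p | P p})
    (h : ∀ e ∈ IsManifold.maximalAtlas (𝓡 n) ∞ M,
      ∀ᵐ z ∂(volume.restrict (dom e U)), P (e.symm z)) :
    ∀ᵐ p ∂(volMeasure G U), P p := by
  obtain ⟨s, hs, hsa, hcov⟩ := exists_countable_charts (n := n) (M := M)
  have h1 : ∀ e ∈ s, volMeasure G U ({p | P p}ᶜ ∩ e.source) = 0 := by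
    intro e he
    have h2 : ∀ᵐ p ∂(volChart G U e), P p :=
      (ae_map_iff (hG.aemeasurable_symm' e) hPm).2
        ((withDensity_absolutelyContinuous _ _) (h e (hsa e he)))
    have h3 : (volMeasure G U).restrict e.source {p | P p}ᶜ = 0 :=
      le_antisymm ((Measure.le_iff'.1 (hG.restrict_volMeasure_le (hsa e he)) _).trans
        (le_of_eq h2)) (zero_le)
    rwa [Measure.restrict_apply hPm.compl] at h3
  have h4 : volMeasure G U (⋃ e ∈ s, {p | P p}ᶜ ∩ e.source) = 0 :=
    (measure_biUnion_null_iff hs).2 h1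
  refine measure_mono_null (fun p hp => ?_) h4
  obtain ⟨e, he, hpe⟩ := hcov p
  exact mem_iUnion₂.2 ⟨e, he, hp, hpe⟩

theorem IsMetricOn.ae_mem [SecondCountableTopology M] (hG : IsMetricOn G U) :
    ∀ᵐ p ∂(volMeasure G U), p ∈ U :=
  hG.ae_of_charts hG.isOpen.measurableSet fun e _ =>
    (ae_restrict_iff' (hG.isOpen_dom e).measurableSet).2
      (Filter.Eventually.of_forall fun _ hz => hz.2)

end Volume
end ScatteringWitten
end

noncomputable section
namespace ScatteringWitten

/-! ### Measurable orthonormalization. -/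

section GramSchmidt

variable {n : ℕ} {α : Type*} [MeasurableSpace α]

/-- The bilinear form of a matrix. -/
def bil (A : Matrix (Fin n) (Fin n) ℝ) (v w : Fin n → ℝ) : ℝ := ∑ i, ∑ j, v i * A i j * w j

theorem bil_eq (A : Matrix (Fin n) (Fin n) ℝ) (v w : Fin n → ℝ) :
    bil A v w = dotProduct v (Matrix.mulVec A w) := by
  simp only [bil, dotProduct, Matrix.mulVec, Finset.mul_sum, mul_assoc]

theorem bil_symm {A : Matrix (Fin n) (Fin n) ℝ} (hA : A.PosDef) (v w : Fin n → ℝ) :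
    bil A v w = bil A w v := by
  simp only [bil]
  rw [Finset.sum_comm]
  refine Finset.sum_congr rfl fun i _ => Finset.sum_congr rfl fun j _ => ?_
  rw [← hA.isHermitian.apply i j, star_trivial]
  ring

theorem bil_pos {A : Matrix (Fin n) (Fin n) ℝ} (hA : A.PosDef) {v : Fin n → ℝ} (hv : v ≠ 0) :
    0 < bil A v v := by
  rw [bil_eq]
  simpa using hA.dotProduct_mulVec_pos hv

theorem bil_smul_left (A : Matrix (Fin n) (Fin n) ℝ) (c : ℝ) (v w : Fin n → ℝ) :
    bil A (fun i => c * v i) w = c * bil A v w := by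
  simp only [bil, Finset.mul_sum, mul_assoc]

theorem bil_sub_sum (A : Matrix (Fin n) (Fin n) ℝ) (s : Finset ℕ) (c : ℕ → ℝ)
    (v w : Fin n → ℝ) (P : ℕ → Fin n → ℝ) :
    bil A (fun j => v j - ∑ i ∈ s, c i * P i j) w = bil A v w - ∑ i ∈ s, c i * bil A (P i) w := by
  have h1 : (fun j => v j - ∑ i ∈ s, c i * P i j) = v - ∑ i ∈ s, c i • P i := by
    funext j; simp
  rw [h1, bil_eq, sub_dotProduct, sum_dotProduct, bil_eq]
  simp only [smul_dotProduct, smul_eq_mul, bil_eq]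

/-- Measurable Gram–Schmidt orthonormalization. -/
theorem exists_gramSchmidt (S : Set α) (A : α → Matrix (Fin n) (Fin n) ℝ)
    (hm : ∀ i j, Measurable fun a => A a i j) (hA : ∀ a ∈ S, (A a).PosDef) :
    ∀ k ≤ n, ∃ P : ℕ → α → Fin n → ℝ, (∀ i j, Measurable fun a => P i a j) ∧
      ∀ a ∈ S, (∀ i < k, ∀ j < k, bil (A a) (P i a) (P j a) = if i = j then 1 else 0) ∧
        ∀ i < k, ∀ j : Fin n, i < j → P i a j = 0 := by
  intro k
  induction k with
  | zero =>
    intro _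
    exact ⟨fun _ _ _ => 0, fun _ _ => measurable_const, fun a _ => ⟨by simp, by simp⟩⟩
  | succ k ih =>
    intro hk
    obtain ⟨P, hP, hPS⟩ := ih (by omega)
    set kk : Fin n := ⟨k, by omega⟩ with hkk
    let ek : Fin n → ℝ := Pi.single kk 1
    let v : α → Fin n → ℝ := fun a j =>
      ek j - ∑ i ∈ Finset.range k, bil (A a) ek (P i a) * P i a j
    have hbm : ∀ v w : α → Fin n → ℝ, (∀ j, Measurable fun a => v a j) →
        (∀ j, Measurable fun a => w a j) → Measurable fun a => bil (A a) (v a) (w a) := by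
      intro v w hv hw
      refine Finset.measurable_sum _ fun i _ => Finset.measurable_sum _ fun j _ => ?_
      exact ((hv i).mul (hm i j)).mul (hw j)
    have hv : ∀ j, Measurable fun a => v a j := by
      intro j
      refine measurable_const.sub (Finset.measurable_sum _ fun i _ => ?_)
      exact (hbm (fun _ => ek) (P i) (fun _ => measurable_const) (hP i)).mul (hP i j)
    let Q : α → Fin n → ℝ := fun a j => (Real.sqrt (bil (A a) (v a) (v a)))⁻¹ * v a j
    refine ⟨Function.update P k Q, ?_, fun a ha => ?_⟩
    · intro i j
      by_cases hik : i = k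
      · subst hik
        simp only [Function.update_self]
        exact ((hbm v v hv hv).sqrt.inv).mul (hv j)
      · simp only [Function.update_of_ne hik]
        exact hP i j
    · obtain ⟨h1, h2⟩ := hPS a ha
      -- The triangular shape carried by the induction is used here: earlier vectors have no k-th
      -- entry, so the k-th entry of v is 1 and v ≠ 0 without any separate independence argument.
      have hvk : v a kk = 1 := by
        have : ∀ i ∈ Finset.range k, bil (A a) ek (P i a) * P i a kk = 0 := fun i hi => by
          rw [h2 i (Finset.mem_range.1 hi) kk (Finset.mem_range.1 hi), mul_zero]
        simp [v, ek, Finset.sum_eq_zero this]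
      have hv0 : v a ≠ 0 := fun h => by
        rw [h] at hvk; simp at hvk
      have hpos := bil_pos (hA a ha) hv0
      have hvP : ∀ j < k, bil (A a) (v a) (P j a) = 0 := by
        intro j hj
        simp only [v]
        rw [bil_sub_sum, Finset.sum_eq_single j]
        · rw [h1 j hj j hj]; simp
        · intro i hi hij
          rw [h1 i (Finset.mem_range.1 hi) j hj, if_neg hij, mul_zero]
        · intro h; exact absurd (Finset.mem_range.2 hj) h
      have hQP : ∀ j < k, bil (A a) (Q a) (P j a) = 0 := by
        intro j hj
        simp only [Q]
        rw [bil_smul_left, hvP j hj, mul_zero]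
      have hQQ : bil (A a) (Q a) (Q a) = 1 := by
        simp only [Q]
        rw [bil_smul_left, bil_symm (hA a ha) (v a)
          (fun j => (Real.sqrt (bil (A a) (v a) (v a)))⁻¹ * v a j), bil_smul_left, ← mul_assoc, ← mul_inv,
          Real.mul_self_sqrt hpos.le, inv_mul_cancel₀ hpos.ne']
      refine ⟨fun i hi j hj => ?_, fun i hi j hij => ?_⟩
      · by_cases hik : i = k <;> by_cases hjk : j = k
        · subst hik; subst hjk; simp [hQQ]
        · subst hik
          rw [Function.update_self, Function.update_of_ne hjk, hQP j (by omega),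
            if_neg (Ne.symm hjk)]
        · subst hjk
          rw [Function.update_self, Function.update_of_ne hik, bil_symm (hA a ha),
            hQP i (by omega), if_neg hik]
        · rw [Function.update_of_ne hik, Function.update_of_ne hjk, h1 i (by omega) j (by omega)]
      · by_cases hik : i = k
        · subst hik
          rw [Function.update_self]
          have hjne : j ≠ kk := fun h => by rw [h] at hij; simp [hkk] at hij
          have : ∀ i' ∈ Finset.range i, bil (A a) ek (P i' a) * P i' a j = 0 := fun i' hi' => by
            have := Finset.mem_range.1 hi'
            rw [h2 i' this j (by omega), mul_zero]
          simp [Q, v, ek, Finset.sum_eq_zero this, hjne]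
        · rw [Function.update_of_ne hik]
          exact h2 i (by omega) j hij

end GramSchmidt

/-! ### Existence of a Borel orthonormal frame. -/

section Frame

set_option linter.unusedSectionVars false

variable {n : ℕ} {M : Type*} [TopologicalSpace M] [ChartedSpace (EuclideanSpace ℝ (Fin n)) M]
  [IsManifold (𝓡 n) ∞ M]
  {e e' : OpenPartialHomeomorph M (EuclideanSpace ℝ (Fin n))} {G : TwoTensor n M} {U : Set M}

/-- The map that sends coordinates and components to the tangent vector they describe. -/
def chartVec (e : OpenPartialHomeomorph M (EuclideanSpace ℝ (Fin n)))
    (q : EuclideanSpace ℝ (Fin n) × EuclideanSpace ℝ (Fin n)) : TangentBundle (𝓡 n) M :=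
  ⟨e.symm q.1, mfderiv 𝓘(ℝ, EuclideanSpace ℝ (Fin n)) (𝓡 n) e.symm q.1 q.2⟩

theorem continuousOn_chartVec (he : e ∈ IsManifold.maximalAtlas (𝓡 n) ∞ M) :
    ContinuousOn (chartVec e) (e.target ×ˢ univ) := by
  have h1 := (contMDiffOn_symm_of_mem_maximalAtlas he).continuousOn_tangentMapWithin
    (by simp) e.open_target.uniqueMDiffOn
  have h2 := (tangentBundleModelSpaceHomeomorph
    𝓘(ℝ, EuclideanSpace ℝ (Fin n))).symm.continuous
  refine (h1.comp h2.continuousOn (s := e.target ×ˢ univ) fun q hq => hq.1).congr fun q hq => ?_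
  rw [tangentBundleModelSpaceHomeomorph_coe_symm]
  change chartVec e q = (⟨e.symm q.1, mfderivWithin 𝓘(ℝ, EuclideanSpace ℝ (Fin n)) (𝓡 n) e.symm e.target q.1
    q.2⟩ : TangentBundle (𝓡 n) M)
  rw [mfderivWithin_of_isOpen e.open_target hq.1]
  rfl

theorem totalSpace_mk_congr {p q : M} (h : p = q) (v : EuclideanSpace ℝ (Fin n)) :
    (⟨p, (v : TangentSpace (𝓡 n) p)⟩ : TangentBundle (𝓡 n) M)
      = ⟨q, (v : TangentSpace (𝓡 n) q)⟩ := by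
  subst h; rfl

/-- At each point use the first chart of a countable atlas whose domain contains it, and
orthonormalize the coordinate vectors there. A choice by first index among Borel sets is Borel. The
lemma shows that the chosen `frame` really has its defining property. -/
theorem exists_isOrthonormalFrame [SecondCountableTopology M] (hG : IsMetricOn G U) :
    ∃ b : ∀ p : M, Fin n → TangentSpace (𝓡 n) p, IsOrthonormalFrame G U b := by
  rcases isEmpty_or_nonempty M with hM | hM
  · exact ⟨fun p => (hM.false p).elim, fun p => (hM.false p).elim, fun i =>
      @measurable_of_empty _ _ (borel _) (borel _) hM _⟩
  let _ : MeasurableSpace M := borel M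
  have _ : BorelSpace M := ⟨rfl⟩
  let _ : MeasurableSpace (TangentBundle (𝓡 n) M) := borel _
  have _ : BorelSpace (TangentBundle (𝓡 n) M) := ⟨rfl⟩
  classical
  obtain ⟨s, hs, hsa, hcov⟩ := exists_countable_charts (n := n) (M := M)
  have hsne : s.Nonempty := by
    obtain ⟨e, he, -⟩ := hcov (Classical.arbitrary M); exact ⟨e, he⟩
  obtain ⟨E, rfl⟩ := hs.exists_eq_range hsne
  have hE : ∀ m, E m ∈ IsManifold.maximalAtlas (𝓡 n) ∞ M := fun m => hsa _ ⟨m, rfl⟩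
  have hcov' : ∀ p : M, ∃ m, p ∈ (E m).source := fun p => by
    obtain ⟨_, ⟨m, rfl⟩, hp⟩ := hcov p; exact ⟨m, hp⟩
  have hGS : ∀ m, ∃ P : Fin n → EuclideanSpace ℝ (Fin n) → EuclideanSpace ℝ (Fin n),
      (∀ i, Measurable (P i)) ∧ ∀ z ∈ dom (E m) U, ∀ i j,
        bil (gram G (E m) z) (P i z) (P j z) = if i = j then 1 else 0 := by
    intro m
    have hSm := (hG.isOpen_dom (E m)).measurableSet
    obtain ⟨P, hP, hPS⟩ := exists_gramSchmidt (dom (E m) U)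
      -- The matrix is set to zero off the chart domain only to make it measurable everywhere;
      -- positivity is used on the domain alone.
      (fun z => Matrix.of fun i j => (dom (E m) U).piecewise (fun z => gram G (E m) z i j)
        (fun _ => 0) z)
      (fun i j => (hG.smooth _ (hE m) i j).continuousOn.measurable_piecewise continuousOn_const hSm)
      (fun z hz => by
        have := hG.posDef (hE m) hz
        convert! this using 1
        ext i j
        simp [piecewise_eq_of_mem _ _ _ hz]) n le_rfl
    refine ⟨fun i z => WithLp.toLp 2 (P i z), fun i => ?_, fun z hz i j => ?_⟩
    · exact (PiLp.continuous_toLp 2 _).measurable.comp (measurable_pi_iff.2 fun j => hP i j)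
    · have h1 := (hPS z hz).1 i i.2 j j.2
      have h2 : (Matrix.of fun i j => (dom (E m) U).piecewise (fun z => gram G (E m) z i j)
        (fun _ => 0) z) = gram G (E m) z := by
        ext i j
        simp [piecewise_eq_of_mem _ _ _ hz]
      rw [h2] at h1
      rw [h1]
      simp [Fin.ext_iff]
  choose P hP hPS using hGS
  let v : ℕ → ∀ p : M, Fin n → TangentSpace (𝓡 n) p := fun m p i =>
    if p ∈ U ∩ (E m).source then
      (mfderiv 𝓘(ℝ, EuclideanSpace ℝ (Fin n)) (𝓡 n) (E m).symm (E m p) (P m i (E m p)) :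
        EuclideanSpace ℝ (Fin n)) else (0 : EuclideanSpace ℝ (Fin n))
  have hvm : ∀ m i, Measurable fun p => (⟨p, v m p i⟩ : TangentBundle (𝓡 n) M) := by
    intro m i
    have m1 : Measurable ((E m).source.piecewise (E m) fun _ => 0) :=
      (E m).continuousOn.measurable_piecewise continuousOn_const (E m).open_source.measurableSet
    -- The default value, a zero vector at an arbitrary point, is discarded by the outer case
    -- distinction.
    have m2 : Measurable (((E m).target ×ˢ univ).piecewise (chartVec (E m))
        fun _ => (⟨Classical.arbitrary M, (0 : EuclideanSpace ℝ (Fin n))⟩ :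
          TangentBundle (𝓡 n) M)) :=
      (continuousOn_chartVec (hE m)).measurable_piecewise continuousOn_const
        ((E m).open_target.measurableSet.prod MeasurableSet.univ)
    have m3 := m2.comp (m1.prodMk ((hP m i).comp m1))
    have m4 : Measurable fun p : M => (⟨p, (0 : EuclideanSpace ℝ (Fin n))⟩ :
        TangentBundle (𝓡 n) M) :=
      (Bundle.contMDiff_zeroSection ℝ (fun p : M => TangentSpace (𝓡 n) p)
        (F := EuclideanSpace ℝ (Fin n)) (IB := 𝓡 n) (n := 0)).continuous.measurable
    have m5 : Measurable ((U ∩ (E m).source).piecewise _ _) :=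
      m3.piecewise (hG.isOpen.measurableSet.inter (E m).open_source.measurableSet) m4
    convert! m5 using 1
    funext p
    by_cases hp : p ∈ U ∩ (E m).source
    · rw [piecewise_eq_of_mem _ _ _ hp]
      simp only [Function.comp_apply]
      rw [piecewise_eq_of_mem _ _ _ hp.2, piecewise_eq_of_mem _ _ _
        (show ((E m) p, _) ∈ (E m).target ×ˢ univ from ⟨(E m).map_source hp.2, trivial⟩)]
      have hv1 : v m p i = (mfderiv 𝓘(ℝ, EuclideanSpace ℝ (Fin n)) (𝓡 n) (E m).symm (E m p)
        (P m i (E m p)) : EuclideanSpace ℝ (Fin n)) := if_pos hp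
      rw [hv1]
      exact totalSpace_mk_congr (n := n) ((E m).left_inv hp.2).symm _
    · rw [piecewise_eq_of_notMem _ _ _ hp]
      have hv1 : v m p i = (0 : EuclideanSpace ℝ (Fin n)) := if_neg hp
      rw [hv1]
  refine ⟨fun p => v (Nat.find (hcov' p)) p, fun p hp i j => ?_, fun i => ?_⟩
  · set m := Nat.find (hcov' p)
    have hps : p ∈ (E m).source := Nat.find_spec (hcov' p)
    have hz : E m p ∈ dom (E m) U :=
      ⟨(E m).map_source hps, by change (E m).symm (E m p) ∈ U; rwa [(E m).left_inv hps]⟩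
    have h1 := hPS m (E m p) hz i j
    rw [bil_eq, gram_mulVec] at h1
    have hv1 : ∀ i, v m p i = (mfderiv 𝓘(ℝ, EuclideanSpace ℝ (Fin n)) (𝓡 n) (E m).symm (E m p)
        (P m i (E m p)) : EuclideanSpace ℝ (Fin n)) := fun i => if_pos ⟨hp, hps⟩
    change G p (v m p i) (v m p j) = _
    rw [hv1, hv1]
    have key : ∀ p q : M, p = q → ∀ v w : EuclideanSpace ℝ (Fin n),
      (G p : EuclideanSpace ℝ (Fin n) →L[ℝ] EuclideanSpace ℝ (Fin n) →L[ℝ] ℝ) v w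
        = (G q : EuclideanSpace ℝ (Fin n) →L[ℝ] EuclideanSpace ℝ (Fin n) →L[ℝ] ℝ) v w := by
      rintro p _ rfl v w; rfl
    exact (key _ _ ((E m).left_inv hps).symm _ _).trans h1
  · exact Measurable.find (f := fun m p => (⟨p, v m p i⟩ : TangentBundle (𝓡 n) M))
      (p := fun m p => p ∈ (E m).source) (fun m => hvm m i)
      (fun m => (E m).open_source.measurableSet) hcov'

theorem isOrthonormalFrame_frame [SecondCountableTopology M] (hG : IsMetricOn G U) :
    IsOrthonormalFrame G U (frame G U) :=
  Classical.epsilon_spec (exists_isOrthonormalFrame hG)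

end Frame
end ScatteringWitten
end

noncomputable section
namespace ScatteringWitten

/-! ### Matrices between the orthonormal frame and coordinate vectors. -/

section FrameMatrix

set_option linter.unusedSectionVars false

variable {n : ℕ} {M : Type*} [TopologicalSpace M] [ChartedSpace (EuclideanSpace ℝ (Fin n)) M]
  [IsManifold (𝓡 n) ∞ M]
  {e e' : OpenPartialHomeomorph M (EuclideanSpace ℝ (Fin n))} {G : TwoTensor n M} {U : Set M}

/-- The components of the coordinate vectors in the chosen orthonormal frame. -/
def frameMat (G : TwoTensor n M) (U : Set M)
    (e : OpenPartialHomeomorph M (EuclideanSpace ℝ (Fin n))) (z : EuclideanSpace ℝ (Fin n)) :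
    Matrix (Fin n) (Fin n) ℝ :=
  Matrix.of fun K i => G (e.symm z) (frame G U (e.symm z) K) (coordVec e z i)

/-- The components of the chosen orthonormal frame in the coordinate vectors. -/
def frameComp (G : TwoTensor n M) (U : Set M)
    (e : OpenPartialHomeomorph M (EuclideanSpace ℝ (Fin n))) (z : EuclideanSpace ℝ (Fin n)) :
    Matrix (Fin n) (Fin n) ℝ :=
  Matrix.of fun j K =>
    WithLp.ofLp (p := 2) (V := Fin n → ℝ)
      (mfderiv (𝓡 n) 𝓘(ℝ, EuclideanSpace ℝ (Fin n)) e (e.symm z) (frame G U (e.symm z) K)) j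

/-- The chain rule gives the composition in the other order; in finite dimension a one-sided inverse
of an endomorphism is two-sided. -/
theorem mfderiv_symm_mfderiv (he : e ∈ IsManifold.maximalAtlas (𝓡 n) ∞ M)
    {z : EuclideanSpace ℝ (Fin n)} (hz : z ∈ e.target) (v : TangentSpace (𝓡 n) (e.symm z)) :
    mfderiv 𝓘(ℝ, EuclideanSpace ℝ (Fin n)) (𝓡 n) e.symm z
      (mfderiv (𝓡 n) 𝓘(ℝ, EuclideanSpace ℝ (Fin n)) e (e.symm z) v) = v := by
  have hd2 : MDifferentiableAt 𝓘(ℝ, EuclideanSpace ℝ (Fin n)) (𝓡 n)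
      (e.symm : EuclideanSpace ℝ (Fin n) → M) z :=
    (contMDiffAt_symm_of_mem_maximalAtlas he hz).mdifferentiableAt (by simp)
  have hd1 : MDifferentiableAt (𝓡 n) 𝓘(ℝ, EuclideanSpace ℝ (Fin n)) e (e.symm z) :=
    (contMDiffAt_of_mem_maximalAtlas he (e.map_target hz)).mdifferentiableAt (by simp)
  have h1 : (e ∘ e.symm : EuclideanSpace ℝ (Fin n) → _) =ᶠ[nhds z] id := by
    filter_upwards [e.open_target.mem_nhds hz] with w hw
    simp [e.right_inv hw]
  have h2 := mfderiv_comp z hd1 hd2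
  rw [h1.mfderiv_eq, mfderiv_id] at h2
  let A : EuclideanSpace ℝ (Fin n) →L[ℝ] EuclideanSpace ℝ (Fin n) :=
    mfderiv 𝓘(ℝ, EuclideanSpace ℝ (Fin n)) (𝓡 n) e.symm z
  let B : EuclideanSpace ℝ (Fin n) →L[ℝ] EuclideanSpace ℝ (Fin n) :=
    mfderiv (𝓡 n) 𝓘(ℝ, EuclideanSpace ℝ (Fin n)) e (e.symm z)
  have h3 : (B : EuclideanSpace ℝ (Fin n) →ₗ[ℝ] EuclideanSpace ℝ (Fin n)) *
      (A : EuclideanSpace ℝ (Fin n) →ₗ[ℝ] EuclideanSpace ℝ (Fin n)) = 1 := by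
    ext1 v
    exact (DFunLike.congr_fun h2 v).symm
  exact DFunLike.congr_fun (mul_eq_one_comm.1 h3) (v : EuclideanSpace ℝ (Fin n))

theorem frame_eq_sum (he : e ∈ IsManifold.maximalAtlas (𝓡 n) ∞ M)
    {z : EuclideanSpace ℝ (Fin n)} (hz : z ∈ e.target) (K : Fin n) :
    (frame G U (e.symm z) K : EuclideanSpace ℝ (Fin n))
      = ∑ j, frameComp G U e z j K • (coordVec e z j : EuclideanSpace ℝ (Fin n)) := by
  have h1 := mfderiv_symm_mfderiv he hz (frame G U (e.symm z) K)
  refine h1.symm.trans ?_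
  exact apply_eq_sum_pd (W := EuclideanSpace ℝ (Fin n))
    (mfderiv 𝓘(ℝ, EuclideanSpace ℝ (Fin n)) (𝓡 n) e.symm z) _

theorem frameMat_eq (he : e ∈ IsManifold.maximalAtlas (𝓡 n) ∞ M)
    {z : EuclideanSpace ℝ (Fin n)} (hz : z ∈ e.target) :
    frameMat G U e z = (frameComp G U e z).transpose * gram G e z := by
  ext K i
  have h1 : (G (e.symm z) : EuclideanSpace ℝ (Fin n) →L[ℝ] EuclideanSpace ℝ (Fin n) →L[ℝ] ℝ)
      (frame G U (e.symm z) K : EuclideanSpace ℝ (Fin n)) (coordVec e z i)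
      = ∑ j, frameComp G U e z j K * gram G e z j i := by
    rw [frame_eq_sum he hz K]
    simp only [map_sum, map_smul, _root_.sum_apply, _root_.smul_apply, smul_eq_mul]
    rfl
  rw [Matrix.mul_apply]
  exact h1

theorem IsMetricOn.frameMat_mul_frameComp [SecondCountableTopology M] (hG : IsMetricOn G U)
    (he : e ∈ IsManifold.maximalAtlas (𝓡 n) ∞ M)
    {z : EuclideanSpace ℝ (Fin n)} (hz : z ∈ dom e U) :
    frameMat G U e z * frameComp G U e z = 1 := by
  ext K L
  have h0 := (isOrthonormalFrame_frame hG).1 (e.symm z) hz.2 K L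
  have h1 : (G (e.symm z) : EuclideanSpace ℝ (Fin n) →L[ℝ] EuclideanSpace ℝ (Fin n) →L[ℝ] ℝ)
      (frame G U (e.symm z) K) (frame G U (e.symm z) L : EuclideanSpace ℝ (Fin n))
      = ∑ j, frameMat G U e z K j * frameComp G U e z j L := by
    rw [frame_eq_sum he hz.1 L, map_sum]
    refine Finset.sum_congr rfl fun j _ => ?_
    rw [map_smul, smul_eq_mul, mul_comm]
    rfl
  rw [Matrix.mul_apply, ← h1, Matrix.one_apply]
  exact h0

theorem IsMetricOn.frameMat_transpose_mul [SecondCountableTopology M] (hG : IsMetricOn G U)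
    (he : e ∈ IsManifold.maximalAtlas (𝓡 n) ∞ M)
    {z : EuclideanSpace ℝ (Fin n)} (hz : z ∈ dom e U) :
    (frameMat G U e z).transpose * frameMat G U e z = gram G e z := by
  have h1 := hG.frameMat_mul_frameComp he hz
  have h2 : (frameComp G U e z) * frameMat G U e z = 1 := mul_eq_one_comm.1 h1
  have h3 := congrArg Matrix.transpose h2
  rw [Matrix.transpose_mul, Matrix.transpose_one] at h3
  calc (frameMat G U e z).transpose * frameMat G U e z
      = (frameMat G U e z).transpose * ((frameComp G U e z).transpose * gram G e z) := by
        rw [← frameMat_eq he hz.1]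
    _ = gram G e z := by rw [← mul_assoc, h3, one_mul]

theorem frameMat_change (he : e ∈ IsManifold.maximalAtlas (𝓡 n) ∞ M)
    (he' : e' ∈ IsManifold.maximalAtlas (𝓡 n) ∞ M) {z : EuclideanSpace ℝ (Fin n)}
    (hz : z ∈ e'.target) (hz' : e'.symm z ∈ e.source) :
    frameMat G U e' z = frameMat G U e (transition e e' z) * jac (transition e e') z := by
  ext K i
  rw [Matrix.mul_apply]
  refine (cotangent_change (fun p => G p (frame G U p K)) he he' hz hz' i).trans ?_
  refine Finset.sum_congr rfl fun a _ => mul_comm _ _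

/-- The frame is merely measurable, but AᵀA is the Gram matrix, so its diagonal bounds every entry
of A. All estimates on frame components come from such bounds on the metric. -/
theorem IsMetricOn.sq_frameMat_le [SecondCountableTopology M] (hG : IsMetricOn G U)
    (he : e ∈ IsManifold.maximalAtlas (𝓡 n) ∞ M)
    {z : EuclideanSpace ℝ (Fin n)} (hz : z ∈ dom e U) (K i : Fin n) :
    frameMat G U e z K i ^ 2 ≤ gram G e z i i := by
  rw [← hG.frameMat_transpose_mul he hz, Matrix.mul_apply]
  have := Finset.single_le_sum (f := fun K => frameMat G U e z K i ^ 2)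
    (fun K _ => sq_nonneg _) (Finset.mem_univ K)
  simpa [sq] using this

theorem chartComp_eq_tact (x : M → ℝ) (h : TwoTensor n M) {k : ℕ} (f : M → Fibre n k)
    (J : Fin k → Fin n) (z : EuclideanSpace ℝ (Fin n)) :
    chartComp x h e f J z = tact (frameMat (scMetric x h) (interiorX x) e z) (f (e.symm z)) J := rfl

/-- The frame is Borel as a map into the tangent bundle, and the tangent map of the chart is
continuous over the chart domain. -/
theorem IsMetricOn.aemeasurable_frameComp [SecondCountableTopology M] [MeasurableSpace M]
    [BorelSpace M] (hG : IsMetricOn G U)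
    (he : e ∈ IsManifold.maximalAtlas (𝓡 n) ∞ M) (j K : Fin n) :
    AEMeasurable (fun z => frameComp G U e z j K) (volume.restrict (dom e U)) := by
  classical
  let _ : MeasurableSpace (TangentBundle (𝓡 n) M) := borel _
  have _ : BorelSpace (TangentBundle (𝓡 n) M) := ⟨rfl⟩
  have hb : Measurable fun p => (⟨p, frame G U p K⟩ : TangentBundle (𝓡 n) M) := by
    have := (isOrthonormalFrame_frame hG).2 K
    rwa [← BorelSpace.measurable_eq (α := M)] at this
  have h1 := (contMDiffOn_of_mem_maximalAtlas he).continuousOn_tangentMapWithin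
    (by simp) e.open_source.uniqueMDiffOn
  let Φ : TangentBundle (𝓡 n) M → ℝ := fun v =>
    WithLp.ofLp (p := 2) (V := Fin n → ℝ)
      (tangentMapWithin (𝓡 n) 𝓘(ℝ, EuclideanSpace ℝ (Fin n)) e e.source v).2 j
  have h2 : ContinuousOn Φ (Bundle.TotalSpace.proj ⁻¹' e.source) := by
    have h3 : Continuous fun v : EuclideanSpace ℝ (Fin n) × EuclideanSpace ℝ (Fin n) => v.2 j := by
      fun_prop
    exact (h3.comp (tangentBundleModelSpaceHomeomorph
      𝓘(ℝ, EuclideanSpace ℝ (Fin n))).continuous).comp_continuousOn h1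
  have h4 : MeasurableSet (Bundle.TotalSpace.proj ⁻¹' e.source : Set (TangentBundle (𝓡 n) M)) :=
    (e.open_source.preimage (FiberBundle.continuous_proj (EuclideanSpace ℝ (Fin n)) _)).measurableSet
  have h5 := h2.measurable_piecewise (g := fun _ => 0) continuousOn_const h4
  refine ((h5.comp hb).comp_aemeasurable (hG.aemeasurable_symm e)).congr ?_
  refine (ae_restrict_iff' (hG.isOpen_dom e).measurableSet).2
    (Filter.Eventually.of_forall fun z hz => ?_)
  have hs : e.symm z ∈ e.source := e.map_target hz.1
  simp only [Function.comp_apply]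
  rw [piecewise_eq_of_mem _ _ _ (show (⟨e.symm z, frame G U (e.symm z) K⟩ :
    TangentBundle (𝓡 n) M) ∈ Bundle.TotalSpace.proj ⁻¹' e.source from hs)]
  change WithLp.ofLp (p := 2) (V := Fin n → ℝ) (mfderivWithin (𝓡 n)
    𝓘(ℝ, EuclideanSpace ℝ (Fin n)) e e.source (e.symm z) (frame G U (e.symm z) K)) j = _
  rw [mfderivWithin_of_isOpen e.open_source hs]
  rfl

theorem IsMetricOn.aemeasurable_frameMat [SecondCountableTopology M] [MeasurableSpace M]
    [BorelSpace M] (hG : IsMetricOn G U)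
    (he : e ∈ IsManifold.maximalAtlas (𝓡 n) ∞ M) (K i : Fin n) :
    AEMeasurable (fun z => frameMat G U e z K i) (volume.restrict (dom e U)) := by
  have hm := (hG.isOpen_dom e).measurableSet
  have h1 : AEMeasurable (fun z => ∑ j, frameComp G U e z j K * gram G e z j i)
      (volume.restrict (dom e U)) :=
    Finset.aemeasurable_fun_sum _ fun j _ => (hG.aemeasurable_frameComp he j K).mul
      ((hG.smooth e he j i).continuousOn.aemeasurable hm)
  refine h1.congr ((ae_restrict_iff' hm).2 (Filter.Eventually.of_forall fun z hz => ?_))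
  simp only
  rw [frameMat_eq he hz.1, Matrix.mul_apply]
  rfl

/-- Components in a chart of a measurable tensor field are measurable. -/
theorem IsMetricOn.aestronglyMeasurable_tact [SecondCountableTopology M] [MeasurableSpace M]
    [BorelSpace M] (hG : IsMetricOn G U)
    (he : e ∈ IsManifold.maximalAtlas (𝓡 n) ∞ M) {k : ℕ} {f : M → Fibre n k}
    (hf : AEStronglyMeasurable f (volMeasure G U)) (J : Fin k → Fin n) :
    AEStronglyMeasurable (fun z => tact (frameMat G U e z) (f (e.symm z)) J)
      (volume.restrict (dom e U)) := by
  have h1 := hG.aestronglyMeasurable_chart he hf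
  simp only [tact]
  refine Finset.aestronglyMeasurable_fun_sum _ fun K _ => AEStronglyMeasurable.mul ?_ ?_
  · exact (EuclideanSpace.proj (𝕜 := ℂ) K).continuous.comp_aestronglyMeasurable h1
  · refine Finset.aestronglyMeasurable_fun_prod _ fun a _ => ?_
    exact Complex.continuous_ofReal.comp_aestronglyMeasurable
      (hG.aemeasurable_frameMat he (K a) (J a)).aestronglyMeasurable

end FrameMatrix
end ScatteringWitten
end

noncomputable section
namespace ScatteringWitten

/-! ### Tensorial terms of order zero. -/

section LowerOrder

variable {n k : ℕ}

/-- The tensor `c ⊗ t + D ⋆ t`, with the covector `c` in the last place, where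
`(D ⋆ t)_{J l} = ∑_a D^q_{l J_a} t_{J_0 … q … J_{k-1}}`. -/
def lot (c : Fin n → ℝ) (D : Fin n → Fin n → Fin n → ℝ) (t : (Fin k → Fin n) → ℂ)
    (J : Fin (k + 1) → Fin n) : ℂ :=
  (c (J (Fin.last k)) : ℂ) * t (Fin.init J) + ∑ a : Fin k, ∑ q : Fin n,
    (D q (J (Fin.last k)) (J a.castSucc) : ℂ) * t (Function.update (Fin.init J) a q)

/-- The map (N, q) ↦ (N with q in place a, N a) is an involution. -/
theorem sum_update_comm {W : Type*} [AddCommMonoid W] (a : Fin k)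
    (Φ : (Fin k → Fin n) → Fin n → W) :
    ∑ N : Fin k → Fin n, ∑ q, Φ N q = ∑ K : Fin k → Fin n, ∑ r, Φ (Function.update K a r) (K a) := by
  rw [← Fintype.sum_prod_type', ← Fintype.sum_prod_type']
  have hinv : Function.Involutive
      (fun x : (Fin k → Fin n) × Fin n => (Function.update x.1 a x.2, x.1 a)) := by
    rintro ⟨N, q⟩; simp
  exact (Equiv.sum_comp hinv.toPerm (fun x => Φ x.1 x.2)).symm

theorem prod_update (J : Matrix (Fin n) (Fin n) ℝ) (K L : Fin k → Fin n) (a : Fin k) (r q : Fin n) :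
    ∏ b, ((J (Function.update K a r b) (Function.update L a q b) : ℝ) : ℂ)
      = (J r q : ℂ) * ∏ b ∈ Finset.univ.erase a, ((J (K b) (L b) : ℝ) : ℂ) := by
  rw [← Finset.mul_prod_erase _ _ (Finset.mem_univ a)]
  simp only [Function.update_self]
  congr 1
  refine Finset.prod_congr rfl fun b hb => ?_
  rw [Function.update_of_ne (Finset.ne_of_mem_erase hb),
    Function.update_of_ne (Finset.ne_of_mem_erase hb)]

/-- The hypotheses say that c' and D' are the transforms of a covector and of a (1,2)-tensor, and
`lot` is a natural contraction of these with t, so it commutes with changes of basis. -/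
theorem lot_tact {c c' : Fin n → ℝ} {D D' : Fin n → Fin n → Fin n → ℝ}
    {J : Matrix (Fin n) (Fin n) ℝ} (hc : ∀ l, c' l = ∑ a, J a l * c a)
    (hD : ∀ p k l, ∑ q, J p q * D' q k l = ∑ a, ∑ b, D p a b * (J a k * J b l))
    (t : (Fin k → Fin n) → ℂ) : lot c' D' (tact J t) = tact J (lot c D t) := by
  funext L
  set l := L (Fin.last k) with hl
  set I : Fin k → Fin n := Fin.init L with hI
  have hIa : ∀ a : Fin k, L a.castSucc = I a := fun a => rfl
  have hsplit : tact J (lot c D t) L = ∑ N : Fin k → Fin n, ∑ m,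
      lot c D t (Fin.snoc N m) * ((∏ a, ((J (N a) (I a) : ℝ) : ℂ)) * (J m l : ℂ)) := by
    rw [← sum_snoc, tact]
    refine Finset.sum_congr rfl fun K _ => ?_
    rw [Fin.prod_univ_castSucc, Fin.snoc_init_self]
    rfl
  rw [hsplit]
  simp only [lot, Fin.snoc_last, Fin.init_snoc, Fin.snoc_castSucc, add_mul,
    Finset.sum_add_distrib]
  congr 1
  · rw [← hl, hc l, ← hI, tact]
    push_cast
    rw [Finset.sum_mul_sum, Finset.sum_comm]
    refine Finset.sum_congr rfl fun N _ => Finset.sum_congr rfl fun m _ => ?_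
    ring
  · rw [← hl, ← hI]
    simp only [hIa]
    have hR : ∑ N : Fin k → Fin n, ∑ m, (∑ a : Fin k, ∑ q, (D q m (N a) : ℂ) *
          t (Function.update N a q)) * ((∏ a, ((J (N a) (I a) : ℝ) : ℂ)) * (J m l : ℂ))
        = ∑ a : Fin k, ∑ N : Fin k → Fin n, ∑ q, ∑ m, (D q m (N a) : ℂ) *
          t (Function.update N a q) * ((∏ a, ((J (N a) (I a) : ℝ) : ℂ)) * (J m l : ℂ)) := by
      rw [Finset.sum_comm (s := (Finset.univ : Finset (Fin k)))]
      refine Finset.sum_congr rfl fun N _ => ?_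
      simp only [Finset.sum_mul]
      rw [Finset.sum_comm]
      refine Finset.sum_congr rfl fun a _ => ?_
      rw [Finset.sum_comm]
    rw [hR]
    refine Finset.sum_congr rfl fun a _ => ?_
    -- Renaming the a-th index of the argument of t lets the factor for that place be matched with
    -- the transformation law of D.
    rw [sum_update_comm a]
    have hD' : ∀ p, ∑ q, (J p q : ℂ) * (D' q l (I a) : ℂ)
        = ∑ r, ∑ m, (D p m r : ℂ) * ((J m l : ℂ) * (J r (I a) : ℂ)) := by
      intro p
      rw [Finset.sum_comm]
      exact_mod_cast congrArg (fun r : ℝ => (r : ℂ)) (hD p l (I a))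
    have hLHS : ∀ q, tact J t (Function.update I a q) = ∑ K : Fin k → Fin n,
        t K * ((J (K a) q : ℂ) * ∏ b ∈ Finset.univ.erase a, ((J (K b) (I b) : ℝ) : ℂ)) := by
      intro q
      rw [tact]
      refine Finset.sum_congr rfl fun K _ => ?_
      have := prod_update J K I a (K a) q
      rw [Function.update_eq_self] at this
      rw [this]
    calc ∑ q, (D' q l (I a) : ℂ) * tact J t (Function.update I a q)
        = ∑ K : Fin k → Fin n, t K * (∏ b ∈ Finset.univ.erase a, ((J (K b) (I b) : ℝ) : ℂ)) *
            ∑ q, (J (K a) q : ℂ) * (D' q l (I a) : ℂ) := by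
          simp only [hLHS, Finset.mul_sum]
          rw [Finset.sum_comm]
          refine Finset.sum_congr rfl fun K _ => Finset.sum_congr rfl fun q _ => ?_
          ring
      _ = _ := by
          refine Finset.sum_congr rfl fun K _ => ?_
          rw [hD', Finset.mul_sum]
          refine Finset.sum_congr rfl fun r _ => ?_
          rw [Finset.mul_sum]
          refine Finset.sum_congr rfl fun m _ => ?_
          have h1 := prod_update J K I a r (I a)
          rw [Function.update_eq_self a I] at h1
          rw [h1, Function.update_idem, Function.update_eq_self, Function.update_self]
          ring

theorem lot_smul (c : Fin n → ℝ) (D : Fin n → Fin n → Fin n → ℝ) (s : ℂ)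
    (t : (Fin k → Fin n) → ℂ) : lot c D (fun K => s * t K) = fun J => s * lot c D t J := by
  funext J
  simp only [lot, mul_add, Finset.mul_sum]
  congr 1
  · ring
  · refine Finset.sum_congr rfl fun a _ => Finset.sum_congr rfl fun q _ => ?_
    ring

theorem lot_add (c : Fin n → ℝ) (D : Fin n → Fin n → Fin n → ℝ)
    (t t' : (Fin k → Fin n) → ℂ) :
    lot c D (fun K => t K + t' K) = fun J => lot c D t J + lot c D t' J := by
  funext J
  simp only [lot, mul_add, Finset.sum_add_distrib]
  ring

theorem norm_lot_le {c : Fin n → ℝ} {D : Fin n → Fin n → Fin n → ℝ} {B T : ℝ} (hB : 0 ≤ B)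
    (hc : ∀ l, |c l| ≤ B) (hD : ∀ q k l, |D q k l| ≤ B) {t : (Fin k → Fin n) → ℂ}
    (ht : ∀ K, ‖t K‖ ≤ T) (J : Fin (k + 1) → Fin n) : ‖lot c D t J‖ ≤ (1 + k * n) * (B * T) := by
  have hterm : ∀ (r : ℝ) (K : Fin k → Fin n), |r| ≤ B → ‖(r : ℂ) * t K‖ ≤ B * T := by
    intro r K hr
    rw [norm_mul, Complex.norm_real, Real.norm_eq_abs]
    exact mul_le_mul hr (ht K) (norm_nonneg _) hB
  refine (norm_add_le _ _).trans ?_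
  have h2 : ‖∑ a : Fin k, ∑ q : Fin n, (D q (J (Fin.last k)) (J a.castSucc) : ℂ) *
      t (Function.update (Fin.init J) a q)‖ ≤ ∑ _a : Fin k, ∑ _q : Fin n, B * T :=
    norm_sum_le_of_le _ fun a _ => norm_sum_le_of_le _ fun q _ => hterm _ _ (hD _ _ _)
  simp only [Finset.sum_const, Finset.card_univ, Fintype.card_fin, nsmul_eq_mul] at h2
  have h1 := hterm _ (Fin.init J) (hc (J (Fin.last k)))
  linarith

end LowerOrder
end ScatteringWitten
end

noncomputable section
namespace ScatteringWitten

/-! ### Charts in which x is a coordinate. -/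

section AdaptedChart

set_option linter.unusedSectionVars false

variable {n : ℕ} {M : Type*} [TopologicalSpace M] [ChartedSpace (EuclideanSpace ℝ (Fin n)) M]
  [IsManifold (𝓡 n) ∞ M]

local notation "V" => EuclideanSpace ℝ (Fin n)

theorem trans_mem_maximalAtlas {e : OpenPartialHomeomorph M (EuclideanSpace ℝ (Fin n))}
    (he : e ∈ IsManifold.maximalAtlas (𝓡 n) ∞ M) (ψ : OpenPartialHomeomorph V V)
    (hψ : ContDiffOn ℝ ∞ ψ ψ.source) (hψ' : ContDiffOn ℝ ∞ ψ.symm ψ.target) :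
    e.trans ψ ∈ IsManifold.maximalAtlas (𝓡 n) ∞ M := by
  rw [IsManifold.mem_maximalAtlas_iff_contMDiffOn]
  constructor
  · rw [OpenPartialHomeomorph.coe_trans, OpenPartialHomeomorph.trans_source]
    exact (contMDiffOn_iff_contDiffOn.2 hψ).comp
      ((contMDiffOn_of_mem_maximalAtlas he).mono inter_subset_left) fun p hp => hp.2
  · rw [OpenPartialHomeomorph.coe_trans_symm, OpenPartialHomeomorph.trans_target]
    exact (contMDiffOn_symm_of_mem_maximalAtlas he).comp
      ((contMDiffOn_iff_contDiffOn.2 hψ').mono inter_subset_left) fun p hp => hp.2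

/-- A function with a non-vanishing partial derivative can be used as a local coordinate. -/
theorem exists_straightening {ξ : V → ℝ} {T : Set V} (hT : IsOpen T) (hξ : ContDiffOn ℝ ∞ ξ T)
    {z₀ : V} (hz₀ : z₀ ∈ T) {o : Fin n} (ho : pd o ξ z₀ ≠ 0) :
    ∃ ψ : OpenPartialHomeomorph V V, z₀ ∈ ψ.source ∧ ψ.source ⊆ T ∧
      ContDiffOn ℝ ∞ ψ ψ.source ∧ ContDiffOn ℝ ∞ ψ.symm ψ.target ∧
      ∀ z ∈ ψ.source, ψ z o = ξ z := by
  let ε : V := EuclideanSpace.single o 1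
  -- Replaces the o-th coordinate by ξ and keeps the others. Its derivative differs from the
  -- identity only in row o, with diagonal entry ∂_oξ, so it is injective exactly when that entry is
  -- nonzero.
  let Ψ : V → V := fun z => z + (ξ z - z o) • ε
  let Ψ' : V → V →L[ℝ] V := fun z =>
    ContinuousLinearMap.id ℝ V + (fderiv ℝ ξ z - EuclideanSpace.proj o).smulRight ε
  have hΨ' : ∀ z ∈ T, HasFDerivAt Ψ (Ψ' z) z := by
    intro z hz
    have h1 : HasFDerivAt ξ (fderiv ℝ ξ z) z :=
      ((hξ.contDiffAt (hT.mem_nhds hz)).differentiableAt (by simp)).hasFDerivAt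
    have h2 : HasFDerivAt (fun z : V => z o) (EuclideanSpace.proj o : V →L[ℝ] ℝ) z :=
      (EuclideanSpace.proj o : V →L[ℝ] ℝ).hasFDerivAt
    exact (hasFDerivAt_id z).add ((h1.sub h2).smul_const ε)
  have hΨ : ContDiffOn ℝ ∞ Ψ T := by
    have h2 : ContDiff ℝ ∞ (fun z : V => z o) := (EuclideanSpace.proj o : V →L[ℝ] ℝ).contDiff
    exact contDiffOn_id.add ((hξ.sub h2.contDiffOn).smul contDiffOn_const)
  have hequiv : ∀ z, pd o ξ z ≠ 0 → ∃ L : V ≃L[ℝ] V, (L : V →L[ℝ] V) = Ψ' z := by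
    intro z hz
    have hinj : Function.Injective (Ψ' z : V →ₗ[ℝ] V) := by
      rw [← LinearMap.ker_eq_bot, LinearMap.ker_eq_bot']
      intro v hv
      have hv1 : v + (fderiv ℝ ξ z v - v o) • ε = 0 := hv
      have hco : ∀ j, j ≠ o → v j = 0 := by
        intro j hj
        have := congrArg (fun w : V => w j) hv1
        simpa [ε, hj] using this
      have hvo : v = v o • ε := by
        ext j
        by_cases hj : j = o
        · subst hj; simp [ε]
        · simp [ε, hj, hco j hj]
      have h3 := congrArg (fun w : V => w o) hv1
      simp only [PiLp.add_apply, PiLp.smul_apply, smul_eq_mul, ε, PiLp.single_apply, if_true,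
        mul_one, add_sub_cancel, PiLp.zero_apply] at h3
      rw [hvo, map_smul, smul_eq_mul] at h3
      have h4 : v o = 0 := by
        rcases mul_eq_zero.1 h3 with h | h
        · exact h
        · exact absurd h hz
      rw [hvo, h4, zero_smul]
    refine ⟨(LinearEquiv.ofInjectiveEndo _ hinj).toContinuousLinearEquiv, ?_⟩
    ext1 v
    rfl
  obtain ⟨L₀, hL₀⟩ := hequiv z₀ ho
  have hc : ContDiffAt ℝ ∞ Ψ z₀ := hΨ.contDiffAt (hT.mem_nhds hz₀)
  have hd : HasFDerivAt Ψ (L₀ : V →L[ℝ] V) z₀ := hL₀ ▸ hΨ' z₀ hz₀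
  let ψ₀ := hc.toOpenPartialHomeomorph Ψ hd (by simp)
  have hpd : ContinuousOn (pd o ξ) T :=
    (hξ.continuousOn_fderiv_of_isOpen hT (by simp)).clm_apply continuousOn_const
  -- Shrinking to ∂_oξ ≠ 0 makes the local inverse smooth at every point of the target, not only at
  -- the image of z₀.
  have hO : IsOpen (T ∩ pd o ξ ⁻¹' {0}ᶜ) := hpd.isOpen_inter_preimage hT isOpen_compl_singleton
  let ψ := ψ₀.restrOpen _ hO
  have hsrc : ψ.source = ψ₀.source ∩ (T ∩ pd o ξ ⁻¹' {0}ᶜ) := ψ₀.restrOpen_source _ hO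
  have hcoe : ∀ z, ψ z = Ψ z := fun z => rfl
  refine ⟨ψ, ?_, ?_, ?_, ?_, ?_⟩
  · rw [hsrc]
    exact ⟨hc.mem_toOpenPartialHomeomorph_source hd (by simp), hz₀, ho⟩
  · rw [hsrc]; exact fun z hz => hz.2.1
  · exact (hΨ.mono (by rw [hsrc]; exact fun z hz => hz.2.1)).congr fun z _ => hcoe z
  · intro w hw
    have hw' : ψ.symm w ∈ ψ.source := ψ.map_target hw
    rw [hsrc] at hw'
    obtain ⟨L, hL⟩ := hequiv _ hw'.2.2
    have h1 : HasFDerivAt ψ (L : V →L[ℝ] V) (ψ.symm w) := hL ▸ hΨ' _ hw'.2.1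
    exact (ψ.contDiffAt_symm hw h1 (hΨ.contDiffAt (hT.mem_nhds hw'.2.1))).contDiffWithinAt
  · intro z _
    rw [hcoe]
    simp [Ψ, ε]

/-- Near a point with `dx ≠ 0`, the function `x` is one of the coordinates of a chart. -/
theorem exists_adapted_chart {x : M → ℝ} (hx : ContMDiff (𝓡 n) 𝓘(ℝ, ℝ) ∞ x) {p : M}
    (hdx : differential (n := n) x p ≠ 0) :
    ∃ e ∈ IsManifold.maximalAtlas (𝓡 n) ∞ M, p ∈ e.source ∧
      ∃ o : Fin n, ∀ y ∈ e.target, x (e.symm y) = y o := by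
  let φ := chartAt (EuclideanSpace ℝ (Fin n)) p
  have hφ : φ ∈ IsManifold.maximalAtlas (𝓡 n) ∞ M := IsManifold.chart_mem_maximalAtlas p
  have hp : p ∈ φ.source := mem_chart_source _ p
  have hz : φ p ∈ φ.target := φ.map_source hp
  have hξ := contDiffOn_comp_symm hx hφ
  have ho : ∃ o : Fin n, pd o (fun w => x (φ.symm w)) (φ p) ≠ 0 := by
    by_contra! h
    apply hdx
    have h0 : differential (n := n) x (φ.symm (φ p)) = 0 := by
      ext v
      rw [← mfderiv_symm_mfderiv hφ hz v]
      have h2 := apply_eq_sum_pd (W := ℝ)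
        ((differential (n := n) x (φ.symm (φ p)) : V →L[ℝ] ℝ).comp
          (mfderiv 𝓘(ℝ, V) (𝓡 n) φ.symm (φ p) : V →L[ℝ] V))
        (mfderiv (𝓡 n) 𝓘(ℝ, V) φ (φ.symm (φ p)) v)
      refine h2.trans (Finset.sum_eq_zero fun i _ => ?_)
      have h3 := differential_coordVec hx hφ hz i
      rw [h i] at h3
      have h4 : ((differential (n := n) x (φ.symm (φ p)) : V →L[ℝ] ℝ).comp
          (mfderiv 𝓘(ℝ, V) (𝓡 n) φ.symm (φ p) : V →L[ℝ] V)) (EuclideanSpace.single i 1) = 0 := h3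
      exact smul_eq_zero_of_right _ h4
    have key : ∀ q : M, q = p → differential (n := n) x q = 0 → differential (n := n) x p = 0 := by
      rintro q rfl h; exact h
    exact key _ (φ.left_inv hp) h0
  obtain ⟨o, ho⟩ := ho
  obtain ⟨ψ, h1, h2, h3, h4, h5⟩ := exists_straightening φ.open_target hξ hz ho
  refine ⟨φ.trans ψ, trans_mem_maximalAtlas hφ ψ h3 h4, ?_, o, fun y hy => ?_⟩
  · rw [OpenPartialHomeomorph.trans_source]; exact ⟨hp, h1⟩
  · rw [OpenPartialHomeomorph.trans_target] at hy
    have h6 := h5 _ (ψ.map_target hy.1)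
    rw [ψ.right_inv hy.1] at h6
    exact h6.symm

end AdaptedChart

/-! ### The projective inversion that sends x = 0 to infinity. -/

section Inversion

variable {n : ℕ}

local notation "V" => EuclideanSpace ℝ (Fin n)

/-- The projective inversion `y ↦ (1 / y_o, y_j / y_o)`. -/
def inversion (o : Fin n) (y : EuclideanSpace ℝ (Fin n)) : EuclideanSpace ℝ (Fin n) :=
  WithLp.toLp 2 fun p => (y o)⁻¹ * if p = o then 1 else y p

theorem inversion_apply (o : Fin n) (y : V) (p : Fin n) :
    inversion o y p = (y o)⁻¹ * if p = o then 1 else y p := rfl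

theorem inversion_self (o : Fin n) (y : V) : inversion o y o = (y o)⁻¹ := by
  simp [inversion_apply]

theorem inversion_inversion {o : Fin n} {y : V} (hy : 0 < y o) :
    inversion o (inversion o y) = y := by
  ext p
  rw [inversion_apply, inversion_self, inv_inv]
  by_cases hp : p = o
  · subst hp; simp
  · rw [if_neg hp, inversion_apply, if_neg hp, mul_inv_cancel_left₀ hy.ne']

theorem contDiff_coord (p : Fin n) : ContDiff ℝ ∞ fun z : V => z p :=
  (EuclideanSpace.proj p : V →L[ℝ] ℝ).contDiff

theorem contDiffOn_inversion (o : Fin n) : ContDiffOn ℝ ∞ (inversion o) {y : V | 0 < y o} := by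
  refine contDiffOn_euclidean.2 fun p => ?_
  simp only [inversion_apply]
  refine ((contDiff_coord o).contDiffOn.inv fun y hy => hy.ne').mul ?_
  by_cases hp : p = o
  · simp only [if_pos hp]; exact contDiffOn_const
  · simp only [if_neg hp]; exact (contDiff_coord p).contDiffOn

theorem isOpen_coord_pos (o : Fin n) : IsOpen {y : V | 0 < y o} :=
  isOpen_lt continuous_const (contDiff_coord o).continuous

/-- The inversion, as a diffeomorphism of the half space. -/
def inversionHomeo (o : Fin n) :
    OpenPartialHomeomorph (EuclideanSpace ℝ (Fin n)) (EuclideanSpace ℝ (Fin n)) where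
  toFun := inversion o
  invFun := inversion o
  source := {y | 0 < y o}
  target := {y | 0 < y o}
  map_source' y hy := by
    change 0 < inversion o y o
    rw [inversion_self]; exact inv_pos.2 hy
  map_target' y hy := by
    change 0 < inversion o y o
    rw [inversion_self]; exact inv_pos.2 hy
  left_inv' _ hy := inversion_inversion hy
  right_inv' _ hy := inversion_inversion hy
  open_source := isOpen_coord_pos o
  open_target := isOpen_coord_pos o
  continuousOn_toFun := (contDiffOn_inversion o).continuousOn
  continuousOn_invFun := (contDiffOn_inversion o).continuousOn

theorem pd_coord (k p : Fin n) (z : V) : pd k (fun w : V => w p) z = if p = k then 1 else 0 := by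
  have h : HasFDerivAt (fun w : V => w p) (EuclideanSpace.proj p : V →L[ℝ] ℝ) z :=
    (EuclideanSpace.proj p : V →L[ℝ] ℝ).hasFDerivAt
  rw [pd, h.fderiv]
  simp

theorem pd_const (k : Fin n) (c : ℝ) (z : V) : pd k (fun _ : V => c) z = 0 := by
  simp [pd]

theorem pd_inv {f : V → ℝ} {z : V} (hf : DifferentiableAt ℝ f z) (h0 : f z ≠ 0) (k : Fin n) :
    pd k (fun w => (f w)⁻¹) z = -(f z ^ 2)⁻¹ * pd k f z := by
  have h := (hasDerivAt_inv h0).comp_hasFDerivAt z hf.hasFDerivAt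
  have h2 : fderiv ℝ (fun w => (f w)⁻¹) z = -(f z ^ 2)⁻¹ • fderiv ℝ f z := h.fderiv
  rw [pd, h2]; simp [pd]

/-- The Jacobian of the inversion is `y_o N(y)` at the point with image `y`. -/
def invJac (o : Fin n) (y : EuclideanSpace ℝ (Fin n)) (p l : Fin n) : ℝ :=
  if l = o then -y p else if p = l then 1 else 0

theorem jac_inversion {o : Fin n} {z : V} (hz : 0 < z o) (p l : Fin n) :
    jac (inversion o) z p l = inversion o z o * invJac o (inversion o z) p l := by
  have hd : DifferentiableAt ℝ (inversion o) z :=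
    ((contDiffOn_inversion o).contDiffAt ((isOpen_coord_pos o).mem_nhds hz)).differentiableAt
      (by simp)
  have hdo : DifferentiableAt ℝ (fun w : V => w o) z := (contDiff_coord o).differentiable (by simp) z
  have h1 : jac (inversion o) z p l = pd l (fun w => inversion o w p) z := (pd_eval hd l p).symm
  rw [h1]
  simp only [inversion_apply, invJac]
  by_cases hp : p = o
  · subst hp
    simp only [if_true, mul_one]
    rw [pd_inv hdo hz.ne', pd_coord]
    by_cases hl : l = p
    · subst hl; simp; field_simp
    · simp [hl, Ne.symm hl]
  · simp only [if_neg hp]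
    rw [pd_mul (a := fun w : V => (w o)⁻¹) (hdo.inv hz.ne')
      ((contDiff_coord p).differentiable (by simp) z), pd_coord,
      pd_inv hdo hz.ne', pd_coord]
    by_cases hl : l = o
    · subst hl; simp [hp]; field_simp
    · simp [hl, Ne.symm hl]

/-- What matters is the factor y_o², with y the image of z: the remaining factor is bounded for
bounded y, and this decay compensates the growth of the inverse Jacobian in the law for Christoffel
symbols. -/
theorem hess_inversion {o : Fin n} {z : V} (hz : 0 < z o) (p k l : Fin n) :
    hess (inversion o) z p k l = inversion o z o ^ 2 *
      (if l = o then -(invJac o (inversion o z) p k) -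
        (if k = o then -1 else 0) * inversion o z p else if p = l then (if k = o then -1 else 0)
        else 0) := by
  have hd : DifferentiableAt ℝ (inversion o) z :=
    ((contDiffOn_inversion o).contDiffAt ((isOpen_coord_pos o).mem_nhds hz)).differentiableAt
      (by simp)
  have hdp : ∀ p, DifferentiableAt ℝ (fun w => inversion o w p) z := fun p =>
    (differentiableAt_euclidean.1 hd) p
  have hpd : ∀ p k, pd k (fun w => inversion o w p) z
      = inversion o z o * invJac o (inversion o z) p k := fun p k =>
    (pd_eval hd k p).trans (jac_inversion hz p k)
  have ho : invJac o (inversion o z) o k = (if k = o then -1 else 0) * inversion o z o := by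
    rw [invJac]
    by_cases hk : k = o
    · simp [hk]
    · simp [hk, Ne.symm hk]
  have h1 : (fun w => jac (inversion o) w p l) =ᶠ[nhds z]
      fun w => inversion o w o * invJac o (inversion o w) p l := by
    filter_upwards [(isOpen_coord_pos o).mem_nhds hz] with w hw
    exact jac_inversion hw p l
  rw [hess, pd_congr h1]
  by_cases hl : l = o
  · have h2 : (fun w => inversion o w o * invJac o (inversion o w) p l)
        = fun w => (-1) * (inversion o w o * inversion o w p) := by
      funext w; simp only [invJac, if_pos hl]; ring
    rw [h2, pd_mul (b := fun w => inversion o w o * inversion o w p) (differentiableAt_const _)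
      ((hdp o).mul (hdp p)), pd_const]
    rw [pd_mul (a := fun w => inversion o w o) (hdp o) (hdp p), hpd, hpd, ho, if_pos hl]
    ring
  · have h2 : (fun w => inversion o w o * invJac o (inversion o w) p l)
        = fun w => (if p = l then 1 else 0) * inversion o w o := by
      funext w; simp only [invJac, if_neg hl]; ring
    rw [h2, pd_mul (differentiableAt_const _) (hdp o), pd_const, hpd, ho, if_neg hl]
    by_cases hp : p = l
    · by_cases hk : k = o
      · simp only [hp, hk, if_true]; ring
      · simp [hp, hk]
    · simp [hp]

theorem jac_inversion_mul {o : Fin n} {z : V} (hz : 0 < z o) :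
    jac (inversion o) (inversion o z) * jac (inversion o) z = 1 := by
  have hy : 0 < inversion o z o := by rw [inversion_self]; exact inv_pos.2 hz
  ext q l
  rw [Matrix.mul_apply]
  simp only [jac_inversion hz, jac_inversion hy, inversion_inversion hz]
  have h1 : z o * inversion o z o = 1 := by rw [inversion_self, mul_inv_cancel₀ hz.ne']
  have h2 : ∀ p, z o * invJac o z q p * (inversion o z o * invJac o (inversion o z) p l)
      = invJac o z q p * invJac o (inversion o z) p l := by
    intro p
    calc _ = (z o * inversion o z o) * (invJac o z q p * invJac o (inversion o z) p l) := by ring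
      _ = _ := by rw [h1, one_mul]
  simp only [h2]
  by_cases hl : l = o
  · subst hl
    simp only [invJac, if_true]
    rw [← Finset.add_sum_erase _ _ (Finset.mem_univ l)]
    simp only [if_true]
    have h3 : ∀ p ∈ Finset.univ.erase l, ((if p = l then -z q else if q = p then 1 else 0) *
        -inversion l z p) = if q = p then -inversion l z p else 0 := by
      intro p hp
      rw [if_neg (Finset.ne_of_mem_erase hp)]
      by_cases hq : q = p <;> simp [hq]
    rw [Finset.sum_congr rfl h3, Finset.sum_ite_eq]
    simp only [Finset.mem_erase, Finset.mem_univ, and_true, inversion_self]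
    by_cases hq : q = l
    · subst hq; simp [hz.ne']
    · simp only [ne_eq, hq, not_false_eq_true, if_true, Matrix.one_apply_ne]
      rw [inversion_apply, if_neg hq]; ring
  · simp only [invJac, if_neg hl, mul_ite, mul_one, mul_zero]
    rw [Finset.sum_ite_eq']
    simp [hl, Matrix.one_apply]

end Inversion
end ScatteringWitten
end

noncomputable section
namespace ScatteringWitten

/-! ### Bounded geometry in the inverted coordinates. -/

section Bounded

variable {n : ℕ}

local notation "V" => EuclideanSpace ℝ (Fin n)

/-- The function and its first derivatives are bounded on the set. -/
def BddC1 (S : Set (EuclideanSpace ℝ (Fin n))) (f : EuclideanSpace ℝ (Fin n) → ℝ) : Prop :=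
  ∃ C, ∀ z ∈ S, |f z| ≤ C ∧ ∀ l, |pd l f z| ≤ C

theorem BddC1.congr {S T : Set V} {f f' : V → ℝ} (h : BddC1 S f) (hT : IsOpen T) (hST : S ⊆ T)
    (hff : ∀ z ∈ T, f' z = f z) : BddC1 S f' := by
  obtain ⟨C, hC⟩ := h
  refine ⟨C, fun z hz => ?_⟩
  have h1 : f' =ᶠ[nhds z] f := by
    filter_upwards [hT.mem_nhds (hST hz)] with w hw using hff w hw
  rw [h1.self_of_nhds]
  refine ⟨(hC z hz).1, fun l => ?_⟩
  rw [pd_congr h1]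
  exact (hC z hz).2 l

theorem BddC1.mul {S T : Set V} {f f' : V → ℝ} (h : BddC1 S f) (h' : BddC1 S f') (hT : IsOpen T)
    (hST : S ⊆ T) (hf : ContDiffOn ℝ ∞ f T) (hf' : ContDiffOn ℝ ∞ f' T) :
    BddC1 S fun z => f z * f' z := by
  obtain ⟨C, hC⟩ := h
  obtain ⟨C', hC'⟩ := h'
  refine ⟨C * C' + C' * C, fun z hz => ?_⟩
  have h0 : 0 ≤ C := (abs_nonneg _).trans (hC z hz).1
  have h0' : 0 ≤ C' := (abs_nonneg _).trans (hC' z hz).1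
  have hd : DifferentiableAt ℝ f z :=
    (hf.contDiffAt (hT.mem_nhds (hST hz))).differentiableAt (by simp)
  have hd' : DifferentiableAt ℝ f' z :=
    (hf'.contDiffAt (hT.mem_nhds (hST hz))).differentiableAt (by simp)
  constructor
  · rw [abs_mul]
    have := mul_le_mul (hC z hz).1 (hC' z hz).1 (abs_nonneg _) h0
    nlinarith
  · intro l
    rw [pd_mul hd hd']
    refine (abs_add_le _ _).trans ?_
    rw [abs_mul, abs_mul]
    exact add_le_add (mul_le_mul (hC z hz).1 ((hC' z hz).2 l) (abs_nonneg _) h0)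
      (mul_le_mul (hC' z hz).1 ((hC z hz).2 l) (abs_nonneg _) h0')

theorem norm_coord_le (y : V) (p : Fin n) : |y p| ≤ ‖y‖ := by
  simpa using PiLp.norm_apply_le y p

theorem abs_invJac_le {o : Fin n} {y : V} {R : ℝ} (hR : 1 ≤ R) (hy : ∀ p, |y p| ≤ R) (p l : Fin n) :
    |invJac o y p l| ≤ R := by
  rw [invJac]
  split_ifs
  · rw [abs_neg]; exact hy p
  · simpa using hR
  · simpa using zero_le_one.trans hR

theorem exists_bound_on_compact {C₀ W : Set V} (hC : IsCompact C₀) (hCW : C₀ ⊆ W) {ι : Type*}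
    [Finite ι] {f : ι → V → ℝ} (hf : ∀ i, ContinuousOn (f i) W) :
    ∃ B, 0 ≤ B ∧ ∀ i, ∀ y ∈ C₀, |f i y| ≤ B := by
  cases nonempty_fintype ι
  have h1 : ∀ i, ∃ B, ∀ y ∈ C₀, ‖f i y‖ ≤ B := fun i =>
    hC.exists_bound_of_continuousOn ((hf i).mono hCW)
  choose B hB using h1
  refine ⟨∑ i, |B i|, Finset.sum_nonneg fun i _ => abs_nonneg _, fun i y hy => ?_⟩
  exact ((hB i y hy).trans (le_abs_self _)).trans
    (Finset.single_le_sum (f := fun i => |B i|) (fun i _ => abs_nonneg _) (Finset.mem_univ i))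

/-- By the chain rule each derivative gains the Jacobian entries y_o N(y), which are bounded on the
compact set C₀. So functions smooth up to y_o = 0 have bounded first derivatives in the noncompact
coordinates. -/
theorem bddC1_comp_inversion {o : Fin n} {C₀ W : Set V} (hC : IsCompact C₀) (hW : IsOpen W)
    (hCW : C₀ ⊆ W) {b : V → ℝ} (hb : ContDiffOn ℝ ∞ b W) :
    BddC1 {z | 0 < z o ∧ inversion o z ∈ C₀} fun z => b (inversion o z) := by
  obtain ⟨R, hR⟩ := hC.exists_bound_of_continuousOn (f := fun y : V => y) continuousOn_id
  have hR' : ∀ y ∈ C₀, ∀ p, |y p| ≤ max R 1 := fun y hy p =>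
    ((norm_coord_le y p).trans (hR y hy)).trans (le_max_left _ _)
  obtain ⟨B, hB0, hB⟩ := exists_bound_on_compact hC hCW
    (f := fun i : Option (Fin n) => i.elim b fun c => pd c b) (by
      rintro (_ | c)
      · exact hb.continuousOn
      · exact (hb.continuousOn_fderiv_of_isOpen hW (by simp)).clm_apply continuousOn_const)
  have hRR : 0 ≤ max R 1 * max R 1 := by positivity
  refine ⟨B + n * (max R 1 * max R 1 * B), fun z hz => ?_⟩
  have hnn : 0 ≤ (n : ℝ) * (max R 1 * max R 1 * B) := by positivity
  refine ⟨(hB none _ hz.2).trans (by linarith), fun l => ?_⟩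
  have hd : DifferentiableAt ℝ (inversion o) z :=
    ((contDiffOn_inversion o).contDiffAt ((isOpen_coord_pos o).mem_nhds hz.1)).differentiableAt
      (by simp)
  rw [pd_comp ((hb.contDiffAt (hW.mem_nhds (hCW hz.2))).differentiableAt (by simp)) hd]
  have h1 : |∑ c, jac (inversion o) z c l * pd c b (inversion o z)|
      ≤ ∑ _c : Fin n, max R 1 * max R 1 * B := by
    refine (Finset.abs_sum_le_sum_abs _ _).trans (Finset.sum_le_sum fun c _ => ?_)
    rw [abs_mul, jac_inversion hz.1, abs_mul]
    exact mul_le_mul (mul_le_mul (hR' _ hz.2 o)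
      (abs_invJac_le (le_max_right _ _) (hR' _ hz.2) c l) (abs_nonneg _) (by positivity))
      (hB (some c) _ hz.2) (abs_nonneg _) hRR
  simp only [Finset.sum_const, Finset.card_univ, Fintype.card_fin, nsmul_eq_mul] at h1
  linarith

/-- On the compact set C₀ the coordinate y_o is bounded above, so z_o = 1/y_o stays away from 0 and
the inversion is continuous on the closed half space in question. Points with y_o → 0 escape to
infinity and add no boundary. -/
theorem isClosed_inversion_preimage {o : Fin n} {C₀ : Set V} (hC : IsCompact C₀) :
    IsClosed {z : V | 0 < z o ∧ inversion o z ∈ C₀} := by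
  obtain ⟨R, hR⟩ := hC.exists_bound_of_continuousOn (f := fun y : V => y) continuousOn_id
  set r := max R 1
  have hr : 0 < r := lt_of_lt_of_le one_pos (le_max_right _ _)
  have h1 : {z : V | 0 < z o ∧ inversion o z ∈ C₀}
      = {z : V | r⁻¹ ≤ z o} ∩ inversion o ⁻¹' C₀ := by
    ext z
    simp only [mem_ofPred_eq, mem_inter_iff, mem_preimage]
    refine ⟨fun h => ⟨?_, h.2⟩, fun h => ⟨lt_of_lt_of_le (inv_pos.2 hr) h.1, h.2⟩⟩
    have h2 : |inversion o z o| ≤ r :=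
      ((norm_coord_le _ o).trans (hR _ h.2)).trans (le_max_left _ _)
    rw [inversion_self, abs_of_pos (inv_pos.2 h.1)] at h2
    exact inv_le_of_inv_le₀ h.1 h2
  rw [h1]
  have h3 : IsClosed {z : V | r⁻¹ ≤ z o} :=
    isClosed_le continuous_const (contDiff_coord o).continuous
  refine ContinuousOn.preimage_isClosed_of_isClosed ?_ h3 hC.isClosed
  exact (contDiffOn_inversion o).continuousOn.mono fun z hz => lt_of_lt_of_le (inv_pos.2 hr) hz

end Bounded

/-! ### The metrics g and g_sc as smooth metrics on open sets. -/

section MetricOn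

set_option linter.unusedSectionVars false

variable {n : ℕ} {M : Type*} [TopologicalSpace M] [ChartedSpace (EuclideanSpace ℝ (Fin n)) M]
  [IsManifold (𝓡 n) ∞ M]

theorem isSmoothTwoTensor_inner
    (g : Bundle.ContMDiffRiemannianMetric (𝓡 n) ∞ (EuclideanSpace ℝ (Fin n))
      (fun p : M => TangentSpace (𝓡 n) p)) : IsSmoothTwoTensor (g.inner : TwoTensor n M) :=
  g.contMDiff

theorem isMetricOn_inner
    (g : Bundle.ContMDiffRiemannianMetric (𝓡 n) ∞ (EuclideanSpace ℝ (Fin n))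
      (fun p : M => TangentSpace (𝓡 n) p)) : IsMetricOn (g.inner : TwoTensor n M) univ where
  isOpen := isOpen_univ
  smooth _ he i j := (contDiffOn_gram (isSmoothTwoTensor_inner g) he i j).mono inter_subset_left
  symm p _ v w := g.symm p v w
  pos p _ v hv := g.pos p v hv

variable {x : M → ℝ} {h : TwoTensor n M}

theorem gram_scMetric (hx : ContMDiff (𝓡 n) 𝓘(ℝ, ℝ) ∞ x)
    {e : OpenPartialHomeomorph M (EuclideanSpace ℝ (Fin n))}
    (he : e ∈ IsManifold.maximalAtlas (𝓡 n) ∞ M) {z : EuclideanSpace ℝ (Fin n)} (hz : z ∈ e.target)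
    (i j : Fin n) :
    gram (scMetric x h) e z i j = (x (e.symm z) ^ 4)⁻¹ * (pd i (fun w => x (e.symm w)) z *
      pd j (fun w => x (e.symm w)) z) + (x (e.symm z) ^ 2)⁻¹ * gram h e z i j := by
  rw [← differential_coordVec hx he hz i, ← differential_coordVec hx he hz j]
  rfl

theorem isMetricOn_scMetric (hx : ContMDiff (𝓡 n) 𝓘(ℝ, ℝ) ∞ x) (h_smooth : IsSmoothTwoTensor h)
    (h_symm : ∀ (p : M) (v w : TangentSpace (𝓡 n) p), h p v w = h p w v)
    (h_int : ∀ p : M, 0 < x p → ∀ v : TangentSpace (𝓡 n) p, v ≠ 0 → 0 < scMetric x h p v v) :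
    IsMetricOn (scMetric x h) (interiorX x) where
  isOpen := isOpen_lt continuous_const hx.continuous
  smooth e he i j := by
    have h1 : ContDiffOn ℝ ∞ (fun w => x (e.symm w)) e.target := contDiffOn_comp_symm hx he
    have h2 : ∀ i : Fin n, ContDiffOn ℝ ∞ (pd i fun w => x (e.symm w)) e.target := fun i =>
      (h1.fderiv_of_isOpen e.open_target (by simp)).clm_apply contDiffOn_const
    have h3 : ContDiffOn ℝ ∞ (fun z => (x (e.symm z) ^ 4)⁻¹ * (pd i (fun w => x (e.symm w)) z *
      pd j (fun w => x (e.symm w)) z) + (x (e.symm z) ^ 2)⁻¹ * gram h e z i j)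
        (dom e (interiorX x)) := by
      have hs : dom e (interiorX x) ⊆ e.target := inter_subset_left
      refine ContDiffOn.add (ContDiffOn.mul ?_ (((h2 i).mono hs).mul ((h2 j).mono hs)))
        (ContDiffOn.mul ?_ ((contDiffOn_gram h_smooth he i j).mono hs))
      · exact ((h1.mono hs).pow 4).inv fun z hz => (pow_pos hz.2 4).ne'
      · exact ((h1.mono hs).pow 2).inv fun z hz => (pow_pos hz.2 2).ne'
    exact h3.congr fun z hz => gram_scMetric hx he hz.1 i j
  symm p _ v w := by
    change (x p ^ 4)⁻¹ * (differential x p v * differential x p w) + (x p ^ 2)⁻¹ * h p v w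
      = (x p ^ 4)⁻¹ * (differential x p w * differential x p v) + (x p ^ 2)⁻¹ * h p w v
    rw [h_symm p v w, mul_comm (differential x p v)]
  pos p hp v hv := h_int p hp v hv

end MetricOn
end ScatteringWitten
end

noncomputable section
namespace ScatteringWitten

/-! ### Uniform bounds for g_sc and for the connection of g up to x = 0. -/

section GoodChart

set_option linter.unusedSectionVars false

variable {n : ℕ} {M : Type*} [TopologicalSpace M] [ChartedSpace (EuclideanSpace ℝ (Fin n)) M]
  [IsManifold (𝓡 n) ∞ M]

local notation "V" => EuclideanSpace ℝ (Fin n)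

/-- The chart `e` of `{x > 0}` has `1 / x` as a coordinate, and bounded geometry over `K`, uniformly
up to `x = 0`, both for the metric `g_sc` and for the connection of `g`. -/
structure GoodChart (x : M → ℝ) (h g : TwoTensor n M)
    (e : OpenPartialHomeomorph M (EuclideanSpace ℝ (Fin n))) (o : Fin n) (K : Set M) : Prop where
  mem : e ∈ IsManifold.maximalAtlas (𝓡 n) ∞ M
  sub : K ∩ interiorX x ⊆ e.source
  closed : IsClosed (dom e (K ∩ interiorX x))
  coord : ∀ z ∈ dom e (interiorX x), (x (e.symm z))⁻¹ = z o
  gram : ∀ i j, BddC1 (dom e (K ∩ interiorX x)) fun z => gram (scMetric x h) e z i j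
  inv : ∀ i j, BddC1 (dom e (K ∩ interiorX x)) fun z => (ScatteringWitten.gram (scMetric x h) e z)⁻¹ i j
  dens : BddC1 (dom e (K ∩ interiorX x)) fun z =>
    Real.sqrt (ScatteringWitten.gram (scMetric x h) e z).det
  dens_lower : ∃ c > 0, ∀ z ∈ dom e (K ∩ interiorX x),
    c ≤ Real.sqrt (ScatteringWitten.gram (scMetric x h) e z).det
  chr : ∃ C, ∀ z ∈ dom e (K ∩ interiorX x), ∀ q k l, |christoffel g e z q k l| ≤ C
  cut : ∀ χ : M → ℝ, ContMDiff (𝓡 n) 𝓘(ℝ, ℝ) ∞ χ →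
    BddC1 (dom e (K ∩ interiorX x)) fun z => χ (e.symm z)

/-- The matrix of `g_sc` in the coordinates `(1 / x, y_j / x)`, as a function of `(x, y_j)`. -/
def stretchedGram (o : Fin n) (H : EuclideanSpace ℝ (Fin n) → Matrix (Fin n) (Fin n) ℝ)
    (y : EuclideanSpace ℝ (Fin n)) : Matrix (Fin n) (Fin n) ℝ :=
  Matrix.of fun i j => (if i = o ∧ j = o then 1 else 0) +
    ∑ a, ∑ b, invJac o y a i * H y a b * invJac o y b j

theorem contDiff_invJac (o p l : Fin n) : ContDiff ℝ ∞ fun y : V => invJac o y p l := by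
  simp only [invJac]
  split_ifs
  · exact (contDiff_coord p).neg
  · exact contDiff_const
  · exact contDiff_const

theorem contDiffOn_stretchedGram {o : Fin n} {H : V → Matrix (Fin n) (Fin n) ℝ} {T : Set V}
    (hH : ∀ a b, ContDiffOn ℝ ∞ (fun y => H y a b) T) (i j : Fin n) :
    ContDiffOn ℝ ∞ (fun y => stretchedGram o H y i j) T := by
  refine contDiffOn_const.add (ContDiffOn.sum fun a _ => ContDiffOn.sum fun b _ => ?_)
  exact ((contDiff_invJac o a i).contDiffOn.mul (hH a b)).mul (contDiff_invJac o b j).contDiffOn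

theorem bil_stretchedGram (o : Fin n) (H : V → Matrix (Fin n) (Fin n) ℝ) (y : V) (v : Fin n → ℝ) :
    bil (stretchedGram o H y) v v = v o ^ 2 +
      bil (H y) (fun a => ∑ i, invJac o y a i * v i) (fun a => ∑ i, invJac o y a i * v i) := by
  simp only [bil, stretchedGram, Matrix.of_apply, mul_add, add_mul, Finset.sum_add_distrib]
  congr 1
  · rw [Finset.sum_eq_single o, Finset.sum_eq_single o]
    · simp; ring
    · intro j _ hj; simp [hj]
    · simp
    · intro i _ hi; exact Finset.sum_eq_zero fun j _ => by simp [hi]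
    · simp
  · have h1 : ∀ i j, v i * (∑ a, ∑ b, invJac o y a i * H y a b * invJac o y b j) * v j
        = ∑ a, ∑ b, (invJac o y a i * v i) * H y a b * (invJac o y b j * v j) := by
      intro i j
      simp only [Finset.mul_sum, Finset.sum_mul]
      refine Finset.sum_congr rfl fun a _ => Finset.sum_congr rfl fun b _ => ?_
      ring
    simp only [h1]
    have h2 : ∀ a b, (∑ i, invJac o y a i * v i) * H y a b * (∑ j, invJac o y b j * v j)
        = ∑ i, ∑ j, (invJac o y a i * v i) * H y a b * (invJac o y b j * v j) := by
      intro a b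
      rw [Finset.sum_mul, Finset.sum_mul_sum]
    simp only [h2]
    rw [Finset.sum_congr rfl fun i _ => Finset.sum_comm]
    rw [Finset.sum_comm]
    refine Finset.sum_congr rfl fun a _ => ?_
    rw [Finset.sum_congr rfl fun i _ => Finset.sum_comm]
    rw [Finset.sum_comm]

/-- At y_o = 0 the form is v_o² + H(Nv, Nv) with (Nv)_o = −y_o v_o = 0, so Nv lies in the kernel of
dx, where H is positive. If Nv = 0 then v_o ≠ 0, since v_o = 0 would force all other entries of v to
vanish. -/
theorem posDef_stretchedGram_of_zero {o : Fin n} {H : V → Matrix (Fin n) (Fin n) ℝ} {y : V}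
    (hy : y o = 0) (hs : ∀ a b, H y a b = H y b a)
    (hp : ∀ w : Fin n → ℝ, w ≠ 0 → w o = 0 → 0 < bil (H y) w w) :
    (stretchedGram o H y).PosDef := by
  refine Matrix.PosDef.of_dotProduct_mulVec_pos ?_ fun v hv => ?_
  · ext i j
    simp only [Matrix.conjTranspose_apply, star_trivial, stretchedGram, Matrix.of_apply]
    congr 1
    · simp only [and_comm]
    · rw [Finset.sum_comm]
      refine Finset.sum_congr rfl fun a _ => Finset.sum_congr rfl fun b _ => ?_
      rw [hs b a]; ring
  · simp only [star_trivial]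
    rw [← bil_eq, bil_stretchedGram]
    set w : Fin n → ℝ := fun a => ∑ i, invJac o y a i * v i with hw
    have hwj : ∀ j, w j = -(y j * v o) + if j = o then 0 else v j := by
      intro j
      simp only [hw]
      rw [← Finset.add_sum_erase _ _ (Finset.mem_univ o)]
      have h3 : ∀ i ∈ Finset.univ.erase o, invJac o y j i * v i = if j = i then v i else 0 := by
        intro i hi
        rw [invJac, if_neg (Finset.ne_of_mem_erase hi)]
        split_ifs <;> simp
      rw [Finset.sum_congr rfl h3, Finset.sum_ite_eq, invJac, if_pos rfl]
      simp only [Finset.mem_erase, Finset.mem_univ, and_true, ne_eq, ite_not]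
      ring
    have hwo : w o = 0 := by rw [hwj, hy]; simp
    by_cases hw0 : w = 0
    · have hvo : v o ≠ 0 := by
        intro hvo
        apply hv
        funext j
        by_cases hj : j = o
        · rw [hj, hvo]; rfl
        · have := hwj j
          rw [hw0, hvo, if_neg hj] at this
          simpa using this.symm
      have h4 : bil (H y) w w = 0 := by rw [hw0]; simp [bil]
      rw [h4]; positivity
    · have := hp w hw0 hwo
      positivity

/-- The inverse Jacobian grows at most like y_o^{-2} as y_o → 0, so the factor y_o² makes it
bounded. -/
theorem abs_inv_jac_le {o : Fin n} {z : V} (hz : 0 < z o) {R : ℝ} (hR : 1 ≤ R)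
    (hy : ∀ p, |inversion o z p| ≤ R) (q p : Fin n) :
    inversion o z o ^ 2 * |jac (inversion o) (inversion o z) q p| ≤ R := by
  have hyo : 0 < inversion o z o := by rw [inversion_self]; exact inv_pos.2 hz
  set Y := inversion o z with hY
  have hzY : inversion o Y = z := inversion_inversion hz
  rw [jac_inversion hyo, hzY, abs_mul]
  have h1 : Y o * z o = 1 := by rw [hY, inversion_self, inv_mul_cancel₀ hz.ne']
  have h2 : Y o ^ 2 * (|z o| * |invJac o z q p|) = Y o * |invJac o z q p| := by
    rw [abs_of_pos hz]
    calc _ = Y o * (Y o * z o) * |invJac o z q p| := by ring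
      _ = _ := by rw [h1, mul_one]
  rw [h2]
  have hYo : Y o ≤ R := (le_abs_self _).trans (hy o)
  rw [invJac]
  split_ifs with hp hq
  · have hzq : z q = (Y o)⁻¹ * (if q = o then 1 else Y q) := by
      have := inversion_apply o Y q
      rwa [hzY] at this
    rw [abs_neg, hzq, abs_mul, abs_inv, abs_of_pos hyo, mul_inv_cancel_left₀ hyo.ne']
    split_ifs
    · simpa using hR
    · exact hy q
  · simpa using hYo
  · simpa using zero_le_one.trans hR

theorem contDiffOn_det {A : V → Matrix (Fin n) (Fin n) ℝ} {W : Set V}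
    (hA : ∀ i j, ContDiffOn ℝ ∞ (fun y => A y i j) W) : ContDiffOn ℝ ∞ (fun y => (A y).det) W := by
  simp only [Matrix.det_apply]
  exact ContDiffOn.sum fun σ _ => ContDiffOn.const_smul _ (contDiffOn_prod fun i _ => hA _ _)

/-- Cramer's rule: an entry of the inverse is a quotient of determinants. -/
theorem contDiffOn_inv_entry {A : V → Matrix (Fin n) (Fin n) ℝ} {W : Set V}
    (hA : ∀ i j, ContDiffOn ℝ ∞ (fun y => A y i j) W) (hdet : ∀ y ∈ W, (A y).det ≠ 0)
    (q r : Fin n) : ContDiffOn ℝ ∞ (fun y => (A y)⁻¹ q r) W := by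
  have h1 : ∀ y, (A y)⁻¹ q r = ((A y).det)⁻¹ * ((A y).updateRow r (Pi.single q 1)).det := by
    intro y
    rw [Matrix.inv_def, Ring.inverse_eq_inv', ← Matrix.adjugate_apply]
    rfl
  simp only [h1]
  refine ((contDiffOn_det hA).inv hdet).mul (contDiffOn_det fun i j => ?_)
  by_cases hi : i = r
  · subst hi
    simp only [Matrix.updateRow_self]
    exact contDiffOn_const
  · simp only [Matrix.updateRow_ne hi]
    exact hA i j

/-- The Christoffel symbols of a metric that is smooth up to `x = 0` are bounded in the coordinates
`(1 / x, y_j / x)`. -/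
theorem exists_chr_bound {o : Fin n} {C₀ W : Set V} (hC : IsCompact C₀) (hW : IsOpen W)
    (hCW : C₀ ⊆ W) {A A' : V → Matrix (Fin n) (Fin n) ℝ}
    (hA : ∀ i j, ContDiffOn ℝ ∞ (fun y => A y i j) W) (hpos : ∀ y ∈ W, (A y).PosDef)
    (hA' : ∀ z, 0 < z o → inversion o z ∈ W → A' z
      = (jac (inversion o) z).transpose * A (inversion o z) * jac (inversion o) z) :
    ∃ C, ∀ z, 0 < z o → inversion o z ∈ C₀ → ∀ q k l, |chr A' z q k l| ≤ C := by
  obtain ⟨R₀, hR₀⟩ := hC.exists_bound_of_continuousOn (f := fun y : V => y) continuousOn_id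
  set R := max R₀ 1
  have hR1 : 1 ≤ R := le_max_right _ _
  have hR : ∀ y ∈ C₀, ∀ p, |y p| ≤ R := fun y hy p =>
    ((norm_coord_le y p).trans (hR₀ y hy)).trans (le_max_left _ _)
  have hchr : ∀ i : Fin n × Fin n × Fin n,
      ContinuousOn (fun y => chr A y i.1 i.2.1 i.2.2) W := by
    rintro ⟨q, k, l⟩
    simp only [chr]
    have hpd : ∀ k i j, ContinuousOn (pd k fun y => A y i j) W := fun k i j =>
      ((hA i j).continuousOn_fderiv_of_isOpen hW (by simp)).clm_apply continuousOn_const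
    have hinv : ∀ r, ContinuousOn (fun y => (A y)⁻¹ q r) W := fun r =>
      (contDiffOn_inv_entry hA (fun y hy => (hpos y hy).det_pos.ne') q r).continuousOn
    exact continuousOn_const.mul (continuousOn_finsetSum _ fun r _ =>
      (hinv r).mul (((hpd _ _ _).add (hpd _ _ _)).sub (hpd _ _ _)))
  obtain ⟨B, hB0, hB⟩ := exists_bound_on_compact hC hCW hchr
  refine ⟨∑ _p : Fin n, R * ((∑ _a : Fin n, ∑ _b : Fin n, B * (R * R)) + (R + R)),
    fun z hz hzC q k l => ?_⟩
  set Y := inversion o z with hY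
  have hyo : 0 < Y o := by rw [hY, inversion_self]; exact inv_pos.2 hz
  have hYR := hR Y hzC
  have hYW := hCW hzC
  have hcd : ContDiffAt ℝ ∞ (inversion o) z :=
    (contDiffOn_inversion o).contDiffAt ((isOpen_coord_pos o).mem_nhds hz)
  have hJJ := jac_inversion_mul hz
  have hJu : IsUnit (jac (inversion o) z).det := by
    have h := congrArg Matrix.det hJJ
    rw [Matrix.det_mul, Matrix.det_one, mul_comm] at h
    exact IsUnit.of_mul_eq_one _ h
  have hev : ∀ᶠ w in nhds z, A' w
      = (jac (inversion o) w).transpose * A (inversion o w) * jac (inversion o) w := by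
    filter_upwards [(isOpen_coord_pos o).mem_nhds hz,
      hcd.continuousAt.preimage_mem_nhds (hW.mem_nhds hYW)] with w hw hw' using hA' w hw hw'
  have hlaw := chr_change hcd (fun i j => ((hA i j).contDiffAt (hW.mem_nhds hYW)).differentiableAt
    (by simp)) ((hpos Y hYW).isHermitian) (hpos Y hYW).det_pos.ne'.isUnit hJu hev
  -- The transformation law solved for the new symbols: as the inversion is an involution, the
  -- inverse Jacobian is its own Jacobian at the image point.
  have hq : chr A' z q k l = ∑ p, jac (inversion o) Y q p *
      ((∑ a, ∑ b, chr A Y p a b * (jac (inversion o) z a k * jac (inversion o) z b l))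
        + hess (inversion o) z p k l) := by
    have hJJ' : ∀ q', ∑ p, jac (inversion o) Y q p * jac (inversion o) z p q'
        = (1 : Matrix (Fin n) (Fin n) ℝ) q q' := by
      intro q'; rw [← hJJ, Matrix.mul_apply]
    calc chr A' z q k l
        = ∑ q', (1 : Matrix (Fin n) (Fin n) ℝ) q q' * chr A' z q' k l := by
          rw [Finset.sum_eq_single q]
          · simp
          · intro b _ hb; simp [Matrix.one_apply_ne hb.symm]
          · simp
      _ = ∑ p, jac (inversion o) Y q p * ∑ q', jac (inversion o) z p q' * chr A' z q' k l := by
          simp only [Finset.mul_sum]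
          rw [Finset.sum_comm]
          refine Finset.sum_congr rfl fun q' _ => ?_
          rw [← hJJ', Finset.sum_mul]
          exact Finset.sum_congr rfl fun p _ => mul_assoc _ _ _
      _ = _ := Finset.sum_congr rfl fun p _ => by rw [hlaw]
  rw [hq]
  refine (Finset.abs_sum_le_sum_abs _ _).trans (Finset.sum_le_sum fun p _ => ?_)
  have hJ : ∀ a k, |jac (inversion o) z a k| ≤ Y o * R := by
    intro a k
    rw [jac_inversion hz, abs_mul, abs_of_pos hyo]
    exact mul_le_mul_of_nonneg_left (abs_invJac_le hR1 hYR a k) hyo.le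
  -- Each Jacobian entry contributes one factor y_o, and the Hessian contributes y_o² below;
  -- together they are paid out against the inverse Jacobian.
  have h1 : |∑ a, ∑ b, chr A Y p a b * (jac (inversion o) z a k * jac (inversion o) z b l)|
      ≤ ∑ _a : Fin n, ∑ _b : Fin n, Y o ^ 2 * (B * (R * R)) := by
    refine (Finset.abs_sum_le_sum_abs _ _).trans (Finset.sum_le_sum fun a _ => ?_)
    refine (Finset.abs_sum_le_sum_abs _ _).trans (Finset.sum_le_sum fun b _ => ?_)
    rw [abs_mul, abs_mul]
    have h3 := mul_le_mul (hJ a k) (hJ b l) (abs_nonneg _) (by positivity)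
    have h4 := mul_le_mul (hB (p, a, b) Y hzC) h3 (by positivity) hB0
    refine h4.trans (le_of_eq (by ring))
  have h2 : |hess (inversion o) z p k l| ≤ Y o ^ 2 * (R + R) := by
    rw [hess_inversion hz, abs_mul, abs_of_nonneg (sq_nonneg _)]
    refine mul_le_mul_of_nonneg_left ?_ (sq_nonneg _)
    have h5 : |(if k = o then (-1 : ℝ) else 0)| ≤ 1 := by split_ifs <;> simp
    split_ifs with hl hk hp hk <;> try simp only [abs_neg, abs_one, abs_zero] <;> try linarith
    · refine (abs_sub _ _).trans (add_le_add ?_ ?_)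
      · rw [abs_neg]; exact abs_invJac_le hR1 hYR p k
      · rw [abs_mul, abs_neg, abs_one, one_mul]; exact hYR p
    · refine (abs_sub _ _).trans (add_le_add ?_ ?_)
      · rw [abs_neg]; exact abs_invJac_le hR1 hYR p k
      · rw [zero_mul, abs_zero]; linarith
  have h1' : ∑ _a : Fin n, ∑ _b : Fin n, Y o ^ 2 * (B * (R * R))
      = Y o ^ 2 * ∑ _a : Fin n, ∑ _b : Fin n, B * (R * R) := by
    rw [Finset.mul_sum]
    exact Finset.sum_congr rfl fun a _ => (Finset.mul_sum _ _ _).symm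
  rw [h1'] at h1
  have h6 : |(∑ a, ∑ b, chr A Y p a b * (jac (inversion o) z a k * jac (inversion o) z b l))
      + hess (inversion o) z p k l|
      ≤ Y o ^ 2 * ((∑ _a : Fin n, ∑ _b : Fin n, B * (R * R)) + (R + R)) := by
    rw [mul_add]; exact (abs_add_le _ _).trans (add_le_add h1 h2)
  rw [abs_mul]
  refine (mul_le_mul_of_nonneg_left h6 (abs_nonneg _)).trans ?_
  rw [← mul_assoc, mul_comm |_| (Y o ^ 2)]
  refine mul_le_mul_of_nonneg_right (abs_inv_jac_le hz hR1 hYR q p) ?_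
  have : 0 ≤ ∑ _a : Fin n, ∑ _b : Fin n, B * (R * R) :=
    Finset.sum_nonneg fun _ _ => Finset.sum_nonneg fun _ _ => by positivity
  linarith

end GoodChart
end ScatteringWitten
end

noncomputable section
namespace ScatteringWitten

/-! ### Existence of good charts. -/

section GoodChartExists

set_option linter.unusedSectionVars false

variable {n : ℕ} {M : Type*} [TopologicalSpace M] [ChartedSpace (EuclideanSpace ℝ (Fin n)) M]
  [IsManifold (𝓡 n) ∞ M]

local notation "V" => EuclideanSpace ℝ (Fin n)

theorem gram_trans_inversion {e : OpenPartialHomeomorph M (EuclideanSpace ℝ (Fin n))}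
    (he : e ∈ IsManifold.maximalAtlas (𝓡 n) ∞ M) {o : Fin n}
    (G : TwoTensor n M) {z : V} (hz : 0 < z o) (hz' : inversion o z ∈ e.target) :
    gram G (e.trans (inversionHomeo o)) z
      = (jac (inversion o) z).transpose * gram G e (inversion o z) * jac (inversion o) z := by
  have he' : e.trans (inversionHomeo o) ∈ IsManifold.maximalAtlas (𝓡 n) ∞ M :=
    trans_mem_maximalAtlas he _ (contDiffOn_inversion o) (contDiffOn_inversion o)
  have htar : (e.trans (inversionHomeo o)).target = {z : V | 0 < z o} ∩ inversion o ⁻¹' e.target :=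
    OpenPartialHomeomorph.trans_target _ _
  have hz1 : z ∈ (e.trans (inversionHomeo o)).target := by rw [htar]; exact ⟨hz, hz'⟩
  have hs : (e.trans (inversionHomeo o)).symm z ∈ e.source := e.map_target hz'
  have ht : ∀ w ∈ (e.trans (inversionHomeo o)).target,
      transition e (e.trans (inversionHomeo o)) w = inversion o w := by
    intro w hw
    rw [htar] at hw
    exact e.right_inv hw.2
  have hj : jac (transition e (e.trans (inversionHomeo o))) z = jac (inversion o) z := by
    ext p l
    have : transition e (e.trans (inversionHomeo o)) =ᶠ[nhds z] inversion o := by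
      filter_upwards [(e.trans (inversionHomeo o)).open_target.mem_nhds hz1] with w hw using ht w hw
    simp only [jac, Matrix.of_apply]
    rw [pd_congr this]
  rw [gram_change G he he' hz1 hs, hj, ht z hz1]

/-- The chart is an adapted chart followed by the inversion. The metric g_sc becomes a function of y
that is smooth across y_o = 0 and positive definite on the compact image of a neighbourhood of p,
including its points with y_o = 0; compactness then gives every bound. -/
theorem exists_goodChart {x : M → ℝ} {h : TwoTensor n M} [T2Space M]
    (g : Bundle.ContMDiffRiemannianMetric (𝓡 n) ∞ (EuclideanSpace ℝ (Fin n))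
      (fun p : M => TangentSpace (𝓡 n) p))
    (hx : ContMDiff (𝓡 n) 𝓘(ℝ, ℝ) ∞ x) (h_smooth : IsSmoothTwoTensor h)
    (h_symm : ∀ (p : M) (v w : TangentSpace (𝓡 n) p), h p v w = h p w v)
    (h_int : ∀ p : M, 0 < x p → ∀ v : TangentSpace (𝓡 n) p, v ≠ 0 → 0 < scMetric x h p v v)
    (h_bdry : ∀ p : M, x p = 0 → ∀ v : TangentSpace (𝓡 n) p, v ≠ 0 →
      differential (n := n) x p v = 0 → 0 < h p v v)
    {p : M} (hdx : differential (n := n) x p ≠ 0) :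
    ∃ e o, ∃ K ∈ nhds p, GoodChart x h g.inner e o K := by
  obtain ⟨e₀, he₀, hp, o, ho⟩ := exists_adapted_chart hx hdx
  have : LocallyCompactSpace M := ChartedSpace.locallyCompactSpace (EuclideanSpace ℝ (Fin n)) M
  obtain ⟨K, hK, hKs, hKc⟩ := local_compact_nhds (e₀.open_source.mem_nhds hp)
  set e := e₀.trans (inversionHomeo o) with he_def
  have he : e ∈ IsManifold.maximalAtlas (𝓡 n) ∞ M :=
    trans_mem_maximalAtlas he₀ _ (contDiffOn_inversion o) (contDiffOn_inversion o)
  have htar : ∀ z, z ∈ e.target ↔ 0 < z o ∧ inversion o z ∈ e₀.target := by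
    intro z
    have h1 : e.target = {z : V | 0 < z o} ∩ inversion o ⁻¹' e₀.target :=
      OpenPartialHomeomorph.trans_target _ _
    rw [h1]; rfl
  have hsymm : ∀ z, e.symm z = e₀.symm (inversion o z) := fun _ => rfl
  have hxo : ∀ z ∈ e.target, x (e.symm z) = inversion o z o := fun z hz => ho _ ((htar z).1 hz).2
  -- The face x = 0 is included so that C₀ is compact, even though the inverted chart only sees x >
  -- 0.
  set C₀ : Set V := e₀ '' (K ∩ {q | 0 ≤ x q}) with hC₀
  have hC : IsCompact C₀ :=
    (hKc.inter_right (isClosed_le continuous_const hx.continuous)).image_of_continuousOn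
      (e₀.continuousOn.mono fun q hq => hKs hq.1)
  have hCt : C₀ ⊆ e₀.target := by
    rintro _ ⟨q, hq, rfl⟩; exact e₀.map_source (hKs hq.1)
  have hCo : ∀ y ∈ C₀, 0 ≤ y o := by
    rintro _ ⟨q, hq, rfl⟩
    rw [← ho _ (e₀.map_source (hKs hq.1)), e₀.left_inv (hKs hq.1)]
    exact hq.2
  have hdom : dom e (K ∩ interiorX x) = {z | 0 < z o ∧ inversion o z ∈ C₀} := by
    ext z
    constructor
    · rintro ⟨hz, hzK, hzx⟩
      have h1 := (htar z).1 hz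
      refine ⟨h1.1, e.symm z, ⟨hzK, le_of_lt (show 0 < x (e.symm z) from hzx)⟩, ?_⟩
      rw [hsymm, e₀.right_inv h1.2]
    · rintro ⟨hz, q, hq, hqz⟩
      have h1 : inversion o z ∈ e₀.target := hqz ▸ e₀.map_source (hKs hq.1)
      have h2 : e.symm z = q := by rw [hsymm, ← hqz, e₀.left_inv (hKs hq.1)]
      refine ⟨(htar z).2 ⟨hz, h1⟩, ?_⟩
      change e.symm z ∈ K ∩ interiorX x
      refine ⟨h2 ▸ hq.1, ?_⟩
      change 0 < x (e.symm z)
      rw [hxo z ((htar z).2 ⟨hz, h1⟩), inversion_self]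
      exact inv_pos.2 hz
  have hsubset : dom e (K ∩ interiorX x) ⊆ e.target := inter_subset_left
  set A : V → Matrix (Fin n) (Fin n) ℝ := stretchedGram o (gram h e₀) with hA
  have hAs : ∀ i j, ContDiffOn ℝ ∞ (fun y => A y i j) e₀.target :=
    contDiffOn_stretchedGram fun a b => contDiffOn_gram h_smooth he₀ a b
  have hgram : ∀ z ∈ e.target, gram (scMetric x h) e z = A (inversion o z) := by
    intro z hz
    obtain ⟨hzo, hzt⟩ := (htar z).1 hz
    have hyo : 0 < inversion o z o := by rw [inversion_self]; exact inv_pos.2 hzo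
    rw [he_def, gram_trans_inversion he₀ _ hzo hzt]
    set Y := inversion o z with hY
    have hpd : ∀ i, pd i (fun w => x (e₀.symm w)) Y = if o = i then 1 else 0 := by
      intro i
      have : (fun w => x (e₀.symm w)) =ᶠ[nhds Y] fun w : V => w o := by
        filter_upwards [e₀.open_target.mem_nhds hzt] with w hw using ho w hw
      rw [pd_congr this, pd_coord]
    ext i j
    simp only [Matrix.mul_apply, Matrix.transpose_apply, Finset.sum_mul, jac_inversion hzo]
    rw [Finset.sum_comm]
    -- The two factors y_o of the Jacobian cancel x⁻² in front of h; in the dx² term they leave x⁻²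
    -- against the entries N_{oi} = −y_o δ_{io}, which gives exactly dz_o².
    have hterm : ∀ a b, Y o * invJac o Y a i * gram (scMetric x h) e₀ Y a b * (Y o * invJac o Y b j)
        = (Y o ^ 2)⁻¹ * ((if o = a then invJac o Y a i else 0) *
            (if o = b then invJac o Y b j else 0))
          + invJac o Y a i * gram h e₀ Y a b * invJac o Y b j := by
      intro a b
      rw [gram_scMetric hx he₀ hzt, ho Y hzt, hpd, hpd]
      have hy0 := hyo.ne'
      have key : ∀ s t p q r : ℝ, Y o * p * ((Y o ^ 4)⁻¹ * (s * t) + (Y o ^ 2)⁻¹ * q) * (Y o * r)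
          = (Y o ^ 2)⁻¹ * ((s * p) * (t * r)) + p * q * r := by
        intros; field_simp
      rw [key]
      simp only [ite_mul, one_mul, zero_mul]
    rw [Finset.sum_congr rfl fun a _ => Finset.sum_congr rfl fun b _ => hterm a b]
    simp only [Finset.sum_add_distrib, hA, stretchedGram, Matrix.of_apply]
    congr 1
    simp only [← Finset.mul_sum, Finset.sum_ite_eq, Finset.mem_univ, if_true, ← Finset.sum_mul]
    have hNo : ∀ i, invJac o Y o i = if i = o then -Y o else 0 := by
      intro i; rw [invJac]
      by_cases hi : i = o
      · simp [hi]
      · simp [hi, Ne.symm hi]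
    rw [hNo, hNo]
    by_cases hi : i = o <;> by_cases hj : j = o <;> simp [hi, hj]
    field_simp
  have hsc := isMetricOn_scMetric hx h_smooth h_symm h_int
  have hApos : ∀ y ∈ C₀, (A y).PosDef := by
    intro y hy
    rcases (hCo y hy).eq_or_lt with h0 | h0
    · refine posDef_stretchedGram_of_zero h0.symm (fun a b => h_symm _ _ _) fun w hw hwo => ?_
      have hyt := hCt hy
      rw [bil_eq, gram_mulVec]
      have hx0 : x (e₀.symm y) = 0 := by rw [ho y hyt]; exact h0.symm
      refine h_bdry _ hx0 _ (fun h => hw ?_) ?_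
      · exact congrArg (WithLp.ofLp) (injective_sum_coordVec he₀ hyt (h.trans (map_zero _).symm))
      · have h2 := apply_eq_sum_pd (W := ℝ)
          ((differential (n := n) x (e₀.symm y) : V →L[ℝ] ℝ).comp
            (mfderiv 𝓘(ℝ, V) (𝓡 n) e₀.symm y : V →L[ℝ] V)) (WithLp.toLp 2 w)
        refine h2.trans (Finset.sum_eq_zero fun i _ => ?_)
        have h3 := differential_coordVec hx he₀ hyt i
        have h5 : pd i (fun w => x (e₀.symm w)) y = if o = i then 1 else 0 := by
          have : (fun w => x (e₀.symm w)) =ᶠ[nhds y] fun w : V => w o := by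
            filter_upwards [e₀.open_target.mem_nhds hyt] with w hw using ho w hw
          rw [pd_congr this, pd_coord]
        have h4 : ((differential (n := n) x (e₀.symm y) : V →L[ℝ] ℝ).comp
          (mfderiv 𝓘(ℝ, V) (𝓡 n) e₀.symm y : V →L[ℝ] V)) (EuclideanSpace.single i 1)
            = if o = i then 1 else 0 := h3.trans h5
        by_cases hi : o = i
        · subst hi
          exact smul_eq_zero_of_left hwo _
        · rw [if_neg hi] at h4
          exact smul_eq_zero_of_right _ h4
    · have h1 : inversion o (inversion o y) = y := inversion_inversion h0
      have h2 : inversion o y ∈ e.target := by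
        rw [htar, h1]
        refine ⟨?_, hCt hy⟩
        rw [inversion_self]; exact inv_pos.2 h0
      rw [← h1, ← hgram _ h2]
      refine hsc.posDef he ⟨h2, ?_⟩
      change 0 < x (e.symm _)
      rw [hxo _ h2, h1]; exact h0
  -- An open neighbourhood of C₀ on which derivatives can be taken; it may contain points with y_o <
  -- 0. Positivity of the determinant is enough there for the inverse and the square root to be
  -- smooth.
  set W : Set V := e₀.target ∩ (fun y => (A y).det) ⁻¹' Ioi 0 with hW
  have hWo : IsOpen W := (contDiffOn_det hAs).continuousOn.isOpen_inter_preimage e₀.open_target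
    isOpen_Ioi
  have hCW : C₀ ⊆ W := fun y hy => ⟨hCt hy, (hApos y hy).det_pos⟩
  have hAW : ∀ i j, ContDiffOn ℝ ∞ (fun y => A y i j) W := fun i j =>
    (hAs i j).mono inter_subset_left
  have hdetW : ContDiffOn ℝ ∞ (fun y => (A y).det) W := contDiffOn_det hAW
  have hsqrt : ContDiffOn ℝ ∞ (fun y => Real.sqrt (A y).det) W :=
    hdetW.sqrt fun y hy => (ne_of_gt hy.2)
  refine ⟨e, o, K, hK, he, ?_, ?_, ?_, ?_, ?_, ?_, ?_, ?_, ?_⟩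
  · intro q hq
    rw [he_def, OpenPartialHomeomorph.trans_source]
    refine ⟨hKs hq.1, ?_⟩
    change 0 < e₀ q o
    rw [← ho _ (e₀.map_source (hKs hq.1)), e₀.left_inv (hKs hq.1)]
    exact hq.2
  · rw [hdom]; exact isClosed_inversion_preimage hC
  · intro z hz
    rw [hxo z hz.1, inversion_self, inv_inv]
  · intro i j
    refine BddC1.congr (f := fun z => A (inversion o z) i j) ?_ e.open_target hsubset
      fun z hz => by rw [hgram z hz]
    rw [hdom]
    exact bddC1_comp_inversion hC hWo hCW (hAW i j)
  · intro i j
    refine BddC1.congr (f := fun z => (A (inversion o z))⁻¹ i j) ?_ e.open_target hsubset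
      fun z hz => by rw [hgram z hz]
    rw [hdom]
    exact bddC1_comp_inversion hC hWo hCW
      (contDiffOn_inv_entry hAW (fun y hy => (ne_of_gt hy.2)) i j)
  · refine BddC1.congr (f := fun z => Real.sqrt (A (inversion o z)).det) ?_ e.open_target hsubset
      fun z hz => by rw [hgram z hz]
    rw [hdom]
    exact bddC1_comp_inversion hC hWo hCW hsqrt
  · rcases C₀.eq_empty_or_nonempty with hemp | hne
    · refine ⟨1, one_pos, fun z hz => ?_⟩
      rw [hdom, hemp] at hz
      exact hz.2.elim
    · obtain ⟨y₀, hy₀, hmin⟩ := hC.exists_isMinOn hne (hsqrt.continuousOn.mono hCW)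
      refine ⟨_, Real.sqrt_pos.2 (hCW hy₀).2, fun z hz => ?_⟩
      rw [hgram z hz.1]
      rw [hdom] at hz
      exact hmin hz.2
  · obtain ⟨C, hCb⟩ := exists_chr_bound hC e₀.open_target hCt (A := gram g.inner e₀)
      (A' := gram g.inner e)
      (fun i j => contDiffOn_gram (isSmoothTwoTensor_inner g) he₀ i j)
      (fun y hy => (isMetricOn_inner g).posDef he₀ ⟨hy, trivial⟩)
      (fun z hz hz' => gram_trans_inversion he₀ _ hz hz')
    refine ⟨C, fun z hz q k l => ?_⟩
    rw [hdom] at hz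
    exact hCb z hz.1 hz.2 q k l
  · intro χ hχ
    rw [hdom]
    exact bddC1_comp_inversion hC e₀.open_target hCt (contDiffOn_comp_symm hχ he₀)

end GoodChartExists
end ScatteringWitten
end

noncomputable section
namespace ScatteringWitten

/-! ### Comparison of L² on the manifold with L² in coordinates. -/

section LocalBound

set_option linter.unusedSectionVars false

variable {n : ℕ} {M : Type*} [TopologicalSpace M] [ChartedSpace (EuclideanSpace ℝ (Fin n)) M]
  [IsManifold (𝓡 n) ∞ M] [SecondCountableTopology M] [MeasurableSpace M] [BorelSpace M]
  {e : OpenPartialHomeomorph M (EuclideanSpace ℝ (Fin n))} {G : TwoTensor n M} {U : Set M}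

local notation "V" => EuclideanSpace ℝ (Fin n)

/-- Where the volume density is at least c, Lebesgue measure is at most c⁻¹ times the volume. -/
theorem IsMetricOn.map_symm_le (hG : IsMetricOn G U)
    (he : e ∈ IsManifold.maximalAtlas (𝓡 n) ∞ M) {S : Set V} (hS : MeasurableSet S)
    (hSd : S ⊆ dom e U) {c : ℝ} (hc : 0 < c)
    (hcS : ∀ z ∈ S, c ≤ Real.sqrt (gram G e z).det) :
    (volume.restrict S).map e.symm ≤ (ENNReal.ofReal c)⁻¹ • volMeasure G U := by
  have hm : AEMeasurable e.symm (volume.restrict S) :=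
    (hG.aemeasurable_symm e).mono_measure (Measure.restrict_mono hSd le_rfl)
  refine Measure.le_iff.2 fun A hA => ?_
  rw [Measure.map_apply_of_aemeasurable hm hA, Measure.restrict_apply' hS, Measure.smul_apply,
    smul_eq_mul]
  have hc0 : ENNReal.ofReal c ≠ 0 := by simpa using hc
  rw [← ENNReal.mul_le_iff_le_inv hc0 ENNReal.ofReal_ne_top]
  calc ENNReal.ofReal c * volume (e.symm ⁻¹' A ∩ S)
      = ∫⁻ _ in e.symm ⁻¹' A ∩ S, ENNReal.ofReal c := by rw [setLIntegral_const]
    _ ≤ ∫⁻ z in e.symm ⁻¹' A ∩ S, density G e z := by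
        refine lintegral_mono_ae ?_
        have h1 : MeasurableSet (e.symm ⁻¹' A ∩ S) := by
          have h2 : e.symm ⁻¹' A ∩ S = (e.target ∩ e.symm ⁻¹' A) ∩ S := by
            ext z
            exact ⟨fun h => ⟨⟨(hSd h.2).1, h.1⟩, h.2⟩, fun h => ⟨h.1.2, h.2⟩⟩
          rw [h2]
          exact (measurableSet_dom_preimage e hA).inter hS
        exact (ae_restrict_iff' h1).2 (Filter.Eventually.of_forall fun z hz =>
          ENNReal.ofReal_le_ofReal (hcS z hz.2))
    _ ≤ ∫⁻ z in dom e (U ∩ A), density G e z :=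
        lintegral_mono_set fun z hz => ⟨(hSd hz.2).1, (hSd hz.2).2, hz.1⟩
    _ = volChart G U e A := (hG.volChart_apply he hA).symm
    _ ≤ volMeasure G U A := Measure.le_iff'.1 (volChart_le he) A

theorem IsMetricOn.norm_tact_frameMat_le (hG : IsMetricOn G U)
    (he : e ∈ IsManifold.maximalAtlas (𝓡 n) ∞ M) {z : V} (hz : z ∈ dom e U) {B : ℝ} (hB : 0 ≤ B)
    (hBz : ∀ i, gram G e z i i ≤ B ^ 2) {k : ℕ} (t : Fibre n k) (J : Fin k → Fin n) :
    ‖tact (frameMat G U e z) t J‖ ≤ (n : ℝ) ^ k * B ^ k * ‖t‖ := by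
  have h1 : ∀ K i, |frameMat G U e z K i| ≤ B := fun K i =>
    abs_le_of_sq_le_sq ((hG.sq_frameMat_le he hz K i).trans (hBz i)) hB
  refine (norm_tact_le _ _ h1 (fun K => PiLp.norm_apply_le t K) J).trans (le_of_eq ?_)
  ring

theorem IsMetricOn.exists_eLpNorm_tact_le (hG : IsMetricOn G U)
    (he : e ∈ IsManifold.maximalAtlas (𝓡 n) ∞ M) {S : Set V} (hS : MeasurableSet S)
    (hSd : S ⊆ dom e U) {c B : ℝ} (hc : 0 < c) (hB : 0 ≤ B)
    (hcS : ∀ z ∈ S, c ≤ Real.sqrt (gram G e z).det) (hBS : ∀ z ∈ S, ∀ i, gram G e z i i ≤ B ^ 2)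
    (k : ℕ) : ∃ C : NNReal, ∀ f : M → Fibre n k, AEStronglyMeasurable f (volMeasure G U) →
      ∀ J, eLpNorm (fun z => tact (frameMat G U e z) (f (e.symm z)) J) 2 (volume.restrict S)
        ≤ C * eLpNorm f 2 (volMeasure G U) := by
  let D : NNReal := ⟨(n : ℝ) ^ k * B ^ k, by positivity⟩
  have hc0 : ENNReal.ofReal c ≠ 0 := by simpa using hc
  let D' : ENNReal := (ENNReal.ofReal c)⁻¹ ^ (1 / (2 : ENNReal)).toReal
  have hD' : D' ≠ ⊤ := ENNReal.rpow_ne_top_of_nonneg (by positivity) (ENNReal.inv_ne_top.2 hc0)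
  refine ⟨D * D'.toNNReal, fun f hf J => ?_⟩
  have hle := hG.map_symm_le he hS hSd hc hcS
  have hm : AEMeasurable e.symm (volume.restrict S) :=
    (hG.aemeasurable_symm e).mono_measure (Measure.restrict_mono hSd le_rfl)
  have hf' : AEStronglyMeasurable f ((volume.restrict S).map e.symm) :=
    (hf.smul_measure _).mono_measure hle
  calc eLpNorm (fun z => tact (frameMat G U e z) (f (e.symm z)) J) 2 (volume.restrict S)
      ≤ D • eLpNorm (f ∘ e.symm) 2 (volume.restrict S) := by
        refine eLpNorm_le_nnreal_smul_eLpNorm_of_ae_le_mul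
          ((ae_restrict_iff' hS).2 (Filter.Eventually.of_forall fun z hz => ?_)) 2
        exact hG.norm_tact_frameMat_le he (hSd hz) hB (hBS z hz) _ J
    _ = D • eLpNorm f 2 ((volume.restrict S).map e.symm) := by
        rw [eLpNorm_map_measure hf' hm]
    _ ≤ D • eLpNorm f 2 ((ENNReal.ofReal c)⁻¹ • volMeasure G U) := by
        gcongr
    _ = D • (D' * eLpNorm f 2 (volMeasure G U)) := by
        rw [eLpNorm_smul_measure_of_ne_top (by simp)]; rfl
    _ = _ := by
        rw [ENNReal.smul_def, smul_eq_mul, ENNReal.coe_mul, ENNReal.coe_toNNReal hD', mul_assoc]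

theorem IsMetricOn.exists_compact_bounds (hG : IsMetricOn G U)
    (he : e ∈ IsManifold.maximalAtlas (𝓡 n) ∞ M) {S : Set V} (hS : IsCompact S)
    (hSd : S ⊆ dom e U) : ∃ c B : ℝ, 0 < c ∧ 0 ≤ B ∧
      (∀ z ∈ S, c ≤ Real.sqrt (gram G e z).det) ∧ ∀ z ∈ S, ∀ i, gram G e z i i ≤ B ^ 2 := by
  obtain ⟨B, hB0, hB⟩ := exists_bound_on_compact hS hSd
    (f := fun i z => gram G e z i i) fun i => (hG.smooth e he i i).continuousOn
  have hB' : ∀ z ∈ S, ∀ i, gram G e z i i ≤ (B + 1) ^ 2 := fun z hz i => by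
    have := (le_abs_self _).trans (hB i z hz)
    nlinarith
  rcases S.eq_empty_or_nonempty with hemp | hne
  · exact ⟨1, B + 1, one_pos, by linarith, by simp [hemp], hB'⟩
  · have hcont : ContinuousOn (fun z => Real.sqrt (gram G e z).det) S :=
      Real.continuous_sqrt.comp_continuousOn ((hG.contDiffOn_det he).continuousOn.mono hSd)
    obtain ⟨y, hy, hmin⟩ := hS.exists_isMinOn hne hcont
    exact ⟨_, B + 1, Real.sqrt_pos.2 (hG.posDef he (hSd hy)).det_pos, by linarith,
      fun z hz => hmin hz, hB'⟩

theorem IsMetricOn.exists_eLpNorm_tact_le_compact (hG : IsMetricOn G U)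
    (he : e ∈ IsManifold.maximalAtlas (𝓡 n) ∞ M) {S : Set V} (hS : IsCompact S)
    (hSd : S ⊆ dom e U) (k : ℕ) :
    ∃ C : NNReal, ∀ f : M → Fibre n k, AEStronglyMeasurable f (volMeasure G U) →
      ∀ J, eLpNorm (fun z => tact (frameMat G U e z) (f (e.symm z)) J) 1 (volume.restrict S)
        ≤ C * eLpNorm f 2 (volMeasure G U) := by
  obtain ⟨c, B, hc, hB, h1, h2⟩ := hG.exists_compact_bounds he hS hSd
  obtain ⟨C, hC⟩ := hG.exists_eLpNorm_tact_le he hS.measurableSet hSd hc hB h1 h2 k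
  let D : ENNReal := (volume.restrict S) univ ^ (1 / (1 : ENNReal).toReal - 1 / (2 : ENNReal).toReal)
  have hD : D ≠ ⊤ := by
    refine ENNReal.rpow_ne_top_of_nonneg (by norm_num) ?_
    rw [Measure.restrict_apply_univ]
    exact hS.measure_lt_top.ne
  refine ⟨C * D.toNNReal, fun f hf J => ?_⟩
  have hm : AEStronglyMeasurable (fun z => tact (frameMat G U e z) (f (e.symm z)) J)
      (volume.restrict S) :=
    (hG.aestronglyMeasurable_tact he hf J).mono_measure (Measure.restrict_mono hSd le_rfl)
  refine (eLpNorm_le_eLpNorm_mul_rpow_measure_univ (p := 1) (q := 2) (by norm_num) hm).trans ?_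
  change _ * D ≤ _
  rw [ENNReal.coe_mul, ENNReal.coe_toNNReal hD]
  calc _ ≤ (C * eLpNorm f 2 (volMeasure G U)) * D := by gcongr; exact hC f hf J
    _ = _ := by ring

theorem IsMetricOn.integrableOn_tact (hG : IsMetricOn G U)
    (he : e ∈ IsManifold.maximalAtlas (𝓡 n) ∞ M) {S : Set V} (hS : IsCompact S)
    (hSd : S ⊆ dom e U) {k : ℕ} {f : M → Fibre n k} (hf : MemLp f 2 (volMeasure G U))
    (J : Fin k → Fin n) :
    IntegrableOn (fun z => tact (frameMat G U e z) (f (e.symm z)) J) S := by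
  obtain ⟨C, hC⟩ := hG.exists_eLpNorm_tact_le_compact he hS hSd k
  rw [IntegrableOn, ← memLp_one_iff_integrable]
  refine ⟨(hG.aestronglyMeasurable_tact he hf.1 J).mono_measure (Measure.restrict_mono hSd le_rfl),
    (hC f hf.1 J).trans_lt ?_⟩
  exact ENNReal.mul_lt_top (by simp) hf.2

theorem IsMetricOn.locallyIntegrableOn_tact (hG : IsMetricOn G U)
    (he : e ∈ IsManifold.maximalAtlas (𝓡 n) ∞ M) {k : ℕ} {f : M → Fibre n k}
    (hf : MemLp f 2 (volMeasure G U)) (J : Fin k → Fin n) :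
    LocallyIntegrableOn (fun z => tact (frameMat G U e z) (f (e.symm z)) J) (dom e U) :=
  (locallyIntegrableOn_iff (hG.isOpen_dom e).isLocallyClosed).2 fun _ hk hkc =>
    hG.integrableOn_tact he hkc hk hf J

/-- Integration of a component against a test function is continuous on `L²`. -/
theorem IsMetricOn.exists_clm_integral (hG : IsMetricOn G U)
    (he : e ∈ IsManifold.maximalAtlas (𝓡 n) ∞ M) {S : Set V} (hS : IsCompact S)
    (hSd : S ⊆ dom e U) {a : V → ℝ} (ha : ContinuousOn a (dom e U)) (ha0 : ∀ z ∉ S, a z = 0)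
    {k : ℕ} (J : Fin k → Fin n) :
    ∃ T : Lp (Fibre n k) 2 (volMeasure G U) →L[ℂ] ℂ, ∀ f,
      Integrable (fun z => a z • tact (frameMat G U e z) (f (e.symm z)) J) ∧
      T f = ∫ z, a z • tact (frameMat G U e z) (f (e.symm z)) J := by
  obtain ⟨C, hC⟩ := hG.exists_eLpNorm_tact_le_compact he hS hSd k
  obtain ⟨D, hD⟩ := hS.exists_bound_of_continuousOn (ha.mono hSd)
  have hint : ∀ f : Lp (Fibre n k) 2 (volMeasure G U),
      Integrable fun z => a z • tact (frameMat G U e z) (f (e.symm z)) J := fun f => by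
    have h1 : IntegrableOn (fun z => a z • tact (frameMat G U e z) (f (e.symm z)) J) S :=
      (hG.integrableOn_tact he hS hSd (Lp.memLp f) J).continuousOn_smul (ha.mono hSd) hS
    refine (integrableOn_iff_integrable_of_support_subset ?_).1 h1
    intro z hz
    by_contra hzS
    exact hz (by simp [ha0 z hzS])
  have hae : ∀ (f : Lp (Fibre n k) 2 (volMeasure G U)) (f' : M → Fibre n k),
      f =ᵐ[volMeasure G U] f' → ∫ z, a z • tact (frameMat G U e z) (f (e.symm z)) J
        = ∫ z, a z • tact (frameMat G U e z) (f' (e.symm z)) J := by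
    intro f f' hff
    refine integral_congr_ae ?_
    have h1 := (ae_restrict_iff' (hG.isOpen_dom e).measurableSet).1 (hG.ae_chart he hff)
    filter_upwards [h1] with z hz
    by_cases hzS : z ∈ S
    · rw [hz (hSd hzS)]
    · simp [ha0 z hzS]
  let T₀ : Lp (Fibre n k) 2 (volMeasure G U) →ₗ[ℂ] ℂ :=
    { toFun := fun f => ∫ z, a z • tact (frameMat G U e z) (f (e.symm z)) J
      map_add' := fun f f' => by
        rw [hae _ _ (Lp.coeFn_add f f'), ← integral_add (hint f) (hint f')]
        refine integral_congr_ae (Filter.Eventually.of_forall fun z => ?_)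
        have := congrFun (tact_add (frameMat G U e z) (f (e.symm z)) (f' (e.symm z))) J
        simp only [← smul_add, ← this]
        rfl
      map_smul' := fun c f => by
        rw [hae _ _ (Lp.coeFn_smul c f), RingHom.id_apply, smul_eq_mul, ← integral_const_mul]
        refine integral_congr_ae (Filter.Eventually.of_forall fun z => ?_)
        have := congrFun (tact_const_mul (frameMat G U e z) c (f (e.symm z))) J
        simp only [mul_smul_comm, ← this]
        rfl }
  refine ⟨T₀.mkContinuous (|D| * C) fun f => ?_, fun f => ⟨hint f, rfl⟩⟩
  have h1 : ‖T₀ f‖ ≤ ∫ z in S, |D| * ‖tact (frameMat G U e z) (f (e.symm z)) J‖ := by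
    have h2 : T₀ f = ∫ z in S, a z • tact (frameMat G U e z) (f (e.symm z)) J := by
      refine (setIntegral_eq_integral_of_forall_compl_eq_zero fun z hz => ?_).symm
      simp [ha0 z hz]
    rw [h2]
    refine norm_integral_le_of_norm_le
      ((hG.integrableOn_tact he hS hSd (Lp.memLp f) J).norm.const_mul _) ?_
    refine (ae_restrict_iff' hS.measurableSet).2 (Filter.Eventually.of_forall fun z hz => ?_)
    rw [norm_smul]
    exact mul_le_mul_of_nonneg_right ((hD z hz).trans (le_abs_self _)) (norm_nonneg _)
  refine h1.trans ?_
  rw [integral_const_mul, mul_assoc]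
  refine mul_le_mul_of_nonneg_left ?_ (abs_nonneg _)
  rw [integral_norm_eq_lintegral_enorm
    (hG.integrableOn_tact he hS hSd (Lp.memLp f) J).aestronglyMeasurable]
  have h3 := hC f (Lp.aestronglyMeasurable f) J
  rw [eLpNorm_one_eq_lintegral_enorm] at h3
  refine (ENNReal.toReal_mono (ENNReal.mul_ne_top (by simp) (Lp.memLp f).2.ne) h3).trans
    (le_of_eq ?_)
  rw [ENNReal.toReal_mul, Lp.norm_def]; rfl

end LocalBound

/-- A convergent sequence in L² has a subsequence converging almost everywhere. -/
theorem isClosed_ae_mem {α E : Type*} [MeasurableSpace α] [NormedAddCommGroup E]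
    {μ : Measure α} {C : α → Set E} (hC : ∀ p, IsClosed (C p)) :
    IsClosed {f : Lp E 2 μ | ∀ᵐ p ∂μ, f p ∈ C p} := by
  refine IsSeqClosed.isClosed fun u f hu hf => ?_
  obtain ⟨ns, -, hns⟩ := (tendstoInMeasure_of_tendsto_Lp hf).exists_seq_tendsto_ae
  filter_upwards [hns, ae_all_iff.2 fun i => hu (ns i)] with p h1 h2
  exact (hC p).mem_of_tendsto h1 (Filter.Eventually.of_forall h2)

end ScatteringWitten
end

noncomputable section
namespace ScatteringWitten

section ChrSmooth

variable {n : ℕ}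

local notation "V" => EuclideanSpace ℝ (Fin n)

theorem contDiffOn_pd {f : V → ℝ} {W : Set V} (hf : ContDiffOn ℝ ∞ f W) (hW : IsOpen W)
    (l : Fin n) : ContDiffOn ℝ ∞ (pd l f) W :=
  (hf.fderiv_of_isOpen hW (by simp)).clm_apply contDiffOn_const

theorem contDiffOn_chr {A : V → Matrix (Fin n) (Fin n) ℝ} {W : Set V} (hW : IsOpen W)
    (hA : ∀ i j, ContDiffOn ℝ ∞ (fun y => A y i j) W) (hdet : ∀ y ∈ W, (A y).det ≠ 0)
    (q k l : Fin n) : ContDiffOn ℝ ∞ (fun y => chr A y q k l) W := by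
  simp only [chr]
  exact contDiffOn_const.mul (ContDiffOn.sum fun r _ => (contDiffOn_inv_entry hA hdet q r).mul
    (((contDiffOn_pd (hA _ _) hW _).add (contDiffOn_pd (hA _ _) hW _)).sub
      (contDiffOn_pd (hA _ _) hW _)))

end ChrSmooth

/-! ### Completeness of the Sobolev space. -/

section DotH1

set_option linter.unusedSectionVars false

variable {n : ℕ} {M : Type*} [TopologicalSpace M] [ChartedSpace (EuclideanSpace ℝ (Fin n)) M]
  [IsManifold (𝓡 n) ∞ M] [SecondCountableTopology M] [MeasurableSpace M] [BorelSpace M]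
  {e : OpenPartialHomeomorph M (EuclideanSpace ℝ (Fin n))} {G : TwoTensor n M} {U : Set M}
  {x : M → ℝ} {h : TwoTensor n M}

local notation "V" => EuclideanSpace ℝ (Fin n)

theorem locallyIntegrableOn_finsetSum {ι : Type*} (s : Finset ι) {f : ι → V → ℂ} {S : Set V}
    (hf : ∀ i ∈ s, LocallyIntegrableOn (f i) S) :
    LocallyIntegrableOn (fun z => ∑ i ∈ s, f i z) S := by
  classical
  induction s using Finset.induction_on with
  | empty => simpa using locallyIntegrableOn_zero
  | insert a s ha ih =>
    simp only [Finset.sum_insert ha]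
    exact (hf a (Finset.mem_insert_self a s)).add
      (ih fun i hi => hf i (Finset.mem_insert_of_mem hi))

theorem IsMetricOn.contDiffOn_christoffel (hG : IsMetricOn G U)
    (he : e ∈ IsManifold.maximalAtlas (𝓡 n) ∞ M) (q k l : Fin n) :
    ContDiffOn ℝ ∞ (fun z => christoffel G e z q k l) (dom e U) :=
  contDiffOn_chr (hG.isOpen_dom e) (hG.smooth e he) (fun _ hz => (hG.posDef he hz).det_pos.ne') q k l

theorem IsMetricOn.chartComp_congr_ae (hsc : IsMetricOn (scMetric x h) (interiorX x))
    (he : e ∈ IsManifold.maximalAtlas (𝓡 n) ∞ M) {k : ℕ} {u u' : M → Fibre n k}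
    (hu : u =ᵐ[volMeasure (scMetric x h) (interiorX x)] u') (J : Fin k → Fin n) :
    chartComp x h e u J =ᵐ[volume.restrict (dom e (interiorX x))] chartComp x h e u' J := by
  filter_upwards [hsc.ae_chart he hu] with z hz
  rw [chartComp_eq_tact, chartComp_eq_tact, hz]

theorem IsWeakCovDeriv.congr_ae (hsc : IsMetricOn (scMetric x h) (interiorX x)) {k : ℕ}
    {u u' : M → Fibre n k} {w w' : M → Fibre n (k + 1)} (H : IsWeakCovDeriv x h G u w)
    (hu : u =ᵐ[volMeasure (scMetric x h) (interiorX x)] u')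
    (hw : w =ᵐ[volMeasure (scMetric x h) (interiorX x)] w') : IsWeakCovDeriv x h G u' w' := by
  intro e he J l
  refine (H e he J l).congr_ae (hsc.isOpen_dom e).measurableSet (hsc.chartComp_congr_ae he hu J) ?_
  filter_upwards [hsc.chartComp_congr_ae he hw (Fin.snoc J l),
    ae_all_iff.2 fun J => hsc.chartComp_congr_ae he hu J] with z h1 h2
  rw [h1]
  simp only [h2]

/-- Pointwise conditions on some representative are replaced by almost everywhere conditions on the
L² classes, a form in which limits can be taken. Conversely, setting the field to zero where the
conditions fail repairs a representative. -/
theorem mem_dotH1_iff (hsc : IsMetricOn (scMetric x h) (interiorX x)) {Ω : Set M}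
    (W : WithLp 2 (L2sc x h 3 × L2sc x h 4)) : W ∈ dotH1 x h Ω ↔
      IsWeakCovDeriv x h (scMetric x h) W.fst W.snd ∧
      ∀ᵐ p ∂(volMeasure (scMetric x h) (interiorX x)), W.fst p ∈
        {t : Fibre n 3 | IsSymmetricTensor t ∧ (p ∈ interiorX x \ closure Ω → t = 0)} := by
  classical
  constructor
  · rintro ⟨u, w, hu, hw, H, hs, h0⟩
    refine ⟨H.congr_ae hsc hu.symm hw.symm, ?_⟩
    filter_upwards [hu] with p hp
    rw [hp]
    exact ⟨hs p, h0 p⟩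
  · rintro ⟨H, hae⟩
    let u : M → Fibre n 3 := fun p => if W.fst p ∈
      {t : Fibre n 3 | IsSymmetricTensor t ∧ (p ∈ interiorX x \ closure Ω → t = 0)} then W.fst p else 0
    have hu : W.fst =ᵐ[volMeasure (scMetric x h) (interiorX x)] u := by
      filter_upwards [hae] with p hp
      exact (if_pos hp).symm
    refine ⟨u, W.snd, hu, Filter.EventuallyEq.rfl, H.congr_ae hsc hu Filter.EventuallyEq.rfl, ?_, ?_⟩
    · intro p
      by_cases hp : W.fst p ∈
        {t : Fibre n 3 | IsSymmetricTensor t ∧ (p ∈ interiorX x \ closure Ω → t = 0)}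
      · simp only [u, if_pos hp]; exact hp.1
      · simp only [u, if_neg hp]; intro σ J; rfl
    · intro p hpΩ
      by_cases hp : W.fst p ∈
        {t : Fibre n 3 | IsSymmetricTensor t ∧ (p ∈ interiorX x \ closure Ω → t = 0)}
      · simp only [u, if_pos hp]; exact hp.2 hpΩ
      · simp only [u, if_neg hp]

theorem isClosed_isSymmetricTensor (n k : ℕ) : IsClosed {t : Fibre n k | IsSymmetricTensor t} := by
  have h1 : {t : Fibre n k | IsSymmetricTensor t}
      = ⋂ (σ : Equiv.Perm (Fin k)) (J : Fin k → Fin n), {t | t (J ∘ σ) = t J} := by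
    ext t; simp [IsSymmetricTensor]
  rw [h1]
  exact isClosed_iInter fun σ => isClosed_iInter fun J =>
    isClosed_eq (EuclideanSpace.proj (𝕜 := ℂ) (J ∘ σ)).continuous
      (EuclideanSpace.proj (𝕜 := ℂ) J).continuous

/-- For each fixed chart, component and test function the weak identity is an equality of continuous
functionals of (u, ∇u) in L². Local integrability holds automatically for L² fields. -/
theorem isClosed_isWeakCovDeriv (hsc : IsMetricOn (scMetric x h) (interiorX x)) :
    IsClosed {W : WithLp 2 (L2sc x h 3 × L2sc x h 4) |
      IsWeakCovDeriv x h (scMetric x h) W.fst W.snd} := by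
  refine IsSeqClosed.isClosed fun W W₀ hW hlim e he J l => ?_
  have hcont : ∀ q a, ContinuousOn (fun z => christoffel (scMetric x h) e z q l (J a))
      (dom e (interiorX x)) := fun q a => (hsc.contDiffOn_christoffel he q l (J a)).continuousOn
  have hloc : ∀ W : WithLp 2 (L2sc x h 3 × L2sc x h 4),
      LocallyIntegrableOn (fun z => chartComp x h e W.snd (Fin.snoc J l) z
        + ∑ a : Fin 3, ∑ q : Fin n, (christoffel (scMetric x h) e z q l (J a) : ℂ) *
          chartComp x h e W.fst (Function.update J a q) z) (dom e (interiorX x)) := by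
    intro W
    refine (hsc.locallyIntegrableOn_tact he (Lp.memLp W.snd) _).add
      (locallyIntegrableOn_finsetSum _ fun a _ => locallyIntegrableOn_finsetSum _ fun q _ => ?_)
    have h1 := (hsc.locallyIntegrableOn_tact he (Lp.memLp W.fst) (Function.update J a q))
    have h2 : LocallyIntegrableOn (fun z => (christoffel (scMetric x h) e z q l (J a)) •
        chartComp x h e W.fst (Function.update J a q) z) (dom e (interiorX x)) :=
      h1.continuousOn_smul (hsc.isOpen_dom e).isLocallyClosed (hcont q a)
    simpa only [Complex.real_smul] using h2
  refine ⟨hsc.locallyIntegrableOn_tact he (Lp.memLp W₀.fst) J, hloc W₀, fun φ hφ hc hs => ?_⟩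
  obtain ⟨T₁, hT₁⟩ := hsc.exists_clm_integral he hc hs (continuous_pd l hφ).continuousOn
    (pd_eq_zero l φ) J
  obtain ⟨T₂, hT₂⟩ := hsc.exists_clm_integral he hc hs hφ.continuous.continuousOn
    (fun z hz => image_eq_zero_of_notMem_tsupport hz) (Fin.snoc J l : Fin 4 → Fin n)
  -- The Christoffel symbol is absorbed into the weight, a continuous function with compact support.
  have hT₃ := fun a q => hsc.exists_clm_integral he hc hs
    (a := fun z => φ z * christoffel (scMetric x h) e z q l (J a))
    (hφ.continuous.continuousOn.mul (hcont q a))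
    (fun z hz => by
      simp only [image_eq_zero_of_notMem_tsupport hz, zero_mul]) (Function.update J a q)
  choose T₃ hT₃ using hT₃
  have key : ∀ W : WithLp 2 (L2sc x h 3 × L2sc x h 4),
      (∫ z, pd l φ z • chartComp x h e W.fst J z
        = - ∫ z, φ z • (chartComp x h e W.snd (Fin.snoc J l) z
          + ∑ a : Fin 3, ∑ q : Fin n, (christoffel (scMetric x h) e z q l (J a) : ℂ) *
            chartComp x h e W.fst (Function.update J a q) z))
      ↔ T₁ W.fst = -(T₂ W.snd + ∑ a, ∑ q, T₃ a q W.fst) := by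
    intro W
    have h1 : ∫ z, φ z • (chartComp x h e W.snd (Fin.snoc J l) z
          + ∑ a : Fin 3, ∑ q : Fin n, (christoffel (scMetric x h) e z q l (J a) : ℂ) *
            chartComp x h e W.fst (Function.update J a q) z)
        = T₂ W.snd + ∑ a, ∑ q, T₃ a q W.fst := by
      rw [(hT₂ W.snd).2]
      simp only [fun a q => (hT₃ a q W.fst).2]
      have h2 : ∑ a, ∑ q, ∫ z, (φ z * christoffel (scMetric x h) e z q l (J a)) •
          tact (frameMat (scMetric x h) (interiorX x) e z) (W.fst (e.symm z)) (Function.update J a q)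
          = ∫ z, ∑ a, ∑ q, (φ z * christoffel (scMetric x h) e z q l (J a)) •
          tact (frameMat (scMetric x h) (interiorX x) e z) (W.fst (e.symm z))
            (Function.update J a q) := by
        rw [integral_finsetSum _ fun a _ => integrable_finsetSum _ fun q _ => (hT₃ a q W.fst).1]
        refine Finset.sum_congr rfl fun a _ => ?_
        rw [integral_finsetSum _ fun q _ => (hT₃ a q W.fst).1]
      rw [h2, ← integral_add (hT₂ W.snd).1 (integrable_finsetSum _ fun a _ =>
        integrable_finsetSum _ fun q _ => (hT₃ a q W.fst).1)]
      refine integral_congr_ae (Filter.Eventually.of_forall fun z => ?_)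
      simp only [smul_add, Finset.smul_sum, chartComp_eq_tact, Complex.real_smul]
      push_cast
      simp only [mul_assoc]
    rw [h1, (hT₁ W.fst).2]
    rfl
  rw [key]
  have hf : Continuous fun W : WithLp 2 (L2sc x h 3 × L2sc x h 4) => W.fst := by fun_prop
  have hg : Continuous fun W : WithLp 2 (L2sc x h 3 × L2sc x h 4) => W.snd := by fun_prop
  have hcl : IsClosed {W : WithLp 2 (L2sc x h 3 × L2sc x h 4) |
      T₁ W.fst = -(T₂ W.snd + ∑ a, ∑ q, T₃ a q W.fst)} := by
    refine isClosed_eq (T₁.continuous.comp hf) (((T₂.continuous.comp hg).add ?_).neg)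
    exact continuous_finsetSum _ fun a _ => continuous_finsetSum _ fun q _ =>
      (T₃ a q).continuous.comp hf
  exact hcl.mem_of_tendsto hlim (Filter.Eventually.of_forall fun i =>
    (key (W i)).1 ((hW i e he J l).2.2 φ hφ hc hs))

theorem isClosed_dotH1 (hsc : IsMetricOn (scMetric x h) (interiorX x)) (Ω : Set M) :
    IsClosed (dotH1 x h Ω : Set (WithLp 2 (L2sc x h 3 × L2sc x h 4))) := by
  have h1 : (dotH1 x h Ω : Set (WithLp 2 (L2sc x h 3 × L2sc x h 4)))
      = {W | IsWeakCovDeriv x h (scMetric x h) W.fst W.snd} ∩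
        (fun W : WithLp 2 (L2sc x h 3 × L2sc x h 4) => W.fst) ⁻¹'
          {f | ∀ᵐ p ∂(volMeasure (scMetric x h) (interiorX x)), f p ∈
            {t : Fibre n 3 | IsSymmetricTensor t ∧ (p ∈ interiorX x \ closure Ω → t = 0)}} := by
    ext W
    exact mem_dotH1_iff hsc W
  rw [h1]
  refine (isClosed_isWeakCovDeriv hsc).inter (IsClosed.preimage (by fun_prop)
    (isClosed_ae_mem fun p => ?_))
  by_cases hp : p ∈ interiorX x \ closure Ω
  · simp only [hp, true_imp_iff]
    exact (isClosed_isSymmetricTensor n 3).inter isClosed_singleton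
  · simp only [hp, false_imp_iff, and_true]
    exact isClosed_isSymmetricTensor n 3

theorem completeSpace_dotH1 (hsc : IsMetricOn (scMetric x h) (interiorX x)) (Ω : Set M) :
    CompleteSpace (dotH1 x h Ω) :=
  (isClosed_dotH1 hsc Ω).completeSpace_coe

end DotH1
end ScatteringWitten
end

noncomputable section
namespace ScatteringWitten

/-! ### The difference of the two connections as a tensor field. -/

section ConjugatedTerm

set_option linter.unusedSectionVars false

variable {n : ℕ} {M : Type*} [TopologicalSpace M] [ChartedSpace (EuclideanSpace ℝ (Fin n)) M]
  [IsManifold (𝓡 n) ∞ M]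
  {e e' : OpenPartialHomeomorph M (EuclideanSpace ℝ (Fin n))} {G g : TwoTensor n M} {U : Set M}
  {x : M → ℝ} {h : TwoTensor n M}

local notation "V" => EuclideanSpace ℝ (Fin n)

theorem IsMetricOn.christoffel_change (hG : IsMetricOn G U)
    (he : e ∈ IsManifold.maximalAtlas (𝓡 n) ∞ M) (he' : e' ∈ IsManifold.maximalAtlas (𝓡 n) ∞ M)
    {z : V} (hz : z ∈ dom e' U) (hz' : e'.symm z ∈ e.source) (p k l : Fin n) :
    ∑ q, jac (transition e e') z p q * christoffel G e' z q k l
      = (∑ a, ∑ b, christoffel G e (transition e e' z) p a b *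
          (jac (transition e e') z a k * jac (transition e e') z b l))
        + hess (transition e e') z p k l := by
  have hmem : transition e e' z ∈ dom e U := ⟨e.map_source hz', by
    change e.symm (transition e e' z) ∈ U
    rw [symm_transition hz']; exact hz.2⟩
  have hpd := hG.posDef he hmem
  refine chr_change ((contDiffOn_transition he he').contDiffAt
    ((isOpen_target_inter e' e.open_source).mem_nhds ⟨hz.1, hz'⟩)) (fun i j => ?_) ?_
    hpd.det_pos.ne'.isUnit (isUnit_det_jac_transition he he' hz.1 hz') ?_ p k l
  · exact ((hG.smooth e he i j).contDiffAt ((hG.isOpen_dom e).mem_nhds hmem)).differentiableAt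
      (by simp)
  · exact hpd.isHermitian
  · filter_upwards [(isOpen_target_inter e' e.open_source).mem_nhds ⟨hz.1, hz'⟩] with w hw
    exact gram_change G he he' hw.1 hw.2

/-- The difference, in the chart `e`, between the conjugated covariant derivative for `g` and the
covariant derivative for `g_sc`. -/
def lotChart (x : M → ℝ) (h g : TwoTensor n M) (F : ℝ)
    (e : OpenPartialHomeomorph M (EuclideanSpace ℝ (Fin n))) (z : EuclideanSpace ℝ (Fin n)) {k : ℕ}
    (t : (Fin k → Fin n) → ℂ) : (Fin (k + 1) → Fin n) → ℂ :=
  lot (fun l => F * pd l (fun w => (x (e.symm w))⁻¹) z)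
    (fun q k l => christoffel (scMetric x h) e z q k l - christoffel g e z q k l) t

theorem contDiffOn_inv_comp_symm (hx : ContMDiff (𝓡 n) 𝓘(ℝ, ℝ) ∞ x)
    (he : e ∈ IsManifold.maximalAtlas (𝓡 n) ∞ M) :
    ContDiffOn ℝ ∞ (fun w => (x (e.symm w))⁻¹) (dom e (interiorX x)) :=
  ((contDiffOn_comp_symm hx he).mono inter_subset_left).inv fun _ hz => ne_of_gt hz.2

/-- The differential of F/x is a covector. The inhomogeneous second derivative terms in the laws for
the Christoffel symbols of g_sc and g are equal and cancel in the difference. -/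
theorem lotChart_change (hx : ContMDiff (𝓡 n) 𝓘(ℝ, ℝ) ∞ x)
    (hsc : IsMetricOn (scMetric x h) (interiorX x)) (hg : IsMetricOn g univ) (F : ℝ)
    (he : e ∈ IsManifold.maximalAtlas (𝓡 n) ∞ M) (he' : e' ∈ IsManifold.maximalAtlas (𝓡 n) ∞ M)
    {z : V} (hz : z ∈ dom e' (interiorX x)) (hz' : e'.symm z ∈ e.source) {k : ℕ}
    (t : (Fin k → Fin n) → ℂ) :
    lotChart x h g F e' z (tact (jac (transition e e') z) t)
      = tact (jac (transition e e') z) (lotChart x h g F e (transition e e' z) t) := by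
  have hmem : transition e e' z ∈ dom e (interiorX x) := ⟨e.map_source hz', by
    change e.symm (transition e e' z) ∈ interiorX x
    rw [symm_transition hz']; exact hz.2⟩
  have hnhds := (isOpen_target_inter e' e.open_source).mem_nhds ⟨hz.1, hz'⟩
  refine lot_tact (fun l => ?_) (fun p k l => ?_) t
  · have h1 : (fun w => (x (e'.symm w))⁻¹)
        =ᶠ[nhds z] fun w => (fun y => (x (e.symm y))⁻¹) (transition e e' w) := by
      filter_upwards [hnhds] with w hw
      simp only [symm_transition hw.2]
    rw [pd_congr h1, pd_comp (((contDiffOn_inv_comp_symm hx he).contDiffAt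
      ((hsc.isOpen_dom e).mem_nhds hmem)).differentiableAt (by simp))
      (((contDiffOn_transition he he').contDiffAt hnhds).differentiableAt (by simp)),
      Finset.mul_sum]
    refine Finset.sum_congr rfl fun a _ => ?_
    ring
  · have h1 := hsc.christoffel_change he he' hz hz' p k l
    have h2 := hg.christoffel_change he he' (z := z) ⟨hz.1, mem_univ _⟩ hz' p k l
    simp only [mul_sub, sub_mul, Finset.sum_sub_distrib]
    rw [h1, h2]; ring

/-- The term of order zero `∇^g_F - ∇^{g_sc}`, with `∇^g_F = e^{-F/x} ∇^g e^{F/x}`. -/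
def lotField (x : M → ℝ) (h g : TwoTensor n M) (F : ℝ) (p : M) {k : ℕ} (t : Fibre n k) :
    Fibre n (k + 1) :=
  WithLp.toLp 2 (tact (frameComp (scMetric x h) (interiorX x)
      (chartAt (EuclideanSpace ℝ (Fin n)) p) (chartAt (EuclideanSpace ℝ (Fin n)) p p))
    (lotChart x h g F (chartAt (EuclideanSpace ℝ (Fin n)) p) (chartAt (EuclideanSpace ℝ (Fin n)) p p)
      (tact (frameMat (scMetric x h) (interiorX x)
        (chartAt (EuclideanSpace ℝ (Fin n)) p) (chartAt (EuclideanSpace ℝ (Fin n)) p p)) t)))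

variable [SecondCountableTopology M]

theorem IsMetricOn.tact_frameMat_tact_frameComp (hG : IsMetricOn G U)
    (he : e ∈ IsManifold.maximalAtlas (𝓡 n) ∞ M) {z : V} (hz : z ∈ dom e U) {k : ℕ}
    (t : (Fin k → Fin n) → ℂ) : tact (frameMat G U e z) (tact (frameComp G U e z) t) = t := by
  rw [← tact_mul, mul_eq_one_comm.1 (hG.frameMat_mul_frameComp he hz), tact_one]

theorem IsMetricOn.tact_frameComp_tact_frameMat (hG : IsMetricOn G U)
    (he : e ∈ IsManifold.maximalAtlas (𝓡 n) ∞ M) {z : V} (hz : z ∈ dom e U) {k : ℕ}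
    (t : (Fin k → Fin n) → ℂ) : tact (frameComp G U e z) (tact (frameMat G U e z) t) = t := by
  rw [← tact_mul, hG.frameMat_mul_frameComp he hz, tact_one]

/-- `lotField` is defined through the preferred chart at each point; tensoriality gives the same
formula in every chart. -/
theorem tact_lotField (hx : ContMDiff (𝓡 n) 𝓘(ℝ, ℝ) ∞ x)
    (hsc : IsMetricOn (scMetric x h) (interiorX x)) (hg : IsMetricOn g univ) (F : ℝ)
    (he : e ∈ IsManifold.maximalAtlas (𝓡 n) ∞ M) {z : V} (hz : z ∈ dom e (interiorX x)) {k : ℕ}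
    (t : Fibre n k) :
    tact (frameMat (scMetric x h) (interiorX x) e z) (lotField x h g F (e.symm z) t)
      = lotChart x h g F e z (tact (frameMat (scMetric x h) (interiorX x) e z) t) := by
  set e₀ := chartAt (EuclideanSpace ℝ (Fin n)) (e.symm z) with he₀
  have he₀' : e₀ ∈ IsManifold.maximalAtlas (𝓡 n) ∞ M := IsManifold.chart_mem_maximalAtlas _
  have hs : e.symm z ∈ e₀.source := mem_chart_source _ _
  have hmem : transition e₀ e z ∈ dom e₀ (interiorX x) := ⟨e₀.map_source hs, by
    change e₀.symm (transition e₀ e z) ∈ interiorX x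
    rw [symm_transition hs]; exact hz.2⟩
  rw [frameMat_change he₀' he hz.1 hs, tact_mul, tact_mul,
    lotChart_change hx hsc hg F he₀' he hz hs]
  congr 1
  exact hsc.tact_frameMat_tact_frameComp he₀' hmem _

theorem lotField_eq (hx : ContMDiff (𝓡 n) 𝓘(ℝ, ℝ) ∞ x)
    (hsc : IsMetricOn (scMetric x h) (interiorX x)) (hg : IsMetricOn g univ) (F : ℝ)
    (he : e ∈ IsManifold.maximalAtlas (𝓡 n) ∞ M) {z : V} (hz : z ∈ dom e (interiorX x)) {k : ℕ}
    (t : Fibre n k) (J : Fin (k + 1) → Fin n) :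
    lotField x h g F (e.symm z) t J = tact (frameComp (scMetric x h) (interiorX x) e z)
      (lotChart x h g F e z (tact (frameMat (scMetric x h) (interiorX x) e z) t)) J := by
  rw [← tact_lotField hx hsc hg F he hz, hsc.tact_frameComp_tact_frameMat he hz]

theorem lotField_add (F : ℝ) (p : M) {k : ℕ} (t t' : Fibre n k) :
    lotField x h g F p (t + t') = lotField x h g F p t + lotField x h g F p t' := by
  ext J
  have h1 : ∀ A : Matrix (Fin n) (Fin n) ℝ, tact A (t + t' : Fibre n k)
      = fun K => tact A t K + tact A t' K := fun A => tact_add A t t'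
  simp only [lotField, lotChart, h1, lot_add, tact_add]
  rfl

theorem lotField_smul (F : ℝ) (p : M) {k : ℕ} (s : ℂ) (t : Fibre n k) :
    lotField x h g F p (s • t) = s • lotField x h g F p t := by
  ext J
  have h1 : ∀ A : Matrix (Fin n) (Fin n) ℝ, tact A (s • t : Fibre n k)
      = fun K => s * tact A t K := fun A => tact_const_mul A s t
  simp only [lotField, lotChart, h1, lot_smul, tact_const_mul]
  rfl

end ConjugatedTerm

end ScatteringWitten
end

noncomputable section
namespace ScatteringWitten

/-! ### Measurability of fields defined chart by chart. -/

section Measurability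

set_option linter.unusedSectionVars false

variable {n : ℕ} {M : Type*} [TopologicalSpace M] [ChartedSpace (EuclideanSpace ℝ (Fin n)) M]
  [IsManifold (𝓡 n) ∞ M] [SecondCountableTopology M] [MeasurableSpace M] [BorelSpace M]
  {e : OpenPartialHomeomorph M (EuclideanSpace ℝ (Fin n))} {G g : TwoTensor n M} {U : Set M}
  {x : M → ℝ} {h : TwoTensor n M}

local notation "V" => EuclideanSpace ℝ (Fin n)

/-- A measurable modification in a chart is composed with the chart map. The exceptional set is
enlarged to a Borel null set first, so that its image has zero volume; countably many charts then
suffice. -/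
theorem IsMetricOn.aemeasurable_of_charts (hG : IsMetricOn G U) {f : M → ℂ}
    (hf : ∀ e ∈ IsManifold.maximalAtlas (𝓡 n) ∞ M,
      AEMeasurable (fun z => f (e.symm z)) (volume.restrict (dom e U))) :
    AEMeasurable f (volMeasure G U) := by
  obtain ⟨s, hs, hsa, hcov⟩ := exists_countable_charts (n := n) (M := M)
  have key : ∀ e ∈ IsManifold.maximalAtlas (𝓡 n) ∞ M,
      AEMeasurable f ((volMeasure G U).restrict e.source) := by
    intro e he
    obtain ⟨f', hf', hff⟩ := hf e he
    obtain ⟨N, hN, hNm, hN0⟩ := exists_measurable_superset_of_null (ae_iff.1 hff)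
    have hsm := e.open_source.measurableSet
    have hem : Measurable (e.source.domRestrict e) :=
      (continuousOn_iff_continuous_domRestrict.1 e.continuousOn).measurable
    have hA : MeasurableSet (e.source ∩ e ⁻¹' N) := by
      have h2 := hsm.subtype_image (hem hNm)
      convert! h2 using 1
      ext z
      simp only [mem_inter_iff, mem_preimage, mem_image, Subtype.exists,
        exists_and_right, exists_eq_right]
      exact ⟨fun h => ⟨h.1, h.2⟩, fun ⟨h, h'⟩ => ⟨h, h'⟩⟩
    have hA0 : volChart G U e (e.source ∩ e ⁻¹' N) = 0 := by
      rw [hG.volChart_apply he hA]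
      refine setLIntegral_measure_zero _ _ (measure_mono_null ?_
        ((Measure.restrict_apply hNm).symm.trans hN0))
      intro z hz
      refine ⟨?_, hz.1, hz.2.1⟩
      have := hz.2.2.2
      rwa [mem_preimage, e.right_inv hz.1] at this
    have h3 : ∀ᵐ p ∂((volMeasure G U).restrict e.source), p ∉ e.source ∩ e ⁻¹' N :=
      measure_eq_zero_iff_ae_notMem.1
        (le_antisymm ((Measure.le_iff'.1 (hG.restrict_volMeasure_le he) _).trans hA0.le) zero_le)
    refine (hf'.comp_aemeasurable (e.continuousOn.aemeasurable hsm)).congr ?_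
    filter_upwards [h3, ae_restrict_mem hsm] with p hp hps
    by_contra hne
    refine hp ⟨hps, hN ?_⟩
    simpa [e.left_inv hps, eq_comm] using hne
  have hU : (⋃ e : s, (e : OpenPartialHomeomorph M (EuclideanSpace ℝ (Fin n))).source) = univ :=
    eq_univ_of_forall fun p => by
      obtain ⟨e, he, hp⟩ := hcov p
      exact mem_iUnion.2 ⟨⟨e, he⟩, hp⟩
  have : Countable s := hs.to_subtype
  rw [← Measure.restrict_univ (μ := volMeasure G U), ← hU]
  exact aemeasurable_iUnion_iff.2 fun e => key e (hsa e e.2)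

theorem aestronglyMeasurable_tact {μ : Measure V} {k : ℕ} {A : V → Matrix (Fin n) (Fin n) ℝ}
    {t : V → (Fin k → Fin n) → ℂ} (hA : ∀ i j, AEMeasurable (fun z => A z i j) μ)
    (ht : ∀ K, AEStronglyMeasurable (fun z => t z K) μ) (J : Fin k → Fin n) :
    AEStronglyMeasurable (fun z => tact (A z) (t z) J) μ := by
  simp only [tact]
  refine Finset.aestronglyMeasurable_fun_sum _ fun K _ => (ht K).mul ?_
  refine Finset.aestronglyMeasurable_fun_prod _ fun a _ => ?_
  exact Complex.continuous_ofReal.comp_aestronglyMeasurable (hA (K a) (J a)).aestronglyMeasurable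

theorem aestronglyMeasurable_lot {μ : Measure V} {k : ℕ} {c : V → Fin n → ℝ}
    {D : V → Fin n → Fin n → Fin n → ℝ}
    {t : V → (Fin k → Fin n) → ℂ} (hc : ∀ l, AEStronglyMeasurable (fun z => c z l) μ)
    (hD : ∀ q k l, AEStronglyMeasurable (fun z => D z q k l) μ)
    (ht : ∀ K, AEStronglyMeasurable (fun z => t z K) μ) (J : Fin (k + 1) → Fin n) :
    AEStronglyMeasurable (fun z => lot (c z) (D z) (t z) J) μ := by
  simp only [lot]
  refine ((Complex.continuous_ofReal.comp_aestronglyMeasurable (hc _)).mul (ht _)).add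
    (Finset.aestronglyMeasurable_fun_sum _ fun a _ =>
      Finset.aestronglyMeasurable_fun_sum _ fun q _ => ?_)
  exact (Complex.continuous_ofReal.comp_aestronglyMeasurable (hD _ _ _)).mul (ht _)

/-- The preferred chart depends on the point with no measurability, so the definition cannot be used
directly. In one fixed chart, `lotField_eq` expresses the field by smooth coefficients and
measurable frame matrices. -/
theorem aestronglyMeasurable_lotField (hx : ContMDiff (𝓡 n) 𝓘(ℝ, ℝ) ∞ x)
    (hsc : IsMetricOn (scMetric x h) (interiorX x)) (hg : IsMetricOn g univ) (F : ℝ) {k : ℕ}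
    {f : M → Fibre n k}
    (hf : AEStronglyMeasurable f (volMeasure (scMetric x h) (interiorX x))) :
    AEStronglyMeasurable (fun p => lotField x h g F p (f p))
      (volMeasure (scMetric x h) (interiorX x)) := by
  have h1 : ∀ J, AEMeasurable (fun p => lotField x h g F p (f p) J)
      (volMeasure (scMetric x h) (interiorX x)) := by
    intro J
    refine hsc.aemeasurable_of_charts fun e he => ?_
    have hm := (hsc.isOpen_dom e).measurableSet
    have hle : volume.restrict (dom e (interiorX x)) ≤ volume.restrict (dom e univ) :=
      Measure.restrict_mono (inter_subset_inter_right _ (preimage_mono (subset_univ _))) le_rfl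
    have h2 : AEStronglyMeasurable (fun z => tact (frameComp (scMetric x h) (interiorX x) e z)
        (lotChart x h g F e z (tact (frameMat (scMetric x h) (interiorX x) e z) (f (e.symm z)))) J)
        (volume.restrict (dom e (interiorX x))) := by
      refine aestronglyMeasurable_tact (fun i j => hsc.aemeasurable_frameComp he i j)
        (fun K => aestronglyMeasurable_lot (fun l => ?_) (fun q k l => ?_)
          (fun K => hsc.aestronglyMeasurable_tact he hf K) K) J
      · exact ((contDiffOn_const.mul (contDiffOn_pd (contDiffOn_inv_comp_symm hx he)
          (hsc.isOpen_dom e) l)).continuousOn).aestronglyMeasurable hm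
      · exact (((hsc.contDiffOn_christoffel he q k l).continuousOn).aestronglyMeasurable hm).sub
          ((((hg.contDiffOn_christoffel he q k l).continuousOn).aestronglyMeasurable
            (hg.isOpen_dom e).measurableSet).mono_measure hle)
    refine (h2.congr ((ae_restrict_iff' hm).2
      (Filter.Eventually.of_forall fun z hz => ?_))).aemeasurable
    exact (lotField_eq hx hsc hg F he hz _ J).symm
  have h3 : AEMeasurable (fun p J => lotField x h g F p (f p) J)
      (volMeasure (scMetric x h) (interiorX x)) := aemeasurable_pi_iff.2 h1
  exact (PiLp.continuous_toLp 2 _).comp_aestronglyMeasurable h3.aestronglyMeasurable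

end Measurability

/-! ### Uniform constants in a good chart. -/

section Bounds

variable {n : ℕ} {M : Type*} [TopologicalSpace M] [ChartedSpace (EuclideanSpace ℝ (Fin n)) M]
  [IsManifold (𝓡 n) ∞ M] [SecondCountableTopology M]
  {e : OpenPartialHomeomorph M (EuclideanSpace ℝ (Fin n))} {G g : TwoTensor n M} {U K : Set M}
  {x : M → ℝ} {h : TwoTensor n M} {o : Fin n}

local notation "V" => EuclideanSpace ℝ (Fin n)

theorem IsMetricOn.frameComp_mul_transpose (hG : IsMetricOn G U)
    (he : e ∈ IsManifold.maximalAtlas (𝓡 n) ∞ M) {z : V} (hz : z ∈ dom e U) :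
    frameComp G U e z * (frameComp G U e z).transpose = (gram G e z)⁻¹ := by
  have h1 := hG.frameMat_mul_frameComp he hz
  have h2 : frameComp G U e z * frameMat G U e z = 1 := mul_eq_one_comm.1 h1
  refine (Matrix.inv_eq_left_inv ?_).symm
  rw [← hG.frameMat_transpose_mul he hz]
  calc frameComp G U e z * (frameComp G U e z).transpose *
        ((frameMat G U e z).transpose * frameMat G U e z)
      = frameComp G U e z * (frameMat G U e z * frameComp G U e z).transpose *
        frameMat G U e z := by rw [Matrix.transpose_mul]; simp only [mul_assoc]
    _ = 1 := by rw [h1, Matrix.transpose_one, mul_one, h2]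

theorem IsMetricOn.sq_frameComp_le (hG : IsMetricOn G U)
    (he : e ∈ IsManifold.maximalAtlas (𝓡 n) ∞ M) {z : V} (hz : z ∈ dom e U) (j L : Fin n) :
    frameComp G U e z j L ^ 2 ≤ (gram G e z)⁻¹ j j := by
  rw [← hG.frameComp_mul_transpose he hz, Matrix.mul_apply]
  have := Finset.single_le_sum (f := fun L => frameComp G U e z j L ^ 2)
    (fun L _ => sq_nonneg _) (Finset.mem_univ L)
  simpa [sq] using this

theorem BddC1.exists_uniform {ι : Type*} [Finite ι] {S : Set V} {f : ι → V → ℝ}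
    (hf : ∀ i, BddC1 S (f i)) : ∃ C, 0 ≤ C ∧ ∀ i, ∀ z ∈ S, |f i z| ≤ C ∧ ∀ l, |pd l (f i) z| ≤ C := by
  cases nonempty_fintype ι
  choose C hC using hf
  have h1 : ∀ i, C i ≤ ∑ j, |C j| := fun i => (le_abs_self _).trans
    (Finset.single_le_sum (f := fun j => |C j|) (fun j _ => abs_nonneg _) (Finset.mem_univ i))
  exact ⟨∑ i, |C i|, Finset.sum_nonneg fun i _ => abs_nonneg _, fun i z hz =>
    ⟨(hC i z hz).1.trans (h1 i), fun l => ((hC i z hz).2 l).trans (h1 i)⟩⟩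

/-- Uniform bounds on the coefficients of the metrics in a good chart. -/
structure ChartBounds (x : M → ℝ) (h g : TwoTensor n M)
    (e : OpenPartialHomeomorph M (EuclideanSpace ℝ (Fin n))) (K : Set M) (C : ℝ) : Prop where
  one_le : 1 ≤ C
  gram : ∀ z ∈ dom e (K ∩ interiorX x), ∀ i, gram (scMetric x h) e z i i ≤ C ^ 2
  frameMat : ∀ z ∈ dom e (K ∩ interiorX x), ∀ i j,
    |frameMat (scMetric x h) (interiorX x) e z i j| ≤ C
  frameComp : ∀ z ∈ dom e (K ∩ interiorX x), ∀ i j,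
    |frameComp (scMetric x h) (interiorX x) e z i j| ≤ C
  chr_sc : ∀ z ∈ dom e (K ∩ interiorX x), ∀ q k l, |christoffel (scMetric x h) e z q k l| ≤ C
  chr : ∀ z ∈ dom e (K ∩ interiorX x), ∀ q k l, |christoffel g e z q k l| ≤ C
  dens_le : ∀ z ∈ dom e (K ∩ interiorX x), Real.sqrt (ScatteringWitten.gram (scMetric x h) e z).det ≤ C
  le_dens : ∀ z ∈ dom e (K ∩ interiorX x),
    C⁻¹ ≤ Real.sqrt (ScatteringWitten.gram (scMetric x h) e z).det

theorem GoodChart.exists_chartBounds (hc : GoodChart x h g e o K)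
    (hsc : IsMetricOn (scMetric x h) (interiorX x)) : ∃ C, ChartBounds x h g e K C := by
  obtain ⟨C₁, h1, hC₁⟩ := BddC1.exists_uniform (ι := Fin n × Fin n) fun i => hc.gram i.1 i.2
  obtain ⟨C₂, h2, hC₂⟩ := BddC1.exists_uniform (ι := Fin n × Fin n) fun i => hc.inv i.1 i.2
  obtain ⟨C₃, hC₃⟩ := hc.dens
  obtain ⟨C₄, hC₄⟩ := hc.chr
  obtain ⟨c, hc0, hcl⟩ := hc.dens_lower
  have hsub : dom e (K ∩ interiorX x) ⊆ dom e (interiorX x) := fun z hz => ⟨hz.1, hz.2.2⟩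
  set C₅ : ℝ := (1 / 2) * (n * (C₂ * (C₁ + C₁ + C₁))) with hC₅
  have h5 : 0 ≤ C₅ := by positivity
  -- One constant above all bounds; the summand 1 gives C ≤ C², so a bound by C on diagonal entries
  -- also bounds frame entries by C.
  set C := 1 + C₁ + C₂ + |C₃| + |C₄| + C₅ + c⁻¹ with hC
  have hi : 0 < c⁻¹ := inv_pos.2 hc0
  have p3 := abs_nonneg C₃
  have p4 := abs_nonneg C₄
  have h1C : 1 ≤ C := by linarith
  have hsq : C ≤ C ^ 2 := by nlinarith
  refine ⟨C, h1C, fun z hz i => ?_, fun z hz i j => ?_, fun z hz i j => ?_, fun z hz q k l => ?_,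
    fun z hz q k l => ?_, fun z hz => ?_, fun z hz => ?_⟩
  · have := (le_abs_self _).trans (hC₁ (i, i) z hz).1
    simp only at this; linarith
  · refine abs_le_of_sq_le_sq ((hsc.sq_frameMat_le hc.mem (hsub hz) i j).trans ?_) (by linarith)
    have := (le_abs_self _).trans (hC₁ (j, j) z hz).1
    simp only at this; linarith
  · refine abs_le_of_sq_le_sq ((hsc.sq_frameComp_le hc.mem (hsub hz) i j).trans ?_) (by linarith)
    have := (le_abs_self _).trans (hC₂ (i, i) z hz).1
    simp only at this; linarith
  · have h6 : |christoffel (scMetric x h) e z q k l| ≤ C₅ := by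
      rw [christoffel, abs_mul, abs_of_pos (by norm_num : (0 : ℝ) < 1 / 2)]
      refine mul_le_mul_of_nonneg_left ((Finset.abs_sum_le_sum_abs _ _).trans ?_) (by norm_num)
      have h7 : ∀ r ∈ Finset.univ, |(ScatteringWitten.gram (scMetric x h) e z)⁻¹ q r *
          (pd k (fun w => ScatteringWitten.gram (scMetric x h) e w r l) z
            + pd l (fun w => ScatteringWitten.gram (scMetric x h) e w r k) z
            - pd r (fun w => ScatteringWitten.gram (scMetric x h) e w k l) z)|
          ≤ C₂ * (C₁ + C₁ + C₁) := by
        intro r _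
        rw [abs_mul]
        refine mul_le_mul (hC₂ (q, r) z hz).1 ?_ (abs_nonneg _) h2
        exact (abs_sub _ _).trans (add_le_add ((abs_add_le _ _).trans
          (add_le_add ((hC₁ (r, l) z hz).2 k) ((hC₁ (r, k) z hz).2 l))) ((hC₁ (k, l) z hz).2 r))
      refine (Finset.sum_le_sum h7).trans (le_of_eq ?_)
      simp
    linarith
  · have := (hC₄ z hz q k l).trans (le_abs_self _)
    linarith
  · have := (le_abs_self _).trans ((hC₃ z hz).1.trans (le_abs_self _))
    linarith
  · refine le_trans ?_ (hcl z hz)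
    rw [inv_le_comm₀ (by linarith) hc0]
    linarith

/-- Because 1/x is the coordinate z_o, the weight F/x is linear and its differential is constant.
This makes the conjugated derivative one with constant coefficients. -/
theorem GoodChart.pd_inv (hc : GoodChart x h g e o K)
    (hsc : IsMetricOn (scMetric x h) (interiorX x)) {z : V} (hz : z ∈ dom e (interiorX x))
    (l : Fin n) : pd l (fun w => (x (e.symm w))⁻¹) z = (Pi.single o 1 : Fin n → ℝ) l := by
  have h1 : (fun w => (x (e.symm w))⁻¹) =ᶠ[nhds z] fun w => w o := by
    filter_upwards [(hsc.isOpen_dom e).mem_nhds hz] with w hw using hc.coord w hw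
  rw [pd_congr h1, pd_coord]
  simp [Pi.single_apply, eq_comm]

theorem GoodChart.lotChart_eq (hc : GoodChart x h g e o K)
    (hsc : IsMetricOn (scMetric x h) (interiorX x)) (F : ℝ) {z : V} (hz : z ∈ dom e (interiorX x))
    {k : ℕ} (t : (Fin k → Fin n) → ℂ) :
    lotChart x h g F e z t = lot (Pi.single o F)
      (fun q k l => christoffel (scMetric x h) e z q k l - christoffel g e z q k l) t := by
  rw [lotChart]
  congr 1
  funext l
  rw [hc.pd_inv hsc hz]
  by_cases hl : l = o
  · subst hl; simp
  · simp [hl]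

theorem norm_le_of_forall_le {k : ℕ} (t : Fibre n k) {D : ℝ} (h : ∀ J, ‖t J‖ ≤ D) :
    ‖t‖ ≤ (n : ℝ) ^ k * D := by
  have h1 : ‖t‖ ≤ ∑ J, ‖t J‖ := by
    rw [EuclideanSpace.norm_eq]
    refine Real.sqrt_le_iff.2 ⟨Finset.sum_nonneg fun J _ => norm_nonneg _, ?_⟩
    exact Finset.sum_sq_le_sq_sum_of_nonneg fun J _ => norm_nonneg _
  refine (h1.trans (Finset.sum_le_sum fun J _ => h J)).trans (le_of_eq ?_)
  simp

theorem GoodChart.exists_norm_lotField_le (hc : GoodChart x h g e o K)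
    (hx : ContMDiff (𝓡 n) 𝓘(ℝ, ℝ) ∞ x)
    (hsc : IsMetricOn (scMetric x h) (interiorX x)) (hg : IsMetricOn g univ) (F : ℝ) (k : ℕ) :
    ∃ C, ∀ p ∈ K ∩ interiorX x, ∀ t : Fibre n k, ‖lotField x h g F p t‖ ≤ C * ‖t‖ := by
  obtain ⟨C, hC⟩ := hc.exists_chartBounds hsc
  have h0 : 0 ≤ C := zero_le_one.trans hC.one_le
  have hB : 0 ≤ |F| + (C + C) := by positivity
  refine ⟨(n : ℝ) ^ (k + 1) * ((n : ℝ) ^ (k + 1) *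
    (((1 + k * n) * ((|F| + (C + C)) * ((n : ℝ) ^ k * C ^ k))) * C ^ (k + 1))), fun p hp t => ?_⟩
  have hps := hc.sub hp
  have hz : e p ∈ dom e (K ∩ interiorX x) := ⟨e.map_source hps, by
    rw [mem_preimage, e.left_inv hps]; exact hp⟩
  have hz' : e p ∈ dom e (interiorX x) := ⟨hz.1, hz.2.2⟩
  have h1 : ∀ J, ‖tact (frameMat (scMetric x h) (interiorX x) e (e p)) t J‖
      ≤ (n : ℝ) ^ k * (‖t‖ * C ^ k) :=
    norm_tact_le _ _ (hC.frameMat _ hz) fun K => PiLp.norm_apply_le t K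
  have h2 : ∀ J, ‖lotChart x h g F e (e p) (tact (frameMat (scMetric x h) (interiorX x) e (e p)) t) J‖
      ≤ (1 + k * n) * ((|F| + (C + C)) * ((n : ℝ) ^ k * (‖t‖ * C ^ k))) := by
    rw [hc.lotChart_eq hsc F hz']
    refine norm_lot_le hB (fun l => ?_) (fun q k l => ?_) h1
    · have h3 : |(Pi.single o F : Fin n → ℝ) l| ≤ |F| := by
        by_cases hl : l = o
        · subst hl; simp
        · simp [hl]
      linarith
    · have := (abs_sub (christoffel (scMetric x h) e (e p) q k l) (christoffel g e (e p) q k l)).trans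
        (add_le_add (hC.chr_sc _ hz q k l) (hC.chr _ hz q k l))
      have := abs_nonneg F
      linarith
  have h4 := norm_tact_le (frameComp (scMetric x h) (interiorX x) e (e p)) _ (hC.frameComp _ hz) h2
  have h5 : ∀ J, ‖lotField x h g F p t J‖ ≤ (n : ℝ) ^ (k + 1) *
      ((1 + k * n) * ((|F| + (C + C)) * ((n : ℝ) ^ k * (‖t‖ * C ^ k))) * C ^ (k + 1)) := by
    intro J
    have h6 := lotField_eq hx hsc hg F hc.mem hz' t J
    rw [e.left_inv hps] at h6
    rw [h6]
    exact h4 J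
  refine (norm_le_of_forall_le _ h5).trans (le_of_eq ?_)
  ring

end Bounds
end ScatteringWitten
end

noncomputable section
namespace ScatteringWitten

/-- Multiplication by a bounded measurable family of linear maps, as an operator on `L²`. -/
theorem exists_clm_of_pointwise {α E E' : Type*} [MeasurableSpace α] [NormedAddCommGroup E]
    [NormedSpace ℂ E] [NormedAddCommGroup E'] [NormedSpace ℂ E'] {μ : Measure α} (A : α → E → E')
    (hadd : ∀ p t t', A p (t + t') = A p t + A p t') (hsmul : ∀ p (c : ℂ) t, A p (c • t) = c • A p t)
    (hm : ∀ f : α → E, AEStronglyMeasurable f μ → AEStronglyMeasurable (fun p => A p (f p)) μ)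
    {C : ℝ} (hC : ∀ p t, ‖A p t‖ ≤ C * ‖t‖) :
    ∃ T : Lp E 2 μ →L[ℂ] Lp E' 2 μ, ∀ f : Lp E 2 μ, T f =ᵐ[μ] fun p => A p (f p) := by
  have hmem : ∀ f : Lp E 2 μ, MemLp (fun p => A p (f p)) 2 μ := fun f =>
    (Lp.memLp f).of_le_mul (hm f (Lp.aestronglyMeasurable f))
      (Filter.Eventually.of_forall fun p => hC p (f p))
  let T₀ : Lp E 2 μ →ₗ[ℂ] Lp E' 2 μ :=
    { toFun := fun f => (hmem f).toLp _
      map_add' := fun f f' => by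
        refine Lp.ext ?_
        filter_upwards [(hmem (f + f')).coeFn_toLp, (hmem f).coeFn_toLp, (hmem f').coeFn_toLp,
          Lp.coeFn_add ((hmem f).toLp _) ((hmem f').toLp _), Lp.coeFn_add f f'] with p h1 h2 h3 h4 h5
        rw [h1, h4, Pi.add_apply, h2, h3, h5, Pi.add_apply, hadd]
      map_smul' := fun c f => by
        refine Lp.ext ?_
        filter_upwards [(hmem (c • f)).coeFn_toLp, (hmem f).coeFn_toLp,
          Lp.coeFn_smul c ((hmem f).toLp _), Lp.coeFn_smul c f] with p h1 h2 h3 h4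
        rw [h1, RingHom.id_apply, h3, Pi.smul_apply, h2, h4, Pi.smul_apply, hsmul] }
  refine ⟨T₀.mkContinuous C fun f => ?_, fun f => (hmem f).coeFn_toLp⟩
  refine Lp.norm_le_mul_norm_of_ae_le_mul ?_
  filter_upwards [(hmem f).coeFn_toLp] with p hp
  change ‖((hmem f).toLp _ : α → E') p‖ ≤ _
  rw [hp]
  exact hC p (f p)

/-- Symmetrization as a linear operator. -/
def symmetrizeL (n k : ℕ) : Fibre n k →L[ℂ] Fibre n k :=
  LinearMap.toContinuousLinearMap
    { toFun := symmetrize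
      map_add' := fun t t' => by
        ext J
        simp [symmetrize_apply, Finset.sum_add_distrib, mul_add]
      map_smul' := fun c t => by
        ext J
        simp [symmetrize_apply, Finset.mul_sum, mul_left_comm] }

theorem symmetrizeL_apply {n k : ℕ} (t : Fibre n k) : symmetrizeL n k t = symmetrize t := rfl

/-! ### The operator d_F on the Sobolev space. -/

section Operator

set_option linter.unusedSectionVars false

variable {n : ℕ} {M : Type*} [TopologicalSpace M] [ChartedSpace (EuclideanSpace ℝ (Fin n)) M]
  [IsManifold (𝓡 n) ∞ M] [SecondCountableTopology M]
  {g : TwoTensor n M} {x : M → ℝ} {h : TwoTensor n M} {Ω : Set M}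

local notation "V" => EuclideanSpace ℝ (Fin n)

/-- Leibniz's rule for e^{F/x} yields the covector d(F/x), and replacing one connection by the other
yields the difference of Christoffel symbols; together they are `lotField`. -/
theorem IsWeakCovDeriv.conj (hx : ContMDiff (𝓡 n) 𝓘(ℝ, ℝ) ∞ x)
    (hsc : IsMetricOn (scMetric x h) (interiorX x)) (hg : IsMetricOn g univ) (F : ℝ) {k : ℕ}
    {u : M → Fibre n k} {w : M → Fibre n (k + 1)} (H : IsWeakCovDeriv x h (scMetric x h) u w) :
    IsWeakCovDeriv x h g (fun p => Real.exp (F / x p) • u p)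
      (fun p => Real.exp (F / x p) • (w p + lotField x h g F p (u p))) := by
  intro e he J l
  have hS := hsc.isOpen_dom e
  have hφ := contDiffOn_inv_comp_symm hx he
  have ha : ContDiffOn ℝ ∞ (fun z => Real.exp (F * (x (e.symm z))⁻¹)) (dom e (interiorX x)) :=
    (contDiffOn_const.mul hφ).exp
  have hcomp : ∀ {m : ℕ} (f : M → Fibre n m) (I : Fin m → Fin n) (z : V),
      chartComp x h e (fun p => Real.exp (F / x p) • f p) I z
        = (Real.exp (F * (x (e.symm z))⁻¹) : ℂ) * chartComp x h e f I z := by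
    intro m f I z
    simp only [chartComp, Finset.mul_sum]
    refine Finset.sum_congr rfl fun K _ => ?_
    rw [← mul_assoc, ← div_eq_mul_inv]
    congr 1
  refine ((H e he J l).smul_smooth hS ha).congr_ae hS.measurableSet
    (Filter.Eventually.of_forall fun z => ?_)
    ((ae_restrict_iff' hS.measurableSet).2 (Filter.Eventually.of_forall fun z hz => ?_))
  · rw [hcomp]; exact Complex.real_smul
  · have hd : DifferentiableAt ℝ (fun z => (x (e.symm z))⁻¹) z :=
      (hφ.contDiffAt (hS.mem_nhds hz)).differentiableAt (by simp)
    have hpd : pd l (fun z => Real.exp (F * (x (e.symm z))⁻¹)) z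
        = Real.exp (F * (x (e.symm z))⁻¹) * (F * pd l (fun z => (x (e.symm z))⁻¹) z) := by
      simp only [pd]
      rw [fderiv_exp (hd.const_mul F), fderiv_const_mul hd F]
      simp
    simp only [hcomp]
    have h1 : chartComp x h e (fun p => w p + lotField x h g F p (u p)) (Fin.snoc J l) z
        = chartComp x h e w (Fin.snoc J l) z
          + lotChart x h g F e z (fun K => chartComp x h e u K z) (Fin.snoc J l) := by
      rw [chartComp_add, chartComp_eq_tact (f := fun p => lotField x h g F p (u p)),
        tact_lotField hx hsc hg F he hz]
      rfl
    rw [h1, hpd]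
    simp only [lotChart, lot, Fin.snoc_last, Fin.init_snoc, Fin.snoc_castSucc, Complex.real_smul]
    simp only [Complex.ofReal_sub, sub_mul, Finset.sum_sub_distrib, Complex.ofReal_mul]
    have h2 : ∑ a : Fin k, ∑ q : Fin n, (christoffel g e z q l (J a) : ℂ) *
          ((Real.exp (F * (x (e.symm z))⁻¹) : ℂ) * chartComp x h e u (Function.update J a q) z)
        = (Real.exp (F * (x (e.symm z))⁻¹) : ℂ) * ∑ a : Fin k, ∑ q : Fin n,
          (christoffel g e z q l (J a) : ℂ) * chartComp x h e u (Function.update J a q) z := by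
      simp only [Finset.mul_sum]
      refine Finset.sum_congr rfl fun a _ => Finset.sum_congr rfl fun q _ => ?_
      ring
    rw [h2]
    ring

variable [MeasurableSpace M] [BorelSpace M]

theorem dotH1_fst_ae_eq_zero (hsc : IsMetricOn (scMetric x h) (interiorX x))
    (W : dotH1 x h Ω) : ∀ᵐ p ∂(volMeasure (scMetric x h) (interiorX x)),
      p ∉ closure Ω → W.1.fst p = 0 := by
  filter_upwards [((mem_dotH1_iff hsc W.1).1 W.2).2, hsc.ae_mem] with p hp hpU hpΩ
  exact hp.2 ⟨hpU, hpΩ⟩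

/-- The term of order zero is bounded only over closure Ω, so it is cut off there before being made
an operator on L². Fields in `dotH1` vanish elsewhere, so the cutoff does not change the formula. -/
theorem exists_symmDiff_operator (hx : ContMDiff (𝓡 n) 𝓘(ℝ, ℝ) ∞ x)
    (hsc : IsMetricOn (scMetric x h) (interiorX x)) (hg : IsMetricOn g univ) (F : ℝ) {C : ℝ}
    (hC0 : 0 ≤ C) (hC : ∀ p ∈ closure Ω ∩ interiorX x, ∀ t : Fibre n 3,
      ‖lotField x h g F p t‖ ≤ C * ‖t‖) :
    ∃ d : dotH1 x h Ω →L[ℂ] L2sc x h 4, ∀ W : dotH1 x h Ω,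
      d W =ᵐ[volMeasure (scMetric x h) (interiorX x)]
        fun p => symmetrize (W.1.snd p + lotField x h g F p (W.1.fst p)) := by
  classical
  have hmeas : MeasurableSet (closure Ω ∩ interiorX x) :=
    isClosed_closure.measurableSet.inter hsc.isOpen.measurableSet
  obtain ⟨T, hT⟩ := exists_clm_of_pointwise (μ := volMeasure (scMetric x h) (interiorX x))
    (fun p (t : Fibre n 3) => (closure Ω ∩ interiorX x).indicator
      (fun p => lotField x h g F p t) p) (C := C) (fun p t t' => by
        by_cases hp : p ∈ closure Ω ∩ interiorX x
        · simp only [indicator_of_mem hp, lotField_add]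
        · simp only [indicator_of_notMem hp, add_zero])
      (fun p c t => by
        by_cases hp : p ∈ closure Ω ∩ interiorX x
        · simp only [indicator_of_mem hp, lotField_smul]
        · simp only [indicator_of_notMem hp, smul_zero])
      (fun f hf => by
        have := (aestronglyMeasurable_lotField hx hsc hg F hf).indicator hmeas
        exact this)
      (fun p t => by
        by_cases hp : p ∈ closure Ω ∩ interiorX x
        · simp only [indicator_of_mem hp]; exact hC p hp t
        · simp only [indicator_of_notMem hp, norm_zero]; positivity)
  let E := WithLp.prodContinuousLinearEquiv 2 ℂ (L2sc x h 3) (L2sc x h 4)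
  let d₀ : WithLp 2 (L2sc x h 3 × L2sc x h 4) →L[ℂ] L2sc x h 4 :=
    ((symmetrizeL n 4).compLpL 2 (volMeasure (scMetric x h) (interiorX x))).comp
      ((ContinuousLinearMap.snd ℂ (L2sc x h 3) (L2sc x h 4)
        + T.comp (ContinuousLinearMap.fst ℂ (L2sc x h 3) (L2sc x h 4))).comp E.toContinuousLinearMap)
  refine ⟨d₀.comp (dotH1 x h Ω).subtypeL, fun W => ?_⟩
  have h1 : (d₀.comp (dotH1 x h Ω).subtypeL) W
      = (symmetrizeL n 4).compLp (W.1.snd + T W.1.fst) := rfl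
  rw [h1]
  filter_upwards [(symmetrizeL n 4).coeFn_compLp (W.1.snd + T W.1.fst),
    Lp.coeFn_add W.1.snd (T W.1.fst), hT W.1.fst, dotH1_fst_ae_eq_zero hsc W,
    hsc.ae_mem] with p h2 h3 h4 h5 hpU
  rw [h2, h3, Pi.add_apply, h4, symmetrizeL_apply]
  by_cases hp : p ∈ closure Ω
  · rw [indicator_of_mem (show p ∈ closure Ω ∩ interiorX x from ⟨hp, hpU⟩)]
  · rw [indicator_of_notMem (show p ∉ closure Ω ∩ interiorX x from fun h => hp h.1), h5 hp]
    have h6 := lotField_smul (x := x) (h := h) (g := g) F p (0 : ℂ) (0 : Fibre n 3)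
    rw [zero_smul, zero_smul] at h6
    rw [h6]

theorem isSymmDiff_of_ae_eq (hx : ContMDiff (𝓡 n) 𝓘(ℝ, ℝ) ∞ x)
    (hsc : IsMetricOn (scMetric x h) (interiorX x)) (hg : IsMetricOn g univ) (F : ℝ)
    (W : dotH1 x h Ω) {f : L2sc x h 4} (hf : f =ᵐ[volMeasure (scMetric x h) (interiorX x)]
        fun p => symmetrize (W.1.snd p + lotField x h g F p (W.1.fst p))) :
    IsSymmDiff x h g F W.1.fst f := by
  refine ⟨W.1.fst, _, Filter.EventuallyEq.rfl,
    (((mem_dotH1_iff hsc W.1).1 W.2).1).conj hx hsc hg F, ?_⟩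
  filter_upwards [hf] with p hp
  rw [hp]
  have h1 : ∀ (r : ℝ) (t : Fibre n 4), symmetrize (r • t) = r • symmetrize t := by
    intro r t
    rw [← Complex.coe_smul, ← symmetrizeL_apply, map_smul, Complex.coe_smul]; rfl
  rw [h1, smul_smul, ← Real.exp_add, neg_add_cancel, Real.exp_zero, one_smul]

end Operator
end ScatteringWitten
end

noncomputable section
namespace ScatteringWitten

/-! ### Uniqueness of weak derivatives and bookkeeping for permutations. -/

section Unique

variable {n : ℕ}

local notation "V" => EuclideanSpace ℝ (Fin n)

theorem IsWeakPartial.ae_eq {S : Set V} {l : Fin n} {f D D' : V → ℂ} (hS : IsOpen S)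
    (H : IsWeakPartial S l f D) (H' : IsWeakPartial S l f D') : D =ᵐ[volume.restrict S] D' := by
  have h1 := hS.ae_eq_zero_of_integral_contDiff_smul_eq_zero (μ := volume)
    (H.2.1.sub H'.2.1) fun φ hφ hc hs => by
      have i1 := IsWeakPartial.integrable H.2.1 hφ.continuous hc hs
        (fun z hz => image_eq_zero_of_notMem_tsupport hz)
      have i2 := IsWeakPartial.integrable H'.2.1 hφ.continuous hc hs
        (fun z hz => image_eq_zero_of_notMem_tsupport hz)
      have h2 := (H.2.2 φ hφ hc hs).symm.trans (H'.2.2 φ hφ hc hs)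
      simp only [Pi.sub_apply, smul_sub]
      rw [integral_sub i1 i2, neg_inj.1 h2, sub_self]
  refine (ae_restrict_iff' hS.measurableSet).2 ?_
  filter_upwards [h1] with z hz hzS
  exact sub_eq_zero.1 (hz hzS)

theorem isWeakPartial_zero (S : Set V) (l : Fin n) :
    IsWeakPartial S l (fun _ => 0) (fun _ => 0) :=
  ⟨locallyIntegrableOn_zero, locallyIntegrableOn_zero, fun φ _ _ _ => by simp⟩

theorem exists_perm_castSucc {k : ℕ} (σ : Equiv.Perm (Fin (k + 1))) (hσ : σ (Fin.last k) = Fin.last k) :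
    ∃ τ : Equiv.Perm (Fin k), ∀ a, (τ a).castSucc = σ a.castSucc := by
  have h1 : ∀ a : Fin k, ∃ b : Fin k, b.castSucc = σ a.castSucc := fun a =>
    Fin.exists_castSucc_eq.2 fun h => (Fin.castSucc_lt_last a).ne (σ.injective (h.trans hσ.symm))
  choose f hf using h1
  have hinj : Function.Injective f := fun a b hab => by
    have := (hf a).symm.trans ((congrArg Fin.castSucc hab).trans (hf b))
    exact Fin.castSucc_injective _ (σ.injective this)
  exact ⟨Equiv.ofBijective f (Finite.injective_iff_bijective.1 hinj), hf⟩

theorem init_comp_perm {k : ℕ} {σ : Equiv.Perm (Fin (k + 1))} {τ : Equiv.Perm (Fin k)}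
    (h : ∀ a, (τ a).castSucc = σ a.castSucc) (J : Fin (k + 1) → Fin n) :
    (Fin.init (J ∘ σ) : Fin k → Fin n) = (Fin.init J : Fin k → Fin n) ∘ τ := by
  funext a
  simp only [Fin.init, Function.comp_apply, h]

theorem sum_sum_update_perm {k : ℕ} {A : Type*} [AddCommMonoid A] (τ : Equiv.Perm (Fin k))
    (J : Fin k → Fin n) (φ : Fin n → Fin n → (Fin k → Fin n) → A) (hφ : ∀ q j K, φ q j (K ∘ τ) = φ q j K) :
    ∑ a, ∑ q, φ q ((J ∘ τ) a) (Function.update (J ∘ τ) a q)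
      = ∑ a, ∑ q, φ q (J a) (Function.update J a q) := by
  rw [← Equiv.sum_comp τ fun a => ∑ q, φ q (J a) (Function.update J a q)]
  refine Finset.sum_congr rfl fun a _ => Finset.sum_congr rfl fun q _ => ?_
  rw [← hφ q _ (Function.update J (τ a) q)]
  congr 1
  funext b
  by_cases hb : b = a
  · subst hb; simp
  · simp [hb]

end Unique

/-! ### Representatives with pointwise symmetry and support. -/

section Representatives

set_option linter.unusedSectionVars false

variable {n : ℕ} {M : Type*} [TopologicalSpace M] [ChartedSpace (EuclideanSpace ℝ (Fin n)) M]
  [IsManifold (𝓡 n) ∞ M] [SecondCountableTopology M] [MeasurableSpace M] [BorelSpace M]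
  {G g : TwoTensor n M} {U : Set M} {x : M → ℝ} {h : TwoTensor n M} {Ω : Set M}

local notation "V" => EuclideanSpace ℝ (Fin n)

/-- Symmetry in all arguments but the last one. -/
def IsInitSymmetric {k : ℕ} (t : (Fin (k + 1) → Fin n) → ℂ) : Prop :=
  ∀ σ : Equiv.Perm (Fin (k + 1)), σ (Fin.last k) = Fin.last k → ∀ J, t (J ∘ σ) = t J

theorem IsInitSymmetric.tact {k : ℕ} {t : (Fin (k + 1) → Fin n) → ℂ} (ht : IsInitSymmetric t)
    (A : Matrix (Fin n) (Fin n) ℝ) : IsInitSymmetric (ScatteringWitten.tact A t) := fun σ hσ J => by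
  rw [tact_perm]
  simp only [ht σ hσ]

theorem isClosed_isInitSymmetric (n k : ℕ) : IsClosed {t : Fibre n (k + 1) | IsInitSymmetric t} := by
  have h1 : {t : Fibre n (k + 1) | IsInitSymmetric t}
      = ⋂ (σ : Equiv.Perm (Fin (k + 1))) (_ : σ (Fin.last k) = Fin.last k)
        (J : Fin (k + 1) → Fin n), {t | t (J ∘ σ) = t J} := by
    ext t; simp [IsInitSymmetric]
  rw [h1]
  exact isClosed_iInter fun σ => isClosed_iInter fun _ => isClosed_iInter fun J =>
    isClosed_eq (EuclideanSpace.proj (𝕜 := ℂ) (J ∘ σ)).continuous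
      (EuclideanSpace.proj (𝕜 := ℂ) J).continuous

theorem chartComp_perm {k : ℕ} {u : M → Fibre n k} (hu : ∀ p, IsSymmetricTensor (u p))
    (e : OpenPartialHomeomorph M (EuclideanSpace ℝ (Fin n))) (σ : Equiv.Perm (Fin k))
    (J : Fin k → Fin n) (z : V) : chartComp x h e u (J ∘ σ) z = chartComp x h e u J z := by
  rw [chartComp_eq_tact, chartComp_eq_tact, tact_perm]
  congr 1
  funext K
  exact hu _ σ K

/-- Permuting the arguments of u changes nothing, so both permuted gradients are weak derivatives of
the same components and agree by uniqueness. Applying the inverse frame matrix carries the symmetry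
from coordinates to the frame. -/
theorem IsWeakCovDeriv.ae_isInitSymmetric (hsc : IsMetricOn (scMetric x h) (interiorX x)) {k : ℕ}
    {u : M → Fibre n k} {w : M → Fibre n (k + 1)} (H : IsWeakCovDeriv x h G u w)
    (hu : ∀ p, IsSymmetricTensor (u p)) (hw : StronglyMeasurable w) :
    ∀ᵐ p ∂(volMeasure (scMetric x h) (interiorX x)), IsInitSymmetric (w p) := by
  refine hsc.ae_of_charts (hw.measurable (isClosed_isInitSymmetric n k).measurableSet) fun e he => ?_
  have hS := hsc.isOpen_dom e
  have h1 : ∀ (τ : Equiv.Perm (Fin k)) (J : Fin k → Fin n) (l : Fin n),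
      ∀ᵐ z ∂(volume.restrict (dom e (interiorX x))),
        chartComp x h e w (Fin.snoc (J ∘ τ) l) z = chartComp x h e w (Fin.snoc J l) z := by
    intro τ J l
    have h2 := H e he (J ∘ τ) l
    rw [show chartComp x h e u (J ∘ τ) = chartComp x h e u J from
      funext fun z => chartComp_perm hu e τ J z] at h2
    filter_upwards [h2.ae_eq hS (H e he J l)] with z hz
    rw [sum_sum_update_perm τ J (fun q j K => (christoffel G e z q l j : ℂ) * chartComp x h e u K z)
      fun q j K => by rw [chartComp_perm hu]] at hz
    exact add_right_cancel hz
  filter_upwards [ae_all_iff.2 fun τ => ae_all_iff.2 fun J => ae_all_iff.2 fun l => h1 τ J l,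
    ae_restrict_mem hS.measurableSet] with z hz hzS
  have h3 : IsInitSymmetric (tact (frameMat (scMetric x h) (interiorX x) e z) (w (e.symm z))) := by
    intro σ hσ J
    obtain ⟨τ, hτ⟩ := exists_perm_castSucc σ hσ
    have h4 := hz τ (Fin.init J) (J (Fin.last k))
    rw [Fin.snoc_init_self, ← init_comp_perm hτ J] at h4
    have h5 : J (Fin.last k) = (J ∘ σ) (Fin.last k) := by rw [Function.comp_apply, hσ]
    rw [h5, Fin.snoc_init_self] at h4
    exact h4
  have h6 := h3.tact (frameComp (scMetric x h) (interiorX x) e z)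
  rwa [hsc.tact_frameComp_tact_frameMat he hzS] at h6

/-- On the open set where u vanishes the zero field is a weak gradient, and weak derivatives are
unique. -/
theorem IsWeakCovDeriv.ae_eq_zero (hsc : IsMetricOn (scMetric x h) (interiorX x)) {k : ℕ}
    {u : M → Fibre n k} {w : M → Fibre n (k + 1)} (H : IsWeakCovDeriv x h G u w)
    (hu : ∀ p ∈ interiorX x \ closure Ω, u p = 0) (hw : StronglyMeasurable w) :
    ∀ᵐ p ∂(volMeasure (scMetric x h) (interiorX x)), p ∉ closure Ω → w p = 0 := by
  refine hsc.ae_of_charts ?_ fun e he => ?_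
  · have h1 : {p | p ∉ closure Ω → w p = 0} = closure Ω ∪ w ⁻¹' {0} := by
      ext p; simp [imp_iff_not_or]
    rw [h1]
    exact isClosed_closure.measurableSet.union (hw.measurable (measurableSet_singleton 0))
  have hS := hsc.isOpen_dom e
  set S' := dom e (interiorX x \ closure Ω) with hS'
  have hS'o : IsOpen S' := isOpen_target_inter e (hsc.isOpen.sdiff isClosed_closure)
  have hss : S' ⊆ dom e (interiorX x) := fun z hz => ⟨hz.1, hz.2.1⟩
  have h0 : ∀ z ∈ S', ∀ J, chartComp x h e u J z = 0 := by
    intro z hz J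
    simp [chartComp, hu _ hz.2]
  have h1 : ∀ J : Fin (k + 1) → Fin n, ∀ᵐ z ∂(volume.restrict S'), chartComp x h e w J z = 0 := by
    intro J
    have h2 := ((H e he (Fin.init J) (J (Fin.last k))).mono hss).congr_ae hS'o.measurableSet
      (f' := fun _ => 0) (D' := chartComp x h e w J)
      ((ae_restrict_iff' hS'o.measurableSet).2 (Filter.Eventually.of_forall fun z hz => h0 z hz _))
      ((ae_restrict_iff' hS'o.measurableSet).2 (Filter.Eventually.of_forall fun z hz => by
        simp [h0 z hz, Fin.snoc_init_self]))
    exact h2.ae_eq hS'o (isWeakPartial_zero S' _)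
  have h3 := (ae_restrict_iff' hS'o.measurableSet).1 (ae_all_iff.2 h1)
  refine (ae_restrict_iff' hS.measurableSet).2 ?_
  filter_upwards [h3] with z hz hzS hzΩ
  have h4 : tact (frameMat (scMetric x h) (interiorX x) e z) (w (e.symm z)) = fun _ => 0 :=
    funext fun J => hz ⟨hzS.1, hzS.2, hzΩ⟩ J
  ext J
  have h5 := hsc.tact_frameComp_tact_frameMat he hzS (w (e.symm z))
  rw [h4] at h5
  rw [← h5]
  simp [tact]

/-- A field and its gradient, with the pointwise properties that elements of `dotH1` have almost
everywhere. -/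
structure IsRep (x : M → ℝ) (h : TwoTensor n M) (Ω : Set M) (u : M → Fibre n 3) (w : M → Fibre n 4) :
    Prop where
  memLp : MemLp u 2 (volMeasure (scMetric x h) (interiorX x))
  memLp_grad : MemLp w 2 (volMeasure (scMetric x h) (interiorX x))
  weak : IsWeakCovDeriv x h (scMetric x h) u w
  symm : ∀ p, IsSymmetricTensor (u p)
  symm_grad : ∀ p, IsInitSymmetric (w p)
  zero : ∀ p ∉ closure Ω ∩ interiorX x, u p = 0
  zero_grad : ∀ p ∉ closure Ω ∩ interiorX x, w p = 0

/-- All properties hold almost everywhere; setting the fields to zero where one fails makes them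
hold everywhere and keeps the L² classes. This frees the later pointwise algebra from exceptional
sets. -/
theorem exists_isRep (hsc : IsMetricOn (scMetric x h) (interiorX x)) (W : dotH1 x h Ω) :
    ∃ u w, IsRep x h Ω u w ∧ W.1.fst =ᵐ[volMeasure (scMetric x h) (interiorX x)] u ∧
      W.1.snd =ᵐ[volMeasure (scMetric x h) (interiorX x)] w := by
  classical
  obtain ⟨u₀, w₀, hu₀, hw₀, H, hs, h0⟩ := W.2
  have H' : IsWeakCovDeriv x h (scMetric x h) u₀ W.1.snd :=
    H.congr_ae hsc Filter.EventuallyEq.rfl hw₀.symm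
  have hw := Lp.stronglyMeasurable W.1.snd
  let A : Set M := closure Ω ∩ interiorX x
  let u : M → Fibre n 3 := A.indicator u₀
  let w : M → Fibre n 4 := ({p | IsInitSymmetric (W.1.snd p)} ∩ A).indicator W.1.snd
  have hu : W.1.fst =ᵐ[volMeasure (scMetric x h) (interiorX x)] u := by
    filter_upwards [hu₀, hsc.ae_mem] with p hp hpU
    rw [hp]
    by_cases hpA : p ∈ A
    · exact (indicator_of_mem hpA _).symm
    · rw [h0 p ⟨hpU, fun hpΩ => hpA ⟨hpΩ, hpU⟩⟩]
      exact (indicator_of_notMem hpA _).symm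
  have hw' : W.1.snd =ᵐ[volMeasure (scMetric x h) (interiorX x)] w := by
    filter_upwards [H'.ae_isInitSymmetric hsc hs hw, H'.ae_eq_zero hsc h0 hw, hsc.ae_mem]
      with p h1 h2 hpU
    by_cases hpA : p ∈ A
    · exact (indicator_of_mem (show p ∈ {p | IsInitSymmetric (W.1.snd p)} ∩ A from ⟨h1, hpA⟩) _).symm
    · rw [h2 fun hpΩ => hpA ⟨hpΩ, hpU⟩]
      exact (indicator_of_notMem (fun h => hpA h.2) _).symm
  refine ⟨u, w, ⟨(Lp.memLp _).ae_eq hu, (Lp.memLp _).ae_eq hw',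
    H'.congr_ae hsc (hu₀.symm.trans hu) hw', fun p => ?_, fun p => ?_, fun p hp => ?_, fun p hp => ?_⟩,
    hu, hw'⟩
  · by_cases hpA : p ∈ A
    · rw [show u p = u₀ p from indicator_of_mem hpA _]; exact hs p
    · rw [show u p = 0 from indicator_of_notMem hpA _]; intro σ J; rfl
  · by_cases hpA : p ∈ {p | IsInitSymmetric (W.1.snd p)} ∩ A
    · rw [show w p = W.1.snd p from indicator_of_mem hpA _]; exact hpA.1
    · rw [show w p = 0 from indicator_of_notMem hpA _]; intro σ _ J; rfl
  · exact indicator_of_notMem hp _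
  · exact indicator_of_notMem (fun h => hp h.2) _

end Representatives

/-! ### Finite partitions of unity. -/

section Partition

variable {n : ℕ} {M : Type*} [TopologicalSpace M] [T2Space M] [SecondCountableTopology M]
  [ChartedSpace (EuclideanSpace ℝ (Fin n)) M] [IsManifold (𝓡 n) ∞ M]

/-- A compact set has a finite smooth partition of unity subordinate to a choice of neighbourhoods
of its points. -/
theorem exists_finite_partition {A : Set M} (hA : IsCompact A) {K : M → Set M}
    (hK : ∀ p ∈ A, K p ∈ nhds p) :
    ∃ (s : Finset M) (χ : s → M → ℝ), (∀ i : s, (i : M) ∈ A) ∧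
      (∀ i, ContMDiff (𝓡 n) 𝓘(ℝ, ℝ) ∞ (χ i)) ∧ (∀ i p, |χ i p| ≤ 1) ∧
      (∀ i : s, ∀ p ∉ K i, χ i p = 0) ∧ ∀ p ∈ A, ∑ i, χ i p = 1 := by
  have : LocallyCompactSpace M := ChartedSpace.locallyCompactSpace (EuclideanSpace ℝ (Fin n)) M
  obtain ⟨s, hsA, hs⟩ := hA.elim_nhds_subcover (fun p => interior (K p))
    fun p hp => interior_mem_nhds.2 (hK p hp)
  obtain ⟨f, hf⟩ := SmoothPartitionOfUnity.exists_isSubordinate (𝓡 n) (ι := s) hA.isClosed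
    (fun i => interior (K i)) (fun i => isOpen_interior) (fun p hp => by
      obtain ⟨i, hi, hp'⟩ := mem_iUnion₂.1 (hs hp)
      exact mem_iUnion.2 ⟨⟨i, hi⟩, hp'⟩)
  refine ⟨s, fun i => f i, fun i => hsA i i.2, fun i => (f i).contMDiff, fun i p => ?_,
    fun i p hp => ?_, fun p hp => ?_⟩
  · rw [abs_of_nonneg (f.nonneg i p)]
    exact f.le_one i p
  · by_contra hne
    exact hp (interior_subset (hf i (subset_tsupport _ hne)))
  · have := f.sum_eq_one hp
    rwa [finsum_eq_sum_of_fintype] at this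

end Partition
end ScatteringWitten
end

noncomputable section
namespace ScatteringWitten

/-! ### Pointwise estimates for component arrays. -/

section Pointwise

variable {n k : ℕ}

theorem sum_norm_sq_tact_le {A : Matrix (Fin n) (Fin n) ℝ} {C : ℝ} (hA : ∀ i j, |A i j| ≤ C)
    (t : (Fin k → Fin n) → ℂ) :
    ∑ J, ‖tact A t J‖ ^ 2 ≤ (n : ℝ) ^ (3 * k) * C ^ (2 * k) * ∑ K, ‖t K‖ ^ 2 := by
  set T := ∑ K, ‖t K‖ ^ 2 with hT
  have hT0 : 0 ≤ T := Finset.sum_nonneg fun K _ => by positivity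
  have h1 : ∀ K, ‖t K‖ ≤ Real.sqrt T := fun K => Real.le_sqrt_of_sq_le
    (Finset.single_le_sum (f := fun K => ‖t K‖ ^ 2) (fun K _ => by positivity) (Finset.mem_univ K))
  have h2 : ∀ J ∈ Finset.univ, ‖tact A t J‖ ^ 2 ≤ (n : ℝ) ^ (2 * k) * C ^ (2 * k) * T := by
    intro J _
    have := pow_le_pow_left₀ (norm_nonneg _) (norm_tact_le A t hA h1 J) 2
    refine this.trans (le_of_eq ?_)
    rw [mul_pow, mul_pow, Real.sq_sqrt hT0, ← pow_mul, ← pow_mul, mul_comm k 2]; ring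
  refine (Finset.sum_le_sum h2).trans (le_of_eq ?_)
  simp only [Finset.sum_const, Finset.card_univ, Fintype.card_fun, Fintype.card_fin, nsmul_eq_mul]
  push_cast
  ring

theorem norm_sq_eq_sum (t : Fibre n k) : ‖t‖ ^ 2 = ∑ J, ‖t J‖ ^ 2 := EuclideanSpace.norm_sq_eq t

theorem isInitSymmetric_lot {c : Fin n → ℝ} {D : Fin n → Fin n → Fin n → ℝ}
    {t : (Fin k → Fin n) → ℂ} (ht : ∀ (σ : Equiv.Perm (Fin k)) J, t (J ∘ σ) = t J) :
    IsInitSymmetric (lot c D t) := by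
  intro σ hσ J
  obtain ⟨τ, hτ⟩ := exists_perm_castSucc σ hσ
  simp only [lot, init_comp_perm hτ, ht]
  have h1 : (J ∘ σ) (Fin.last k) = J (Fin.last k) := by rw [Function.comp_apply, hσ]
  have h2 : ∀ a : Fin k, (J ∘ σ) a.castSucc = ((Fin.init J : Fin k → Fin n) ∘ τ) a := fun a =>
    congrFun (init_comp_perm hτ J) a
  simp only [h1, h2]
  congr 1
  exact sum_sum_update_perm τ (Fin.init J)
    (fun q j K => (D q (J (Fin.last k)) j : ℂ) * t K) fun q j K => by rw [ht]

theorem symArr_add (s t : (Fin k → Fin n) → ℂ) :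
    symArr (fun J => s J + t J) = fun J => symArr s J + symArr t J := by
  funext J; simp [symArr, Finset.sum_add_distrib, mul_add]

theorem symArr_const_mul (c : ℂ) (t : (Fin k → Fin n) → ℂ) :
    symArr (fun J => c * t J) = fun J => c * symArr t J := by
  funext J; simp [symArr, Finset.mul_sum, mul_left_comm]

theorem norm_add_sq_le (a b : ℂ) : ‖a + b‖ ^ 2 ≤ 2 * ‖a‖ ^ 2 + 2 * ‖b‖ ^ 2 := by
  have h1 := pow_le_pow_left₀ (norm_nonneg _) (norm_add_le a b) 2
  nlinarith [sq_nonneg (‖a‖ - ‖b‖)]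

end Pointwise

/-! ### Moving integrals between the manifold and a chart. -/

section Transfer

set_option linter.unusedSectionVars false

variable {n : ℕ} {M : Type*} [TopologicalSpace M] [ChartedSpace (EuclideanSpace ℝ (Fin n)) M]
  [IsManifold (𝓡 n) ∞ M] [MeasurableSpace M] [BorelSpace M]
  {e : OpenPartialHomeomorph M (EuclideanSpace ℝ (Fin n))} {G : TwoTensor n M} {U : Set M}

local notation "V" => EuclideanSpace ℝ (Fin n)

/-- Each chart measure is dominated by the volume, so a bound by density times Φ in the chart
integrates to a bound on M. The companion below goes the other way and needs Φ to vanish off the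
chart domain. -/
theorem IsMetricOn.integrable_of_le (hG : IsMetricOn G U)
    (he : e ∈ IsManifold.maximalAtlas (𝓡 n) ∞ M) {Φ : M → ℝ} (hΦ : Integrable Φ (volMeasure G U))
    (hΦ0 : ∀ p, 0 ≤ Φ p) {q : V → ℝ} (hq : AEStronglyMeasurable q) (hq0 : ∀ z, 0 ≤ q z)
    (hqS : ∀ z ∉ dom e U, q z = 0)
    (hle : ∀ z ∈ dom e U, q z ≤ Real.sqrt (gram G e z).det * Φ (e.symm z)) :
    Integrable q ∧ ∫ z, q z ≤ ∫ p, Φ p ∂(volMeasure G U) := by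
  have hS := (hG.isOpen_dom e).measurableSet
  have h1 : ∫⁻ z, ENNReal.ofReal (q z) ≤ ENNReal.ofReal (∫ p, Φ p ∂(volMeasure G U)) := by
    rw [ofReal_integral_eq_lintegral_ofReal hΦ (Filter.Eventually.of_forall hΦ0)]
    refine le_trans ?_ (hG.lintegral_dom_le he hΦ.1.aemeasurable.ennreal_ofReal)
    rw [← setLIntegral_eq_of_support_subset (s := dom e U)]
    · refine setLIntegral_mono' hS fun z hz => ?_
      rw [density, ← ENNReal.ofReal_mul (Real.sqrt_nonneg _)]
      exact ENNReal.ofReal_le_ofReal (hle z hz)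
    · intro z hz
      by_contra hzS
      exact hz (by simp [hqS z hzS])
  have h2 : Integrable q := by
    refine ⟨hq, ?_⟩
    rw [hasFiniteIntegral_iff_ofReal (Filter.Eventually.of_forall hq0)]
    exact h1.trans_lt ENNReal.ofReal_lt_top
  refine ⟨h2, ?_⟩
  rw [← ofReal_integral_eq_lintegral_ofReal h2 (Filter.Eventually.of_forall hq0)] at h1
  exact (ENNReal.ofReal_le_ofReal_iff (integral_nonneg hΦ0)).1 h1

theorem IsMetricOn.integral_le_of_le (hG : IsMetricOn G U)
    (he : e ∈ IsManifold.maximalAtlas (𝓡 n) ∞ M) {Φ : M → ℝ} (hΦ : Integrable Φ (volMeasure G U))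
    (hΦ0 : ∀ p, 0 ≤ Φ p) (hΦs : ∀ p ∉ e.source, Φ p = 0) {q : V → ℝ} (hq : Integrable q)
    (hq0 : ∀ z, 0 ≤ q z)
    (hle : ∀ z ∈ dom e U, Real.sqrt (gram G e z).det * Φ (e.symm z) ≤ q z) :
    ∫ p, Φ p ∂(volMeasure G U) ≤ ∫ z, q z := by
  have hS := (hG.isOpen_dom e).measurableSet
  rw [← ENNReal.ofReal_le_ofReal_iff (integral_nonneg hq0),
    ofReal_integral_eq_lintegral_ofReal hΦ (Filter.Eventually.of_forall hΦ0),
    ofReal_integral_eq_lintegral_ofReal hq (Filter.Eventually.of_forall hq0)]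
  rw [← setLIntegral_eq_of_support_subset (s := e.source)]
  · refine (hG.lintegral_source_le he hΦ.1.aemeasurable.ennreal_ofReal).trans ?_
    refine le_trans ?_ (setLIntegral_le_lintegral (dom e U) _)
    refine setLIntegral_mono' hS fun z hz => ?_
    rw [density, ← ENNReal.ofReal_mul (Real.sqrt_nonneg _)]
    exact ENNReal.ofReal_le_ofReal (hle z hz)
  · intro p hp
    by_contra hps
    exact hp (by simp [hΦs p hps])

end Transfer

/-! ### Localized components and their derivatives. -/

section Localization

set_option linter.unusedSectionVars false

variable {n : ℕ} {M : Type*} [TopologicalSpace M] [ChartedSpace (EuclideanSpace ℝ (Fin n)) M]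
  [IsManifold (𝓡 n) ∞ M] [SecondCountableTopology M] [MeasurableSpace M] [BorelSpace M]
  {e : OpenPartialHomeomorph M (EuclideanSpace ℝ (Fin n))} {g : TwoTensor n M} {K Ω : Set M}
  {x χ : M → ℝ} {h : TwoTensor n M} {o : Fin n} {C : ℝ} {u : M → Fibre n 3} {w : M → Fibre n 4}

local notation "V" => EuclideanSpace ℝ (Fin n)

/-- The component `χ u_J` in the chart `e`, extended by zero. -/
def localized (x : M → ℝ) (h : TwoTensor n M)
    (e : OpenPartialHomeomorph M (EuclideanSpace ℝ (Fin n))) (K : Set M) (χ : M → ℝ)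
    (u : M → Fibre n 3) (J : Fin 3 → Fin n) : EuclideanSpace ℝ (Fin n) → ℂ :=
  (dom e (K ∩ interiorX x)).indicator fun z => (χ (e.symm z) : ℂ) * chartComp x h e u J z

/-- The components of the first derivatives of `χ u_J` that do not involve `∇ u`, for the
connection with Christoffel symbols `Γ`. -/
def localizedLot (x : M → ℝ) (h : TwoTensor n M)
    (e : OpenPartialHomeomorph M (EuclideanSpace ℝ (Fin n))) (χ : M → ℝ)
    (c : Fin n → ℝ) (Γ : Fin n → Fin n → Fin n → ℝ) (u : M → Fibre n 3)
    (z : EuclideanSpace ℝ (Fin n)) : (Fin 4 → Fin n) → ℂ :=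
  lot (fun l => pd l (fun y => χ (e.symm y)) z + χ (e.symm z) * c l)
    (fun q k l => χ (e.symm z) * Γ q k l) fun J => chartComp x h e u J z

/-- The partial derivatives of `localized`. -/
def localizedGrad (x : M → ℝ) (h : TwoTensor n M)
    (e : OpenPartialHomeomorph M (EuclideanSpace ℝ (Fin n))) (K : Set M) (χ : M → ℝ)
    (u : M → Fibre n 3) (w : M → Fibre n 4) (J : Fin 3 → Fin n) (l : Fin n) :
    EuclideanSpace ℝ (Fin n) → ℂ :=
  (dom e (K ∩ interiorX x)).indicator fun z =>
    (χ (e.symm z) : ℂ) * chartComp x h e w (Fin.snoc J l) z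
      + localizedLot x h e χ 0 (christoffel (scMetric x h) e z) u z (Fin.snoc J l)

theorem memLp_ofReal_mul {S : Set V} (hS : MeasurableSet S) {a : V → ℝ} (ha : ContinuousOn a S)
    (hC : ∀ z ∈ S, |a z| ≤ C) {f : V → ℂ} (hf : MemLp f 2 (volume.restrict S)) :
    MemLp (fun z => (a z : ℂ) * f z) 2 (volume.restrict S) := by
  refine hf.of_le_mul (c := C) ((Complex.continuous_ofReal.comp_aestronglyMeasurable
    (ha.aestronglyMeasurable hS)).mul hf.1)
    ((ae_restrict_iff' hS).2 (Filter.Eventually.of_forall fun z hz => ?_))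
  rw [norm_mul, Complex.norm_real]
  exact mul_le_mul_of_nonneg_right (hC z hz) (norm_nonneg _)

theorem GoodChart.memLp_chartComp (hc : GoodChart x h g e o K) (hC : ChartBounds x h g e K C)
    (hsc : IsMetricOn (scMetric x h) (interiorX x)) {k : ℕ} {f : M → Fibre n k}
    (hf : MemLp f 2 (volMeasure (scMetric x h) (interiorX x))) (J : Fin k → Fin n) :
    MemLp (chartComp x h e f J) 2 (volume.restrict (dom e (K ∩ interiorX x))) := by
  have hsub : dom e (K ∩ interiorX x) ⊆ dom e (interiorX x) := fun z hz => ⟨hz.1, hz.2.2⟩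
  have hC0 : 0 < C := one_pos.trans_le hC.one_le
  obtain ⟨D, hD⟩ := hsc.exists_eLpNorm_tact_le hc.mem hc.closed.measurableSet hsub (inv_pos.2 hC0)
    hC0.le hC.le_dens hC.gram k
  exact ⟨(hsc.aestronglyMeasurable_tact hc.mem hf.1 J).mono_measure
    (Measure.restrict_mono hsub le_rfl),
    (hD f hf.1 J).trans_lt (ENNReal.mul_lt_top (by simp) hf.2)⟩

/-- The cutoff kills everything off K, and the coordinate image of K ∩ {x > 0} is closed in the
whole Euclidean space, so extension by zero creates no boundary terms. Square integrability uses the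
uniform lower bound on the density and the bounds on the frame matrices. -/
theorem GoodChart.isH1_localized (hc : GoodChart x h g e o K) (hC : ChartBounds x h g e K C)
    (hsc : IsMetricOn (scMetric x h) (interiorX x)) (hχ : ContMDiff (𝓡 n) 𝓘(ℝ, ℝ) ∞ χ)
    (hχ0 : ∀ p ∉ K, χ p = 0) (hR : IsRep x h Ω u w) (J : Fin 3 → Fin n) :
    IsH1 (localized x h e K χ u J) (localizedGrad x h e K χ u w J) := by
  have hsub : dom e (K ∩ interiorX x) ⊆ dom e (interiorX x) := fun z hz => ⟨hz.1, hz.2.2⟩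
  have hS := hsc.isOpen_dom e
  have hK := hc.closed.measurableSet
  have hX : ContDiffOn ℝ ∞ (fun z => χ (e.symm z)) (dom e (interiorX x)) :=
    (contDiffOn_comp_symm hχ hc.mem).mono inter_subset_left
  obtain ⟨D, hD⟩ := hc.cut χ hχ
  have hXc := hX.continuousOn.mono hsub
  have hXD : ∀ z ∈ dom e (K ∩ interiorX x), |χ (e.symm z)| ≤ D := fun z hz => (hD z hz).1
  have hX0 : ∀ z ∈ dom e (interiorX x), z ∉ dom e (K ∩ interiorX x) → χ (e.symm z) = 0 :=
    fun z hz hzK => hχ0 _ fun h => hzK ⟨hz.1, h, hz.2⟩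
  have hpd0 : ∀ z ∈ dom e (interiorX x), z ∉ dom e (K ∩ interiorX x) →
      ∀ l, pd l (fun y => χ (e.symm y)) z = 0 := by
    intro z hz hzK l
    have h1 : (fun y => χ (e.symm y)) =ᶠ[nhds z] fun _ => 0 := by
      filter_upwards [(hS.sdiff hc.closed).mem_nhds ⟨hz, hzK⟩] with y hy using hX0 y hy.1 hy.2
    rw [pd_congr h1, pd_const]
  have hu := fun J => hc.memLp_chartComp hC hsc hR.memLp J
  refine ⟨(memLp_indicator_iff_restrict hK).2 (memLp_ofReal_mul hK hXc hXD (hu J)),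
    fun l => (memLp_indicator_iff_restrict hK).2 ?_, fun l => ?_⟩
  · refine (memLp_ofReal_mul hK hXc hXD (hc.memLp_chartComp hC hsc hR.memLp_grad _)).add ?_
    simp only [localizedLot, lot, Fin.snoc_last, Fin.init_snoc, Pi.zero_apply, mul_zero, add_zero]
    refine (memLp_ofReal_mul hK ((contDiffOn_pd hX hS l).continuousOn.mono hsub)
      (fun z hz => (hD z hz).2 l) (hu J)).add
      (memLp_finsetSum _ fun a _ => memLp_finsetSum _ fun q _ => ?_)
    refine memLp_ofReal_mul hK (C := D * C) (hXc.mul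
      ((hsc.contDiffOn_christoffel hc.mem _ _ _).continuousOn.mono hsub)) (fun z hz => ?_) (hu _)
    refine (abs_mul _ _).le.trans ?_
    exact mul_le_mul (hXD z hz) (hC.chr_sc z hz _ _ _) (abs_nonneg _)
      ((abs_nonneg _).trans (hXD z hz))
  · refine IsWeakPartial.extend hc.closed hS hsub
      (((hR.weak e hc.mem J l).smul_smooth hS hX).congr_ae hS.measurableSet
        ((ae_restrict_iff' hS.measurableSet).2 (Filter.Eventually.of_forall fun z hz => ?_))
        ((ae_restrict_iff' hS.measurableSet).2 (Filter.Eventually.of_forall fun z hz => ?_)))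
      (fun z hz => indicator_of_notMem hz _) (fun z hz => indicator_of_notMem hz _)
    · by_cases hzK : z ∈ dom e (K ∩ interiorX x)
      · rw [localized, indicator_of_mem hzK]; exact Complex.real_smul
      · rw [localized, indicator_of_notMem hzK]
        simp [hX0 z hz hzK]
    · by_cases hzK : z ∈ dom e (K ∩ interiorX x)
      · rw [localizedGrad, indicator_of_mem hzK]
        simp only [localizedLot, lot, Fin.snoc_last, Fin.init_snoc, Pi.zero_apply, mul_zero,
          add_zero, Fin.snoc_castSucc, Complex.real_smul, Complex.ofReal_mul, mul_add,
          Finset.mul_sum, mul_assoc]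
        ring
      · rw [localizedGrad, indicator_of_notMem hzK]
        simp [hX0 z hz hzK, hpd0 z hz hzK l]

theorem conjDeriv_localized (s : Fin n → ℝ) {z : V} (hz : z ∈ dom e (K ∩ interiorX x)) :
    conjDeriv s (localized x h e K χ u) (localizedGrad x h e K χ u w) z
      = fun J => (χ (e.symm z) : ℂ) * chartComp x h e w J z
        + localizedLot x h e χ s (christoffel (scMetric x h) e z) u z J := by
  funext J
  rw [conjDeriv, localized, localizedGrad, indicator_of_mem hz, indicator_of_mem hz,
    Fin.snoc_init_self]
  simp only [localizedLot, lot, Pi.zero_apply, mul_zero, add_zero, Complex.ofReal_add,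
    Complex.ofReal_mul]
  ring

/-- The whole dependence on F sits in the conjugated derivative of u for g. The remainder contains
only derivatives of χ and the Christoffel symbols of g, so its bound is independent of F, as the
final absorption requires. -/
theorem GoodChart.conjDeriv_localized (hc : GoodChart x h g e o K)
    (hx : ContMDiff (𝓡 n) 𝓘(ℝ, ℝ) ∞ x)
    (hsc : IsMetricOn (scMetric x h) (interiorX x)) (hg : IsMetricOn g univ) (F : ℝ)
    {z : V} (hz : z ∈ dom e (K ∩ interiorX x)) :
    conjDeriv (Pi.single o F) (localized x h e K χ u) (localizedGrad x h e K χ u w) z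
      = fun J => (χ (e.symm z) : ℂ) *
          chartComp x h e (fun p => w p + lotField x h g F p (u p)) J z
        + localizedLot x h e χ 0 (christoffel g e z) u z J := by
  have hz' : z ∈ dom e (interiorX x) := ⟨hz.1, hz.2.2⟩
  rw [ScatteringWitten.conjDeriv_localized _ hz]
  funext J
  have h1 : chartComp x h e (fun p => lotField x h g F p (u p)) J z
      = lotChart x h g F e z (fun I => chartComp x h e u I z) J := by
    rw [chartComp_eq_tact, tact_lotField hx hsc hg F hc.mem hz']
    rfl
  rw [chartComp_add, h1, hc.lotChart_eq hsc F hz']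
  simp only [localizedLot, lot, Pi.zero_apply, mul_zero, add_zero, Complex.ofReal_add,
    Complex.ofReal_mul, Complex.ofReal_sub, sub_mul, mul_add, Finset.sum_sub_distrib, mul_sub,
    Finset.mul_sum, mul_assoc]
  ring

theorem ChartBounds.norm_localizedLot_le (hC : ChartBounds x h g e K C) {D : ℝ}
    (hχ1 : ∀ p, |χ p| ≤ 1) (hD : ∀ z ∈ dom e (K ∩ interiorX x), ∀ l,
      |pd l (fun y => χ (e.symm y)) z| ≤ D) {z : V}
    (hz : z ∈ dom e (K ∩ interiorX x)) {Γ : Fin n → Fin n → Fin n → ℝ} (hΓ : ∀ q k l, |Γ q k l| ≤ C)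
    (J : Fin 4 → Fin n) :
    ‖localizedLot x h e χ 0 Γ u z J‖
      ≤ (1 + 3 * n) * ((|D| + C) * ((n : ℝ) ^ 3 * C ^ 3)) * ‖u (e.symm z)‖ := by
  have hC0 : 0 ≤ C := zero_le_one.trans hC.one_le
  have h1 : ∀ I, ‖chartComp x h e u I z‖ ≤ (n : ℝ) ^ 3 * (‖u (e.symm z)‖ * C ^ 3) := fun I =>
    norm_tact_le _ _ (hC.frameMat _ hz) (fun I => PiLp.norm_apply_le _ I) I
  have h2 := norm_lot_le (n := n) (k := 3) (B := |D| + C) (by positivity)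
    (c := fun l => pd l (fun y => χ (e.symm y)) z + χ (e.symm z) * (0 : Fin n → ℝ) l)
    (D := fun q k l => χ (e.symm z) * Γ q k l) (fun l => ?_) (fun q k l => ?_) h1 J
  · refine h2.trans (le_of_eq ?_)
    push_cast
    ring
  · simp only [Pi.zero_apply, mul_zero, add_zero]
    have := (hD z hz l).trans (le_abs_self D)
    linarith
  · rw [abs_mul]
    have := mul_le_mul (hχ1 (e.symm z)) (hΓ q k l) (abs_nonneg _) zero_le_one
    have := abs_nonneg D
    linarith

end Localization
end ScatteringWitten
end

noncomputable section
namespace ScatteringWitten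

/-! ### The symmetrized derivative in a good chart. -/

section Coercive

set_option linter.unusedSectionVars false

variable {n : ℕ} {M : Type*} [TopologicalSpace M] [ChartedSpace (EuclideanSpace ℝ (Fin n)) M]
  [IsManifold (𝓡 n) ∞ M] [SecondCountableTopology M] [MeasurableSpace M] [BorelSpace M]
  {e : OpenPartialHomeomorph M (EuclideanSpace ℝ (Fin n))} {g : TwoTensor n M} {K Ω : Set M}
  {x χ : M → ℝ} {h : TwoTensor n M} {o : Fin n} {C D : ℝ} {u : M → Fibre n 3} {w : M → Fibre n 4}

local notation "V" => EuclideanSpace ℝ (Fin n)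

theorem IsMetricOn.contDiffOn_sqrt_det {G : TwoTensor n M} {U : Set M} (hG : IsMetricOn G U)
    (he : e ∈ IsManifold.maximalAtlas (𝓡 n) ∞ M) :
    ContDiffOn ℝ ∞ (fun z => Real.sqrt (gram G e z).det) (dom e U) :=
  (hG.contDiffOn_det he).sqrt fun _ hz => (hG.posDef he hz).det_pos.ne'

theorem IsMetricOn.contDiffOn_inv {G : TwoTensor n M} {U : Set M} (hG : IsMetricOn G U)
    (he : e ∈ IsManifold.maximalAtlas (𝓡 n) ∞ M) (i j : Fin n) :
    ContDiffOn ℝ ∞ (fun z => (gram G e z)⁻¹ i j) (dom e U) :=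
  contDiffOn_inv_entry (hG.smooth e he) (fun _ hz => (hG.posDef he hz).det_pos.ne') i j

/-- The coefficients of the cross term in the Korn inequality. -/
def kornCoeff (x : M → ℝ) (h : TwoTensor n M)
    (e : OpenPartialHomeomorph M (EuclideanSpace ℝ (Fin n))) (I L : Fin 4 → Fin n)
    (z : EuclideanSpace ℝ (Fin n)) : ℝ :=
  Real.sqrt (gram (scMetric x h) e z).det * crossCoeff (gram (scMetric x h) e z)⁻¹ I L

theorem contDiffOn_kornCoeff (hsc : IsMetricOn (scMetric x h) (interiorX x))
    (he : e ∈ IsManifold.maximalAtlas (𝓡 n) ∞ M) (I L : Fin 4 → Fin n) :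
    ContDiffOn ℝ ∞ (kornCoeff x h e I L) (dom e (interiorX x)) :=
  (hsc.contDiffOn_sqrt_det he).mul ((((hsc.contDiffOn_inv he _ _).mul (hsc.contDiffOn_inv he _ _)).mul
    (hsc.contDiffOn_inv he _ _)).mul (hsc.contDiffOn_inv he _ _))

theorem GoodChart.bddC1_kornCoeff (hc : GoodChart x h g e o K)
    (hsc : IsMetricOn (scMetric x h) (interiorX x)) (I L : Fin 4 → Fin n) :
    BddC1 (dom e (K ∩ interiorX x)) (kornCoeff x h e I L) := by
  have hsub : dom e (K ∩ interiorX x) ⊆ dom e (interiorX x) := fun z hz => ⟨hz.1, hz.2.2⟩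
  have hS := hsc.isOpen_dom e
  have hi := fun i j => hsc.contDiffOn_inv hc.mem i j
  exact hc.dens.mul ((((hc.inv _ _).mul (hc.inv _ _) hS hsub (hi _ _) (hi _ _)).mul (hc.inv _ _) hS
    hsub ((hi _ _).mul (hi _ _)) (hi _ _)).mul (hc.inv _ _) hS hsub
    (((hi _ _).mul (hi _ _)).mul (hi _ _)) (hi _ _)) hS hsub (hsc.contDiffOn_sqrt_det hc.mem)
    ((((hi _ _).mul (hi _ _)).mul (hi _ _)).mul (hi _ _))

/-- The density of the squared norm of the symmetrized conjugated derivative of `χ u`. -/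
def symDensity (x : M → ℝ) (h : TwoTensor n M)
    (e : OpenPartialHomeomorph M (EuclideanSpace ℝ (Fin n))) (K : Set M) (χ : M → ℝ)
    (u : M → Fibre n 3) (w : M → Fibre n 4) (s : Fin n → ℝ) : EuclideanSpace ℝ (Fin n) → ℝ :=
  (dom e (K ∩ interiorX x)).indicator fun z => Real.sqrt (gram (scMetric x h) e z).det *
    ∑ I, ‖tact (frameComp (scMetric x h) (interiorX x) e z)
      (symArr (conjDeriv s (localized x h e K χ u) (localizedGrad x h e K χ u w) z)) I‖ ^ 2

theorem symDensity_nonneg (s : Fin n → ℝ) (z : V) : 0 ≤ symDensity x h e K χ u w s z :=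
  indicator_nonneg (fun z _ => mul_nonneg (Real.sqrt_nonneg _)
    (Finset.sum_nonneg fun I _ => by positivity)) z

theorem isInitSymmetric_conjDeriv (hR : IsRep x h Ω u w) (s : Fin n → ℝ) {z : V}
    (hz : z ∈ dom e (K ∩ interiorX x)) :
    IsInitSymmetric (conjDeriv s (localized x h e K χ u) (localizedGrad x h e K χ u w) z) := by
  rw [conjDeriv_localized s hz]
  intro σ hσ J
  have h2 : IsInitSymmetric (tact (frameMat (scMetric x h) (interiorX x) e z) (w (e.symm z))) :=
    (hR.symm_grad (e.symm z)).tact _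
  have hsym : ∀ (σ : Equiv.Perm (Fin 3)) (J : Fin 3 → Fin n),
      chartComp x h e u (J ∘ σ) z = chartComp x h e u J z := fun σ J =>
    chartComp_perm hR.symm e σ J z
  have h3 : IsInitSymmetric (localizedLot x h e χ s (christoffel (scMetric x h) e z) u z) := by
    unfold localizedLot
    exact isInitSymmetric_lot hsym
  have h4 : chartComp x h e w (J ∘ σ) z = chartComp x h e w J z := h2 σ hσ J
  have h5 := h3 σ hσ J
  simp only [h4, h5]

/-- This is the pointwise hypothesis of the Korn inequality, with t' the derivative conjugated by
−s. In the constant, C⁻¹ bounds the density from below, and the other factor is the loss in passing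
from frame components to coordinate components. -/
theorem GoodChart.le_symDensity (hc : GoodChart x h g e o K) (hC : ChartBounds x h g e K C)
    (hsc : IsMetricOn (scMetric x h) (interiorX x)) (hR : IsRep x h Ω u w) (s : Fin n → ℝ) {z : V}
    (hz : z ∈ dom e (K ∩ interiorX x)) :
    (C⁻¹ * ((n : ℝ) ^ (3 * 4) * C ^ (2 * 4))⁻¹ / 4) *
        ∑ I, ‖conjDeriv s (localized x h e K χ u) (localizedGrad x h e K χ u w) z I‖ ^ 2
      + (3 / 4) * (∑ I, ∑ L, (kornCoeff x h e I L z : ℂ) * kornBracket s (localized x h e K χ u)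
          (localizedGrad x h e K χ u w) I L z).re
      ≤ symDensity x h e K χ u w s z := by
  have hz' : z ∈ dom e (interiorX x) := ⟨hz.1, hz.2.2⟩
  have hC0 : 0 < C := one_pos.trans_le hC.one_le
  have hn : 0 < (n : ℝ) := by exact_mod_cast o.pos
  set N : ℝ := (n : ℝ) ^ (3 * 4) * C ^ (2 * 4) with hN
  have hN0 : 0 < N := by positivity
  set t := conjDeriv s (localized x h e K χ u) (localizedGrad x h e K χ u w) z with ht
  set B := frameComp (scMetric x h) (interiorX x) e z with hB
  set ρ := Real.sqrt (ScatteringWitten.gram (scMetric x h) e z).det with hρ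
  have hts : IsInitSymmetric t := isInitSymmetric_conjDeriv hR s hz
  have key := sum_norm_symArr_ge B t
    (conjDeriv (-s) (localized x h e K χ u) (localizedGrad x h e K χ u w) z) hts
  rw [hB, hsc.frameComp_mul_transpose hc.mem hz', ← hB] at key
  have hlow : N⁻¹ * ∑ I, ‖t I‖ ^ 2 ≤ ∑ I, ‖tact B t I‖ ^ 2 := by
    rw [inv_mul_le_iff₀ hN0]
    have h1 := sum_norm_sq_tact_le (hC.frameMat z hz) (tact B t)
    rwa [hsc.tact_frameMat_tact_frameComp hc.mem hz'] at h1
  have hsum : ∑ I, ∑ L, (kornCoeff x h e I L z : ℂ) * kornBracket s (localized x h e K χ u)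
          (localizedGrad x h e K χ u w) I L z
      = (ρ : ℂ) * ∑ I, ∑ L, (crossCoeff (ScatteringWitten.gram (scMetric x h) e z)⁻¹ I L : ℂ) *
          (t (Function.update I 3 (L 3)) * (starRingEnd ℂ) (t (Function.update L 3 (I 3)))
            - conjDeriv (-s) (localized x h e K χ u) (localizedGrad x h e K χ u w) z I *
              (starRingEnd ℂ) (conjDeriv (-s) (localized x h e K χ u)
                (localizedGrad x h e K χ u w) z L)) := by
    simp only [Finset.mul_sum]
    refine Finset.sum_congr rfl fun I _ => Finset.sum_congr rfl fun L _ => ?_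
    rw [kornCoeff, Complex.ofReal_mul, mul_assoc]
    rfl
  rw [hsum, Complex.re_ofReal_mul, symDensity, indicator_of_mem hz]
  have hρ0 : 0 ≤ ρ := Real.sqrt_nonneg _
  have hρC : C⁻¹ ≤ ρ := hC.le_dens z hz
  have h2 := mul_le_mul_of_nonneg_left key hρ0
  refine le_trans ?_ h2
  have h3 : C⁻¹ * (N⁻¹ * ∑ I, ‖t I‖ ^ 2) ≤ ρ * ∑ I, ‖tact B t I‖ ^ 2 :=
    mul_le_mul hρC hlow (by positivity) hρ0
  rw [mul_add]
  refine add_le_add (le_trans (le_of_eq ?_) ((mul_le_mul_of_nonneg_left h3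
    (by norm_num : (0 : ℝ) ≤ 1 / 4)).trans (le_of_eq ?_))) (le_of_eq ?_)
  · ring
  · ring
  · ring

/-- In the frame the symmetrized derivative of χu is χ d_F u plus a remainder bounded by |u| with a
constant independent of F; |a + b|² ≤ 2|a|² + 2|b|² separates the two. -/
theorem GoodChart.integral_symDensity_le (hc : GoodChart x h g e o K)
    (hC : ChartBounds x h g e K C) (hx : ContMDiff (𝓡 n) 𝓘(ℝ, ℝ) ∞ x)
    (hsc : IsMetricOn (scMetric x h) (interiorX x)) (hg : IsMetricOn g univ)
    (hχ : ContMDiff (𝓡 n) 𝓘(ℝ, ℝ) ∞ χ) (hχ1 : ∀ p, |χ p| ≤ 1) (hχ0 : ∀ p ∉ K, χ p = 0)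
    (hD : ∀ z ∈ dom e (K ∩ interiorX x), ∀ l, |pd l (fun y => χ (e.symm y)) z| ≤ D)
    (hR : IsRep x h Ω u w) (F : ℝ)
    (hE : MemLp (fun p => symmetrize (w p + lotField x h g F p (u p))) 2
      (volMeasure (scMetric x h) (interiorX x))) :
    Integrable (symDensity x h e K χ u w (Pi.single o F)) ∧
    ∫ z, symDensity x h e K χ u w (Pi.single o F) z
      ≤ 2 * (∫ p, ‖symmetrize (w p + lotField x h g F p (u p))‖ ^ 2
          ∂(volMeasure (scMetric x h) (interiorX x)))
        + 2 * ((n : ℝ) ^ (3 * 4) * C ^ (2 * 4) * ((n : ℝ) ^ 4 *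
          ((1 + 3 * n) * ((|D| + C) * ((n : ℝ) ^ 3 * C ^ 3))) ^ 2)) *
          ∫ p, ‖u p‖ ^ 2 ∂(volMeasure (scMetric x h) (interiorX x)) := by
  have hsub : dom e (K ∩ interiorX x) ⊆ dom e (interiorX x) := fun z hz => ⟨hz.1, hz.2.2⟩
  have hK := hc.closed.measurableSet
  have hC0 : 0 < C := one_pos.trans_le hC.one_le
  set N : ℝ := (n : ℝ) ^ (3 * 4) * C ^ (2 * 4) with hN
  have hN0 : 0 ≤ N := by positivity
  set L : ℝ := (1 + 3 * n) * ((|D| + C) * ((n : ℝ) ^ 3 * C ^ 3)) with hL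
  have hL0 : 0 ≤ L := by positivity
  have i1 := hE.integrable_norm_pow (p := 2) (by norm_num)
  have i2 := hR.memLp.integrable_norm_pow (p := 2) (by norm_num)
  rw [← integral_const_mul, ← integral_const_mul, ← integral_add (i1.const_mul _) (i2.const_mul _)]
  refine hsc.integrable_of_le hc.mem ((i1.const_mul _).add (i2.const_mul _)) (fun p => ?_) ?_
    (fun z => symDensity_nonneg _ z) (fun z hz => indicator_of_notMem (fun h => hz (hsub h)) _)
    fun z hz => ?_
  · simp only [Pi.add_apply]; positivity
  · refine (aestronglyMeasurable_indicator_iff hK).2 ?_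
    refine (((hsc.contDiffOn_sqrt_det hc.mem).continuousOn.mono hsub).aestronglyMeasurable hK).mul
      (Finset.aestronglyMeasurable_fun_sum _ fun I _ => ?_)
    refine (AEStronglyMeasurable.norm ?_).pow 2
    refine ScatteringWitten.aestronglyMeasurable_tact (fun i j => (hsc.aemeasurable_frameComp hc.mem i j).mono_measure
      (Measure.restrict_mono hsub le_rfl)) (fun J => ?_) I
    simp only [symArr]
    refine (Finset.aestronglyMeasurable_fun_sum _ fun σ _ => ?_).const_mul _
    have H := fun J => hc.isH1_localized hC hsc hχ hχ0 hR J
    exact (((H _).memLp_grad _).1.add ((H _).memLp.1.const_mul _)).restrict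
  · by_cases hzK : z ∈ dom e (K ∩ interiorX x)
    swap
    · rw [symDensity, indicator_of_notMem hzK]
      simp only [Pi.add_apply]; positivity
    rw [symDensity, indicator_of_mem hzK]
    refine mul_le_mul_of_nonneg_left ?_ (Real.sqrt_nonneg _)
    rw [hc.conjDeriv_localized hx hsc hg F hzK, symArr_add, symArr_const_mul, tact_add,
      tact_const_mul]
    have h1 : tact (frameComp (scMetric x h) (interiorX x) e z)
        (symArr fun J => chartComp x h e (fun p => w p + lotField x h g F p (u p)) J z)
        = symmetrize (w (e.symm z) + lotField x h g F (e.symm z) (u (e.symm z))) := by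
      rw [tact_symArr]
      have h2 := hsc.tact_frameComp_tact_frameMat hc.mem hz
        (w (e.symm z) + lotField x h g F (e.symm z) (u (e.symm z)))
      exact congrArg symArr h2
    rw [h1]
    set R := localizedLot x h e χ 0 (christoffel g e z) u z with hRdef
    have h3 : ∀ J, ‖symArr R J‖ ≤ L * ‖u (e.symm z)‖ := norm_symArr_le R
      (hC.norm_localizedLot_le hχ1 hD hzK (hC.chr z hzK))
    have h4 : ∑ J, ‖symArr R J‖ ^ 2 ≤ (n : ℝ) ^ 4 * (L ^ 2 * ‖u (e.symm z)‖ ^ 2) := by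
      refine (Finset.sum_le_sum fun J _ => pow_le_pow_left₀ (norm_nonneg _) (h3 J) 2).trans
        (le_of_eq ?_)
      simp only [Finset.sum_const, Finset.card_univ, Fintype.card_fun, Fintype.card_fin,
        nsmul_eq_mul]
      push_cast; ring
    have h5 := (sum_norm_sq_tact_le (hC.frameComp z hzK) (symArr R)).trans
      (mul_le_mul_of_nonneg_left h4 hN0)
    simp only [Pi.add_apply]
    rw [norm_sq_eq_sum (symmetrize _), Finset.mul_sum]
    refine (Finset.sum_le_sum fun I _ => norm_add_sq_le _ _).trans ?_
    rw [Finset.sum_add_distrib]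
    refine add_le_add (Finset.sum_le_sum fun I _ => ?_) ?_
    · refine mul_le_mul_of_nonneg_left (pow_le_pow_left₀ (norm_nonneg _) ?_ 2) (by norm_num)
      rw [norm_mul, Complex.norm_real]
      exact mul_le_of_le_one_left (norm_nonneg _) (hχ1 _)
    · rw [← Finset.mul_sum]
      refine (mul_le_mul_of_nonneg_left h5 (by norm_num)).trans (le_of_eq ?_)
      ring

end Coercive
end ScatteringWitten
end

noncomputable section
namespace ScatteringWitten

/-! ### From the chart estimate back to the manifold. -/

section Reverse

set_option linter.unusedSectionVars false

variable {n : ℕ} {M : Type*} [TopologicalSpace M] [ChartedSpace (EuclideanSpace ℝ (Fin n)) M]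
  [IsManifold (𝓡 n) ∞ M] [SecondCountableTopology M] [MeasurableSpace M] [BorelSpace M]
  {e : OpenPartialHomeomorph M (EuclideanSpace ℝ (Fin n))} {g : TwoTensor n M} {K Ω : Set M}
  {x χ : M → ℝ} {h : TwoTensor n M} {o : Fin n} {C D : ℝ} {u : M → Fibre n 3} {w : M → Fibre n 4}

local notation "V" => EuclideanSpace ℝ (Fin n)

theorem integrable_sq_mul {k : ℕ} {μ : Measure M} (hχ : ContMDiff (𝓡 n) 𝓘(ℝ, ℝ) ∞ χ)
    (hχ1 : ∀ p, |χ p| ≤ 1) {f : M → Fibre n k} (hf : MemLp f 2 μ) :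
    Integrable (fun p => χ p ^ 2 * ‖f p‖ ^ 2) μ := by
  refine (hf.integrable_norm_pow (p := 2) (by norm_num)).bdd_mul (c := 1)
    (hχ.continuous.pow 2).aestronglyMeasurable (Filter.Eventually.of_forall fun p => ?_)
  rw [Real.norm_eq_abs, abs_pow]
  exact pow_le_one₀ (abs_nonneg _) (hχ1 p)

theorem sq_mul_norm_sq_le {A B : Matrix (Fin n) (Fin n) ℝ} {k : ℕ} (hB : ∀ i j, |B i j| ≤ C)
    (hAB : ∀ t : (Fin k → Fin n) → ℂ, tact B (tact A t) = t) (r : ℝ) (t : Fibre n k) :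
    r ^ 2 * ‖t‖ ^ 2 ≤ (n : ℝ) ^ (3 * k) * C ^ (2 * k) * ∑ J, ‖(r : ℂ) * tact A t J‖ ^ 2 := by
  have h1 := sum_norm_sq_tact_le hB fun J => (r : ℂ) * tact A t J
  refine le_trans (le_of_eq ?_) h1
  rw [tact_const_mul, hAB, norm_sq_eq_sum, Finset.mul_sum]
  refine Finset.sum_congr rfl fun J _ => ?_
  rw [norm_mul, mul_pow, Complex.norm_real, Real.norm_eq_abs, sq_abs]

theorem GoodChart.integral_sq_mul_le (hc : GoodChart x h g e o K) (hC : ChartBounds x h g e K C)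
    (hsc : IsMetricOn (scMetric x h) (interiorX x))
    (hχ : ContMDiff (𝓡 n) 𝓘(ℝ, ℝ) ∞ χ) (hχ1 : ∀ p, |χ p| ≤ 1) (hχ0 : ∀ p ∉ K, χ p = 0)
    (hR : IsRep x h Ω u w) :
    ∫ p, χ p ^ 2 * ‖u p‖ ^ 2 ∂(volMeasure (scMetric x h) (interiorX x))
      ≤ C * ((n : ℝ) ^ (3 * 3) * C ^ (2 * 3)) * ∑ J, sqNorm (localized x h e K χ u J) := by
  have hC0 : 0 < C := one_pos.trans_le hC.one_le
  have H := fun J => hc.isH1_localized hC hsc hχ hχ0 hR J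
  have i1 := fun J => integrable_norm_sq (H J).memLp
  have h1 : C * ((n : ℝ) ^ (3 * 3) * C ^ (2 * 3)) * ∑ J, sqNorm (localized x h e K χ u J)
      = ∫ z, C * ((n : ℝ) ^ (3 * 3) * C ^ (2 * 3)) * ∑ J, ‖localized x h e K χ u J z‖ ^ 2 := by
    rw [integral_const_mul, integral_finsetSum _ fun J _ => i1 J]
    rfl
  rw [h1]
  refine hsc.integral_le_of_le hc.mem (integrable_sq_mul hχ hχ1 hR.memLp)
    (fun p => by positivity) (fun p hp => ?_) ((integrable_finsetSum _ fun J _ => i1 J).const_mul _)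
    (fun z => by positivity) (fun z hz => ?_)
  · by_cases hpK : p ∈ K
    · have hpU : p ∉ interiorX x := fun hpU => hp (hc.sub ⟨hpK, hpU⟩)
      rw [hR.zero p fun h => hpU h.2]; simp
    · rw [hχ0 p hpK]; simp
  · by_cases hzK : z ∈ dom e (K ∩ interiorX x)
    · rw [mul_assoc]
      refine mul_le_mul (hC.dens_le z hzK) ?_ (by positivity) hC0.le
      refine (sq_mul_norm_sq_le (hC.frameComp z hzK)
        (fun t => hsc.tact_frameComp_tact_frameMat hc.mem hz t) _ _).trans (le_of_eq ?_)
      simp only [localized, indicator_of_mem hzK]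
      rfl
    · rw [hχ0 (e.symm z) fun h => hzK ⟨hz.1, h, hz.2⟩]
      simp only [ne_eq, OfNat.ofNat_ne_zero, not_false_eq_true, zero_pow, zero_mul, mul_zero]
      positivity

theorem GoodChart.integral_sq_mul_grad_le (hc : GoodChart x h g e o K)
    (hC : ChartBounds x h g e K C) (hsc : IsMetricOn (scMetric x h) (interiorX x))
    (hχ : ContMDiff (𝓡 n) 𝓘(ℝ, ℝ) ∞ χ) (hχ1 : ∀ p, |χ p| ≤ 1) (hχ0 : ∀ p ∉ K, χ p = 0)
    (hD : ∀ z ∈ dom e (K ∩ interiorX x), ∀ l, |pd l (fun y => χ (e.symm y)) z| ≤ D)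
    (hR : IsRep x h Ω u w) :
    ∫ p, χ p ^ 2 * ‖w p‖ ^ 2 ∂(volMeasure (scMetric x h) (interiorX x))
      ≤ C * ((n : ℝ) ^ (3 * 4) * C ^ (2 * 4)) * 2 *
          (∑ J, ∑ l, sqNorm (localizedGrad x h e K χ u w J l))
        + 2 * ((n : ℝ) ^ (3 * 4) * C ^ (2 * 4) * ((n : ℝ) ^ 4 *
          ((1 + 3 * n) * ((|D| + C) * ((n : ℝ) ^ 3 * C ^ 3))) ^ 2)) *
          ∫ p, ‖u p‖ ^ 2 ∂(volMeasure (scMetric x h) (interiorX x)) := by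
  have hsub : dom e (K ∩ interiorX x) ⊆ dom e (interiorX x) := fun z hz => ⟨hz.1, hz.2.2⟩
  have hK := hc.closed.measurableSet
  have hC0 : 0 < C := one_pos.trans_le hC.one_le
  set N : ℝ := (n : ℝ) ^ (3 * 4) * C ^ (2 * 4) with hN
  have hN0 : 0 ≤ N := by positivity
  set L : ℝ := (1 + 3 * n) * ((|D| + C) * ((n : ℝ) ^ 3 * C ^ 3)) with hL
  have hL0 : 0 ≤ L := by positivity
  set P := 2 * (N * ((n : ℝ) ^ 4 * L ^ 2)) with hP
  have hP0 : 0 ≤ P := by positivity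
  have H := fun J => hc.isH1_localized hC hsc hχ hχ0 hR J
  have i1 := fun J l => integrable_norm_sq ((H J).memLp_grad l)
  -- The error made in recovering χ∇u from the partial derivatives of χu: terms with dχ and the
  -- Christoffel symbols of g_sc, of size |u|.
  let q : V → ℝ := (dom e (K ∩ interiorX x)).indicator fun z =>
    Real.sqrt (ScatteringWitten.gram (scMetric x h) e z).det * (P * ‖u (e.symm z)‖ ^ 2)
  have hq0 : ∀ z, 0 ≤ q z := fun z =>
    indicator_nonneg (fun z _ => mul_nonneg (Real.sqrt_nonneg _) (by positivity)) z
  have hqi := hsc.integrable_of_le hc.mem (q := q)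
    ((hR.memLp.integrable_norm_pow (p := 2) (by norm_num)).const_mul P) (fun p => by positivity)
    ((aestronglyMeasurable_indicator_iff hK).2
      ((((hsc.contDiffOn_sqrt_det hc.mem).continuousOn.mono hsub).aestronglyMeasurable hK).mul
        ((((hsc.aestronglyMeasurable_chart hc.mem hR.memLp.1).mono_measure
          (Measure.restrict_mono hsub le_rfl)).norm.pow 2).const_mul P))) hq0
    (fun z hz => indicator_of_notMem (fun h => hz (hsub h)) _)
    (fun z hz => by
      by_cases hzK : z ∈ dom e (K ∩ interiorX x)
      · exact (indicator_of_mem hzK _).le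
      · rw [show q z = 0 from indicator_of_notMem hzK _]
        exact mul_nonneg (Real.sqrt_nonneg _) (by positivity))
  rw [integral_const_mul] at hqi
  have iS : Integrable fun z => C * N * 2 *
      ∑ J, ∑ l, ‖localizedGrad x h e K χ u w J l z‖ ^ 2 :=
    (integrable_finsetSum _ fun J _ => integrable_finsetSum _ fun l _ => i1 J l).const_mul _
  have h1 : C * N * 2 * (∑ J, ∑ l, sqNorm (localizedGrad x h e K χ u w J l))
      = ∫ z, C * N * 2 * ∑ J, ∑ l, ‖localizedGrad x h e K χ u w J l z‖ ^ 2 := by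
    rw [integral_const_mul, integral_finsetSum _ fun J _ => integrable_finsetSum _ fun l _ => i1 J l]
    congr 1
    refine Finset.sum_congr rfl fun J _ => ?_
    rw [integral_finsetSum _ fun l _ => i1 J l]
    rfl
  rw [h1]
  refine le_trans ?_ (add_le_add_right hqi.2 _)
  rw [← integral_add iS hqi.1]
  refine hsc.integral_le_of_le hc.mem (integrable_sq_mul hχ hχ1 hR.memLp_grad)
    (fun p => by positivity) (fun p hp => ?_) (iS.add hqi.1)
    (fun z => add_nonneg (by positivity) (hq0 z)) (fun z hz => ?_)
  · by_cases hpK : p ∈ K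
    · have hpU : p ∉ interiorX x := fun hpU => hp (hc.sub ⟨hpK, hpU⟩)
      rw [hR.zero_grad p fun h => hpU h.2]; simp
    · rw [hχ0 p hpK]; simp
  · by_cases hzK : z ∈ dom e (K ∩ interiorX x)
    swap
    · rw [hχ0 (e.symm z) fun h => hzK ⟨hz.1, h, hz.2⟩]
      simp only [ne_eq, OfNat.ofNat_ne_zero, not_false_eq_true, zero_pow, zero_mul, mul_zero]
      exact add_nonneg (by positivity) (hq0 z)
    set ρ := Real.sqrt (ScatteringWitten.gram (scMetric x h) e z).det with hρ
    have hρ0 : 0 ≤ ρ := Real.sqrt_nonneg _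
    have hq : q z = ρ * (P * ‖u (e.symm z)‖ ^ 2) := indicator_of_mem hzK _
    set S := ∑ J, ∑ l, ‖localizedGrad x h e K χ u w J l z‖ ^ 2 with hS
    have hS0 : 0 ≤ S := by positivity
    have h2 := sq_mul_norm_sq_le (hC.frameComp z hzK)
      (fun t => hsc.tact_frameComp_tact_frameMat hc.mem hz t) (χ (e.symm z)) (w (e.symm z))
    have h3 : ∀ J : Fin 4 → Fin n,
        ‖(χ (e.symm z) : ℂ) * tact (frameMat (scMetric x h) (interiorX x) e z) (w (e.symm z)) J‖ ^ 2
        ≤ 2 * (fun J l => ‖localizedGrad x h e K χ u w J l z‖ ^ 2) (Fin.init J) (J (Fin.last 3))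
          + 2 * (L * ‖u (e.symm z)‖) ^ 2 := by
      intro J
      have h4 : (χ (e.symm z) : ℂ) *
          tact (frameMat (scMetric x h) (interiorX x) e z) (w (e.symm z)) J
          = localizedGrad x h e K χ u w (Fin.init J) (J (Fin.last 3)) z
            + -localizedLot x h e χ 0 (christoffel (scMetric x h) e z) u z J := by
        rw [localizedGrad, indicator_of_mem hzK, Fin.snoc_init_self, add_neg_cancel_right]
        rfl
      rw [h4]
      refine (norm_add_sq_le _ _).trans (add_le_add_right (mul_le_mul_of_nonneg_left
        (pow_le_pow_left₀ (norm_nonneg _) ?_ 2) (by norm_num)) _)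
      rw [norm_neg]
      exact hC.norm_localizedLot_le hχ1 hD hzK (hC.chr_sc z hzK) J
    have h5 : ∑ J : Fin 4 → Fin n,
        ‖(χ (e.symm z) : ℂ) * tact (frameMat (scMetric x h) (interiorX x) e z) (w (e.symm z)) J‖ ^ 2
        ≤ 2 * S + 2 * ((n : ℝ) ^ 4 * L ^ 2) * ‖u (e.symm z)‖ ^ 2 := by
      refine (Finset.sum_le_sum fun J _ => h3 J).trans (le_of_eq ?_)
      have hs : ∑ J : Fin 4 → Fin n, (fun J l => ‖localizedGrad x h e K χ u w J l z‖ ^ 2)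
          (Fin.init J) (J (Fin.last 3)) = S :=
        sum_snoc fun J l => ‖localizedGrad x h e K χ u w J l z‖ ^ 2
      rw [Finset.sum_add_distrib, ← Finset.mul_sum, hs]
      simp only [Finset.sum_const, Finset.card_univ, Fintype.card_fun, Fintype.card_fin,
        nsmul_eq_mul]
      push_cast; ring
    have h6 := h2.trans (mul_le_mul_of_nonneg_left h5 hN0)
    rw [hq]
    refine (mul_le_mul_of_nonneg_left h6 hρ0).trans ?_
    have h7 : ρ * (N * 2 * S) ≤ C * (N * 2 * S) :=
      mul_le_mul_of_nonneg_right (hC.dens_le z hzK) (by positivity)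
    have h8 : ρ * (N * (2 * S + 2 * ((n : ℝ) ^ 4 * L ^ 2) * ‖u (e.symm z)‖ ^ 2))
        = ρ * (N * 2 * S) + ρ * (P * ‖u (e.symm z)‖ ^ 2) := by rw [hP]; ring
    rw [h8]
    linarith

/-- Here a and b are the squared norms of d_F u and u, Q and R those of the localized components and
of their gradients, and I and I' the localized norms of u and ∇u. The resulting constant does not
contain F. -/
theorem coercive_arith {κ P A B a b Q R F I I' : ℝ} (hκ : 0 < κ) (hP : 0 ≤ P) (hA : 0 ≤ A)
    (hB : 0 ≤ B) (ha : 0 ≤ a) (hb : 0 ≤ b) (hQ : 0 ≤ Q) (hR : 0 ≤ R)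
    (h₁ : κ / 8 * (R + F ^ 2 * Q) ≤ 2 * a + P * b) (h₂ : I ≤ A * Q) (h₃ : I' ≤ B * R + P * b) :
    F ^ 2 * I + I' ≤ ((A + B) * (8 / κ) * (2 + P) + P) * (a + b) := by
  have hF : 0 ≤ F ^ 2 * Q := by positivity
  have e1 : κ / 8 * (R + F ^ 2 * Q) ≤ (2 + P) * (a + b) := by
    have := mul_nonneg hP ha
    linarith
  have e2 : R + F ^ 2 * Q ≤ (8 / κ) * ((2 + P) * (a + b)) := by
    calc R + F ^ 2 * Q = (8 / κ) * (κ / 8 * (R + F ^ 2 * Q)) := by field_simp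
      _ ≤ _ := mul_le_mul_of_nonneg_left e1 (by positivity)
  have e3 := mul_le_mul_of_nonneg_left e2 (add_nonneg hA hB)
  have e4 := mul_le_mul_of_nonneg_left h₂ (sq_nonneg F)
  have e5 := mul_nonneg hA hR
  have e6 := mul_nonneg hB hF
  have e7 := mul_nonneg hP ha
  calc F ^ 2 * I + I' ≤ (A + B) * (R + F ^ 2 * Q) + P * (a + b) := by linarith
    _ ≤ (A + B) * ((8 / κ) * ((2 + P) * (a + b))) + P * (a + b) := by linarith
    _ = _ := by ring

/-- The coercivity estimate in one good chart. -/
theorem GoodChart.exists_coercive (hc : GoodChart x h g e o K)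
    (hx : ContMDiff (𝓡 n) 𝓘(ℝ, ℝ) ∞ x)
    (hsc : IsMetricOn (scMetric x h) (interiorX x)) (hg : IsMetricOn g univ)
    (hχ : ContMDiff (𝓡 n) 𝓘(ℝ, ℝ) ∞ χ) (hχ1 : ∀ p, |χ p| ≤ 1) (hχ0 : ∀ p ∉ K, χ p = 0) :
    ∃ C F₁ : ℝ, 0 ≤ C ∧ 0 < F₁ ∧ ∀ (Ω : Set M) (u : M → Fibre n 3) (w : M → Fibre n 4),
      IsRep x h Ω u w → ∀ F, F₁ ≤ F →
      MemLp (fun p => symmetrize (w p + lotField x h g F p (u p))) 2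
        (volMeasure (scMetric x h) (interiorX x)) →
      F ^ 2 * (∫ p, χ p ^ 2 * ‖u p‖ ^ 2 ∂(volMeasure (scMetric x h) (interiorX x)))
        + ∫ p, χ p ^ 2 * ‖w p‖ ^ 2 ∂(volMeasure (scMetric x h) (interiorX x))
      ≤ C * ((∫ p, ‖symmetrize (w p + lotField x h g F p (u p))‖ ^ 2
          ∂(volMeasure (scMetric x h) (interiorX x)))
        + ∫ p, ‖u p‖ ^ 2 ∂(volMeasure (scMetric x h) (interiorX x))) := by
  obtain ⟨C, hC⟩ := hc.exists_chartBounds hsc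
  obtain ⟨D, hD'⟩ := hc.cut χ hχ
  have hD : ∀ z ∈ dom e (K ∩ interiorX x), ∀ l, |pd l (fun y => χ (e.symm y)) z| ≤ D :=
    fun z hz => (hD' z hz).2
  have hC0 : 0 < C := one_pos.trans_le hC.one_le
  have hn : 0 < (n : ℝ) := by exact_mod_cast o.pos
  obtain ⟨A, hA0, hA⟩ := BddC1.exists_uniform
    (ι := (Fin 4 → Fin n) × (Fin 4 → Fin n)) fun i => hc.bddC1_kornCoeff hsc i.1 i.2
  set N₃ : ℝ := (n : ℝ) ^ (3 * 3) * C ^ (2 * 3) with hN₃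
  set N₄ : ℝ := (n : ℝ) ^ (3 * 4) * C ^ (2 * 4) with hN₄
  have hN₃0 : 0 < N₃ := by positivity
  have hN₄0 : 0 < N₄ := by positivity
  set P := 2 * (N₄ * ((n : ℝ) ^ 4 *
    ((1 + 3 * n) * ((|D| + C) * ((n : ℝ) ^ 3 * C ^ 3))) ^ 2)) with hP
  have hP0 : 0 ≤ P := by positivity
  -- The coercivity constant supplied by `GoodChart.le_symDensity`; it depends on the chart alone,
  -- so the threshold for F is uniform in u and Ω.
  set κ := C⁻¹ * N₄⁻¹ with hκ
  have hκ0 : 0 < κ := by positivity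
  obtain ⟨F₁, hF₁, hKorn⟩ := exists_korn_const n hκ0 hA0
  refine ⟨(C * N₃ + C * N₄ * 2) * (8 / κ) * (2 + P) + P, F₁, by positivity, hF₁, ?_⟩
  intro Ω u w hR F hF hE
  have hsub : dom e (K ∩ interiorX x) ⊆ dom e (interiorX x) := fun z hz => ⟨hz.1, hz.2.2⟩
  have e1 := hc.integral_symDensity_le hC hx hsc hg hχ hχ1 hχ0 hD hR F hE
  have e2 := hKorn (dom e (interiorX x)) (dom e (K ∩ interiorX x)) (hsc.isOpen_dom e) hc.closed hsub
    (kornCoeff x h e) (contDiffOn_kornCoeff hsc hc.mem) (fun I L z hz => (hA (I, L) z hz).1)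
    (fun I L l z hz => (hA (I, L) z hz).2 l) (localized x h e K χ u) (localizedGrad x h e K χ u w)
    (hc.isH1_localized hC hsc hχ hχ0 hR) (fun J z hz => indicator_of_notMem hz _)
    (fun J l z hz => indicator_of_notMem hz _) o F hF _ e1.1 (symDensity_nonneg _)
    (fun z hz => hc.le_symDensity hC hsc hR _ hz)
  have e3 := hc.integral_sq_mul_le hC hsc hχ hχ1 hχ0 hR
  have e4 := hc.integral_sq_mul_grad_le hC hsc hχ hχ1 hχ0 hD hR
  refine coercive_arith hκ0 hP0 (by positivity) (by positivity)
    (integral_nonneg fun p => by positivity) (integral_nonneg fun p => by positivity)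
    (Finset.sum_nonneg fun J _ => sqNorm_nonneg _)
    (Finset.sum_nonneg fun J _ => Finset.sum_nonneg fun l _ => sqNorm_nonneg _)
    (e2.trans e1.2) e3 e4

end Reverse
end ScatteringWitten
end

noncomputable section
namespace ScatteringWitten

/-! ### Invertibility of δd from a lower bound on d. -/

section LaxMilgram

theorem laplacianOf_apply {H K : Type*} [NormedAddCommGroup H] [InnerProductSpace ℂ H]
    [NormedAddCommGroup K] [InnerProductSpace ℂ K] (d : H →L[ℂ] K) (u v : H) : laplacianOf d u v = ⟪d v, d u⟫_ℂ := rfl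

variable {H K : Type*} [NormedAddCommGroup H] [InnerProductSpace ℂ H] [CompleteSpace H]
  [NormedAddCommGroup K] [InnerProductSpace ℂ K] [CompleteSpace K]

/-- If `d` is bounded below, then `δ d : H → H^*` is invertible. -/
theorem laplacianOf_isInvertible (d : H →L[ℂ] K) {c : ℝ} (hc : 0 < c)
    (hd : ∀ u, c * ‖u‖ ≤ ‖d u‖) : (laplacianOf d).IsInvertible := by
  have hker : (laplacianOf d).ker = ⊥ := by
    rw [LinearMap.ker_eq_bot']
    intro u hu
    have h1 : ⟪d u, d u⟫_ℂ = 0 := by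
      rw [← laplacianOf_apply]
      simpa using congrArg (fun L : H →L⋆[ℂ] ℂ => L u) hu
    rw [inner_self_eq_zero] at h1
    have h2 := hd u
    rw [h1, norm_zero] at h2
    exact norm_eq_zero.1 (le_antisymm (by nlinarith) (norm_nonneg u))
  have hanti : AntilipschitzWith (Real.toNNReal c⁻¹) d :=
    AddMonoidHomClass.antilipschitz_of_bound d fun u => by
      rw [Real.coe_toNNReal _ (by positivity)]
      have := hd u
      rw [inv_mul_eq_div, le_div_iff₀ hc]; linarith
  -- A map bounded below on a complete space has closed range, so the Riesz theorem is available on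
  -- the range.
  have hclosed : IsClosed (Set.range d) := hanti.isClosed_range d.uniformContinuous
  have hcl : IsClosed ((d : H →ₗ[ℂ] K).range : Set K) := by
    convert hclosed using 1; ext y; simp
  have : CompleteSpace ((d : H →ₗ[ℂ] K).range) := hcl.completeSpace_coe
  have hinj : Function.Injective d := hanti.injective
  have hsurj : (laplacianOf d).range = ⊤ := by
    rw [LinearMap.range_eq_top]
    intro L
    let E : H ≃ₗ[ℂ] (d : H →ₗ[ℂ] K).range := LinearEquiv.ofInjective (d : H →ₗ[ℂ] K) hinj
    have hE : ∀ v, ((E v : (d : H →ₗ[ℂ] K).range) : K) = d v := fun v => rfl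
    -- L is antilinear; conjugation makes it linear and `inner_conj_symm` undoes this at the end.
    -- The lower bound on d makes it bounded on the range.
    let l : (d : H →ₗ[ℂ] K).range →ₗ[ℂ] ℂ :=
      { toFun := fun y => (starRingEnd ℂ) (L (E.symm y))
        map_add' := fun y z => by simp
        map_smul' := fun a y => by simp }
    let l' : (d : H →ₗ[ℂ] K).range →L[ℂ] ℂ := l.mkContinuous (‖L‖ * c⁻¹) fun y => by
      have h1 := hd (E.symm y)
      rw [← hE, E.apply_symm_apply] at h1
      have h2 : ‖E.symm y‖ ≤ c⁻¹ * ‖y‖ := by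
        rw [inv_mul_eq_div, le_div_iff₀ hc]
        have h3 : ‖(y : K)‖ = ‖y‖ := rfl
        rw [h3] at h1; linarith
      calc ‖l y‖ = ‖L (E.symm y)‖ := by simp [l]
        _ ≤ ‖L‖ * ‖E.symm y‖ := L.le_opNorm _
        _ ≤ ‖L‖ * (c⁻¹ * ‖y‖) := by gcongr
        _ = _ := by ring
    let y := (InnerProductSpace.toDual ℂ ((d : H →ₗ[ℂ] K).range)).symm l'
    refine ⟨E.symm y, ?_⟩
    ext v
    have h1 : laplacianOf d (E.symm y) v = ⟪d v, d (E.symm y)⟫_ℂ := rfl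
    have h2 : ⟪y, E v⟫_ℂ = l' (E v) := InnerProductSpace.toDual_symm_apply
    have h3 : l' (E v) = (starRingEnd ℂ) (L v) := by
      change (starRingEnd ℂ) (L (E.symm (E v))) = _
      rw [E.symm_apply_apply]
    have h4 : ⟪d v, d (E.symm y)⟫_ℂ = ⟪E v, y⟫_ℂ := by
      rw [← hE, ← hE, E.apply_symm_apply]; rfl
    change laplacianOf d (E.symm y) v = L v
    rw [h1, h4, ← inner_conj_symm, h2, h3, Complex.conj_conj]
  exact ⟨ContinuousLinearEquiv.ofBijective (laplacianOf d) hker hsurj,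
    ContinuousLinearEquiv.coe_ofBijective _ _ _⟩

end LaxMilgram
end ScatteringWitten
end

noncomputable section
namespace ScatteringWitten

theorem norm_sq_eq_integral {α E : Type*} [MeasurableSpace α] [NormedAddCommGroup E]
    [InnerProductSpace ℂ E] {μ : Measure α} (f : Lp E 2 μ) : ‖f‖ ^ 2 = ∫ p, ‖f p‖ ^ 2 ∂μ := by
  have h1 : ⟪f, f⟫_ℂ = ((∫ p, ‖f p‖ ^ 2 ∂μ : ℝ) : ℂ) := by
    rw [L2.inner_def, ← integral_complex_ofReal]
    refine integral_congr_ae (Filter.Eventually.of_forall fun p => ?_)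
    simp only [inner_self_eq_norm_sq_to_K]
    push_cast; rfl
  rw [inner_self_eq_norm_sq_to_K] at h1
  refine Complex.ofReal_injective (Eq.trans ?_ h1)
  push_cast; rfl

/-! ### Patching the chart estimates over closure Ω. -/

section Global

set_option linter.unusedSectionVars false

variable {n : ℕ} {M : Type*} [TopologicalSpace M] [T2Space M] [SecondCountableTopology M]
  [MeasurableSpace M] [BorelSpace M] [ChartedSpace (EuclideanSpace ℝ (Fin n)) M]
  [IsManifold (𝓡 n) ∞ M] {g : TwoTensor n M} {x : M → ℝ} {h : TwoTensor n M} {Ω : Set M}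

/-- A finite smooth partition of unity on a neighbourhood of `A`, subordinate to good charts. -/
structure GoodPartition (x : M → ℝ) (h g : TwoTensor n M) (A : Set M) {ι : Type*} [Fintype ι]
    (e : ι → OpenPartialHomeomorph M (EuclideanSpace ℝ (Fin n))) (o : ι → Fin n) (K : ι → Set M)
    (χ : ι → M → ℝ) : Prop where
  chart : ∀ i, GoodChart x h g (e i) (o i) (K i)
  smooth : ∀ i, ContMDiff (𝓡 n) 𝓘(ℝ, ℝ) ∞ (χ i)
  abs_le : ∀ i p, |χ i p| ≤ 1
  eq_zero : ∀ i, ∀ p ∉ K i, χ i p = 0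
  sum_eq : ∀ p ∈ A, ∑ i, χ i p = 1

theorem exists_goodPartition {A : Set M} (hA : IsCompact A)
    (hc : ∀ p ∈ A, ∃ e o, ∃ K ∈ nhds p, GoodChart x h g e o K) :
    ∃ (s : Finset M) (e : s → OpenPartialHomeomorph M (EuclideanSpace ℝ (Fin n))) (o : s → Fin n)
      (K : s → Set M) (χ : s → M → ℝ), GoodPartition x h g A e o K χ := by
  have h1 : ∀ p, ∃ K : Set M, p ∈ A → K ∈ nhds p ∧ ∃ e o, GoodChart x h g e o K := by
    intro p
    by_cases hp : p ∈ A
    · obtain ⟨e, o, K, hK, h⟩ := hc p hp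
      exact ⟨K, fun _ => ⟨hK, e, o, h⟩⟩
    · exact ⟨∅, fun h => absurd h hp⟩
  choose K hK using h1
  obtain ⟨s, χ, hsA, hχ, hχ1, hχ0, hsum⟩ := exists_finite_partition (n := n) hA
    fun p hp => (hK p hp).1
  choose e o h2 using fun i : s => (hK i (hsA i)).2
  exact ⟨s, e, o, fun i => K i, χ, h2, hχ, hχ1, hχ0, hsum⟩

variable {ι : Type*} [Fintype ι] {e : ι → OpenPartialHomeomorph M (EuclideanSpace ℝ (Fin n))}
  {o : ι → Fin n} {K : ι → Set M} {χ : ι → M → ℝ}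

theorem GoodPartition.exists_norm_lotField_le (H : GoodPartition x h g (closure Ω) e o K χ)
    (hx : ContMDiff (𝓡 n) 𝓘(ℝ, ℝ) ∞ x) (hsc : IsMetricOn (scMetric x h) (interiorX x))
    (hg : IsMetricOn g univ) (F : ℝ) :
    ∃ C, 0 ≤ C ∧ ∀ p ∈ closure Ω ∩ interiorX x, ∀ t : Fibre n 3,
      ‖lotField x h g F p t‖ ≤ C * ‖t‖ := by
  choose C hC using fun i => (H.chart i).exists_norm_lotField_le hx hsc hg F 3
  refine ⟨∑ i, |C i|, Finset.sum_nonneg fun i _ => abs_nonneg _, fun p hp t => ?_⟩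
  obtain ⟨i, hi⟩ : ∃ i, p ∈ K i := by
    by_contra! hne
    have h1 := H.sum_eq p hp.1
    rw [Finset.sum_eq_zero fun i _ => H.eq_zero i p (hne i)] at h1
    exact zero_ne_one h1
  refine (hC i p ⟨hi, hp.2⟩ t).trans (mul_le_mul_of_nonneg_right ((le_abs_self _).trans ?_)
    (norm_nonneg t))
  exact Finset.single_le_sum (f := fun i => |C i|) (fun i _ => abs_nonneg _) (Finset.mem_univ i)

/-- Cauchy–Schwarz on the support of f: 1 = (∑ χ_i)² is at most the number of charts times ∑ χ_i².
-/
theorem GoodPartition.integral_le_sum (H : GoodPartition x h g (closure Ω) e o K χ) {k : ℕ}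
    {f : M → Fibre n k} {μ : Measure M} (hf : MemLp f 2 μ)
    (h0 : ∀ p ∉ closure Ω ∩ interiorX x, f p = 0) :
    ∫ p, ‖f p‖ ^ 2 ∂μ ≤ Fintype.card ι * ∑ i, ∫ p, χ i p ^ 2 * ‖f p‖ ^ 2 ∂μ := by
  have hi : ∀ i, Integrable (fun p => χ i p ^ 2 * ‖f p‖ ^ 2) μ := fun i =>
    integrable_sq_mul (H.smooth i) (H.abs_le i) hf
  rw [← integral_finsetSum _ fun i _ => hi i, ← integral_const_mul]
  refine integral_mono (hf.integrable_norm_pow (p := 2) (by norm_num))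
    ((integrable_finsetSum _ fun i _ => hi i).const_mul _) fun p => ?_
  by_cases hp : p ∈ closure Ω ∩ interiorX x
  · have h1 := sq_sum_le_card_mul_sum_sq (s := (Finset.univ : Finset ι)) (f := fun i => χ i p)
    rw [H.sum_eq p hp.1, one_pow, Finset.card_univ] at h1
    have h2 := mul_le_mul_of_nonneg_right h1 (sq_nonneg ‖f p‖)
    rw [one_mul, mul_assoc, Finset.sum_mul] at h2
    exact h2
  · simp [h0 p hp]

/-- The coercivity estimate for the conjugated symmetric differential. -/
theorem GoodPartition.exists_coercive (H : GoodPartition x h g (closure Ω) e o K χ)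
    (hx : ContMDiff (𝓡 n) 𝓘(ℝ, ℝ) ∞ x) (hsc : IsMetricOn (scMetric x h) (interiorX x))
    (hg : IsMetricOn g univ) :
    ∃ F₀ c : ℝ, 0 < F₀ ∧ 0 < c ∧ ∀ F, F₀ ≤ F → ∀ d : dotH1 x h Ω →L[ℂ] L2sc x h 4,
      (∀ W : dotH1 x h Ω, d W =ᵐ[volMeasure (scMetric x h) (interiorX x)]
        fun p => symmetrize (W.1.snd p + lotField x h g F p (W.1.fst p))) →
      ∀ W, c * ‖W‖ ≤ ‖d W‖ := by
  choose C F₁ hC hF₁ hco using fun i =>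
    (H.chart i).exists_coercive hx hsc hg (H.smooth i) (H.abs_le i) (H.eq_zero i)
  set T : ℝ := Fintype.card ι * ∑ i, C i with hT
  have hT0 : 0 ≤ T := mul_nonneg (Nat.cast_nonneg _) (Finset.sum_nonneg fun i _ => hC i)
  have hS0 : 0 ≤ ∑ i, F₁ i := Finset.sum_nonneg fun i _ => (hF₁ i).le
  -- The sum of the F₁ puts F above each chart threshold, and 1 + T gives F² ≥ 1 + T, so T‖u‖² moves
  -- to the left. This leaves ‖W‖² ≤ T‖dW‖², and T ≤ (1 + T)² explains the constant.
  refine ⟨1 + T + ∑ i, F₁ i, (1 + T)⁻¹, by positivity, by positivity, fun F hF d hd W => ?_⟩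
  obtain ⟨u, w, hR, hu, hw⟩ := exists_isRep hsc W
  have hdW : d W =ᵐ[volMeasure (scMetric x h) (interiorX x)]
      fun p => symmetrize (w p + lotField x h g F p (u p)) := by
    filter_upwards [hd W, hu, hw] with p h1 h2 h3
    rw [h1, h2, h3]
  have hE := (Lp.memLp (d W)).ae_eq hdW
  have ha : ‖d W‖ ^ 2 = ∫ p, ‖symmetrize (w p + lotField x h g F p (u p))‖ ^ 2
      ∂(volMeasure (scMetric x h) (interiorX x)) := by
    rw [norm_sq_eq_integral]
    exact integral_congr_ae (hdW.mono fun p hp => by simp only [hp])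
  have hb : ‖W.1.fst‖ ^ 2 = ∫ p, ‖u p‖ ^ 2 ∂(volMeasure (scMetric x h) (interiorX x)) := by
    rw [norm_sq_eq_integral]
    exact integral_congr_ae (hu.mono fun p hp => by simp only [hp])
  have hc' : ‖W.1.snd‖ ^ 2 = ∫ p, ‖w p‖ ^ 2 ∂(volMeasure (scMetric x h) (interiorX x)) := by
    rw [norm_sq_eq_integral]
    exact integral_congr_ae (hw.mono fun p hp => by simp only [hp])
  have e0 : ‖W‖ ^ 2 = ‖W.1.fst‖ ^ 2 + ‖W.1.snd‖ ^ 2 := WithLp.prod_norm_sq_eq_of_L2 W.1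
  have e1 := fun i => hco i Ω u w hR F (by
    have := Finset.single_le_sum (f := F₁) (fun i _ => (hF₁ i).le) (Finset.mem_univ i)
    linarith) hE
  have e2 := H.integral_le_sum hR.memLp hR.zero
  have e3 := H.integral_le_sum hR.memLp_grad hR.zero_grad
  have e4 := Finset.sum_le_sum fun i (_ : i ∈ Finset.univ) => e1 i
  rw [Finset.sum_add_distrib, ← Finset.mul_sum, ← Finset.sum_mul] at e4
  rw [← ha, ← hb] at e4
  rw [← hb] at e2
  rw [← hc'] at e3
  have e5 := mul_le_mul_of_nonneg_left e4 (Nat.cast_nonneg (α := ℝ) (Fintype.card ι))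
  have e6 := mul_le_mul_of_nonneg_left e2 (sq_nonneg F)
  have e7 : F ^ 2 * ‖W.1.fst‖ ^ 2 + ‖W.1.snd‖ ^ 2 ≤ T * (‖d W‖ ^ 2 + ‖W.1.fst‖ ^ 2) := by
    refine (add_le_add e6 e3).trans (le_trans (le_of_eq ?_) (e5.trans (le_of_eq ?_)))
    · ring
    · rw [hT]; ring
  have hF1 : 1 + T ≤ F ^ 2 := by nlinarith
  have e8 : ‖W‖ ^ 2 ≤ T * ‖d W‖ ^ 2 := by
    have := mul_le_mul_of_nonneg_right hF1 (sq_nonneg ‖W.1.fst‖)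
    rw [e0]; linarith
  refine abs_le_of_sq_le_sq' ?_ (norm_nonneg _) |>.2
  rw [mul_pow, inv_pow, inv_mul_le_iff₀ (by positivity)]
  refine e8.trans (mul_le_mul_of_nonneg_right ?_ (sq_nonneg _))
  nlinarith

end Global
end ScatteringWitten
end

theorem mainTheorem9 {n : ℕ} (hn : 3 ≤ n)
    {M : Type*} [TopologicalSpace M] [T2Space M] [SecondCountableTopology M]
    [MeasurableSpace M] [BorelSpace M]
    [ChartedSpace (EuclideanSpace ℝ (Fin n)) M] [IsManifold (𝓡 n) ∞ M]
    (g : Bundle.ContMDiffRiemannianMetric (𝓡 n) ∞ (EuclideanSpace ℝ (Fin n))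
      (fun p : M => TangentSpace (𝓡 n) p))
    (x : M → ℝ) (hx : ContMDiff (𝓡 n) 𝓘(ℝ, ℝ) ∞ x)
    (h : ScatteringWitten.TwoTensor n M)
    (h_smooth : ScatteringWitten.IsSmoothTwoTensor h)
    (h_symm : ∀ (p : M) (v w : TangentSpace (𝓡 n) p), h p v w = h p w v)
    (h_int : ∀ p : M, 0 < x p → ∀ v : TangentSpace (𝓡 n) p, v ≠ 0 →
      0 < ScatteringWitten.scMetric x h p v v)
    (h_bdry : ∀ p : M, x p = 0 → ∀ v : TangentSpace (𝓡 n) p, v ≠ 0 →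
      ScatteringWitten.differential (n := n) x p v = 0 → 0 < h p v v)
    (Ω : Set M) (hΩX : ∀ p ∈ Ω, 0 ≤ x p) (hΩ : IsCompact (closure Ω))
    (hdx : ∀ p ∈ closure Ω, ScatteringWitten.differential (n := n) x p ≠ 0) :
    ∃ F₀ : ℝ, 0 < F₀ ∧ ∀ F : ℝ, F₀ ≤ F →
      ∃ d : ScatteringWitten.dotH1 x h Ω →L[ℂ] ScatteringWitten.L2sc x h 4,
        (∀ u : ScatteringWitten.dotH1 x h Ω,
          ScatteringWitten.IsSymmDiff x h g.inner F u.1.fst (d u)) ∧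
        (ScatteringWitten.laplacianOf d).IsInvertible := by
  have hsc := ScatteringWitten.isMetricOn_scMetric hx h_smooth h_symm h_int
  have hg := ScatteringWitten.isMetricOn_inner g
  obtain ⟨s, e, o, K, χ, H⟩ := ScatteringWitten.exists_goodPartition (h := h) (g := g.inner) hΩ
    fun p hp => ScatteringWitten.exists_goodChart g hx h_smooth h_symm h_int h_bdry (hdx p hp)
  obtain ⟨F₀, c, hF₀, hc, hco⟩ := H.exists_coercive hx hsc hg
  refine ⟨F₀, hF₀, fun F hF => ?_⟩
  obtain ⟨C, hC0, hC⟩ := H.exists_norm_lotField_le hx hsc hg F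
  obtain ⟨d, hd⟩ := ScatteringWitten.exists_symmDiff_operator hx hsc hg F hC0 hC
  -- Completeness of the domain is what makes the range of d closed.
  have := ScatteringWitten.completeSpace_dotH1 hsc Ω
  exact ⟨d, fun u => ScatteringWitten.isSymmDiff_of_ae_eq hx hsc hg F u (hd u),
    ScatteringWitten.laplacianOf_isInvertible d hc (hco F hF d hd)⟩
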